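/- **Conventions.** Let $G$ be a finite group. $\mathrm{FB}_G$ is the category of finite sets, with morphisms $I\to J$ the pairs $(f,g)$ of a bijection $f:I\to J$ and a colouring $g:I\to G$, composed by $(f',g')\circ(f,g)=(f'f,(g'\circ f)\cdot g)$; it is symmetric monoidal under disjoint union, and $\mathrm{Aut}([n])$ is the wreath product $S_n[G]=G^n\rtimes S_n$. Let $\Bbbk$ be a commutative ring. A *GTCA* of graded $\Bbbk$-modules is a lax symmetric monoidal functor $A_\bullet$ from $\mathrm{FB}_G$ to graded $\Bbbk$-modules (non-negatively graded, with the Koszul sign in the symmetry), with $A_\emptyset=\Bbbk$ the monoidal unit. It is described on the skeleton $[0],[1],[2],\dots$ by graded representations $A_n=A_{[n]}$ of $S_n[G]$ and equivariant products $A_m\otimes A_n\to A_{m+n}$. *Operations.* The tensor product of GTCAs is the Day convolution, $(A\otimes B)_{n}=\bigoplus_{i+j=n}\mathrm{Ind}_{S_i[G]\times S_j[G]}^{S_n[G]}(A_i\otimes B_j)$, with $(x\otimes y)(x'\otimes y')=(-1)^{|y||x'|}xx'\otimes yy'$; an infinite tensor product is the direct limit of the finite ones along $x\mapsto x\otimes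 1$. For $H\le G$, $\mathrm{Ind}_{\mathrm{FB}_H}^{\mathrm{FB}_G}$ is the left Kan extension along the inclusion, $(\mathrm{Ind}\,A)_n=\mathrm{Ind}_{S_n[H]}^{S_n[G]}A_n$. For a representation $V$ of $G\times S_n$ homogeneous of some degree, $\mathrm{Ind}_{G\times S_n}^{\mathrm{FB}_G}(V)$ is the left Kan extension of the $(G\times S_n)$-TCA $[m]\mapsto V^{\otimes m}$ (permutations act with Koszul signs) along $[m]\mapsto[m]\times[n]$, where $G\times S_n\subseteq S_n[G]$ with $G$ embedded diagonally; its value on $[mn]$ is $\mathrm{Ind}_{S_m[G\times S_n]}^{S_{mn}[G]}V^{\otimes m}$. *Homology.* For a bounded finite poset $P$, $\overline P=P\setminus\{\hat0,\hat1\}$ and $\widetilde H_*(\overline P)$ is the reduced homology of its order complex with coefficients in $\Bbbk$; if $P$ is a point, $\widetilde H_{-2}(\overline P)=\Bbbk$ and all other groups vanish. The Whitney homology of a finite poset $P$ with a least element is $WH_*(P)=\bigoplus_{p\in P}\widetilde H_{*-2}(\overline{P^{\le p}})$. An order embedding $f:P\to Q$ of bounded posets acts on chains $\hat0=x_0<\dots<x_r=\hat1$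 elementwise, chains whose image misses $\hat0$ or $\hat1$ being sent to zero. Products are induced by the shuffle cross product. *Dowling posets.* Let $S$ be a finite $G$-set and $T\subseteq S$ a $G$-invariant subset. $D_I^T(G,S)$ is the set of pairs $(\widetilde\beta,z)$: $\widetilde\beta$ is a partition of a subset of $I$ into blocks $B$, each with a colouring $b:B\to G$ up to $b\sim bg$ ($g\in G$), and $z:Z\to S$ is a colouring of the complement $Z$ of the union of the blocks, such that $|z^{-1}(Gs)|=1$ only if $s\in T$. The order is generated by merging two blocks, $\widetilde A,\widetilde B\mapsto \widetilde{A\cup B}$ with colouring $a\cup bg$ for some $g\in G$, and by moving a block $\widetilde B$ into $Z$ with $z|_B=f\circ b$ for a $G$-equivariant $f:G\to S$. A morphism $(f,g)$ of $\mathrm{FB}_G$ sends colours to $b'(f(i))=g(i)b(i)$ and $z'(f(i))=g(i)z(i)$. With disjoint unions this makes $WH_*(D_\bullet^T(G,S))$ a GTCA of graded $\Bbbk$-modules. For $s\in S$ with stabilizer $G_s$, $D_\bullet^T(G_s,s)$ denotes the Dowling posets of the group $G_s$ and the one point $G_s$-set $\{s\}$ (with $T\cap\{s\}$ in place of $T$);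 they are bounded. $\Pi_n$ is the lattice of partitions of $[n]$. **Theorem (Whitney homology factorization).** Let $G$ be a finite group, $S$ a finite $G$-set, $T\subseteq S$ a $G$-invariant subset and $\Bbbk$ a commutative ring, and choose a representative $s$ of each orbit $[s]\in S/G$. Then $WH_*(D_\bullet^T(G,S))$ is a GTCA of graded $\Bbbk$-modules, and there is an isomorphism of GTCAs of graded $\Bbbk$-modules $$WH_*(D_\bullet^T(G,S))\;\cong\;\bigotimes_{n=1}^\infty \mathrm{Ind}_{G\times S_n}^{\mathrm{FB}_G}\bigl(\widetilde H_{n-3}(\overline{\Pi_n})\bigr)\;\otimes\bigotimes_{[s]\in S/G}\mathrm{Ind}_{\mathrm{FB}_{G_s}}^{\mathrm{FB}_G}\bigl(\widetilde H_{|\bullet|-2}(\overline{D_\bullet^T(G_s,s)})\bigr),$$ where $G$ acts trivially on $\Pi_n$, $\widetilde H_{n-3}(\overline{\Pi_n})$ is homogeneous of degree $n-1$, and $\widetilde H_{n-2}(\overline{D_{n}^T(G_s,s)})$, the value on $[n]$ of the twisted algebra $\widetilde H_{|\bullet|-2}(\overline{D_\bullet^T(G_s,s)})$, is homogeneous of degree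 $n$. -/

import Mathlib

universe u

noncomputable section

namespace Dowling

open scoped TensorProduct DirectSum

/-! ### The groupoid of finite sets and `G`-bijections -/

/-- A morphism `I → J` of the category of finite sets and `G`-bijections:
a bijection `I ≃ J` together with a colouring `I → G`. -/
@[ext] structure FBHom (G : Type*) (I J : Type*) where
  toEquiv : I ≃ J
  color : I → G

namespace FBHom

variable {G : Type*} [Group G] {I J K I' J' K' : Type*}

/-- The identity, with trivial colouring. -/
def id (G : Type*) [Group G] (I : Type*) : FBHom G I I := ⟨Equiv.refl I, fun _ => 1⟩

/-- `comp ψ φ = ψ ∘ φ`; pull the colouring of `ψ` back along `φ` and multiply on the left. -/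
def comp (ψ : FBHom G J K) (φ : FBHom G I J) : FBHom G I K :=
  ⟨φ.toEquiv.trans ψ.toEquiv, fun i => ψ.color (φ.toEquiv i) * φ.color i⟩

/-- The inverse morphism. -/
def symm (φ : FBHom G I J) : FBHom G J I :=
  ⟨φ.toEquiv.symm, fun j => (φ.color (φ.toEquiv.symm j))⁻¹⟩

/-- A bijection, as a morphism with trivial colouring. -/
def ofEquiv (G : Type*) [Group G] (e : I ≃ J) : FBHom G I J := ⟨e, fun _ => 1⟩

/-- The monoidal product of morphisms: disjoint union. -/
def sum (φ : FBHom G I J) (φ' : FBHom G I' J') : FBHom G (I ⊕ I') (J ⊕ J') :=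
  ⟨Equiv.sumCongr φ.toEquiv φ'.toEquiv, Sum.elim φ.color φ'.color⟩

/-- The automorphism group of `I`: the wreath product of `G` with the permutations of `I`. -/
instance : Group (FBHom G I I) where
  mul := comp
  one := id G I
  inv := symm
  mul_assoc a b c := by
    apply FBHom.ext
    · rfl
    · funext i; exact mul_assoc _ _ _
  one_mul a := by
    apply FBHom.ext
    · rfl
    · funext i; exact one_mul _
  mul_one a := by
    apply FBHom.ext
    · rfl
    · funext i; exact mul_one _
  inv_mul_cancel a := by
    apply FBHom.ext
    · exact Equiv.self_trans_symm _
    · funext i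
      change (a.color (a.toEquiv.symm (a.toEquiv i)))⁻¹ * a.color i = 1
      simp

theorem mul_def (a b : FBHom G I I) : a * b = comp a b := rfl
theorem one_def : (1 : FBHom G I I) = id G I := rfl
@[simp] theorem mul_toEquiv (a b : FBHom G I I) : (a * b).toEquiv = b.toEquiv.trans a.toEquiv := rfl
@[simp] theorem mul_color (a b : FBHom G I I) (i : I) :
    (a * b).color i = a.color (b.toEquiv i) * b.color i := rfl
@[simp] theorem one_toEquiv : (1 : FBHom G I I).toEquiv = Equiv.refl I := rfl
@[simp] theorem one_color (i : I) : (1 : FBHom G I I).color i = 1 := rfl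

theorem comp_assoc {L : Type*} (a : FBHom G K L) (b : FBHom G J K) (c : FBHom G I J) :
    comp (comp a b) c = comp a (comp b c) := by
  apply FBHom.ext
  · rfl
  · funext i; exact mul_assoc _ _ _

theorem id_comp (a : FBHom G I J) : comp (id G J) a = a := by
  apply FBHom.ext
  · rfl
  · funext i; exact one_mul _

theorem comp_id (a : FBHom G I J) : comp a (id G I) = a := by
  apply FBHom.ext
  · rfl
  · funext i; exact mul_one _

theorem sum_comp (a : FBHom G J K) (b : FBHom G I J) (a' : FBHom G J' K') (b' : FBHom G I' J') :
    sum (comp a b) (comp a' b') = comp (sum a a') (sum b b') := by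
  apply FBHom.ext
  · ext (i | i) <;> rfl
  · funext i; rcases i with i | i <;> rfl

theorem sum_id : sum (id G I) (id G I') = id G (I ⊕ I') := by
  apply FBHom.ext
  · ext (i | i) <;> rfl
  · funext i; rcases i with i | i <;> rfl

theorem ofEquiv_trans (e : I ≃ J) (f : J ≃ K) :
    ofEquiv G (e.trans f) = comp (ofEquiv G f) (ofEquiv G e) := by
  apply FBHom.ext
  · rfl
  · funext i; exact (one_mul _).symm

end FBHom

/-- The wreath product `G^n ⋊ S_n`, as the automorphism group of `[n]`. -/
abbrev Wr (G : Type*) (n : ℕ) := FBHom G (Fin n) (Fin n)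

/-- The block diagonal embedding, more generally for morphisms `I → [m]`, `J → [n]`. -/
def FBHom.join {G : Type*} [Group G] {I J : Type*} {m n : ℕ} (a : FBHom G I (Fin m))
    (b : FBHom G J (Fin n)) : FBHom G (I ⊕ J) (Fin (m + n)) :=
  FBHom.comp (FBHom.ofEquiv G finSumFinEquiv) (FBHom.sum a b)

/-- The block diagonal embedding of wreath products. -/
def Wr.block {G : Type*} [Group G] {m n : ℕ} (a : Wr G m) (b : Wr G n) : Wr G (m + n) :=
  FBHom.comp (FBHom.join a b) (FBHom.ofEquiv G finSumFinEquiv.symm)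

theorem FBHom.block_comp_join {G : Type*} [Group G] {I J : Type*} {m n : ℕ} (w : Wr G m)
    (w' : Wr G n) (a : FBHom G I (Fin m)) (b : FBHom G J (Fin n)) :
    FBHom.comp (Wr.block w w') (FBHom.join a b) =
      FBHom.join (FBHom.comp w a) (FBHom.comp w' b) := by
  apply FBHom.ext
  · ext (i | i) <;> simp [Wr.block, FBHom.join, FBHom.comp, FBHom.ofEquiv, FBHom.sum]
  · funext i
    rcases i with i | i <;> simp [Wr.block, FBHom.join, FBHom.comp, FBHom.ofEquiv, FBHom.sum]

theorem FBHom.join_comp {G : Type*} [Group G] {I J I' J' : Type*} {m n : ℕ}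
    (a : FBHom G I (Fin m)) (b : FBHom G J (Fin n)) (c : FBHom G I' I) (d : FBHom G J' J) :
    FBHom.join (FBHom.comp a c) (FBHom.comp b d) =
      FBHom.comp (FBHom.join a b) (FBHom.sum c d) := by
  rw [FBHom.join, FBHom.join, FBHom.sum_comp, FBHom.comp_assoc]

/-! ### Dowling posets -/

/-- An element of the Dowling poset `D_I^T(G,S)`: a partial `G`-partition of `I` together with an
`S`-colouring of its zero block.

`zero i = some s` says that `i` lies in the zero block with colour `s`, and `zero i = none` that `i`
lies in one of the blocks. The blocks and their relative colourings `b : B → G`, defined up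
to `b ∼ b g`, are recorded by the well defined ratios `b i * (b j)⁻¹`: the relation `rel i g j`
says that `i` and `j` lie in the same block `B` and `b i = g * b j`. -/
@[ext] structure Poset (G : Type*) [Group G] (S : Type*) [MulAction G S] (T : Set S)
    (I : Type*) where
  zero : I → Option S
  rel : I → G → I → Prop
  rel_refl : ∀ i, rel i 1 i ↔ zero i = none
  rel_symm : ∀ {i g j}, rel i g j → rel j g⁻¹ i
  rel_trans : ∀ {i g j h l}, rel i g j → rel j h l → rel i (g * h) l
  rel_unique : ∀ {i g}, rel i g i → g = 1
  /-- `|z⁻¹(G.s)| = 1` only if `s ∈ T` -/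
  mem_of_unique : ∀ s, (∃! i, ∃ g : G, zero i = some (g • s)) → s ∈ T

namespace Poset

variable {G : Type*} [Group G] {S : Type*} [MulAction G S] {T : Set S} {I J K : Type*}

theorem zero_left (α : Poset G S T I) {i g j} (h : α.rel i g j) : α.zero i = none := by
  rw [← α.rel_refl]
  simpa using α.rel_trans h (α.rel_symm h)

theorem zero_right (α : Poset G S T I) {i g j} (h : α.rel i g j) : α.zero j = none :=
  α.zero_left (α.rel_symm h)

/-- Every element is given by a choice of colours `b : I → G`. -/
theorem exists_coloring (α : Poset G S T I) : ∃ b : I → G, ∀ i g j,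
    α.rel i g j ↔ (∃ h, α.rel i h j) ∧ b i = g * b j := by
  classical
  have key : ∀ i j, (∃ h, α.rel i h j) →
      {l | ∃ h, α.rel l h i} = {l | ∃ h, α.rel l h j} := by
    rintro i j ⟨h, hij⟩
    ext l
    exact ⟨fun ⟨a, ha⟩ => ⟨_, α.rel_trans ha hij⟩,
      fun ⟨a, ha⟩ => ⟨_, α.rel_trans ha (α.rel_symm hij)⟩⟩
  let base : I → I := fun i => if h : ({l | ∃ h, α.rel l h i}).Nonempty then h.some else i
  have hbase : ∀ i j, (∃ h, α.rel i h j) → base i = base j := by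
    intro i j hij
    have e := key i j hij
    have hne : ({l | ∃ h, α.rel l h j}).Nonempty := ⟨i, hij⟩
    simp only [base]
    rw [dif_pos hne, dif_pos (e ▸ hne)]
    congr 1
  have hrel : ∀ i j, (∃ h, α.rel i h j) → ∃ h, α.rel j h (base j) := by
    intro i j hij
    have hne : ({l | ∃ h, α.rel l h j}).Nonempty := ⟨i, hij⟩
    simp only [base]
    rw [dif_pos hne]
    obtain ⟨h, hh⟩ := hne.some_mem
    exact ⟨_, α.rel_symm hh⟩
  let b : I → G := fun i => if h : ∃ h, α.rel i h (base i) then h.choose else 1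
  refine ⟨b, fun i g j => ?_⟩
  have main : ∀ h, α.rel i h j → b i = h * b j := by
    intro h hij
    have hj := hrel i j ⟨h, hij⟩
    have hi := hrel j i ⟨_, α.rel_symm hij⟩
    have bi : b i = hi.choose := dif_pos hi
    have bj : b j = hj.choose := dif_pos hj
    have e := hbase i j ⟨h, hij⟩
    have h1 := hi.choose_spec
    have h2 := hj.choose_spec
    rw [← bi, e] at h1
    rw [← bj] at h2
    have h3 := α.rel_unique
      (α.rel_trans (α.rel_trans hij h2) (α.rel_trans (α.rel_symm h1) (α.rel_trans h1 (α.rel_symm h1))))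
    simp only [mul_inv_cancel, mul_one] at h3
    have h4 : h * b j * (b i)⁻¹ = 1 := by simpa [mul_assoc] using h3
    exact (mul_inv_eq_one.1 h4).symm
  constructor
  · intro hij
    exact ⟨⟨g, hij⟩, main g hij⟩
  · rintro ⟨⟨h, hij⟩, e⟩
    have := main h hij
    rw [e] at this
    exact mul_right_cancel this ▸ hij

/-- The order generated by merging blocks and colouring blocks: `α ≤ β` when the zero block of `β`
contains that of `α` with the same colours, and every block of `α` is either contained in a block of
`β`, compatibly with the relative colourings, or contained in the zero block of `β`, on which
its colouring is `f ∘ b` for a `G`-equivariant `f : G → S`. -/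
instance : PartialOrder (Poset G S T I) where
  le α β := (∀ i s, α.zero i = some s → β.zero i = some s) ∧
    ∀ i g j, α.rel i g j → β.rel i g j ∨ ∃ s, β.zero j = some s ∧ β.zero i = some (g • s)
  le_refl α := ⟨fun _ _ h => h, fun _ _ _ h => Or.inl h⟩
  le_trans α β γ h h' := by
    refine ⟨fun i s hs => h'.1 _ _ (h.1 _ _ hs), fun i g j hr => ?_⟩
    rcases h.2 _ _ _ hr with hr | ⟨s, hs, hs'⟩
    · exact h'.2 _ _ _ hr
    · exact Or.inr ⟨s, h'.1 _ _ hs, h'.1 _ _ hs'⟩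
  le_antisymm α β h h' := by
    have aux : ∀ {α β : Poset G S T I}, (∀ i s, β.zero i = some s → α.zero i = some s) →
        (∀ i g j, α.rel i g j → β.rel i g j ∨ ∃ s, β.zero j = some s ∧ β.zero i = some (g • s)) →
        ∀ i g j, α.rel i g j → β.rel i g j := by
      intro α β h0 h1 i g j hr
      rcases h1 _ _ _ hr with hr' | ⟨s, hs, -⟩
      · exact hr'
      · have := h0 _ _ hs
        rw [α.zero_right hr] at this
        exact absurd this (by simp)
    apply Poset.ext
    · funext i
      apply Option.ext
      intro s
      exact ⟨h.1 i s, h'.1 i s⟩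
    · funext i g j
      exact propext ⟨aux h'.1 h.2 i g j, aux h.1 h'.2 i g j⟩

theorem le_def {α β : Poset G S T I} : α ≤ β ↔
    (∀ i s, α.zero i = some s → β.zero i = some s) ∧
    ∀ i g j, α.rel i g j → β.rel i g j ∨ ∃ s, β.zero j = some s ∧ β.zero i = some (g • s) :=
  Iff.rfl

/-- The partition into singletons, with empty zero block. -/
instance : OrderBot (Poset G S T I) where
  bot :=
    { zero := fun _ => none
      rel := fun i g j => i = j ∧ g = 1
      rel_refl := by simp
      rel_symm := by rintro i g j ⟨rfl, rfl⟩; simp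
      rel_trans := by rintro i g j h l ⟨rfl, rfl⟩ ⟨rfl, rfl⟩; simp
      rel_unique := by rintro i g ⟨-, rfl⟩; rfl
      mem_of_unique := by rintro s ⟨i, ⟨g, hg⟩, -⟩; simp at hg }
  bot_le α := by
    refine ⟨fun i s h => absurd h (by simp), ?_⟩
    rintro i g j ⟨rfl, rfl⟩
    cases h : α.zero i with
    | none => exact Or.inl ((α.rel_refl i).2 h)
    | some s => exact Or.inr ⟨s, rfl, by simp⟩

/-- Functoriality under `G`-bijections: `φ = (f, c)` replaces the colours `b`, `z` by
`b' (f i) = c i * b i` and `z' (f i) = c i • z i`. -/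
def map (φ : FBHom G I J) (α : Poset G S T I) : Poset G S T J where
  zero j := (α.zero (φ.toEquiv.symm j)).map (φ.color (φ.toEquiv.symm j) • ·)
  rel i g j := α.rel (φ.toEquiv.symm i)
    ((φ.color (φ.toEquiv.symm i))⁻¹ * g * φ.color (φ.toEquiv.symm j)) (φ.toEquiv.symm j)
  rel_refl i := by simp [α.rel_refl]
  rel_symm h := by simpa [mul_assoc] using α.rel_symm h
  rel_trans h h' := by simpa [mul_assoc] using α.rel_trans h h'
  rel_unique h := by
    have := α.rel_unique h
    rw [mul_assoc, inv_mul_eq_one] at this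
    exact (mul_eq_right.1 this.symm)
  mem_of_unique s := by
    rintro ⟨j, ⟨g, hg⟩, hu⟩
    refine α.mem_of_unique s ⟨φ.toEquiv.symm j, ?_, ?_⟩
    · obtain ⟨t, ht, ht'⟩ := Option.map_eq_some_iff.1 hg
      refine ⟨(φ.color (φ.toEquiv.symm j))⁻¹ * g, ?_⟩
      rw [ht, mul_smul, ← ht', inv_smul_smul]
    · rintro i ⟨h, hi⟩
      rw [Equiv.eq_symm_apply]
      apply hu
      exact ⟨φ.color i * h, by simp [hi, mul_smul]⟩

theorem map_le_map (φ : FBHom G I J) {α β : Poset G S T I} (h : α ≤ β) : map φ α ≤ map φ β := by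
  refine ⟨fun i s hs => ?_, fun i g j hr => ?_⟩
  · obtain ⟨t, ht, ht'⟩ := Option.map_eq_some_iff.1 hs
    exact Option.map_eq_some_iff.2 ⟨t, h.1 _ _ ht, ht'⟩
  · rcases h.2 _ _ _ hr with hr | ⟨s, hs, hs'⟩
    · exact Or.inl hr
    · refine Or.inr ⟨φ.color (φ.toEquiv.symm j) • s, ?_, ?_⟩
      · simp [map, hs]
      · simp [map, hs', mul_smul]

theorem map_id (α : Poset G S T I) : map (FBHom.id G I) α = α := by
  apply Poset.ext
  · funext i; simp [map, FBHom.id]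
  · funext i g j; simp [map, FBHom.id]

theorem map_comp (ψ : FBHom G J K) (φ : FBHom G I J) (α : Poset G S T I) :
    map (FBHom.comp ψ φ) α = map ψ (map φ α) := by
  apply Poset.ext
  · funext i; simp [map, FBHom.comp, mul_smul, Function.comp_def]
  · funext i g j; simp [map, FBHom.comp, mul_assoc]

theorem map_injective (φ : FBHom G I J) : Function.Injective (map φ : Poset G S T I → _) := by
  intro α β h
  have e : FBHom.comp φ.symm φ = FBHom.id G I := by
    apply FBHom.ext
    · exact Equiv.self_trans_symm _
    · funext i; simp [FBHom.comp, FBHom.symm, FBHom.id]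
  rw [← map_id α, ← map_id β, ← e, map_comp, map_comp, h]

theorem map_strictMono (φ : FBHom G I J) : StrictMono (map φ : Poset G S T I → _) :=
  (show Monotone (map φ : Poset G S T I → _) from fun _ _ h => map_le_map φ h).strictMono_of_injective
    (map_injective φ)

/-- Disjoint union. -/
def union (α : Poset G S T I) (β : Poset G S T J) : Poset G S T (I ⊕ J) where
  zero := Sum.elim α.zero β.zero
  rel
    | .inl i, g, .inl j => α.rel i g j
    | .inr i, g, .inr j => β.rel i g j
    | _, _, _ => False
  rel_refl := by rintro (i | i) <;> simp [α.rel_refl, β.rel_refl]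
  rel_symm := by
    rintro (i | i) g (j | j) h
    exacts [α.rel_symm h, h.elim, h.elim, β.rel_symm h]
  rel_trans := by
    rintro (i | i) g (j | j) h (l | l) h1 h2
    exacts [α.rel_trans h1 h2, h2.elim, h1.elim, h1.elim, h1.elim, h1.elim, h2.elim,
      β.rel_trans h1 h2]
  rel_unique := by
    rintro (i | i) g h
    exacts [α.rel_unique h, β.rel_unique h]
  mem_of_unique s := by
    rintro ⟨i | i, hi, hu⟩
    · exact α.mem_of_unique s ⟨i, hi, fun j hj => Sum.inl_injective (hu (.inl j) hj)⟩
    · exact β.mem_of_unique s ⟨i, hi, fun j hj => Sum.inr_injective (hu (.inr j) hj)⟩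

theorem union_le_union {α α' : Poset G S T I} {β β' : Poset G S T J} (h : α ≤ α') (h' : β ≤ β') :
    union α β ≤ union α' β' := by
  refine ⟨?_, ?_⟩
  · rintro (i | i) s hs
    exacts [h.1 _ _ hs, h'.1 _ _ hs]
  · rintro (i | i) g (j | j) hr
    exacts [h.2 _ _ _ hr, hr.elim, hr.elim, h'.2 _ _ _ hr]

theorem union_injective {α α' : Poset G S T I} {β β' : Poset G S T J}
    (h : union α β = union α' β') : α = α' ∧ β = β' := by
  have h0 := congrArg Poset.zero h
  have h1 := congrArg Poset.rel h
  constructor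
  · apply Poset.ext
    · funext i; exact congrFun h0 (.inl i)
    · funext i g j; exact congrFun (congrFun (congrFun h1 (.inl i)) g) (.inl j)
  · apply Poset.ext
    · funext i; exact congrFun h0 (.inr i)
    · funext i g j; exact congrFun (congrFun (congrFun h1 (.inr i)) g) (.inr j)

theorem map_union {I' J' : Type*} (φ : FBHom G I I') (ψ : FBHom G J J') (α : Poset G S T I)
    (β : Poset G S T J) : map (FBHom.sum φ ψ) (union α β) = union (map φ α) (map ψ β) := by
  apply Poset.ext
  · funext i; rcases i with i | i <;> rfl
  · funext i g j; rcases i with i | i <;> rcases j with j | j <;> rfl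

/-- The product `D_[m] × D_[n] → D_[m+n]`. -/
def mul {m n : ℕ} (α : Poset G S T (Fin m)) (β : Poset G S T (Fin n)) : Poset G S T (Fin (m + n)) :=
  map (FBHom.ofEquiv G finSumFinEquiv) (union α β)

theorem mul_strictMono {m n : ℕ} : StrictMono
    (fun p : Poset G S T (Fin m) × Poset G S T (Fin n) => mul p.1 p.2) := by
  have h1 : Monotone (fun p : Poset G S T (Fin m) × Poset G S T (Fin n) => mul p.1 p.2) :=
    fun p q h => map_le_map _ (union_le_union h.1 h.2)
  refine h1.strictMono_of_injective fun p q h => ?_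
  obtain ⟨a, b⟩ := union_injective (map_injective _ h)
  exact Prod.ext a b

theorem map_mul {m n : ℕ} (a : Wr G m) (b : Wr G n) (α : Poset G S T (Fin m))
    (β : Poset G S T (Fin n)) : map (Wr.block a b) (mul α β) = mul (map a α) (map b β) := by
  rw [mul, mul, ← map_union, ← map_comp, ← map_comp]
  congr 1
  apply FBHom.ext
  · ext (i | i) <;> simp [Wr.block, FBHom.join, FBHom.comp, FBHom.ofEquiv, FBHom.sum]
  · funext i
    rcases i with i | i <;> simp [Wr.block, FBHom.join, FBHom.comp, FBHom.ofEquiv, FBHom.sum]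

instance [IsEmpty I] : Subsingleton (Poset G S T I) :=
  ⟨fun _ _ => Poset.ext (funext fun i => isEmptyElim i) (funext fun i => isEmptyElim i)⟩

end Poset

section SubQuot

variable {k : Type*} [CommRing k] {V W U : Type*} [AddCommGroup V] [Module k V] [AddCommGroup W]
  [Module k W] [AddCommGroup U] [Module k U]

/-- A bilinear map descends to quotients. -/
def liftQ₂ (p : Submodule k V) (q : Submodule k W)
    (f : V →ₗ[k] W →ₗ[k] U) (hp : ∀ x ∈ p, ∀ y, f x y = 0) (hq : ∀ x, ∀ y ∈ q, f x y = 0) :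
    (V ⧸ p) →ₗ[k] (W ⧸ q) →ₗ[k] U :=
  p.liftQ (q.liftQ f.flip fun y hy => LinearMap.ext fun x => hq x y hy).flip fun x hx => by
    refine LinearMap.mem_ker.2 (LinearMap.ext fun y => ?_)
    obtain ⟨y, rfl⟩ := q.mkQ_surjective y
    exact hp x hx y

theorem liftQ₂_mk (p : Submodule k V) (q : Submodule k W)
    (f : V →ₗ[k] W →ₗ[k] U) (hp : ∀ x ∈ p, ∀ y, f x y = 0)
    (hq : ∀ x, ∀ y ∈ q, f x y = 0) (x : V) (y : W) :
    liftQ₂ p q f hp hq (p.mkQ x) (q.mkQ y) = f x y := rfl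

/-- The quotient of a submodule `Z` by (its intersection with) a submodule `B`. -/
def SubQuot (Z B : Submodule k V) : Type _ := Z ⧸ B.comap Z.subtype

namespace SubQuot

variable {Z B : Submodule k V} {Z' B' : Submodule k W} {Z'' B'' : Submodule k U}

instance : AddCommGroup (SubQuot Z B) := inferInstanceAs (AddCommGroup (Z ⧸ B.comap Z.subtype))
instance : Module k (SubQuot Z B) := inferInstanceAs (Module k (Z ⧸ B.comap Z.subtype))

/-- The class of an element. -/
def mk : Z →ₗ[k] SubQuot Z B := Submodule.mkQ _

theorem mk_surjective (x : SubQuot Z B) : ∃ z, ∃ hz : z ∈ Z, mk ⟨z, hz⟩ = x := by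
  obtain ⟨⟨z, hz⟩, rfl⟩ := Submodule.mkQ_surjective _ x
  exact ⟨z, hz, rfl⟩

theorem mk_eq_zero {z : V} (hz : z ∈ Z) (h : z ∈ B) : mk (B := B) ⟨z, hz⟩ = 0 :=
  (Submodule.Quotient.mk_eq_zero _).2 h

theorem mk_congr {z w : V} (h : z = w) (hz : z ∈ Z) (hw : w ∈ Z) :
    mk (B := B) ⟨z, hz⟩ = mk ⟨w, hw⟩ := by subst h; rfl

/-- Functoriality. -/
def map (f : V →ₗ[k] W) (hZ : ∀ z ∈ Z, f z ∈ Z') (hB : ∀ z ∈ B, f z ∈ B') :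
    SubQuot Z B →ₗ[k] SubQuot Z' B' :=
  Submodule.mapQ _ _ (f.restrict hZ) fun z hz => hB z.1 hz

theorem map_mk (f : V →ₗ[k] W) (hZ : ∀ z ∈ Z, f z ∈ Z') (hB : ∀ z ∈ B, f z ∈ B') {z : V}
    (hz : z ∈ Z) : map f hZ hB (mk ⟨z, hz⟩) = mk ⟨f z, hZ z hz⟩ := rfl

/-- Bifunctoriality. -/
def map₂ (f : V →ₗ[k] W →ₗ[k] U) (hZ : ∀ z ∈ Z, ∀ w ∈ Z', f z w ∈ Z'')
    (hB : ∀ z ∈ B, ∀ w ∈ Z', f z w ∈ B'') (hB' : ∀ z ∈ Z, ∀ w ∈ B', f z w ∈ B'') :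
    SubQuot Z B →ₗ[k] SubQuot Z' B' →ₗ[k] SubQuot Z'' B'' :=
  liftQ₂ _ _
    (LinearMap.mk₂ k (fun (z : Z) (w : Z') => mk (B := B'') ⟨f z w, hZ z z.2 w w.2⟩)
      (fun z z' w => by
        rw [← map_add]; exact mk_congr (by simp) _ (Z''.add_mem (hZ _ z.2 _ w.2) (hZ _ z'.2 _ w.2)))
      (fun c z w => by
        rw [← map_smul]; exact mk_congr (by simp) _ (Z''.smul_mem c (hZ _ z.2 _ w.2)))
      (fun z w w' => by
        rw [← map_add]; exact mk_congr (by simp) _ (Z''.add_mem (hZ _ z.2 _ w.2) (hZ _ z.2 _ w'.2)))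
      (fun c z w => by
        rw [← map_smul]; exact mk_congr (by simp) _ (Z''.smul_mem c (hZ _ z.2 _ w.2))))
    (fun z hz w => mk_eq_zero _ (hB z.1 hz w.1 w.2))
    (fun z w hw => mk_eq_zero _ (hB' z.1 z.2 w.1 hw))

theorem map₂_mk (f : V →ₗ[k] W →ₗ[k] U) (hZ : ∀ z ∈ Z, ∀ w ∈ Z', f z w ∈ Z'')
    (hB : ∀ z ∈ B, ∀ w ∈ Z', f z w ∈ B'') (hB' : ∀ z ∈ Z, ∀ w ∈ B', f z w ∈ B'') {z : V} {w : W}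
    (hz : z ∈ Z) (hw : w ∈ Z') :
    map₂ f hZ hB hB' (mk ⟨z, hz⟩) (mk ⟨w, hw⟩) = mk ⟨f z w, hZ z hz w hw⟩ := rfl

end SubQuot

end SubQuot

/-! ### Homology of bounded posets -/

section Boundary

variable (k : Type u) [CommRing k] {P Q : Type*}

/-- The alternating sum of the interior faces of a list `x_0, …, x_r`. -/
def bdry : (List P →₀ k) →ₗ[k] (List P →₀ k) :=
  Finsupp.linearCombination k fun l =>
    ∑ i ∈ Finset.Ico 1 (l.length - 1), (-1 : k) ^ i • Finsupp.single (l.eraseIdx i) 1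

theorem bdry_single (l : List P) : bdry k (Finsupp.single l (1 : k)) =
    ∑ i ∈ Finset.Ico 1 (l.length - 1), (-1 : k) ^ i • Finsupp.single (l.eraseIdx i) 1 := by
  simp [bdry]

theorem head?_eraseIdx {l : List P} {i : ℕ} (h : 1 ≤ i) : (l.eraseIdx i).head? = l.head? := by
  obtain ⟨i, rfl⟩ := Nat.exists_eq_add_of_le' h
  cases l <;> simp

theorem getLast?_eraseIdx {l : List P} {i : ℕ} (h : i < l.length - 1) :
    (l.eraseIdx i).getLast? = l.getLast? := by
  induction l generalizing i with
  | nil => simp at h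
  | cons a l ih =>
    cases i with
    | zero =>
      cases l with
      | nil => simp at h
      | cons b l => simp
    | succ i =>
      simp only [List.length_cons, Nat.add_sub_cancel] at h
      have h' : i < l.length - 1 := by omega
      have := ih h'
      simp only [List.eraseIdx_cons_succ]
      rw [List.getLast?_cons, List.getLast?_cons, this]

/-- Prepending an element, on linear combinations of lists. -/
def consMap (x : P) : (List P →₀ k) →ₗ[k] (List P →₀ k) := Finsupp.lmapDomain k k (List.cons x)

/-- Deleting the first element, on linear combinations of lists; lists with at most one entry are
sent to zero. -/
def tailMap : (List P →₀ k) →ₗ[k] (List P →₀ k) :=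
  Finsupp.linearCombination k fun l => if 2 ≤ l.length then Finsupp.single l.tail 1 else 0

@[simp] theorem consMap_single (x : P) (l : List P) (c : k) :
    consMap k x (Finsupp.single l c) = Finsupp.single (x :: l) c := by
  simp [consMap]

theorem bdry_consMap (x : P) (c : List P →₀ k) :
    bdry k (consMap k x c) = - consMap k x (tailMap k c + bdry k c) := by
  rw [eq_neg_iff_add_eq_zero]
  refine DFunLike.congr_fun (f := bdry k ∘ₗ consMap k x + consMap k x ∘ₗ (tailMap k + bdry k))
    (g := 0) ?_ c
  refine Finsupp.lhom_ext' fun l => LinearMap.ext_ring ?_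
  simp only [LinearMap.comp_apply, Finsupp.lsingle_apply, LinearMap.zero_apply, LinearMap.add_apply,
    consMap_single, bdry_single]
  rw [← eq_neg_iff_add_eq_zero]
  rcases l with _ | ⟨y, l⟩
  · simp [tailMap]
  · rcases l with _ | ⟨z, l⟩
    · simp [tailMap]
    · simp only [tailMap, Finsupp.linearCombination_single, one_smul, List.length_cons,
        Nat.add_sub_cancel, List.tail_cons]
      have e := Finset.sum_Ico_add' (fun i => (-1 : k) ^ i •
        Finsupp.single ((x :: y :: z :: l).eraseIdx i) (1 : k)) 1 (l.length + 1) 1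
      rw [if_pos (by omega), Finset.sum_eq_sum_Ico_succ_bot (by omega), map_add, map_sum, neg_add,
        ← Finset.sum_neg_distrib, ← e]
      congr 1
      · simp
      · refine Finset.sum_congr rfl fun i _ => ?_
        simp [pow_succ]

end Boundary

section Homology

variable (k : Type u) [CommRing k] {P Q R : Type*} [PartialOrder P] [PartialOrder Q]
  [PartialOrder R]

/-- The first entry is the least and the last entry is the greatest element. -/
def Ends (l : List P) : Prop := (∀ x ∈ l.head?, IsBot x) ∧ (∀ x ∈ l.getLast?, IsTop x)

/-- A chain `0̂ = x_0 < x_1 < ⋯ < x_r = 1̂` of a bounded poset. -/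
def IsFull (r : ℕ) (l : List P) : Prop :=
  l.length = r + 1 ∧ l.IsChain (· < ·) ∧ Ends l

variable (P) in
/-- The free module on the chains `0̂ = x_0 < x_1 < ⋯ < x_r = 1̂`. -/
def chains (r : ℕ) : Submodule k (List P →₀ k) := Finsupp.supported k k {l | IsFull r l}

variable (P) in
/-- Cycles. -/
def cycles (r : ℕ) : Submodule k (List P →₀ k) := chains k P r ⊓ LinearMap.ker (bdry k)

variable (P) in
/-- Boundaries. -/
def boundaries (r : ℕ) : Submodule k (List P →₀ k) := (chains k P (r + 1)).map (bdry k)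

variable (P) in
/-- The shifted reduced homology `H̃_{r-2}(P̄)` of a bounded poset `P`, where `P̄` is `P` without
`0̂` and `1̂`. A simplex of dimension `r - 2` of the order complex of `P̄` is a chain
`x_1 < ⋯ < x_{r-1}` of `P̄` (the empty one when `r = 1`), that is, a chain
`0̂ < x_1 < ⋯ < x_{r-1} < 1̂` of `P`, and the simplicial boundary deletes interior
elements. For a one point poset this is the usual convention: `H̃_{-2} = k` and all other groups
vanish. -/
abbrev RedHom (r : ℕ) : Type _ := SubQuot (cycles k P r) (boundaries k P r)

theorem single_mem_chains {r : ℕ} {l : List P} (h : IsFull r l) :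
    Finsupp.single l (1 : k) ∈ chains k P r :=
  Finsupp.single_mem_supported k 1 h

theorem chains_induction {r : ℕ} {N : Submodule k (List P →₀ k)}
    (h : ∀ l, IsFull r l → Finsupp.single l (1 : k) ∈ N) : chains k P r ≤ N := by
  rw [chains, Finsupp.supported_eq_span_single, Submodule.span_le]
  rintro _ ⟨l, hl, rfl⟩
  exact h l hl

theorem ends_eraseIdx {l : List P} {i : ℕ} (h : i ∈ Finset.Ico 1 (l.length - 1)) :
    Ends (l.eraseIdx i) ↔ Ends l := by
  rw [Finset.mem_Ico] at h
  rw [Ends, Ends, head?_eraseIdx h.1, getLast?_eraseIdx h.2]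

open Classical in
/-- The map of chains induced by a map of posets; a chain is sent to zero if its image misses `0̂` or
`1̂`. -/
def chainMap (f : P ↪o Q) : (List P →₀ k) →ₗ[k] (List Q →₀ k) :=
  Finsupp.linearCombination k fun l =>
    if Ends (l.map f) then Finsupp.single (l.map f) 1 else 0

open Classical in
theorem chainMap_single (f : P ↪o Q) (l : List P) : chainMap k f (Finsupp.single l 1) =
    if Ends (l.map f) then Finsupp.single (l.map f) 1 else 0 := by
  simp [chainMap]

theorem bdry_chainMap (f : P ↪o Q) (x : List P →₀ k) :
    bdry k (chainMap k f x) = chainMap k f (bdry k x) := by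
  classical
  refine DFunLike.congr_fun (f := bdry k ∘ₗ chainMap k f) (g := chainMap k f ∘ₗ bdry k) ?_ x
  refine Finsupp.lhom_ext' fun l => LinearMap.ext_ring ?_
  simp only [LinearMap.comp_apply, Finsupp.lsingle_apply]
  rw [chainMap_single, bdry_single, map_sum]
  have : ∀ i ∈ Finset.Ico 1 (l.length - 1),
      chainMap k f ((-1 : k) ^ i • Finsupp.single (l.eraseIdx i) 1) =
      if Ends (l.map f) then (-1 : k) ^ i • Finsupp.single ((l.map f).eraseIdx i) 1 else 0 := by
    intro i hi
    have hi' : i ∈ Finset.Ico 1 ((l.map f).length - 1) := by simpa using hi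
    rw [map_smul, chainMap_single, ← List.eraseIdx_map]
    simp only [ends_eraseIdx hi']
    split_ifs <;> simp
  rw [Finset.sum_congr rfl this]
  split_ifs
  · rw [bdry_single]; simp
  · simp

theorem chainMap_mem (f : P ↪o Q) {r : ℕ} :
    chains k P r ≤ (chains k Q r).comap (chainMap k f) := by
  classical
  refine chains_induction k fun l hl => ?_
  rw [Submodule.mem_comap, chainMap_single]
  split_ifs with h
  · refine single_mem_chains k ⟨by simpa using hl.1, ?_, h⟩
    rw [List.isChain_map]
    exact hl.2.1.imp fun a b hab => f.strictMono hab
  · exact Submodule.zero_mem _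

theorem chainMap_cycles (f : P ↪o Q) {r : ℕ} (z) (hz : z ∈ cycles k P r) :
    chainMap k f z ∈ cycles k Q r := by
  refine ⟨chainMap_mem k f hz.1, ?_⟩
  change bdry k _ = 0
  rw [bdry_chainMap, show bdry k z = 0 from hz.2, map_zero]

theorem chainMap_boundaries (f : P ↪o Q) {r : ℕ} (z) (hz : z ∈ boundaries k P r) :
    chainMap k f z ∈ boundaries k Q r := by
  obtain ⟨c, hc, rfl⟩ := hz
  exact ⟨chainMap k f c, chainMap_mem k f hc, bdry_chainMap k f c⟩

/-- The map in homology induced by an embedding of bounded posets. -/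
def RedHom.map (f : P ↪o Q) (r : ℕ) : RedHom k P r →ₗ[k] RedHom k Q r :=
  SubQuot.map (chainMap k f) (chainMap_cycles k f) (chainMap_boundaries k f)

theorem RedHom.map_id {f : P ↪o P} (h : ∀ x, f x = x) (r : ℕ) (x : RedHom k P r) :
    RedHom.map k f r x = x := by
  classical
  obtain ⟨z, hz, rfl⟩ := SubQuot.mk_surjective x
  refine SubQuot.mk_congr ?_ _ _
  have : chains k P r ≤ LinearMap.eqLocus (chainMap k f) LinearMap.id := by
    refine chains_induction k fun l hl => ?_
    have e : l.map f = l := by rw [show (f : P → P) = id from funext h, List.map_id]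
    rw [LinearMap.mem_eqLocus, chainMap_single, e, if_pos hl.2.2]; rfl
  exact this hz.1

theorem ends_of_map (g : Q ↪o R) {l : List Q} (h : Ends (l.map g)) : Ends l := by
  refine ⟨fun x hx y => ?_, fun x hx y => ?_⟩
  · refine g.le_iff_le.1 (h.1 (g x) ?_ (g y))
    rw [List.head?_map, hx]; rfl
  · refine g.le_iff_le.1 (h.2 (g x) ?_ (g y))
    rw [List.getLast?_map, hx]; rfl

theorem chainMap_comp (g : Q ↪o R) (f : P ↪o Q) (x : List P →₀ k) :
    chainMap k (f.trans g) x = chainMap k g (chainMap k f x) := by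
  classical
  refine DFunLike.congr_fun (f := chainMap k (f.trans g)) (g := chainMap k g ∘ₗ chainMap k f) ?_ x
  refine Finsupp.lhom_ext' fun l => LinearMap.ext_ring ?_
  simp only [LinearMap.comp_apply, Finsupp.lsingle_apply, chainMap_single]
  have e : l.map (f.trans g) = (l.map f).map g := by simp
  rw [e]
  by_cases h : Ends (l.map f)
  · rw [if_pos h, chainMap_single]
  · rw [if_neg h, map_zero, if_neg fun h' => h (ends_of_map g h')]

theorem RedHom.map_comp (g : Q ↪o R) (f : P ↪o Q) (r : ℕ) (x : RedHom k P r) :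
    RedHom.map k (f.trans g) r x = RedHom.map k g r (RedHom.map k f r x) := by
  obtain ⟨z, hz, rfl⟩ := SubQuot.mk_surjective x
  exact SubQuot.mk_congr (chainMap_comp k g f z) _ _

/-- For a one point poset, the generator of `H̃_{-2} = k`. -/
def RedHom.point (x : P) (hb : IsBot x) (ht : IsTop x) : RedHom k P 0 :=
  SubQuot.mk ⟨Finsupp.single [x] 1, Submodule.mem_inf.2
    ⟨single_mem_chains k ⟨rfl, List.isChain_singleton _, by simpa [Ends] using ⟨hb, ht⟩⟩,
      by simp [bdry]⟩⟩

/-! ### The cross product -/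

end Homology

section Shuffle

variable (k : Type u) [CommRing k] {P Q : Type*}

/-- The signed sum of all the lattice paths through the grid `l × l'` (shuffles). A step in
`l'` contributes the sign `-1` for every step in `l` that comes after it. -/
def shuffle : List P → List Q → (List (P × Q) →₀ k)
  | [], _ => 0
  | _ :: _, [] => 0
  | x :: l, y :: l' =>
    if l = [] ∧ l' = [] then Finsupp.single [(x, y)] 1
    else consMap k (x, y) (shuffle l (y :: l') + (-1 : k) ^ l.length • shuffle (x :: l) l')
  termination_by l l' => l.length + l'.length

/-- The bilinear extension of `shuffle`. -/
def shuffleMap : (List P →₀ k) →ₗ[k] (List Q →₀ k) →ₗ[k] (List (P × Q) →₀ k) :=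
  Finsupp.linearCombination k fun l => Finsupp.linearCombination k fun l' => shuffle k l l'

@[simp] theorem shuffle_nil_left (l' : List Q) : shuffle k ([] : List P) l' = 0 := by
  rw [shuffle]

@[simp] theorem shuffle_nil_right (l : List P) : shuffle k l ([] : List Q) = 0 := by
  cases l <;> rw [shuffle]

theorem shuffle_single_single (x : P) (y : Q) :
    shuffle k [x] [y] = Finsupp.single [(x, y)] 1 := by
  rw [shuffle, if_pos ⟨rfl, rfl⟩]

theorem shuffle_cons_cons (x : P) (y : Q) (l : List P) (l' : List Q) (h : ¬ (l = [] ∧ l' = [])) :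
    shuffle k (x :: l) (y :: l') =
      consMap k (x, y) (shuffle k l (y :: l') + (-1 : k) ^ l.length • shuffle k (x :: l) l') := by
  rw [shuffle, if_neg h]

@[simp] theorem shuffleMap_single (l : List P) (l' : List Q) :
    shuffleMap k (Finsupp.single l 1) (Finsupp.single l' 1) = shuffle k l l' := by
  simp [shuffleMap]

theorem shuffleMap_nil_left (c : List Q →₀ k) :
    shuffleMap k (Finsupp.single ([] : List P) 1) c = 0 := by
  refine DFunLike.congr_fun (f := shuffleMap k (Finsupp.single ([] : List P) 1)) (g := 0) ?_ c
  refine Finsupp.lhom_ext' fun l => LinearMap.ext_ring ?_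
  simp

theorem shuffleMap_nil_right (c : List P →₀ k) :
    shuffleMap k c (Finsupp.single ([] : List Q) 1) = 0 := by
  refine DFunLike.congr_fun (f := (shuffleMap k).flip (Finsupp.single ([] : List Q) 1)) (g := 0) ?_ c
  refine Finsupp.lhom_ext' fun l => LinearMap.ext_ring ?_
  simp

/-- Linear combinations of lists of length `n`. -/
def lists (P : Type*) (n : ℕ) : Submodule k (List P →₀ k) :=
  Finsupp.supported k k {l | l.length = n}

theorem lists_induction {n : ℕ} {N : Submodule k (List P →₀ k)}
    (h : ∀ l : List P, l.length = n → Finsupp.single l (1 : k) ∈ N) : lists k P n ≤ N := by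
  rw [lists, Finsupp.supported_eq_span_single, Submodule.span_le]
  rintro _ ⟨l, hl, rfl⟩
  exact h l hl

theorem single_mem_lists {n : ℕ} {l : List P} (h : l.length = n) :
    Finsupp.single l (1 : k) ∈ lists k P n :=
  Finsupp.single_mem_supported k 1 h

theorem bdry_mem_lists (l : List P) : bdry k (Finsupp.single l 1) ∈ lists k P (l.length - 1) := by
  rw [bdry_single]
  refine Submodule.sum_mem _ fun i hi => Submodule.smul_mem _ _ (single_mem_lists k ?_)
  rw [Finset.mem_Ico] at hi
  rw [List.length_eraseIdx, if_pos (by omega)]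

theorem tailMap_single (l : List P) : tailMap k (Finsupp.single l 1) =
    if 2 ≤ l.length then Finsupp.single l.tail 1 else 0 := by
  simp [tailMap]

theorem tailMap_mem_lists (l : List P) :
    tailMap k (Finsupp.single l 1) ∈ lists k P (l.length - 1) := by
  rw [tailMap_single]
  split_ifs
  · exact single_mem_lists k (by simp)
  · exact Submodule.zero_mem _

theorem tailMap_consMap {n : ℕ} (x : P) (c : List P →₀ k)
    (hc : c ∈ lists k P (n + 1)) : tailMap k (consMap k x c) = c := by
  have : lists k P (n + 1) ≤ LinearMap.eqLocus (tailMap k ∘ₗ consMap k x) LinearMap.id := by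
    refine lists_induction k fun l hl => ?_
    rw [LinearMap.mem_eqLocus, LinearMap.comp_apply, consMap_single, tailMap_single,
      if_pos (by simp; omega)]
    rfl
  exact this hc

theorem shuffle_mem_lists (l : List P) (l' : List Q) :
    shuffle k l l' ∈ lists k (P × Q) (l.length + l'.length - 1) := by
  induction hn : l.length + l'.length using Nat.strong_induction_on generalizing l l' with
  | _ n ih =>
  rcases l with _ | ⟨x, l⟩
  · simp
  rcases l' with _ | ⟨y, l'⟩
  · simp
  by_cases h : l = [] ∧ l' = []
  · obtain ⟨rfl, rfl⟩ := h
    rw [shuffle_single_single]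
    subst hn
    exact single_mem_lists k rfl
  · rw [shuffle_cons_cons k x y l l' h]
    have hpos : 1 ≤ l.length + l'.length := by
      rcases l with _ | ⟨a, l⟩
      · rcases l' with _ | ⟨b, l'⟩
        · simp at h
        · simp
      · simp; omega
    simp only [List.length_cons] at hn
    have hcons : ∀ c ∈ lists k (P × Q) (n - 2),
        consMap k (x, y) c ∈ lists k (P × Q) (n - 1) := by
      intro c hc
      have : lists k (P × Q) (n - 2) ≤ (lists k (P × Q) (n - 1)).comap (consMap k (x, y)) := by
        refine lists_induction k fun l hl => ?_
        rw [Submodule.mem_comap, consMap_single]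
        exact single_mem_lists k (by simp; omega)
      exact this hc
    refine hcons _ (Submodule.add_mem _ ?_ (Submodule.smul_mem _ _ ?_))
    · have := ih (l.length + (y :: l').length) (by simp; omega) l (y :: l') rfl
      rwa [show l.length + (y :: l').length - 1 = n - 2 by simp; omega] at this
    · have := ih ((x :: l).length + l'.length) (by simp; omega) (x :: l) l' rfl
      rwa [show (x :: l).length + l'.length - 1 = n - 2 by simp; omega] at this

theorem shuffleMap_consMap_consMap {m : ℕ} (x : P) (y : Q) (c : List P →₀ k)
    (hc : c ∈ lists k P (m + 1)) (l' : List Q) :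
    shuffleMap k (consMap k x c) (Finsupp.single (y :: l') 1) =
      consMap k (x, y) (shuffleMap k c (Finsupp.single (y :: l') 1) +
        (-1 : k) ^ (m + 1) • shuffleMap k (consMap k x c) (Finsupp.single l' 1)) := by
  have : lists k P (m + 1) ≤ LinearMap.eqLocus
      ((shuffleMap k).flip (Finsupp.single (y :: l') 1) ∘ₗ consMap k x)
      (consMap k (x, y) ∘ₗ ((shuffleMap k).flip (Finsupp.single (y :: l') 1) +
        (-1 : k) ^ (m + 1) • ((shuffleMap k).flip (Finsupp.single l' 1) ∘ₗ consMap k x))) := by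
    refine lists_induction k fun l hl => ?_
    simp only [LinearMap.mem_eqLocus, LinearMap.comp_apply, LinearMap.flip_apply, consMap_single,
      LinearMap.add_apply, LinearMap.smul_apply, shuffleMap_single]
    rw [shuffle_cons_cons, hl]
    rintro ⟨rfl, -⟩
    simp at hl
  exact this hc

theorem shuffleMap_consMap_consMap' {m : ℕ} (x : P) (y : Q) (l : List P) (c : List Q →₀ k)
    (hc : c ∈ lists k Q (m + 1)) :
    shuffleMap k (Finsupp.single (x :: l) 1) (consMap k y c) =
      consMap k (x, y) (shuffleMap k (Finsupp.single l 1) (consMap k y c) +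
        (-1 : k) ^ l.length • shuffleMap k (Finsupp.single (x :: l) 1) c) := by
  have : lists k Q (m + 1) ≤ LinearMap.eqLocus
      (shuffleMap k (Finsupp.single (x :: l) 1) ∘ₗ consMap k y)
      (consMap k (x, y) ∘ₗ (shuffleMap k (Finsupp.single l 1) ∘ₗ consMap k y +
        (-1 : k) ^ l.length • (shuffleMap k (Finsupp.single (x :: l) 1)))) := by
    refine lists_induction k fun l' hl => ?_
    simp only [LinearMap.mem_eqLocus, LinearMap.comp_apply, consMap_single,
      LinearMap.add_apply, LinearMap.smul_apply, shuffleMap_single]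
    rw [shuffle_cons_cons]
    rintro ⟨-, rfl⟩
    simp at hl
  exact this hc

theorem tailMap_shuffle (x : P) (y : Q) (l : List P) (l' : List Q) :
    tailMap k (shuffle k (x :: l) (y :: l')) =
      shuffle k l (y :: l') + (-1 : k) ^ l.length • shuffle k (x :: l) l' := by
  by_cases h : l = [] ∧ l' = []
  · obtain ⟨rfl, rfl⟩ := h
    rw [shuffle_single_single, tailMap_single]
    simp
  · rw [shuffle_cons_cons k x y l l' h]
    have hpos : 1 ≤ l.length + l'.length := by
      rcases l with _ | ⟨a, l⟩
      · rcases l' with _ | ⟨b, l'⟩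
        · simp at h
        · simp
      · simp; omega
    refine tailMap_consMap (n := l.length + l'.length - 1) k _ _
      (Submodule.add_mem _ ?_ (Submodule.smul_mem _ _ ?_))
    · have := shuffle_mem_lists k l (y :: l')
      rwa [show l.length + (y :: l').length - 1 = l.length + l'.length - 1 + 1 by simp; omega]
        at this
    · have := shuffle_mem_lists k (x :: l) l'
      rwa [show (x :: l).length + l'.length - 1 = l.length + l'.length - 1 + 1 by simp; omega]
        at this

theorem tail_add_bdry_mem (l : List P) :
    tailMap k (Finsupp.single l 1) + bdry k (Finsupp.single l 1) = 0 ∨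
      ∃ m, l.length = m + 1 + 1 ∧
        tailMap k (Finsupp.single l 1) + bdry k (Finsupp.single l 1) ∈ lists k P (m + 1) := by
  rcases l with _ | ⟨x, _ | ⟨y, l⟩⟩
  · left; simp [tailMap, bdry_single]
  · left; simp [tailMap, bdry_single]
  · right
    exact ⟨l.length, rfl, Submodule.add_mem _ (tailMap_mem_lists k _) (bdry_mem_lists k _)⟩

theorem tailMap_add (x : P) (y : Q) (l : List P) (l' : List Q) :
    tailMap k (shuffle k l (y :: l') + (-1 : k) ^ l.length • shuffle k (x :: l) l') =
      shuffleMap k (tailMap k (Finsupp.single l 1)) (Finsupp.single (y :: l') 1) +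
        shuffleMap k (Finsupp.single (x :: l) 1) (tailMap k (Finsupp.single l' 1)) := by
  have esq : (-1 : k) ^ l.length * (-1 : k) ^ l.length = 1 := by
    rw [← mul_pow]; simp
  have h1 : ∀ (l : List P), tailMap k (Finsupp.single l (1 : k)) = Finsupp.single l.tail 1 -
      if l.length ≤ 1 then Finsupp.single [] 1 else 0 := by
    intro l
    rcases l with _ | ⟨x, _ | ⟨y, l⟩⟩ <;> simp [tailMap_single]
  have h2 : ∀ (l : List Q), tailMap k (Finsupp.single l (1 : k)) = Finsupp.single l.tail 1 -
      if l.length ≤ 1 then Finsupp.single [] 1 else 0 := by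
    intro l
    rcases l with _ | ⟨x, _ | ⟨y, l⟩⟩ <;> simp [tailMap_single]
  have h1' : shuffleMap k (tailMap k (Finsupp.single l 1)) (Finsupp.single (y :: l') 1) =
      shuffle k l.tail (y :: l') := by
    rw [h1, map_sub, LinearMap.sub_apply, shuffleMap_single]
    split_ifs <;> simp
  have h2' : shuffleMap k (Finsupp.single (x :: l) 1) (tailMap k (Finsupp.single l' 1)) =
      shuffle k (x :: l) l'.tail := by
    rw [h2, map_sub, shuffleMap_single]
    split_ifs <;> simp
  rw [h1', h2', map_add, map_smul]
  rcases l with _ | ⟨x', l⟩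
  · rcases l' with _ | ⟨y', l'⟩
    · simp
    · rw [tailMap_shuffle]; simp
  · rw [tailMap_shuffle]
    rcases l' with _ | ⟨y', l'⟩
    · simp
    · rw [tailMap_shuffle, smul_add, smul_smul, esq, one_smul]
      simp only [List.length_cons, pow_succ, List.tail_cons, mul_neg, mul_one, neg_smul]
      abel

/-- The Leibniz rule. -/
theorem bdry_shuffle (l : List P) (l' : List Q) :
    bdry k (shuffle k l l') = shuffleMap k (bdry k (Finsupp.single l 1)) (Finsupp.single l' 1) +
      (-1 : k) ^ (l.length + 1) •
        shuffleMap k (Finsupp.single l 1) (bdry k (Finsupp.single l' 1)) := by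
  induction hn : l.length + l'.length using Nat.strong_induction_on generalizing l l' with
  | _ n ih =>
  rcases l with _ | ⟨x, l⟩
  · rw [shuffleMap_nil_left]
    simp [bdry_single]
  rcases l' with _ | ⟨y, l'⟩
  · rw [shuffleMap_nil_right]
    simp [bdry_single]
  by_cases h : l = [] ∧ l' = []
  · obtain ⟨rfl, rfl⟩ := h
    rw [shuffle_single_single]
    simp [bdry_single]
  · have ih1 := ih (l.length + (y :: l').length) (by simp at hn ⊢; omega) l (y :: l') rfl
    have ih2 := ih ((x :: l).length + l'.length) (by simp at hn ⊢; omega) (x :: l) l' rfl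
    have hx : bdry k (Finsupp.single (x :: l) (1 : k)) =
        - consMap k x (tailMap k (Finsupp.single l 1) + bdry k (Finsupp.single l 1)) := by
      rw [← consMap_single, bdry_consMap]
    have hy : bdry k (Finsupp.single (y :: l') (1 : k)) =
        - consMap k y (tailMap k (Finsupp.single l' 1) + bdry k (Finsupp.single l' 1)) := by
      rw [← consMap_single, bdry_consMap]
    have hA := tail_add_bdry_mem k l
    have hB := tail_add_bdry_mem k l'
    have htail := tailMap_add k x y l l'
    have hR := (map_add (bdry k) _ _).trans (congrArg₂ (· + ·) ih1
      ((map_smul (bdry k) ((-1 : k) ^ l.length) _).trans (congrArg ((-1 : k) ^ l.length • ·) ih2)))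
    rw [shuffle_cons_cons k x y l l' h, bdry_consMap, htail, hR, hx, hy]
    have e1 : shuffleMap k (consMap k x (tailMap k (Finsupp.single l 1) +
        bdry k (Finsupp.single l 1))) (Finsupp.single (y :: l') 1) = consMap k (x, y)
          (shuffleMap k (tailMap k (Finsupp.single l 1) + bdry k (Finsupp.single l 1))
            (Finsupp.single (y :: l') 1) - (-1 : k) ^ l.length •
          shuffleMap k (consMap k x (tailMap k (Finsupp.single l 1) +
            bdry k (Finsupp.single l 1))) (Finsupp.single l' 1)) := by
      rcases hA with hA | ⟨m, hm, hA⟩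
      · simp [hA]
      · rw [shuffleMap_consMap_consMap k x y _ hA, hm, pow_succ (-1 : k) (m + 1)]
        rw [mul_neg_one, neg_smul, sub_neg_eq_add]
    have e2 : shuffleMap k (Finsupp.single (x :: l) 1) (consMap k y (tailMap k (Finsupp.single l' 1) +
        bdry k (Finsupp.single l' 1))) = consMap k (x, y)
          (shuffleMap k (Finsupp.single l 1) (consMap k y (tailMap k (Finsupp.single l' 1) +
            bdry k (Finsupp.single l' 1))) + (-1 : k) ^ l.length •
          shuffleMap k (Finsupp.single (x :: l) 1) (tailMap k (Finsupp.single l' 1) +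
            bdry k (Finsupp.single l' 1))) := by
      rcases hB with hB | ⟨m, hm, hB⟩
      · simp [hB]
      · rw [shuffleMap_consMap_consMap' k x y _ _ hB]
    have esq : (-1 : k) ^ l.length * (-1 : k) ^ l.length = 1 := by
      rw [← mul_pow]; simp
    simp only [map_neg (shuffleMap k), map_neg (shuffleMap k _), LinearMap.neg_apply, e1, e2]
    simp only [List.length_cons, pow_succ, map_add, map_sub, map_smul, map_neg, LinearMap.add_apply,
      smul_add, smul_neg, smul_smul, mul_neg, mul_one, neg_smul, neg_neg, esq, one_smul]
    abel

end Shuffle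

section Cross

set_option linter.unusedSectionVars false

variable (k : Type u) [CommRing k] {P Q P' Q' : Type*} [PartialOrder P] [PartialOrder Q]
  [PartialOrder P'] [PartialOrder Q']

/-- A chain `x = x_0 < ⋯ < x_r = y`. -/
def IsPath (x y : P) (r : ℕ) (l : List P) : Prop :=
  l.length = r + 1 ∧ l.IsChain (· < ·) ∧ l.head? = some x ∧ l.getLast? = some y

/-- Linear combinations of chains from `x` to `y`. -/
def paths (x y : P) (r : ℕ) : Submodule k (List P →₀ k) :=
  Finsupp.supported k k {l | IsPath x y r l}

theorem paths_induction {x y : P} {r : ℕ} {N : Submodule k (List P →₀ k)}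
    (h : ∀ l, IsPath x y r l → Finsupp.single l (1 : k) ∈ N) : paths k x y r ≤ N := by
  rw [paths, Finsupp.supported_eq_span_single, Submodule.span_le]
  rintro _ ⟨l, hl, rfl⟩
  exact h l hl

theorem single_mem_paths {x y : P} {r : ℕ} {l : List P} (h : IsPath x y r l) :
    Finsupp.single l (1 : k) ∈ paths k x y r :=
  Finsupp.single_mem_supported k 1 h

theorem IsFull.exists_isPath {r : ℕ} {l : List P} (h : IsFull r l) :
    ∃ x y, IsBot x ∧ IsTop y ∧ IsPath x y r l := by
  obtain ⟨h1, h2, h3, h4⟩ := h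
  have hne : l ≠ [] := by rintro rfl; simp at h1
  exact ⟨l.head hne, l.getLast hne, h3 _ (List.head?_eq_some_head hne),
    h4 _ (List.getLast?_eq_some_getLast hne), h1, h2, List.head?_eq_some_head hne,
    List.getLast?_eq_some_getLast hne⟩

theorem paths_le_chains {x y : P} (hx : IsBot x) (hy : IsTop y) (r : ℕ) :
    paths k x y r ≤ chains k P r := by
  refine paths_induction k fun l hl => single_mem_chains k ⟨hl.1, hl.2.1, ?_, ?_⟩
  · rw [hl.2.2.1]; rintro _ ⟨⟩; exact hx
  · rw [hl.2.2.2]; rintro _ ⟨⟩; exact hy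

theorem consMap_mem_paths {x y z : P} (hxy : x < y) {r : ℕ} {c : List P →₀ k}
    (hc : c ∈ paths k y z r) : consMap k x c ∈ paths k x z (r + 1) := by
  have : paths k y z r ≤ (paths k x z (r + 1)).comap (consMap k x) := by
    refine paths_induction k fun l hl => ?_
    rw [Submodule.mem_comap, consMap_single]
    refine single_mem_paths k ⟨by simp [hl.1], ?_, rfl, ?_⟩
    · rw [List.isChain_cons]
      refine ⟨?_, hl.2.1⟩
      rw [hl.2.2.1]; rintro _ ⟨⟩; exact hxy
    · rw [List.getLast?_cons, hl.2.2.2]; rfl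
  exact this hc

theorem IsPath.tail {x y z : P} {r : ℕ} {l : List P} (h : IsPath x y r (x :: z :: l)) :
    ∃ s, r = s + 1 ∧ x < z ∧ IsPath z y s (z :: l) := by
  obtain ⟨h1, h2, h3, h4⟩ := h
  rw [List.isChain_cons_cons] at h2
  refine ⟨l.length, by simpa using h1.symm, h2.1, by simp, h2.2, rfl, ?_⟩
  rwa [List.getLast?_cons_cons] at h4

theorem IsPath.head {x x' y : P} {r : ℕ} {l : List P} (h : IsPath x y r (x' :: l)) : x' = x := by
  simpa using h.2.2.1

theorem shuffle_mem_paths {x y : P} {x' y' : Q} {r s : ℕ} {l : List P} {l' : List Q}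
    (h : IsPath x y r l) (h' : IsPath x' y' s l') :
    shuffle k l l' ∈ paths k (x, x') (y, y') (r + s) := by
  induction hn : r + s using Nat.strong_induction_on generalizing l l' x x' r s with
  | _ n ih =>
  rcases l with _ | ⟨a, l⟩
  · simp
  rcases l' with _ | ⟨b, l'⟩
  · simp
  obtain rfl := h.head
  obtain rfl := h'.head
  by_cases hne : l = [] ∧ l' = []
  · obtain ⟨rfl, rfl⟩ := hne
    rw [shuffle_single_single]
    have h1 := h.1
    have h2 := h'.1
    have h3 := h.2.2.2
    have h4 := h'.2.2.2
    simp at h1 h2 h3 h4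
    subst hn h1 h2 h3 h4
    exact single_mem_paths k ⟨rfl, List.isChain_singleton _, rfl, rfl⟩
  · rw [shuffle_cons_cons k a b l l' hne, map_add, map_smul]
    refine Submodule.add_mem _ ?_ (Submodule.smul_mem _ _ ?_)
    · rcases l with _ | ⟨c, l⟩
      · simp
      · obtain ⟨t, rfl, hlt, ht⟩ := h.tail
        have := ih (t + s) (by omega) ht h' rfl
        rw [show n = t + s + 1 by omega]
        exact consMap_mem_paths k (Prod.mk_lt_mk.2 (Or.inl ⟨hlt, le_rfl⟩)) this
    · rcases l' with _ | ⟨c, l'⟩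
      · simp
      · obtain ⟨t, rfl, hlt, ht⟩ := h'.tail
        have := ih (r + t) (by omega) h ht rfl
        rw [show n = r + t + 1 by omega]
        exact consMap_mem_paths k (Prod.mk_lt_mk.2 (Or.inr ⟨le_rfl, hlt⟩)) this

theorem isBot_prod {x : P} {y : Q} (hx : IsBot x) (hy : IsBot y) : IsBot (x, y) :=
  fun z => ⟨hx z.1, hy z.2⟩

theorem isTop_prod {x : P} {y : Q} (hx : IsTop x) (hy : IsTop y) : IsTop (x, y) :=
  fun z => ⟨hx z.1, hy z.2⟩

theorem shuffleMap_mem_chains {r s : ℕ} {c : List P →₀ k} {c' : List Q →₀ k}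
    (h : c ∈ chains k P r) (h' : c' ∈ chains k Q s) :
    shuffleMap k c c' ∈ chains k (P × Q) (r + s) := by
  have h1 : ∀ l : List P, IsFull r l → ∀ c' ∈ chains k Q s,
      shuffleMap k (Finsupp.single l 1) c' ∈ chains k (P × Q) (r + s) := by
    intro l hl c' hc'
    have : chains k Q s ≤ (chains k (P × Q) (r + s)).comap (shuffleMap k (Finsupp.single l 1)) := by
      refine chains_induction k fun l' hl' => ?_
      rw [Submodule.mem_comap, shuffleMap_single]
      obtain ⟨x, y, hx, hy, hp⟩ := hl.exists_isPath
      obtain ⟨x', y', hx', hy', hp'⟩ := hl'.exists_isPath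
      exact paths_le_chains k (isBot_prod hx hx') (isTop_prod hy hy') _
        (shuffle_mem_paths k hp hp')
    exact this hc'
  have : chains k P r ≤ (chains k (P × Q) (r + s)).comap ((shuffleMap k).flip c') :=
    chains_induction k fun l hl => h1 l hl c' h'
  exact this h

theorem bdry_shuffleMap {r : ℕ} {c : List P →₀ k} (c' : List Q →₀ k) (h : c ∈ chains k P r) :
    bdry k (shuffleMap k c c') =
      shuffleMap k (bdry k c) c' + (-1 : k) ^ r • shuffleMap k c (bdry k c') := by
  have : chains k P r ≤ LinearMap.eqLocus (bdry k ∘ₗ (shuffleMap k).flip c')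
      ((shuffleMap k).flip c' ∘ₗ bdry k + (-1 : k) ^ r • (shuffleMap k).flip (bdry k c')) := by
    refine chains_induction k fun l hl => ?_
    rw [LinearMap.mem_eqLocus]
    refine DFunLike.congr_fun (f := bdry k ∘ₗ shuffleMap k (Finsupp.single l 1))
      (g := shuffleMap k (bdry k (Finsupp.single l 1)) + (-1 : k) ^ r •
        (shuffleMap k (Finsupp.single l 1) ∘ₗ bdry k)) ?_ c'
    refine Finsupp.lhom_ext' fun l' => LinearMap.ext_ring ?_
    simp only [LinearMap.comp_apply, Finsupp.lsingle_apply, LinearMap.add_apply,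
      LinearMap.smul_apply, shuffleMap_single]
    rw [bdry_shuffle, hl.1, pow_succ, pow_succ]
    simp
  exact this h

theorem shuffleMap_cycles {r s : ℕ} (z) (hz : z ∈ cycles k P r) (w) (hw : w ∈ cycles k Q s) :
    shuffleMap k z w ∈ cycles k (P × Q) (r + s) := by
  refine ⟨shuffleMap_mem_chains k hz.1 hw.1, ?_⟩
  change bdry k _ = 0
  rw [bdry_shuffleMap k w hz.1, show bdry k z = 0 from hz.2, show bdry k w = 0 from hw.2]
  simp

theorem shuffleMap_boundaries_left {r s : ℕ} (z) (hz : z ∈ boundaries k P r) (w)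
    (hw : w ∈ cycles k Q s) : shuffleMap k z w ∈ boundaries k (P × Q) (r + s) := by
  obtain ⟨c, hc, rfl⟩ := hz
  refine ⟨shuffleMap k c w, ?_, ?_⟩
  · rw [show r + s + 1 = r + 1 + s by omega]
    exact shuffleMap_mem_chains k hc hw.1
  · rw [bdry_shuffleMap k w hc, show bdry k w = 0 from hw.2]
    simp

theorem shuffleMap_boundaries_right {r s : ℕ} (z) (hz : z ∈ cycles k P r) (w)
    (hw : w ∈ boundaries k Q s) : shuffleMap k z w ∈ boundaries k (P × Q) (r + s) := by
  obtain ⟨c, hc, rfl⟩ := hw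
  refine ⟨(-1 : k) ^ r • shuffleMap k z c, ?_, ?_⟩
  · exact Submodule.smul_mem _ _ (shuffleMap_mem_chains (s := s + 1) k hz.1 hc)
  · rw [map_smul, bdry_shuffleMap k c hz.1, show bdry k z = 0 from hz.2, smul_add, smul_smul,
      ← mul_pow]
    simp

/-- The cross product
`H̃_{r-2}(P̄) ⊗ H̃_{s-2}(Q̄) → H̃_{r+s-2}` of the proper part of `P × Q`. -/
def RedHom.cross (r s : ℕ) : RedHom k P r →ₗ[k] RedHom k Q s →ₗ[k] RedHom k (P × Q) (r + s) :=
  SubQuot.map₂ (shuffleMap k) (shuffleMap_cycles k) (shuffleMap_boundaries_left k)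
    (shuffleMap_boundaries_right k)

/-- The product of two embeddings. -/
def prodEmb (f : P ↪o P') (g : Q ↪o Q') : P × Q ↪o P' × Q' :=
  OrderEmbedding.ofMapLEIff (Prod.map f g) fun a b => by
    simp [Prod.le_def]

theorem mapDomain_shuffle {P Q P' Q' : Type*} (f : P → P') (g : Q → Q') (l : List P) (l' : List Q) :
    Finsupp.lmapDomain k k (List.map (Prod.map f g)) (shuffle k l l') =
      shuffle k (l.map f) (l'.map g) := by
  have hc : ∀ (x : P) (y : Q) (c : List (P × Q) →₀ k),
      Finsupp.lmapDomain k k (List.map (Prod.map f g)) (consMap k (x, y) c) =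
      consMap k (f x, g y) (Finsupp.lmapDomain k k (List.map (Prod.map f g)) c) := by
    intro x y c
    refine DFunLike.congr_fun
      (f := Finsupp.lmapDomain k k (List.map (Prod.map f g)) ∘ₗ consMap k (x, y))
      (g := consMap k (f x, g y) ∘ₗ Finsupp.lmapDomain k k (List.map (Prod.map f g))) ?_ c
    refine Finsupp.lhom_ext' fun l => LinearMap.ext_ring ?_
    simp
  induction hn : l.length + l'.length using Nat.strong_induction_on generalizing l l' with
  | _ n ih =>
  rcases l with _ | ⟨x, l⟩
  · simp
  rcases l' with _ | ⟨y, l'⟩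
  · simp
  by_cases h : l = [] ∧ l' = []
  · obtain ⟨rfl, rfl⟩ := h
    simp [shuffle_single_single]
  · rw [shuffle_cons_cons k x y l l' h, hc, map_add, map_smul,
      ih (l.length + (y :: l').length) (by simp at hn ⊢; omega) l (y :: l') rfl,
      ih ((x :: l).length + l'.length) (by simp at hn ⊢; omega) (x :: l) l' rfl,
      List.map_cons, List.map_cons, shuffle_cons_cons k (f x) (g y) _ _ (by simpa using h),
      List.length_map]

open Classical in
theorem chainMap_of_paths (f : P ↪o Q) {x y : P} {r : ℕ} {c : List P →₀ k}
    (hc : c ∈ paths k x y r) : chainMap k f c =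
      if IsBot (f x) ∧ IsTop (f y) then Finsupp.lmapDomain k k (List.map f) c else 0 := by
  have : paths k x y r ≤ LinearMap.eqLocus (chainMap k f)
      (if IsBot (f x) ∧ IsTop (f y) then Finsupp.lmapDomain k k (List.map f) else 0) := by
    refine paths_induction k fun l hl => ?_
    have e : Ends (l.map f) ↔ IsBot (f x) ∧ IsTop (f y) := by
      simp [Ends, List.head?_map, List.getLast?_map, hl.2.2.1, hl.2.2.2]
    rw [LinearMap.mem_eqLocus, chainMap_single]
    simp only [e]
    split_ifs <;> simp
  have h2 := this hc
  rw [LinearMap.mem_eqLocus] at h2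
  rw [h2]
  split_ifs <;> rfl

theorem isBot_prod_iff {x : P} {y : Q} : IsBot (x, y) ↔ IsBot x ∧ IsBot y :=
  ⟨fun h => ⟨fun z => (h (z, y)).1, fun z => (h (x, z)).2⟩, fun h => isBot_prod h.1 h.2⟩

theorem isTop_prod_iff {x : P} {y : Q} : IsTop (x, y) ↔ IsTop x ∧ IsTop y :=
  ⟨fun h => ⟨fun z => (h (z, y)).1, fun z => (h (x, z)).2⟩, fun h => isTop_prod h.1 h.2⟩

theorem chainMap_shuffleMap (f : P ↪o P') (g : Q ↪o Q') {r s : ℕ} {c : List P →₀ k}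
    {c' : List Q →₀ k} (h : c ∈ chains k P r) (h' : c' ∈ chains k Q s) :
    shuffleMap k (chainMap k f c) (chainMap k g c') =
      chainMap k (prodEmb f g) (shuffleMap k c c') := by
  classical
  have key : ∀ (l : List P) (l' : List Q), IsFull r l → IsFull s l' →
      shuffleMap k (chainMap k f (Finsupp.single l 1)) (chainMap k g (Finsupp.single l' 1)) =
      chainMap k (prodEmb f g) (shuffleMap k (Finsupp.single l 1) (Finsupp.single l' 1)) := by
    intro l l' hl hl'
    obtain ⟨x, y, -, -, hp⟩ := hl.exists_isPath
    obtain ⟨x', y', -, -, hp'⟩ := hl'.exists_isPath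
    rw [shuffleMap_single, chainMap_of_paths k _ (shuffle_mem_paths k hp hp'),
      chainMap_of_paths k f (single_mem_paths k hp), chainMap_of_paths k g (single_mem_paths k hp')]
    have e1 : IsBot (prodEmb f g (x, x')) ↔ IsBot (f x) ∧ IsBot (g x') := isBot_prod_iff
    have e2 : IsTop (prodEmb f g (y, y')) ↔ IsTop (f y) ∧ IsTop (g y') := isTop_prod_iff
    rw [e1, e2]
    have e3 : shuffleMap k (Finsupp.lmapDomain k k (List.map f) (Finsupp.single l 1))
        (Finsupp.lmapDomain k k (List.map g) (Finsupp.single l' 1)) =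
        Finsupp.lmapDomain k k (List.map (prodEmb f g)) (shuffle k l l') := by
      rw [show (prodEmb f g : P × Q → P' × Q') = Prod.map f g from rfl, mapDomain_shuffle]
      simp
    by_cases hf : IsBot (f x) ∧ IsTop (f y)
    · by_cases hg : IsBot (g x') ∧ IsTop (g y')
      · rw [if_pos hf, if_pos hg, if_pos ⟨⟨hf.1, hg.1⟩, hf.2, hg.2⟩, e3]
      · rw [if_neg hg, map_zero, if_neg fun h => hg ⟨h.1.2, h.2.2⟩]
    · rw [if_neg hf, map_zero, LinearMap.zero_apply, if_neg fun h => hf ⟨h.1.1, h.2.1⟩]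
  have h1 : ∀ l : List P, IsFull r l → ∀ c' ∈ chains k Q s,
      shuffleMap k (chainMap k f (Finsupp.single l 1)) (chainMap k g c') =
      chainMap k (prodEmb f g) (shuffleMap k (Finsupp.single l 1) c') := by
    intro l hl c' hc'
    have : chains k Q s ≤ LinearMap.eqLocus
        (shuffleMap k (chainMap k f (Finsupp.single l 1)) ∘ₗ chainMap k g)
        (chainMap k (prodEmb f g) ∘ₗ shuffleMap k (Finsupp.single l 1)) :=
      chains_induction k fun l' hl' => key l l' hl hl'
    exact this hc'
  have : chains k P r ≤ LinearMap.eqLocus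
      ((shuffleMap k).flip (chainMap k g c') ∘ₗ chainMap k f)
      (chainMap k (prodEmb f g) ∘ₗ (shuffleMap k).flip c') :=
    chains_induction k fun l hl => h1 l hl c' h'
  exact this h

theorem RedHom.cross_map (f : P ↪o P') (g : Q ↪o Q') (r s : ℕ) (x : RedHom k P r)
    (y : RedHom k Q s) : RedHom.cross k r s (RedHom.map k f r x) (RedHom.map k g s y) =
      RedHom.map k (prodEmb f g) (r + s) (RedHom.cross k r s x y) := by
  obtain ⟨z, hz, rfl⟩ := SubQuot.mk_surjective x
  obtain ⟨w, hw, rfl⟩ := SubQuot.mk_surjective y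
  exact SubQuot.mk_congr (chainMap_shuffleMap k f g hz.1 hw.1) _ _

end Cross

/-! ### Embeddings of Dowling posets -/

namespace Poset

variable {G : Type*} [Group G] {S : Type*} [MulAction G S] {T : Set S} {I J K : Type*}

theorem map_symm_map (φ : FBHom G I J) (α : Poset G S T I) : map φ.symm (map φ α) = α := by
  have e : FBHom.comp φ.symm φ = FBHom.id G I := by
    apply FBHom.ext
    · exact Equiv.self_trans_symm _
    · funext i; simp [FBHom.comp, FBHom.symm, FBHom.id]
  rw [← map_comp, e, map_id]

/-- `map`, as an embedding of posets. -/
def mapEmb (φ : FBHom G I J) : Poset G S T I ↪o Poset G S T J :=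
  OrderEmbedding.ofMapLEIff (map φ) fun α β =>
    ⟨fun h => by simpa only [map_symm_map] using map_le_map φ.symm h, map_le_map φ⟩

theorem union_le_union_iff {α α' : Poset G S T I} {β β' : Poset G S T J} :
    union α β ≤ union α' β' ↔ α ≤ α' ∧ β ≤ β' := by
  refine ⟨fun h => ⟨⟨fun i => h.1 (.inl i), fun i g j => h.2 (.inl i) g (.inl j)⟩,
    ⟨fun i => h.1 (.inr i), fun i g j => h.2 (.inr i) g (.inr j)⟩⟩,
    fun h => union_le_union h.1 h.2⟩

/-- The product `D_[m] × D_[n] → D_[m+n]`, as an embedding of posets. -/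
def mulEmb (G S : Type*) [Group G] [MulAction G S] (T : Set S) (m n : ℕ) :
    Poset G S T (Fin m) × Poset G S T (Fin n) ↪o Poset G S T (Fin (m + n)) :=
  OrderEmbedding.ofMapLEIff (fun p => mul p.1 p.2) fun _ _ =>
    ((mapEmb (FBHom.ofEquiv G finSumFinEquiv)).le_iff_le).trans
      (union_le_union_iff.trans Prod.le_def.symm)

end Poset

/-! ### Whitney homology -/

theorem RedHom.map_point (k : Type u) [CommRing k] {P Q : Type*} [PartialOrder P] [PartialOrder Q]
    (f : P ↪o Q) (x : P) (hb : IsBot x) (ht : IsTop x) (hb' : IsBot (f x)) (ht' : IsTop (f x)) :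
    RedHom.map k f 0 (RedHom.point k x hb ht) = RedHom.point k (f x) hb' ht' := by
  classical
  refine SubQuot.mk_congr ?_ _ _
  change chainMap k f (Finsupp.single [x] 1) = _
  rw [chainMap_single, if_pos]
  · rfl
  · simpa [Ends] using ⟨hb', ht'⟩

theorem RedHom.cross_point (k : Type u) [CommRing k] {P Q : Type*} [PartialOrder P]
    [PartialOrder Q] (x : P) (hb : IsBot x) (ht : IsTop x) (y : Q) (hb' : IsBot y) (ht' : IsTop y) :
    RedHom.cross k 0 0 (RedHom.point k x hb ht) (RedHom.point k y hb' ht') =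
      RedHom.point k (x, y) (isBot_prod hb hb') (isTop_prod ht ht') := by
  refine SubQuot.mk_congr ?_ _ _
  change shuffleMap k (Finsupp.single [x] 1) (Finsupp.single [y] 1) = _
  rw [shuffleMap_single, shuffle_single_single]

section Whitney

variable (k : Type u) [CommRing k] {P Q R P' Q' : Type*} [PartialOrder P] [PartialOrder Q]
  [PartialOrder R] [PartialOrder P'] [PartialOrder Q']

variable (P) in
/-- Whitney homology: `WH_r(P) = ⨁ p, H̃_{r-2}` of the proper part of `P^{≤ p}`. -/
abbrev WH (r : ℕ) : Type _ := ⨁ p : P, RedHom k (Set.Iic p) r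

/-- The inclusion of a summand. -/
def WH.incl (r : ℕ) (p : P) : RedHom k (Set.Iic p) r →ₗ[k] WH k P r :=
  letI : DecidableEq P := Classical.decEq P
  DirectSum.lof k P (fun p => RedHom k (Set.Iic p) r) p

variable {k} in
/-- The linear map given by its restrictions to the summands. -/
def WH.desc {M : Type*} [AddCommGroup M] [Module k M] {r : ℕ}
    (f : ∀ p : P, RedHom k (Set.Iic p) r →ₗ[k] M) : WH k P r →ₗ[k] M :=
  letI : DecidableEq P := Classical.decEq P
  DirectSum.toModule k P M f

variable {k} in
@[simp] theorem WH.desc_incl {M : Type*} [AddCommGroup M] [Module k M] {r : ℕ}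
    (f : ∀ p : P, RedHom k (Set.Iic p) r →ₗ[k] M) (p : P) (c : RedHom k (Set.Iic p) r) :
    WH.desc f (WH.incl k r p c) = f p c := by
  simp [WH.desc, WH.incl]

variable {k} in
theorem WH.hom_ext {M : Type*} [AddCommGroup M] [Module k M] {r : ℕ} {f g : WH k P r →ₗ[k] M}
    (h : ∀ p c, f (WH.incl k r p c) = g (WH.incl k r p c)) : f = g := by
  let _ : DecidableEq P := Classical.decEq P
  exact DirectSum.linearMap_ext _ fun p => LinearMap.ext fun c => h p c

/-- An embedding restricts to lower intervals. -/
def iicEmb (f : P ↪o Q) (p : P) : Set.Iic p ↪o Set.Iic (f p) :=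
  OrderEmbedding.ofMapLEIff (fun x => ⟨f x, Set.mem_Iic.2 (f.monotone (Set.mem_Iic.1 x.2))⟩) fun _ _ => f.le_iff_le

/-- The product of two lower intervals. -/
def iicProd (p : P) (q : Q) : Set.Iic p × Set.Iic q ↪o Set.Iic (p, q) :=
  OrderEmbedding.ofMapLEIff (fun x => ⟨(x.1, x.2), Set.mem_Iic.2
    (Prod.mk_le_mk.2 ⟨Set.mem_Iic.1 x.1.2, Set.mem_Iic.1 x.2.2⟩)⟩) fun _ _ => Iff.rfl

theorem incl_map_congr {r : ℕ} {p q : P} (h : p = q) (f : R ↪o Set.Iic p) (g : R ↪o Set.Iic q)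
    (hfg : ∀ x, (f x : P) = g x) (c : RedHom k R r) :
    WH.incl k r p (RedHom.map k f r c) =
      WH.incl k r q (RedHom.map k g r c) := by
  subst h
  have : f = g := by ext x; exact hfg x
  rw [this]

/-- Functoriality of Whitney homology under embeddings. -/
def WH.map (f : P ↪o Q) (r : ℕ) : WH k P r →ₗ[k] WH k Q r :=
  WH.desc fun p =>
    WH.incl k r (f p) ∘ₗ RedHom.map k (iicEmb f p) r

theorem WH.map_incl (f : P ↪o Q) (r : ℕ) (p : P) (c : RedHom k (Set.Iic p) r) :
    WH.map k f r (WH.incl k r p c) =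
      WH.incl k r (f p) (RedHom.map k (iicEmb f p) r c) := by
  rw [WH.map, WH.desc_incl]; rfl

theorem WH.map_id {f : P ↪o P} (h : ∀ x, f x = x) (r : ℕ) : WH.map k f r = LinearMap.id := by
  refine WH.hom_ext fun p c => ?_
  rw [LinearMap.id_apply]
  rw [WH.map_incl, incl_map_congr k (h p) (iicEmb f p) (RelEmbedding.refl _) fun x => h x.1,
    RedHom.map_id k fun _ => rfl]

theorem WH.map_comp (g : Q ↪o R) (f : P ↪o Q) (h : P ↪o R) (e : ∀ x, h x = g (f x)) (r : ℕ) :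
    WH.map k h r = WH.map k g r ∘ₗ WH.map k f r := by
  refine WH.hom_ext fun p c => ?_
  simp only [LinearMap.comp_apply]
  rw [WH.map_incl, WH.map_incl, WH.map_incl, ← RedHom.map_comp]
  exact incl_map_congr k (e p) _ _ (fun x => e x.1) c

/-- The cross product in Whitney homology. -/
def WH.cross (r s : ℕ) : WH k P r →ₗ[k] WH k Q s →ₗ[k] WH k (P × Q) (r + s) :=
  WH.desc fun p => LinearMap.flip <| WH.desc fun q =>
    ((RedHom.cross k r s).compr₂
      (WH.incl k (r + s) (p, q) ∘ₗ
        RedHom.map k (iicProd p q) (r + s))).flip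

theorem WH.cross_incl_incl (r s : ℕ) (p : P) (q : Q) (c : RedHom k (Set.Iic p) r)
    (d : RedHom k (Set.Iic q) s) :
    WH.cross k r s (WH.incl k r p c)
      (WH.incl k s q d) =
      WH.incl k (r + s) (p, q)
        (RedHom.map k (iicProd p q) (r + s) (RedHom.cross k r s c d)) := by
  simp [WH.cross]

theorem WH.cross_map (f : P ↪o P') (g : Q ↪o Q') (r s : ℕ) (x : WH k P r) (y : WH k Q s) :
    WH.cross k r s (WH.map k f r x) (WH.map k g s y) =
      WH.map k (prodEmb f g) (r + s) (WH.cross k r s x y) := by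
  have h : (WH.cross k r s).compl₁₂ (WH.map k f r) (WH.map k g s) =
      (WH.cross k r s).compr₂ (WH.map k (prodEmb f g) (r + s)) := by
    refine WH.hom_ext fun p c => WH.hom_ext fun q d => ?_
    simp only [LinearMap.compl₁₂_apply, LinearMap.compr₂_apply]
    rw [WH.map_incl, WH.map_incl, WH.cross_incl_incl, WH.cross_incl_incl, WH.map_incl,
      RedHom.cross_map, ← RedHom.map_comp, ← RedHom.map_comp]
    exact incl_map_congr k (R := Set.Iic p × Set.Iic q) rfl _ _ (fun _ => rfl) _
  exact LinearMap.congr_fun₂ h x y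

/-- The unit of Whitney homology at a least element `p`: the generator of
`H̃_{-2}` of the proper part of the one point poset `P^{≤ p}`. -/
def WH.unit (p : P) (hp : IsBot p) : WH k P 0 :=
  WH.incl k 0 p (RedHom.point k ⟨p, Set.self_mem_Iic⟩ (fun x => hp x.1) (fun x => x.2))

theorem WH.cross_unit (p : P) (hp : IsBot p) (q : Q) (hq : IsBot q) :
    WH.cross k 0 0 (WH.unit k p hp) (WH.unit k q hq) = WH.unit k (p, q) (isBot_prod hp hq) := by
  rw [WH.unit, WH.unit, WH.cross_incl_incl]
  refine congrArg (WH.incl k 0 (p, q)) ?_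
  refine (congrArg (RedHom.map k (iicProd p q) 0) (RedHom.cross_point k _ _ _ _ _ _)).trans ?_
  apply RedHom.map_point

theorem WH.map_unit (f : P ↪o Q) (p : P) (hp : IsBot p) (q : Q) (hq : IsBot q) (h : f p = q) :
    WH.map k f 0 (WH.unit k p hp) = WH.unit k q hq := by
  subst h
  rw [WH.unit, WH.map_incl]
  refine congrArg (WH.incl k 0 (f p)) ?_
  apply RedHom.map_point

end Whitney

/-! ### GTCAs -/

/-- The data of a `G`-twisted algebra in graded `k`-modules, on the skeleton `[0], [1], …`:
a graded representation of the wreath product of `G` with `S_n` for every `n`, and equivariant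
products `A_[m] ⊗ A_[n] → A_[m+n]`. `obj n p` is the part of `A_[n]` of degree `p`.
Associativity, unit and commutativity are in `TwAlg.IsGTCA`. -/
structure TwAlg (k : Type*) [CommRing k] (G : Type*) [Group G] where
  obj : ℕ → ℕ → Type u
  [addCommGroup : ∀ n p, AddCommGroup (obj n p)]
  [module : ∀ n p, Module k (obj n p)]
  act : ∀ n p, Representation k (Wr G n) (obj n p)
  mul : ∀ m n p q, obj m p →ₗ[k] obj n q →ₗ[k] obj (m + n) (p + q)
  one : obj 0 0
  mul_act : ∀ m n p q a b x y, mul m n p q (act m p a x) (act n q b y) =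
    act (m + n) (p + q) (Wr.block a b) (mul m n p q x y)
  one_mul_one : mul 0 0 0 0 one one = one

attribute [instance] TwAlg.addCommGroup TwAlg.module

namespace TwAlg

variable {k : Type*} [CommRing k] {G : Type*} [Group G]

/-- An element of `A`, together with its arity and degree. -/
def elem (A : TwAlg k G) {n p : ℕ} (x : A.obj n p) : Σ i : ℕ × ℕ, A.obj i.1 i.2 := ⟨(n, p), x⟩

/-- The bijection `[m + n] → [n + m]` that interchanges the two blocks, as a permutation of
`[m + n]`. -/
def blockSwap (m n : ℕ) : Equiv.Perm (Fin (m + n)) :=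
  finSumFinEquiv.symm.trans ((Equiv.sumComm _ _).trans
    (finSumFinEquiv.trans (finCongr (Nat.add_comm n m))))

/-- The axioms of a GTCA in graded `k`-modules (with the Koszul sign in the symmetry), that is, of a
lax symmetric monoidal functor on finite sets and `G`-bijections; it is unital: `A_∅` is
the monoidal unit `k` in degree zero. -/
structure IsGTCA (A : TwAlg k G) : Prop where
  mul_assoc : ∀ {l m n p q r : ℕ} (x : A.obj l p) (y : A.obj m q) (z : A.obj n r),
    A.elem (A.mul _ _ _ _ (A.mul _ _ _ _ x y) z) = A.elem (A.mul _ _ _ _ x (A.mul _ _ _ _ y z))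
  one_mul : ∀ {n p : ℕ} (x : A.obj n p), A.elem (A.mul _ _ _ _ A.one x) = A.elem x
  mul_one : ∀ {n p : ℕ} (x : A.obj n p), A.elem (A.mul _ _ _ _ x A.one) = A.elem x
  mul_comm : ∀ {m n p q : ℕ} (x : A.obj m p) (y : A.obj n q),
    A.elem (A.act _ _ (FBHom.ofEquiv G (blockSwap m n)) (A.mul _ _ _ _ x y)) =
      A.elem ((-1 : k) ^ (p * q) • A.mul _ _ _ _ y x)
  unital : Function.Bijective (fun c : k => c • A.one)
  unital' : ∀ p, p ≠ 0 → Subsingleton (A.obj 0 p)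

/-- An isomorphism of GTCAs in graded `k`-modules. -/
structure Iso (A B : TwAlg k G) where
  equiv : ∀ n p, A.obj n p ≃ₗ[k] B.obj n p
  map_act : ∀ n p a x, equiv n p (A.act n p a x) = B.act n p a (equiv n p x)
  map_mul : ∀ m n p q x y, equiv (m + n) (p + q) (A.mul m n p q x y) =
    B.mul m n p q (equiv m p x) (equiv n q y)
  map_one : equiv 0 0 A.one = B.one

end TwAlg

section

variable (k : Type u) [CommRing k] (G S : Type u) [Group G] [MulAction G S] (T : Set S)

/-- The GTCA of Whitney homologies `WH_*(D_•^T(G, S))`. -/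
def whitney : TwAlg.{u} k G where
  obj n r := WH k (Poset G S T (Fin n)) r
  act n r :=
    { toFun a := WH.map k (Poset.mapEmb a) r
      map_one' := WH.map_id k Poset.map_id r
      map_mul' a b := WH.map_comp k _ _ _ (Poset.map_comp a b) r }
  mul m n p q := (WH.cross k p q).compr₂ (WH.map k (Poset.mulEmb G S T m n) (p + q))
  one := WH.unit k ⊥ isBot_bot
  mul_act m n p q a b x y := by
    change WH.map k _ _ (WH.cross k p q (WH.map k _ _ x) (WH.map k _ _ y)) =
      WH.map k _ _ (WH.map k _ _ (WH.cross k p q x y))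
    rw [WH.cross_map]
    have h1 := WH.map_comp k (Poset.mulEmb G S T m n)
      (prodEmb (Poset.mapEmb a) (Poset.mapEmb b))
      ((prodEmb (Poset.mapEmb a) (Poset.mapEmb b)).trans (Poset.mulEmb G S T m n))
      (fun _ => rfl) (p + q)
    have h2 := WH.map_comp k (Poset.mapEmb (Wr.block a b)) (Poset.mulEmb G S T m n)
      ((prodEmb (Poset.mapEmb a) (Poset.mapEmb b)).trans (Poset.mulEmb G S T m n))
      (fun x => (Poset.map_mul a b x.1 x.2).symm) (p + q)
    exact DFunLike.congr_fun (h1.symm.trans h2) _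
  one_mul_one := by
    change WH.map k (Poset.mulEmb G S T 0 0) 0
      (WH.cross k 0 0 (WH.unit k ⊥ isBot_bot) (WH.unit k ⊥ isBot_bot)) = WH.unit k ⊥ isBot_bot
    rw [WH.cross_unit]
    have : Subsingleton (Poset G S T (Fin (0 + 0))) :=
      inferInstanceAs (Subsingleton (Poset G S T (Fin 0)))
    exact WH.map_unit k _ _ _ _ _ (Subsingleton.elim _ _)

end

/-! ### Modules glued from a family -/

section Glue

variable {k : Type*} [CommRing k] {J J' : Type*} {M : J → Type*} [∀ j, AddCommGroup (M j)]
  [∀ j, Module k (M j)] {M' : J' → Type*} [∀ j, AddCommGroup (M' j)] [∀ j, Module k (M' j)]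
  {N : Type*} [AddCommGroup N] [Module k N]

/-- The inclusion of a summand in a direct sum. -/
def dsIncl (k : Type*) [CommRing k] (M : J → Type*) [∀ j, AddCommGroup (M j)]
    [∀ j, Module k (M j)] (j : J) : M j →ₗ[k] ⨁ j, M j :=
  letI : DecidableEq J := Classical.decEq J
  DirectSum.lof k J M j

/-- The linear map out of a direct sum given by its restrictions to the summands. -/
def dsDesc (f : ∀ j, M j →ₗ[k] N) : (⨁ j, M j) →ₗ[k] N :=
  letI : DecidableEq J := Classical.decEq J
  DirectSum.toModule k J N f

theorem dsDesc_incl (f : ∀ j, M j →ₗ[k] N) (j : J) (x : M j) :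
    dsDesc f (dsIncl k M j x) = f j x := by
  simp [dsDesc, dsIncl]

theorem ds_hom_ext {f g : (⨁ j, M j) →ₗ[k] N}
    (h : ∀ j x, f (dsIncl k M j x) = g (dsIncl k M j x)) : f = g := by
  let _ : DecidableEq J := Classical.decEq J
  exact DirectSum.linearMap_ext _ fun j => LinearMap.ext fun x => h j x

/-- The submodule generated by the differences of related elements. -/
def glueRel (k : Type*) [CommRing k] (M : J → Type*) [∀ j, AddCommGroup (M j)]
    [∀ j, Module k (M j)] (R : (Σ j, M j) → (Σ j, M j) → Prop) : Submodule k (⨁ j, M j) :=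
  Submodule.span k {z | ∃ a b, R a b ∧ z = dsIncl k M a.1 a.2 - dsIncl k M b.1 b.2}

/-- The quotient of the direct sum of the `M j` by the relations `a = b` for `R a b`. -/
def Glue (k : Type*) [CommRing k] (M : J → Type*) [∀ j, AddCommGroup (M j)]
    [∀ j, Module k (M j)] (R : (Σ j, M j) → (Σ j, M j) → Prop) : Type _ :=
  (⨁ j, M j) ⧸ glueRel k M R

namespace Glue

variable {R : (Σ j, M j) → (Σ j, M j) → Prop} {R' : (Σ j, M' j) → (Σ j, M' j) → Prop}

instance : AddCommGroup (Glue k M R) := inferInstanceAs (AddCommGroup ((⨁ j, M j) ⧸ glueRel k M R))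
instance : Module k (Glue k M R) := inferInstanceAs (Module k ((⨁ j, M j) ⧸ glueRel k M R))

variable (k R) in
/-- The canonical map from a member of the family. -/
def of (j : J) : M j →ₗ[k] Glue k M R := (glueRel k M R).mkQ ∘ₗ dsIncl k M j

variable (k) in
theorem of_eq {a b : Σ j, M j} (h : R a b) : of k R a.1 a.2 = of k R b.1 b.2 :=
  (Submodule.Quotient.eq _).2 (Submodule.subset_span ⟨a, b, h, rfl⟩)

/-- A family of linear maps that respects the relations descends. -/
def desc (f : ∀ j, M j →ₗ[k] N) (h : ∀ a b, R a b → f a.1 a.2 = f b.1 b.2) : Glue k M R →ₗ[k] N :=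
  (glueRel k M R).liftQ (dsDesc f) <| by
    rw [glueRel, Submodule.span_le]
    rintro _ ⟨a, b, hab, rfl⟩
    change dsDesc f _ = 0
    rw [map_sub, dsDesc_incl, dsDesc_incl, h a b hab, sub_self]

@[simp] theorem desc_of (f : ∀ j, M j →ₗ[k] N) (h : ∀ a b, R a b → f a.1 a.2 = f b.1 b.2) (j : J)
    (x : M j) : desc f h (of k R j x) = f j x :=
  dsDesc_incl f j x

theorem hom_ext {f g : Glue k M R →ₗ[k] N} (h : ∀ j x, f (of k R j x) = g (of k R j x)) : f = g :=
  Submodule.linearMap_qext _ (ds_hom_ext h)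

/-- A family of bilinear maps that respects the relations descends. -/
def desc₂ (f : ∀ j j', M j →ₗ[k] M' j' →ₗ[k] N)
    (h : ∀ a b, R a b → ∀ j' y, f a.1 j' a.2 y = f b.1 j' b.2 y)
    (h' : ∀ j x a b, R' a b → f j a.1 x a.2 = f j b.1 x b.2) :
    Glue k M R →ₗ[k] Glue k M' R' →ₗ[k] N :=
  desc (fun j => (desc (fun j' => (f j j').flip)
      fun a b hab => LinearMap.ext fun x => h' j x a b hab).flip) <| by
    intro a b hab
    refine hom_ext fun j' y => ?_
    simpa using h a b hab j' y

@[simp] theorem desc₂_of (f : ∀ j j', M j →ₗ[k] M' j' →ₗ[k] N)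
    (h : ∀ a b, R a b → ∀ j' y, f a.1 j' a.2 y = f b.1 j' b.2 y)
    (h' : ∀ j x a b, R' a b → f j a.1 x a.2 = f j b.1 x b.2) (j : J) (x : M j) (j' : J')
    (y : M' j') : desc₂ f h h' (of k R j x) (of k R' j' y) = f j j' x y := by
  simp [desc₂]

theorem hom_ext₂ {f g : Glue k M R →ₗ[k] Glue k M' R' →ₗ[k] N}
    (h : ∀ j x j' y, f (of k R j x) (of k R' j' y) = g (of k R j x) (of k R' j' y)) : f = g :=
  hom_ext fun j x => hom_ext fun j' y => h j x j' y

end Glue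

end Glue

/-! ### Modules concentrated in one arity and degree -/

section Only

variable (k : Type*) [CommRing k] {M N L : Type*} [AddCommGroup M] [Module k M] [AddCommGroup N]
  [Module k N] [AddCommGroup L] [Module k L]

variable (M) in
/-- The module `M` if `b` holds, and the zero module otherwise. -/
def only (b : Prop) : Submodule k M where
  carrier := {x | ¬ b → x = 0}
  zero_mem' _ := rfl
  add_mem' hx hy hb := by rw [hx hb, hy hb, add_zero]
  smul_mem' c x hx hb := by rw [hx hb, smul_zero]

variable {k}

/-- A linear map, on `only`. -/
def onlyMap {b : Prop} (f : M →ₗ[k] N) : only k M b →ₗ[k] only k N b :=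
  f.restrict fun x hx hb => by rw [hx hb, map_zero]

/-- A bilinear map, on `only`. -/
def onlyMap₂ {b c d : Prop} (f : M →ₗ[k] N →ₗ[k] L) (h : b → c → d) :
    only k M b →ₗ[k] only k N c →ₗ[k] only k L d :=
  LinearMap.mk₂ k (fun x y => ⟨f x y, fun hd => by
      by_cases hb : b
      · rw [y.2 fun hc => hd (h hb hc), map_zero]
      · rw [x.2 hb, map_zero, LinearMap.zero_apply]⟩)
    (fun x x' y => Subtype.ext (by simp)) (fun c x y => Subtype.ext (by simp))
    (fun x y y' => Subtype.ext (by simp)) (fun c x y => Subtype.ext (by simp))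

@[simp] theorem coe_onlyMap {b : Prop} (f : M →ₗ[k] N) (x : only k M b) :
    (onlyMap f x : N) = f x := rfl

@[simp] theorem coe_onlyMap₂ {b c d : Prop} (f : M →ₗ[k] N →ₗ[k] L) (h : b → c → d)
    (x : only k M b) (y : only k N c) : (onlyMap₂ f h x y : L) = f x y := rfl

end Only

namespace TwAlg

/-! ### Tensor powers -/

section TPow

variable {k H : Type u} [CommRing k] [Group H] {V : Type u} [AddCommGroup V] [Module k V]

/-- The sign of a permutation, in `k`. -/
def sgn (k : Type*) [CommRing k] {n : ℕ} (σ : Equiv.Perm (Fin n)) : k :=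
  ((Equiv.Perm.sign σ : ℤ) : k)

theorem sgn_trans {n : ℕ} (σ τ : Equiv.Perm (Fin n)) :
    sgn k (Equiv.trans τ σ) = sgn k σ * sgn k τ := by
  rw [show Equiv.trans τ σ = σ * τ from rfl, sgn, map_mul]
  simp [sgn]

theorem sgn_block {m n : ℕ} (a : Wr H m) (b : Wr H n) :
    sgn k (Wr.block a b).toEquiv = sgn k a.toEquiv * sgn k b.toEquiv := by
  have e : (Wr.block a b).toEquiv = (finSumFinEquiv.symm.trans
    (Equiv.Perm.sumCongr a.toEquiv b.toEquiv)).trans finSumFinEquiv := rfl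
  rw [sgn, e, Equiv.Perm.sign_symm_trans_trans, Equiv.Perm.sign_sumCongr]
  simp [sgn]

/-- The action of the wreath product on `V^{⊗ m}` when `V` is homogeneous of degree `d`: elements
of `H` act on the tensor factors, and permutations permute the factors with Koszul signs. -/
def tpowAct (ρ : Representation k H V) (d m : ℕ) (a : Wr H m) :
    (⨂[k]^m V) →ₗ[k] (⨂[k]^m V) :=
  sgn k a.toEquiv ^ d • ((PiTensorProduct.reindex k (fun _ => V) a.toEquiv).toLinearMap ∘ₗ
    PiTensorProduct.map fun i => ρ (a.color i))

theorem tpowAct_tprod (ρ : Representation k H V) (d m : ℕ) (a : Wr H m) (f : Fin m → V) :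
    tpowAct ρ d m a (PiTensorProduct.tprod k f) = sgn k a.toEquiv ^ d •
      PiTensorProduct.tprod k fun i => ρ (a.color (a.toEquiv.symm i)) (f (a.toEquiv.symm i)) := by
  simp only [tpowAct, LinearMap.smul_apply, LinearMap.comp_apply, PiTensorProduct.map_tprod,
    LinearEquiv.coe_coe]
  erw [PiTensorProduct.reindex_tprod]

/-- Concatenation `V^{⊗ m} ⊗ V^{⊗ n} → V^{⊗ (m+n)}`. -/
def tpowMul (V : Type u) [AddCommGroup V] [Module k V] (m n : ℕ) :
    (⨂[k]^m V) →ₗ[k] (⨂[k]^n V) →ₗ[k] (⨂[k]^(m + n) V) :=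
  (TensorProduct.mk k _ _).compr₂ TensorPower.mulEquiv.toLinearMap

theorem tpowMul_tprod (m n : ℕ) (f : Fin m → V) (g : Fin n → V) :
    tpowMul (k := k) V m n (PiTensorProduct.tprod k f) (PiTensorProduct.tprod k g) =
      PiTensorProduct.tprod k (Fin.append f g) :=
  TensorPower.tprod_mul_tprod k f g

theorem tpowMul_act (ρ : Representation k H V) (d m n : ℕ) (a : Wr H m) (b : Wr H n) (x y) :
    tpowMul V m n (tpowAct ρ d m a x) (tpowAct ρ d n b y) =
      tpowAct ρ d (m + n) (Wr.block a b) (tpowMul V m n x y) := by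
  have h : (tpowMul V m n).compl₁₂ (tpowAct ρ d m a) (tpowAct ρ d n b) =
      (tpowMul V m n).compr₂ (tpowAct ρ d (m + n) (Wr.block a b)) := by
    apply PiTensorProduct.ext
    ext f : 1
    apply PiTensorProduct.ext
    ext g : 1
    simp only [LinearMap.compMultilinearMap_apply, LinearMap.compl₁₂_apply,
      LinearMap.compr₂_apply]
    rw [tpowAct_tprod, tpowAct_tprod, tpowMul_tprod, tpowAct_tprod, map_smul, map_smul,
      LinearMap.smul_apply, tpowMul_tprod, sgn_block, smul_smul, mul_pow, mul_comm]
    congr 2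
    funext i
    refine Fin.addCases (fun i => ?_) (fun i => ?_) i <;>
      simp [Wr.block, FBHom.join, FBHom.comp, FBHom.ofEquiv, FBHom.sum]
  exact LinearMap.congr_fun₂ h x y

/-- The `H`-twisted algebra freely generated by the representation `V` of `H`, placed in arity `1`
and homogeneous of degree `d`: its value on `[m]` is `V^{⊗ m}`. -/
def TPow (ρ : Representation k H V) (d : ℕ) : TwAlg.{u} k H where
  obj m p := only k (⨂[k]^m V) (p = m * d)
  act m p :=
    { toFun a := onlyMap (tpowAct ρ d m a)
      map_one' := by
        refine LinearMap.ext fun x => Subtype.ext ?_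
        refine DFunLike.congr_fun (f := tpowAct ρ d m 1) (g := LinearMap.id) ?_ x.1
        refine PiTensorProduct.ext (MultilinearMap.ext fun f => ?_)
        rw [LinearMap.compMultilinearMap_apply, tpowAct_tprod]
        simp [sgn]
      map_mul' a b := by
        refine LinearMap.ext fun x => Subtype.ext ?_
        refine DFunLike.congr_fun (f := tpowAct ρ d m (a * b))
          (g := tpowAct ρ d m a ∘ₗ tpowAct ρ d m b) ?_ x.1
        refine PiTensorProduct.ext (MultilinearMap.ext fun f => ?_)
        rw [LinearMap.compMultilinearMap_apply, LinearMap.compMultilinearMap_apply,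
          LinearMap.comp_apply, tpowAct_tprod, tpowAct_tprod, map_smul, tpowAct_tprod, smul_smul]
        simp [sgn_trans, mul_pow, mul_comm] }
  mul m n p q := onlyMap₂ (tpowMul V m n) fun h h' => by rw [h, h', add_mul]
  one := ⟨PiTensorProduct.tprod k Fin.elim0, fun h => absurd (Nat.zero_mul d).symm h⟩
  mul_act m n p q a b x y := Subtype.ext (tpowMul_act ρ d m n a b x y)
  one_mul_one := by
    refine Subtype.ext ((tpowMul_tprod 0 0 _ _).trans ?_)
    exact congrArg _ (funext fun i : Fin 0 => i.elim0)

end TPow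

/-! ### Induction -/

section Ind

variable {k : Type u} [CommRing k] {G H : Type u} [Group G] [Group H] {D : Type}
  (ρ : H →* FBHom G D D)

/-- The functor `[m] ↦ [m] × D` from finite sets and `H`-bijections to finite sets
and `G`-bijections given by an action `ρ` of `H` on `D` by `G`-bijections. -/
def blow {m : ℕ} (h : Wr H m) : FBHom G (Fin m × D) (Fin m × D) where
  toEquiv := (Equiv.prodShear h.toEquiv fun i => (ρ (h.color i)).toEquiv)
  color x := (ρ (h.color x.1)).color x.2

/-- The bijection `[m + n] × D ≃ [m] × D ⊔ [n] × D`. -/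
def blowSum (D : Type) (m n : ℕ) : Fin (m + n) × D ≃ (Fin m × D) ⊕ (Fin n × D) :=
  (Equiv.prodCongr finSumFinEquiv.symm (Equiv.refl D)).trans (Equiv.sumProdDistrib _ _ _)

theorem blow_one {m : ℕ} : blow ρ (1 : Wr H m) = FBHom.id G _ := by
  apply FBHom.ext
  · ext x <;> simp [blow, FBHom.id]
  · funext x; simp [blow, FBHom.id]

/-- The product of two elements of the index set of `Ind`. -/
def indJoin {m m' n n' : ℕ} (φ : FBHom G (Fin m × D) (Fin n)) (φ' : FBHom G (Fin m' × D) (Fin n')) :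
    FBHom G (Fin (m + m') × D) (Fin (n + n')) :=
  FBHom.comp (FBHom.join φ φ') (FBHom.ofEquiv G (blowSum D m m'))

theorem indJoin_comp {m m' n n' : ℕ} (φ : FBHom G (Fin m × D) (Fin n))
    (φ' : FBHom G (Fin m' × D) (Fin n')) (h : Wr H m) (h' : Wr H m') :
    indJoin (FBHom.comp φ (blow ρ h)) (FBHom.comp φ' (blow ρ h')) =
      FBHom.comp (indJoin φ φ') (blow ρ (Wr.block h h')) := by
  apply FBHom.ext
  · ext ⟨i, x⟩
    refine Fin.addCases (fun i => ?_) (fun i => ?_) i <;>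
      simp [indJoin, blow, blowSum, Wr.block, FBHom.join, FBHom.comp, FBHom.ofEquiv, FBHom.sum]
  · funext ⟨i, x⟩
    refine Fin.addCases (fun i => ?_) (fun i => ?_) i <;>
      simp [indJoin, blow, blowSum, Wr.block, FBHom.join, FBHom.comp, FBHom.ofEquiv, FBHom.sum]

variable (A : TwAlg.{u} k H)

/-- The relations in the left Kan extension along `blow ρ`. -/
inductive IndRel (n p : ℕ) : (Σ j : Σ m, FBHom G (Fin m × D) (Fin n), A.obj j.1 p) →
    (Σ j : Σ m, FBHom G (Fin m × D) (Fin n), A.obj j.1 p) → Prop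
  | mk (m : ℕ) (φ : FBHom G (Fin m × D) (Fin n)) (h : Wr H m) (x : A.obj m p) :
    IndRel n p ⟨⟨m, FBHom.comp φ (blow ρ h)⟩, x⟩ ⟨⟨m, φ⟩, A.act m p h x⟩

/-- The value at `[n]` of the left Kan extension of `A` along `[m] ↦ [m] × D`,
in degree `p`: the coend over `[m]` of `Hom([m] × D, [n]) ⊗ A_[m]`. -/
abbrev IndObj (n p : ℕ) : Type u :=
  Glue k (fun j : Σ m, FBHom G (Fin m × D) (Fin n) => A.obj j.1 p) (IndRel ρ A n p)

/-- The class of `φ ⊗ x`. -/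
def IndObj.of {n p m : ℕ} (φ : FBHom G (Fin m × D) (Fin n)) : A.obj m p →ₗ[k] IndObj ρ A n p :=
  Glue.of k (IndRel ρ A n p) ⟨m, φ⟩

theorem IndObj.of_comp {n p m : ℕ} (φ : FBHom G (Fin m × D) (Fin n)) (h : Wr H m) (x : A.obj m p) :
    IndObj.of ρ A (FBHom.comp φ (blow ρ h)) x = IndObj.of ρ A φ (A.act m p h x) :=
  Glue.of_eq k (IndRel.mk (ρ := ρ) (A := A) (p := p) m φ h x)

/-- The action on `IndObj`. -/
def indAct {n p : ℕ} (w : Wr G n) : IndObj ρ A n p →ₗ[k] IndObj ρ A n p :=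
  Glue.desc (fun j => IndObj.of ρ A (FBHom.comp w j.2)) <| by
    rintro _ _ ⟨m, φ, h, x⟩
    change IndObj.of ρ A (FBHom.comp w (FBHom.comp φ (blow ρ h))) x = IndObj.of ρ A _ _
    rw [← FBHom.comp_assoc, IndObj.of_comp]

theorem indAct_of {n p m : ℕ} (w : Wr G n) (φ : FBHom G (Fin m × D) (Fin n)) (x : A.obj m p) :
    indAct ρ A w (IndObj.of ρ A φ x) = IndObj.of ρ A (FBHom.comp w φ) x :=
  Glue.desc_of _ _ _ _

/-- The product on `IndObj`. -/
def indMul (n n' p p' : ℕ) :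
    IndObj ρ A n p →ₗ[k] IndObj ρ A n' p' →ₗ[k] IndObj ρ A (n + n') (p + p') :=
  Glue.desc₂ (fun j j' => (A.mul j.1 j'.1 p p').compr₂ (IndObj.of ρ A (indJoin j.2 j'.2)))
    (by
      rintro _ _ ⟨m, φ, h, x⟩ ⟨m', φ'⟩ y
      change IndObj.of ρ A (indJoin (FBHom.comp φ (blow ρ h)) φ') (A.mul _ _ _ _ x y) =
        IndObj.of ρ A (indJoin φ φ') (A.mul _ _ _ _ (A.act _ _ h x) y)
      have e := indJoin_comp ρ φ φ' h 1
      rw [blow_one, FBHom.comp_id] at e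
      rw [e, IndObj.of_comp, ← A.mul_act, map_one, Module.End.one_apply])
    (by
      rintro ⟨m, φ⟩ x _ _ ⟨m', φ', h, y⟩
      change IndObj.of ρ A (indJoin φ (FBHom.comp φ' (blow ρ h))) (A.mul _ _ _ _ x y) =
        IndObj.of ρ A (indJoin φ φ') (A.mul _ _ _ _ x (A.act _ _ h y))
      have e := indJoin_comp ρ φ φ' 1 h
      rw [blow_one, FBHom.comp_id] at e
      rw [e, IndObj.of_comp, ← A.mul_act, map_one, Module.End.one_apply])

theorem indMul_of {n n' p p' m m' : ℕ} (φ : FBHom G (Fin m × D) (Fin n)) (x : A.obj m p)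
    (φ' : FBHom G (Fin m' × D) (Fin n')) (y : A.obj m' p') :
    indMul ρ A n n' p p' (IndObj.of ρ A φ x) (IndObj.of ρ A φ' y) =
      IndObj.of ρ A (indJoin φ φ') (A.mul m m' p p' x y) :=
  Glue.desc₂_of _ _ _ _ _ _ _

/-- The induced twisted algebra: the left Kan extension along `[m] ↦ [m] × D`. -/
def Ind : TwAlg.{u} k G where
  obj n p := IndObj ρ A n p
  act n p :=
    { toFun w := indAct ρ A w
      map_one' := by
        refine Glue.hom_ext fun ⟨m, φ⟩ x => (indAct_of ρ A 1 φ x).trans ?_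
        rw [FBHom.one_def, FBHom.id_comp]
        rfl
      map_mul' a b := by
        refine Glue.hom_ext fun ⟨m, φ⟩ x => (indAct_of ρ A (a * b) φ x).trans ?_
        change _ = indAct ρ A a (indAct ρ A b (IndObj.of ρ A φ x))
        rw [indAct_of, indAct_of, FBHom.mul_def, FBHom.comp_assoc] }
  mul n n' p p' := indMul ρ A n n' p p'
  one := IndObj.of ρ A (FBHom.ofEquiv G (Equiv.equivOfIsEmpty _ _)) A.one
  mul_act n n' p p' a b x y := by
    have h : (indMul ρ A n n' p p').compl₁₂ (indAct ρ A a) (indAct ρ A b) =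
        (indMul ρ A n n' p p').compr₂ (indAct ρ A (Wr.block a b)) := by
      refine Glue.hom_ext₂ fun ⟨m, φ⟩ x ⟨m', φ'⟩ y => ?_
      change indMul ρ A n n' p p' (indAct ρ A a (IndObj.of ρ A φ x))
        (indAct ρ A b (IndObj.of ρ A φ' y)) = indAct ρ A (Wr.block a b)
          (indMul ρ A n n' p p' (IndObj.of ρ A φ x) (IndObj.of ρ A φ' y))
      rw [indMul_of]
      rw [indAct_of, indAct_of, indAct_of, indMul_of, indJoin, indJoin, ← FBHom.comp_assoc,
        FBHom.block_comp_join]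
    exact LinearMap.congr_fun₂ h x y
  one_mul_one := by
    rw [indMul_of, A.one_mul_one]
    have : IsEmpty (Fin (0 + 0) × D) := inferInstanceAs (IsEmpty (Fin 0 × D))
    have e : indJoin (FBHom.ofEquiv G (Equiv.equivOfIsEmpty (Fin 0 × D) (Fin 0)))
        (FBHom.ofEquiv G (Equiv.equivOfIsEmpty (Fin 0 × D) (Fin 0))) =
        FBHom.ofEquiv G (Equiv.equivOfIsEmpty (Fin (0 + 0) × D) (Fin 0)) := by
      apply FBHom.ext
      · ext x; exact isEmptyElim x
      · funext x; exact isEmptyElim x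
    rw [e]

end Ind

/-! ### Tensor products -/

section Tensor

variable {k : Type u} [CommRing k] {G : Type u} [Group G] (A B : TwAlg.{u} k G)

/-- The index set of the tensor product in arity `n` and degree `p`: arities `i, j`,
degrees `a + b = p`, and a morphism `[i] ⊔ [j] → [n]`. -/
structure DayIdx (G : Type u) (n p : ℕ) where
  i : ℕ
  j : ℕ
  a : ℕ
  b : ℕ
  deg : a + b = p
  hom : FBHom G (Fin i ⊕ Fin j) (Fin n)

/-- The relations in the Day convolution. -/
inductive DayRel (n p : ℕ) : (Σ d : DayIdx G n p, A.obj d.i d.a ⊗[k] B.obj d.j d.b) →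
    (Σ d : DayIdx G n p, A.obj d.i d.a ⊗[k] B.obj d.j d.b) → Prop
  | mk (i j a b : ℕ) (deg : a + b = p) (φ : FBHom G (Fin i ⊕ Fin j) (Fin n)) (g : Wr G i)
    (h : Wr G j) (t : A.obj i a ⊗[k] B.obj j b) :
    DayRel n p ⟨⟨i, j, a, b, deg, FBHom.comp φ (FBHom.sum g h)⟩, t⟩
      ⟨⟨i, j, a, b, deg, φ⟩, TensorProduct.map (A.act i a g) (B.act j b h) t⟩

/-- The Day convolution: the coend over `[i], [j]` of
`Hom([i] ⊔ [j], [n]) ⊗ A_[i] ⊗ B_[j]`, in degree `p`. -/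
abbrev DayObj (n p : ℕ) : Type u :=
  Glue k (fun d : DayIdx G n p => A.obj d.i d.a ⊗[k] B.obj d.j d.b) (DayRel A B n p)

/-- The class of `φ ⊗ t`. -/
def DayObj.of {n p i j a b : ℕ} (deg : a + b = p) (φ : FBHom G (Fin i ⊕ Fin j) (Fin n)) :
    A.obj i a ⊗[k] B.obj j b →ₗ[k] DayObj A B n p :=
  Glue.of k (DayRel A B n p) ⟨i, j, a, b, deg, φ⟩

theorem DayObj.of_comp {n p i j a b : ℕ} (deg : a + b = p) (φ : FBHom G (Fin i ⊕ Fin j) (Fin n))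
    (g : Wr G i) (h : Wr G j) (t : A.obj i a ⊗[k] B.obj j b) :
    DayObj.of A B deg (FBHom.comp φ (FBHom.sum g h)) t =
      DayObj.of A B deg φ (TensorProduct.map (A.act i a g) (B.act j b h) t) :=
  Glue.of_eq k (DayRel.mk (A := A) (B := B) i j a b deg φ g h t)

/-- The action on the Day convolution. -/
def dayAct {n p : ℕ} (w : Wr G n) : DayObj A B n p →ₗ[k] DayObj A B n p :=
  Glue.desc (fun d => DayObj.of A B d.deg (FBHom.comp w d.hom)) <| by
    rintro _ _ ⟨i, j, a, b, deg, φ, g, h, t⟩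
    change DayObj.of A B deg (FBHom.comp w (FBHom.comp φ (FBHom.sum g h))) t =
      DayObj.of A B deg _ _
    rw [← FBHom.comp_assoc, DayObj.of_comp]

theorem dayAct_of {n p i j a b : ℕ} (w : Wr G n) (deg : a + b = p)
    (φ : FBHom G (Fin i ⊕ Fin j) (Fin n)) (t : A.obj i a ⊗[k] B.obj j b) :
    dayAct A B w (DayObj.of A B deg φ t) = DayObj.of A B deg (FBHom.comp w φ) t :=
  Glue.desc_of _ _ _ _

/-- The bijection `[i + i'] ⊔ [j + j'] ≃ ([i] ⊔ [j]) ⊔ ([i'] ⊔ [j'])`. -/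
def dayShuf (i j i' j' : ℕ) :
    Fin (i + i') ⊕ Fin (j + j') ≃ (Fin i ⊕ Fin j) ⊕ (Fin i' ⊕ Fin j') :=
  (Equiv.sumCongr finSumFinEquiv.symm finSumFinEquiv.symm).trans (Equiv.sumSumSumComm _ _ _ _)

/-- The product of two elements of the index set of the Day convolution. -/
def dayJoin {i j i' j' n n' : ℕ} (φ : FBHom G (Fin i ⊕ Fin j) (Fin n))
    (φ' : FBHom G (Fin i' ⊕ Fin j') (Fin n')) :
    FBHom G (Fin (i + i') ⊕ Fin (j + j')) (Fin (n + n')) :=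
  FBHom.comp (FBHom.join φ φ') (FBHom.ofEquiv G (dayShuf i j i' j'))

theorem dayJoin_comp {i j i' j' n n' : ℕ} (φ : FBHom G (Fin i ⊕ Fin j) (Fin n))
    (φ' : FBHom G (Fin i' ⊕ Fin j') (Fin n')) (g : Wr G i) (h : Wr G j) (g' : Wr G i')
    (h' : Wr G j') :
    dayJoin (FBHom.comp φ (FBHom.sum g h)) (FBHom.comp φ' (FBHom.sum g' h')) =
      FBHom.comp (dayJoin φ φ') (FBHom.sum (Wr.block g g') (Wr.block h h')) := by
  apply FBHom.ext
  · ext (x | x) <;> refine Fin.addCases (fun x => ?_) (fun x => ?_) x <;>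
      simp [dayJoin, dayShuf, Wr.block, FBHom.join, FBHom.comp, FBHom.ofEquiv, FBHom.sum]
  · funext x
    rcases x with x | x <;> refine Fin.addCases (fun x => ?_) (fun x => ?_) x <;>
      simp [dayJoin, dayShuf, Wr.block, FBHom.join, FBHom.comp, FBHom.ofEquiv, FBHom.sum]

/-- `(x ⊗ y)(x' ⊗ y') = (-1)^{|y||x'|} xx' ⊗ yy'`. -/
def dayMul₀ (i j i' j' a b a' b' : ℕ) :
    A.obj i a ⊗[k] B.obj j b →ₗ[k] A.obj i' a' ⊗[k] B.obj j' b' →ₗ[k]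
      A.obj (i + i') (a + a') ⊗[k] B.obj (j + j') (b + b') :=
  (-1 : k) ^ (b * a') • TensorProduct.map₂ (A.mul i i' a a') (B.mul j j' b b')

theorem dayMul₀_tmul (i j i' j' a b a' b' : ℕ) (x : A.obj i a) (y : B.obj j b) (x' : A.obj i' a')
    (y' : B.obj j' b') : dayMul₀ A B i j i' j' a b a' b' (x ⊗ₜ y) (x' ⊗ₜ y') =
      (-1 : k) ^ (b * a') • (A.mul i i' a a' x x' ⊗ₜ B.mul j j' b b' y y') := by
  simp [dayMul₀]

theorem dayMul₀_act {i j i' j' a b a' b' : ℕ} (g : Wr G i) (h : Wr G j) (g' : Wr G i')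
    (h' : Wr G j') (t : A.obj i a ⊗[k] B.obj j b) (t' : A.obj i' a' ⊗[k] B.obj j' b') :
    dayMul₀ A B i j i' j' a b a' b' (TensorProduct.map (A.act i a g) (B.act j b h) t)
      (TensorProduct.map (A.act i' a' g') (B.act j' b' h') t') =
    TensorProduct.map (A.act _ _ (Wr.block g g')) (B.act _ _ (Wr.block h h'))
      (dayMul₀ A B i j i' j' a b a' b' t t') := by
  have e : (dayMul₀ A B i j i' j' a b a' b').compl₁₂
      (TensorProduct.map (A.act i a g) (B.act j b h))
      (TensorProduct.map (A.act i' a' g') (B.act j' b' h')) =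
      (dayMul₀ A B i j i' j' a b a' b').compr₂
        (TensorProduct.map (A.act _ _ (Wr.block g g')) (B.act _ _ (Wr.block h h'))) := by
    refine TensorProduct.ext' fun x y => TensorProduct.ext' fun x' y' => ?_
    simp only [LinearMap.compl₁₂_apply, LinearMap.compr₂_apply, TensorProduct.map_tmul]
    rw [dayMul₀_tmul, dayMul₀_tmul, map_smul, TensorProduct.map_tmul, A.mul_act, B.mul_act]
  exact LinearMap.congr_fun₂ e t t'

theorem day_deg {a b a' b' p p' : ℕ} (h : a + b = p) (h' : a' + b' = p') :
    a + a' + (b + b') = p + p' := by omega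

/-- The product on the Day convolution. -/
def dayMul (n n' p p' : ℕ) :
    DayObj A B n p →ₗ[k] DayObj A B n' p' →ₗ[k] DayObj A B (n + n') (p + p') :=
  Glue.desc₂ (fun d d' => (dayMul₀ A B d.i d.j d'.i d'.j d.a d.b d'.a d'.b).compr₂
      (DayObj.of A B (day_deg d.deg d'.deg) (dayJoin d.hom d'.hom)))
    (by
      rintro _ _ ⟨i, j, a, b, deg, φ, g, h, t⟩ ⟨i', j', a', b', deg', φ'⟩ t'
      change DayObj.of A B _ (dayJoin (FBHom.comp φ (FBHom.sum g h)) φ')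
          (dayMul₀ A B _ _ _ _ _ _ _ _ t t') =
        DayObj.of A B _ (dayJoin φ φ') (dayMul₀ A B _ _ _ _ _ _ _ _
          (TensorProduct.map (A.act i a g) (B.act j b h) t) t')
      have e := dayJoin_comp φ φ' g h 1 1
      rw [FBHom.one_def, FBHom.one_def, FBHom.sum_id, FBHom.comp_id] at e
      have e' := dayMul₀_act A B g h 1 1 t t'
      rw [map_one, map_one, Module.End.one_eq_id, Module.End.one_eq_id, TensorProduct.map_id,
        LinearMap.id_apply] at e'
      rw [e, DayObj.of_comp, e']
      rfl)
    (by
      rintro ⟨i, j, a, b, deg, φ⟩ t _ _ ⟨i', j', a', b', deg', φ', g, h, t'⟩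
      change DayObj.of A B _ (dayJoin φ (FBHom.comp φ' (FBHom.sum g h)))
          (dayMul₀ A B _ _ _ _ _ _ _ _ t t') =
        DayObj.of A B _ (dayJoin φ φ') (dayMul₀ A B _ _ _ _ _ _ _ _ t
          (TensorProduct.map (A.act i' a' g) (B.act j' b' h) t'))
      have e := dayJoin_comp φ φ' 1 1 g h
      rw [FBHom.one_def, FBHom.one_def, FBHom.sum_id, FBHom.comp_id] at e
      have e' := dayMul₀_act A B 1 1 g h t t'
      rw [map_one, map_one, Module.End.one_eq_id, Module.End.one_eq_id, TensorProduct.map_id,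
        LinearMap.id_apply] at e'
      rw [e, DayObj.of_comp, e']
      rfl)

theorem dayMul_of {n n' p p' i j i' j' a b a' b' : ℕ} (deg : a + b = p) (deg' : a' + b' = p')
    (φ : FBHom G (Fin i ⊕ Fin j) (Fin n)) (φ' : FBHom G (Fin i' ⊕ Fin j') (Fin n'))
    (t : A.obj i a ⊗[k] B.obj j b) (t' : A.obj i' a' ⊗[k] B.obj j' b') :
    dayMul A B n n' p p' (DayObj.of A B deg φ t) (DayObj.of A B deg' φ' t') =
      DayObj.of A B (day_deg deg deg') (dayJoin φ φ')
        (dayMul₀ A B i j i' j' a b a' b' t t') :=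
  Glue.desc₂_of _ _ _ _ _ _ _

/-- The tensor product of twisted algebras, with the Koszul sign rule. -/
def tensor : TwAlg.{u} k G where
  obj n p := DayObj A B n p
  act n p :=
    { toFun w := dayAct A B w
      map_one' := by
        refine Glue.hom_ext fun ⟨i, j, a, b, deg, φ⟩ t => (dayAct_of A B 1 deg φ t).trans ?_
        rw [FBHom.one_def, FBHom.id_comp]
        rfl
      map_mul' v w := by
        refine Glue.hom_ext fun ⟨i, j, a, b, deg, φ⟩ t => (dayAct_of A B (v * w) deg φ t).trans ?_
        change _ = dayAct A B v (dayAct A B w (DayObj.of A B deg φ t))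
        rw [dayAct_of, dayAct_of, FBHom.mul_def, FBHom.comp_assoc] }
  mul n n' p p' := dayMul A B n n' p p'
  one := DayObj.of A B (a := 0) (b := 0) rfl (FBHom.ofEquiv G (Equiv.equivOfIsEmpty _ _))
    (A.one ⊗ₜ B.one)
  mul_act n n' p p' v w x y := by
    have h : (dayMul A B n n' p p').compl₁₂ (dayAct A B v) (dayAct A B w) =
        (dayMul A B n n' p p').compr₂ (dayAct A B (Wr.block v w)) := by
      refine Glue.hom_ext₂ fun ⟨i, j, a, b, deg, φ⟩ t ⟨i', j', a', b', deg', φ'⟩ t' => ?_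
      change dayMul A B n n' p p' (dayAct A B v (DayObj.of A B deg φ t))
        (dayAct A B w (DayObj.of A B deg' φ' t')) = dayAct A B (Wr.block v w)
          (dayMul A B n n' p p' (DayObj.of A B deg φ t) (DayObj.of A B deg' φ' t'))
      rw [dayAct_of, dayAct_of, dayMul_of, dayMul_of, dayAct_of, dayJoin, dayJoin,
        ← FBHom.comp_assoc, FBHom.block_comp_join]
    exact LinearMap.congr_fun₂ h x y
  one_mul_one := by
    rw [dayMul_of, dayMul₀_tmul, A.one_mul_one, B.one_mul_one, Nat.zero_mul, pow_zero, one_smul]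
    have : IsEmpty (Fin (0 + 0) ⊕ Fin (0 + 0)) := inferInstanceAs (IsEmpty (Fin 0 ⊕ Fin 0))
    have e : dayJoin (FBHom.ofEquiv G (Equiv.equivOfIsEmpty (Fin 0 ⊕ Fin 0) (Fin 0)))
        (FBHom.ofEquiv G (Equiv.equivOfIsEmpty (Fin 0 ⊕ Fin 0) (Fin 0))) =
        FBHom.ofEquiv G (Equiv.equivOfIsEmpty (Fin (0 + 0) ⊕ Fin (0 + 0)) (Fin 0)) := by
      apply FBHom.ext
      · ext x; exact isEmptyElim x
      · funext x; exact isEmptyElim x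
    rw [e]

variable (k G) in
/-- The unit of the tensor product: `k`, in arity and degree zero. -/
def unit : TwAlg.{u} k G where
  obj n p := only k k (n = 0 ∧ p = 0)
  act _ _ := 1
  mul m n p q := onlyMap₂ (LinearMap.mul k k) fun h h' => ⟨by rw [h.1, h'.1], by rw [h.2, h'.2]⟩
  one := ⟨1, fun h => absurd ⟨rfl, rfl⟩ h⟩
  mul_act _ _ _ _ _ _ _ _ := rfl
  one_mul_one := Subtype.ext (mul_one 1)

/-- Finite tensor products. -/
def tensorList (l : List (TwAlg.{u} k G)) : TwAlg.{u} k G := l.foldr tensor (unit k G)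

/-- The tensor product `A_0 ⊗ ⋯ ⊗ A_{N-1}`. -/
def tensorUpTo (A : ℕ → TwAlg.{u} k G) : ℕ → TwAlg.{u} k G
  | 0 => unit k G
  | N + 1 => tensor (tensorUpTo A N) (A N)

/-- The map `A → A ⊗ B` that sends `x` to `x ⊗ 1`. -/
def tensorOne (n p : ℕ) : A.obj n p →ₗ[k] (tensor A B).obj n p :=
  DayObj.of A B (b := 0) rfl (FBHom.ofEquiv G (Equiv.sumEmpty (Fin n) (Fin 0))) ∘ₗ
    (TensorProduct.mk k _ _).flip B.one

theorem tensorOne_apply {n p : ℕ} (x : A.obj n p) : tensorOne A B n p x =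
    DayObj.of A B (b := 0) rfl (FBHom.ofEquiv G (Equiv.sumEmpty (Fin n) (Fin 0))) (x ⊗ₜ B.one) :=
  rfl

theorem tensorOne_act {n p : ℕ} (w : Wr G n) (x : A.obj n p) :
    tensorOne A B n p (A.act n p w x) = (tensor A B).act n p w (tensorOne A B n p x) := by
  change _ = dayAct A B w _
  rw [tensorOne_apply, tensorOne_apply, dayAct_of]
  have e : FBHom.comp w (FBHom.ofEquiv G (Equiv.sumEmpty (Fin n) (Fin 0))) =
      FBHom.comp (FBHom.ofEquiv G (Equiv.sumEmpty (Fin n) (Fin 0))) (FBHom.sum w 1) := by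
    apply FBHom.ext
    · ext (x | x)
      · rfl
      · exact x.elim0
    · funext x
      rcases x with x | x
      · simp [FBHom.comp, FBHom.ofEquiv, FBHom.sum]
      · exact x.elim0
  rw [e, DayObj.of_comp, TensorProduct.map_tmul, map_one, Module.End.one_apply]

theorem tensorOne_mul {m n p q : ℕ} (x : A.obj m p) (y : A.obj n q) :
    (tensor A B).mul m n p q (tensorOne A B m p x) (tensorOne A B n q y) =
      tensorOne A B (m + n) (p + q) (A.mul m n p q x y) := by
  change dayMul A B m n p q _ _ = _
  rw [tensorOne_apply, tensorOne_apply, tensorOne_apply, dayMul_of, dayMul₀_tmul, B.one_mul_one,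
    Nat.zero_mul, pow_zero, one_smul]
  have e : dayJoin (FBHom.ofEquiv G (Equiv.sumEmpty (Fin m) (Fin 0)))
      (FBHom.ofEquiv G (Equiv.sumEmpty (Fin n) (Fin 0))) =
      FBHom.ofEquiv G (Equiv.sumEmpty (Fin (m + n)) (Fin 0)) := by
    apply FBHom.ext
    · ext (x | x)
      · refine Fin.addCases (fun x => ?_) (fun x => ?_) x <;>
          simp [dayJoin, dayShuf, FBHom.join, FBHom.comp, FBHom.ofEquiv, FBHom.sum]
      · exact Fin.elim0 x
    · funext x
      rcases x with x | x
      · refine Fin.addCases (fun x => ?_) (fun x => ?_) x <;>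
          simp [dayJoin, dayShuf, FBHom.join, FBHom.comp, FBHom.ofEquiv, FBHom.sum]
      · exact Fin.elim0 x
  exact congrArg (fun φ => DayObj.of A B (b := 0) rfl φ (A.mul m n p q x y ⊗ₜ B.one)) e

theorem tensorOne_one : tensorOne A B 0 0 A.one = (tensor A B).one := by
  change _ = DayObj.of A B (a := 0) (b := 0) rfl (FBHom.ofEquiv G (Equiv.equivOfIsEmpty _ _))
    (A.one ⊗ₜ B.one)
  rw [tensorOne_apply]
  have e : FBHom.ofEquiv G (Equiv.sumEmpty (Fin 0) (Fin 0)) =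
      FBHom.ofEquiv G (Equiv.equivOfIsEmpty _ _) := by
    apply FBHom.ext
    · ext x; exact isEmptyElim x
    · funext x; exact isEmptyElim x
  rw [e]

end Tensor

/-! ### Infinite tensor products -/

section Seq

variable {k : Type u} [CommRing k] {G : Type u} [Group G] (A : ℕ → TwAlg.{u} k G)

/-- The map `x ↦ x ⊗ 1` to the next finite tensor product. -/
def step (N n p : ℕ) : (tensorUpTo A N).obj n p →ₗ[k] (tensorUpTo A (N + 1)).obj n p :=
  tensorOne (tensorUpTo A N) (A N) n p

theorem step_act {N n p : ℕ} (w : Wr G n) (x : (tensorUpTo A N).obj n p) :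
    step A N n p ((tensorUpTo A N).act n p w x) =
      (tensorUpTo A (N + 1)).act n p w (step A N n p x) :=
  tensorOne_act _ _ w x

theorem step_mul {N m n p q : ℕ} (x : (tensorUpTo A N).obj m p) (y : (tensorUpTo A N).obj n q) :
    (tensorUpTo A (N + 1)).mul m n p q (step A N m p x) (step A N n q y) =
      step A N (m + n) (p + q) ((tensorUpTo A N).mul m n p q x y) :=
  tensorOne_mul _ _ x y

/-- The maps `x ↦ x ⊗ 1 ⊗ ⋯ ⊗ 1` between the finite tensor products. -/
def stage {M N : ℕ} (h : M ≤ N) (n p : ℕ) :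
    (tensorUpTo A M).obj n p →ₗ[k] (tensorUpTo A N).obj n p :=
  Nat.leRec (motive := fun N _ => (tensorUpTo A M).obj n p →ₗ[k] (tensorUpTo A N).obj n p)
    LinearMap.id (fun N _ f => step A N n p ∘ₗ f) h

theorem stage_self (M n p : ℕ) : stage A (le_refl M) n p = LinearMap.id := Nat.leRec_self _ _

theorem stage_succ {M N : ℕ} (h : M ≤ N) (n p : ℕ) : stage A (Nat.le_succ_of_le h) n p =
    step A N n p ∘ₗ stage A h n p :=
  Nat.leRec_succ _ _ h

theorem stage_act {M N : ℕ} (h : M ≤ N) {n p : ℕ} (w : Wr G n) (x) :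
    stage A h n p ((tensorUpTo A M).act n p w x) =
      (tensorUpTo A N).act n p w (stage A h n p x) := by
  induction N, h using Nat.le_induction with
  | base => simp only [stage_self, LinearMap.id_apply]
  | succ N h ih =>
    rw [stage_succ A h, LinearMap.comp_apply, LinearMap.comp_apply, ih, step_act]

theorem stage_mul {M N : ℕ} (h : M ≤ N) {m n p q : ℕ} (x y) :
    (tensorUpTo A N).mul m n p q (stage A h m p x) (stage A h n q y) =
      stage A h (m + n) (p + q) ((tensorUpTo A M).mul m n p q x y) := by
  induction N, h using Nat.le_induction with
  | base => simp only [stage_self, LinearMap.id_apply]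
  | succ N h ih =>
    rw [stage_succ A h, stage_succ A h, stage_succ A h, LinearMap.comp_apply,
      LinearMap.comp_apply, LinearMap.comp_apply, ← ih, ← step_mul]

theorem stage_stage {L M N : ℕ} (h : L ≤ M) (h' : M ≤ N) {n p : ℕ} (x) :
    stage A h' n p (stage A h n p x) = stage A (h.trans h') n p x := by
  induction N, h' using Nat.le_induction with
  | base => simp only [stage_self, LinearMap.id_apply]
  | succ N h' ih =>
    rw [stage_succ A h', stage_succ A (h.trans h'), LinearMap.comp_apply, LinearMap.comp_apply, ih]

/-- Identification of an element with its image at a later stage. -/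
inductive SeqRel (n p : ℕ) : (Σ N, (tensorUpTo A N).obj n p) →
    (Σ N, (tensorUpTo A N).obj n p) → Prop
  | mk (M N : ℕ) (h : M ≤ N) (x : (tensorUpTo A M).obj n p) :
    SeqRel n p ⟨M, x⟩ ⟨N, stage A h n p x⟩

/-- The direct limit of the finite tensor products. -/
abbrev SeqObj (n p : ℕ) : Type u := Glue k (fun N => (tensorUpTo A N).obj n p) (SeqRel A n p)

/-- The map from a finite stage. -/
def SeqObj.of {n p : ℕ} (N : ℕ) : (tensorUpTo A N).obj n p →ₗ[k] SeqObj A n p :=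
  Glue.of k (SeqRel A n p) N

theorem SeqObj.of_stage {n p M N : ℕ} (h : M ≤ N) (x : (tensorUpTo A M).obj n p) :
    SeqObj.of A N (stage A h n p x) = SeqObj.of A M x :=
  (Glue.of_eq k (SeqRel.mk (A := A) M N h x)).symm

/-- The action on the direct limit. -/
def seqAct {n p : ℕ} (w : Wr G n) : SeqObj A n p →ₗ[k] SeqObj A n p :=
  Glue.desc (fun N => SeqObj.of A N ∘ₗ (tensorUpTo A N).act n p w) <| by
    rintro _ _ ⟨M, N, h, x⟩
    change SeqObj.of A M _ = SeqObj.of A N ((tensorUpTo A N).act n p w (stage A h n p x))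
    rw [← stage_act, SeqObj.of_stage]

theorem seqAct_of {n p N : ℕ} (w : Wr G n) (x : (tensorUpTo A N).obj n p) :
    seqAct A w (SeqObj.of A N x) = SeqObj.of A N ((tensorUpTo A N).act n p w x) :=
  Glue.desc_of _ _ _ _

/-- The product at a common stage. -/
def seqMul₀ {M N L : ℕ} (h : M ≤ L) (h' : N ≤ L) (m n p q : ℕ) :
    (tensorUpTo A M).obj m p →ₗ[k] (tensorUpTo A N).obj n q →ₗ[k] SeqObj A (m + n) (p + q) :=
  (((tensorUpTo A L).mul m n p q).compl₁₂ (stage A h m p) (stage A h' n q)).compr₂ (SeqObj.of A L)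

theorem seqMul₀_apply {M N L : ℕ} (h : M ≤ L) (h' : N ≤ L) {m n p q : ℕ} (x y) :
    seqMul₀ A h h' m n p q x y = SeqObj.of A L
      ((tensorUpTo A L).mul m n p q (stage A h m p x) (stage A h' n q y)) := rfl

theorem seqMul₀_eq {M N L L' : ℕ} (h : M ≤ L) (h' : N ≤ L) (g : L ≤ L') {m n p q : ℕ} (x y) :
    seqMul₀ A h h' m n p q x y = seqMul₀ A (h.trans g) (h'.trans g) m n p q x y := by
  rw [seqMul₀_apply, seqMul₀_apply, ← stage_stage A h g, ← stage_stage A h' g, stage_mul,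
    SeqObj.of_stage]

/-- The product on the direct limit. -/
def seqMul (m n p q : ℕ) : SeqObj A m p →ₗ[k] SeqObj A n q →ₗ[k] SeqObj A (m + n) (p + q) :=
  Glue.desc₂ (fun M N => seqMul₀ A (le_max_left M N) (le_max_right M N) m n p q)
    (by
      rintro _ _ ⟨M, M', h, x⟩ N y
      change seqMul₀ A _ _ m n p q x y = seqMul₀ A _ _ m n p q (stage A h m p x) y
      rw [seqMul₀_eq A _ _ (max_le_max_right N h), seqMul₀_apply, seqMul₀_apply, stage_stage])
    (by
      rintro M x _ _ ⟨N, N', h, y⟩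
      change seqMul₀ A _ _ m n p q x y = seqMul₀ A _ _ m n p q x (stage A h n q y)
      rw [seqMul₀_eq A _ _ (max_le_max_left M h), seqMul₀_apply, seqMul₀_apply, stage_stage])

theorem seqMul_of {M N m n p q : ℕ} (x y) :
    seqMul A m n p q (SeqObj.of A M x) (SeqObj.of A N y) =
      seqMul₀ A (le_max_left M N) (le_max_right M N) m n p q x y :=
  Glue.desc₂_of _ _ _ _ _ _ _

/-- The infinite tensor product `A_0 ⊗ A_1 ⊗ ⋯`: the direct limit of the finite tensor products
along the maps `x ↦ x ⊗ 1`. -/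
def tensorSeq : TwAlg.{u} k G where
  obj n p := SeqObj A n p
  act n p :=
    { toFun w := seqAct A w
      map_one' := by
        refine Glue.hom_ext fun N x => (seqAct_of A 1 x).trans ?_
        rw [map_one]
        rfl
      map_mul' v w := by
        refine Glue.hom_ext fun N x => (seqAct_of A (v * w) x).trans ?_
        change _ = seqAct A v (seqAct A w (SeqObj.of A N x))
        rw [seqAct_of, seqAct_of, map_mul]
        rfl }
  mul m n p q := seqMul A m n p q
  one := SeqObj.of A 0 (tensorUpTo A 0).one
  mul_act m n p q v w x y := by
    have h : (seqMul A m n p q).compl₁₂ (seqAct A v) (seqAct A w) =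
        (seqMul A m n p q).compr₂ (seqAct A (Wr.block v w)) := by
      refine Glue.hom_ext₂ fun M x N y => ?_
      change seqMul A m n p q (seqAct A v (SeqObj.of A M x)) (seqAct A w (SeqObj.of A N y)) =
        seqAct A (Wr.block v w) (seqMul A m n p q (SeqObj.of A M x) (SeqObj.of A N y))
      rw [seqAct_of, seqAct_of, seqMul_of, seqMul_of, seqMul₀_apply, seqMul₀_apply, seqAct_of,
        stage_act, stage_act, (tensorUpTo A _).mul_act]
    exact LinearMap.congr_fun₂ h x y
  one_mul_one := by
    rw [seqMul_of, seqMul₀_apply]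
    have e := stage_self A 0 0 0
    change SeqObj.of A 0 ((tensorUpTo A 0).mul 0 0 0 0 (stage A (le_refl 0) 0 0 _)
      (stage A (le_refl 0) 0 0 _)) = _
    rw [e, LinearMap.id_apply, (tensorUpTo A 0).one_mul_one]

end Seq

end TwAlg

/-! ### The factors -/

section Factors

variable (k : Type u) [CommRing k]

/-- The action of a permutation on the partition lattice. -/
def partEmb {n : ℕ} (σ : Equiv.Perm (Fin n)) : Setoid (Fin n) ↪o Setoid (Fin n) :=
  OrderEmbedding.ofMapLEIff (fun r => r.comap σ.symm) fun r s => by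
    refine ⟨fun h x y hxy => ?_, fun h x y hxy => h hxy⟩
    have := @h (σ x) (σ y) (by simpa [Setoid.comap_rel] using hxy)
    simpa [Setoid.comap_rel] using this

variable (G : Type u) [Group G]

/-- The representation of `G × S_n` on `H̃_{n-3}` of the proper part of the partition lattice
of `[n]`, where `G` acts trivially. -/
def partRep (n : ℕ) : Representation k (G × Equiv.Perm (Fin n))
    (RedHom k (Setoid (Fin n)) (n - 1)) where
  toFun g := RedHom.map k (partEmb g.2) (n - 1)
  map_one' := LinearMap.ext fun x => RedHom.map_id k (fun _ => rfl) _ x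
  map_mul' g h := LinearMap.ext fun x => RedHom.map_comp k (partEmb g.2) (partEmb h.2) (n - 1) x

/-- The inclusion of `G × S_n`, with `G` diagonal, in the wreath product. -/
def diagHom (n : ℕ) : G × Equiv.Perm (Fin n) →* FBHom G (Fin n) (Fin n) where
  toFun g := ⟨g.2, fun _ => g.1⟩
  map_one' := rfl
  map_mul' _ _ := rfl

variable {G} in
/-- An element of `G`, as an automorphism of the one point set. -/
def pointHom (H : Subgroup G) : H →* FBHom G Unit Unit where
  toFun h := ⟨Equiv.refl _, fun _ => h⟩
  map_one' := rfl
  map_mul' _ _ := rfl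

/-- `Ind_{G × S_n}` of `H̃_{n-3}` of the proper part of the partition lattice of `[n]`, which is
homogeneous of degree `n - 1`. -/
def partitionFactor (n : ℕ) : TwAlg.{u} k G :=
  TwAlg.Ind (diagHom G n) (TwAlg.TPow (partRep k G n) (n - 1))

variable (H : Type u) [Group H]

/-- The subset of the one point set that is everything if `b` holds, and empty otherwise. -/
def pointSet (b : Prop) : Set PUnit.{u + 1} := {_s | b}

/-- The `H`-twisted algebra of the top homologies `H̃_{n-2}` of the proper parts of the bounded
posets `D_[n]^T(H, s)`, in degree `n`. Here `H` acts trivially on the point `s`,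
and `b` says whether `s ∈ T`. -/
def dowlingTop (b : Prop) : TwAlg.{u} k H where
  obj n p := only k (RedHom k (Poset H PUnit.{u + 1} (pointSet b) (Fin n)) p) (p = n)
  act n p :=
    { toFun a := onlyMap (RedHom.map k (Poset.mapEmb a) p)
      map_one' := LinearMap.ext fun x => Subtype.ext (RedHom.map_id k Poset.map_id p x.1)
      map_mul' a b' := LinearMap.ext fun x => Subtype.ext <| by
        have e : (Poset.mapEmb (a * b') : Poset H PUnit.{u + 1} (pointSet b) (Fin n) ↪o _) =
            (Poset.mapEmb b').trans (Poset.mapEmb a) :=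
          RelEmbedding.ext (Poset.map_comp a b')
        change RedHom.map k (Poset.mapEmb (a * b')) p x.1 = _
        rw [e]
        exact RedHom.map_comp k _ _ _ _ }
  mul m n p q := onlyMap₂
    ((RedHom.cross k p q).compr₂ (RedHom.map k (Poset.mulEmb H PUnit (pointSet b) m n) (p + q)))
    fun h h' => by rw [h, h']
  one := ⟨RedHom.point k ⊥ isBot_bot fun _ => (Subsingleton.elim _ _).le,
    fun h => absurd rfl h⟩
  mul_act m n p q a c x y := Subtype.ext <| by
    change RedHom.map k _ _ (RedHom.cross k p q (RedHom.map k _ _ x.1) (RedHom.map k _ _ y.1)) =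
      RedHom.map k _ _ (RedHom.map k _ _ (RedHom.cross k p q x.1 y.1))
    rw [RedHom.cross_map, ← RedHom.map_comp, ← RedHom.map_comp]
    refine DFunLike.congr_fun (congrArg (fun f => RedHom.map k f (p + q)) ?_) _
    exact RelEmbedding.ext fun z => (Poset.map_mul a c z.1 z.2).symm
  one_mul_one := Subtype.ext <| by
    have h0 : Subsingleton (Poset H PUnit.{u + 1} (pointSet b) (Fin (0 + 0))) :=
      inferInstanceAs (Subsingleton (Poset H PUnit.{u + 1} (pointSet b) (Fin 0)))
    have hx : ∀ x : Poset H PUnit.{u + 1} (pointSet b) (Fin (0 + 0)), IsBot x ∧ IsTop x :=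
      fun x => ⟨fun y => (Subsingleton.elim x y).le, fun y => (Subsingleton.elim y x).le⟩
    change RedHom.map k (Poset.mulEmb H PUnit (pointSet b) 0 0) 0
      (RedHom.cross k 0 0 (RedHom.point k ⊥ isBot_bot (hx _).2)
        (RedHom.point k ⊥ isBot_bot (hx _).2)) = RedHom.point k ⊥ isBot_bot (hx _).2
    refine (congrArg (RedHom.map k (Poset.mulEmb H PUnit (pointSet b) 0 0) 0)
      (RedHom.cross_point k _ _ _ _ _ _)).trans ?_
    refine (RedHom.map_point k _ _ _ _ (hx _).1 (hx _).2).trans ?_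
    refine SubQuot.mk_congr ?_ _ _
    exact congrArg (fun x => Finsupp.single [x] (1 : k)) (Subsingleton.elim _ _)

/-- `Ind` from the stabilizer `G_s` of the top homologies of `D_•^T(G_s, s)`. -/
def dowlingFactor {S : Type u} [MulAction G S] (T : Set S) (s : S) : TwAlg.{u} k G :=
  TwAlg.Ind (pointHom (MulAction.stabilizer G s))
    (dowlingTop k (MulAction.stabilizer G s) (s ∈ T))

end Factors

end Dowling

end

/-!
Each point `i` of an element `α` of the Dowling poset has a *type* (`Poset.type`): the orbit of
its colour if `i` lies in the zero block, and the size of its block otherwise. If `U` and `V` are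
disjoint sets of types, then an element with types in `U ∪ V` is, up to the obvious ambiguity, in
one way a disjoint union of an element with types in `U` and one with types in `V`
(`exists_decomposition`, `decomposition_unique`). Below such a disjoint union every element is a
disjoint union again, as no block and no orbit of colours meets both parts; hence its lower
interval is the product of the lower intervals of the parts (`splitEmb_surjective`). Since Whitney
homology is the sum of the homologies of the lower intervals, its part on the types `U ∪ V` is the
Day convolution of the parts on `U` and `V`, as soon as the Künneth homomorphism for these
products is an isomorphism.

The Künneth isomorphism holds over every commutative ring, because the homology of a lower
interval is concentrated in the degree of its rank (`concentrated_iic`). This follows by induction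
from joins with an atom `e`: below `α` there is an operation `x ↦ x ∨ e` which lowers the number
of blocks by at most one (`exists_isJoin`), although the poset need not be a lattice. The chains
from the least element to `α` that avoid all `x < α` with `x ∨ e = α` form an acyclic complex,
with the insertion of `x ∨ e` as a contracting homotopy up to a filtration, and the others come
from the intervals below coatoms (`exactAt_of_isJoin`). In the top degree homology is the module
of cycles, and this is a direct summand of the chains (`exists_projection_cycles`). A cycle of top
degree on a product is determined by its coefficients on the chains that go through the first
factor first (`IsRanked.eq_zero`). Reading off these coefficients is a version of the
Alexander-Whitney map, and inverse to the shuffle product (`exists_kunneth`).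

A `Realization` of a twisted algebra `A` on a set `U` of types is an injective homomorphism from
`A` to Whitney homology with the part on `U` as its image. Realizations on disjoint sets of types
can be multiplied, finitely (`Realization.tensor`) or infinitely many of them
(`Realization.tensorSeq`), and there is a similar construction for induced algebras
(`IndData.realization`). The factor of the partition lattice `Π_n` is realized on the single type
of blocks of size `n`: the lower interval of an element with `m` such blocks is the product of `m`
copies of `Π_n`, and so its homology is a tensor power (`partitionRealization`). The factor of the
representative `s` is realized on the single type of colours in the orbit of `s`: the lower
interval of the element for which all points have colour `s` is the Dowling poset of the
stabilizer of `s` (`dowlingRealization`). Together these sets contain every type, and a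
realization on all types is an isomorphism (`Realization.nonempty_iso`).

That Whitney homology is a GTCA (`whitney_isGTCA`) comes down to the associativity and the signed
commutativity of the shuffle product (`shuffle_assoc`, `shuffle_comm`).
-/

noncomputable section

namespace Dowling

open scoped TensorProduct DirectSum

/-! ### The interior boundary of chains -/

section BoundarySquare

variable (k : Type u) [CommRing k] {P Q : Type*}

theorem finsupp_lists_induction {X : Set (List P)} {N : Submodule k (List P →₀ k)}
    (h : ∀ l ∈ X, Finsupp.single l (1 : k) ∈ N) : Finsupp.supported k k X ≤ N := by
  rw [Finsupp.supported_eq_span_single, Submodule.span_le]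
  rintro _ ⟨l, hl, rfl⟩
  exact h l hl

theorem single_mem_span {X : Set (List P)} {l : List P} (h : l ∈ X) :
    Finsupp.single l (1 : k) ∈ Finsupp.supported k k X :=
  Finsupp.single_mem_supported k 1 h

theorem consMap_mem_supported {X Y : Set (List P)} {x : P} (h : ∀ l ∈ X, x :: l ∈ Y)
    {c : List P →₀ k} (hc : c ∈ Finsupp.supported k k X) :
    consMap k x c ∈ Finsupp.supported k k Y := by
  have : Finsupp.supported k k X ≤ (Finsupp.supported k k Y).comap (consMap k x) :=
    finsupp_lists_induction k fun l hl => by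
      rw [Submodule.mem_comap, consMap_single]
      exact single_mem_span k (h l hl)
  exact this hc

theorem bdry_cons (x : P) (l : List P) : bdry k (Finsupp.single (x :: l) (1 : k)) =
    - consMap k x (tailMap k (Finsupp.single l 1) + bdry k (Finsupp.single l 1)) := by
  rw [← consMap_single, bdry_consMap]

theorem tailMap_tailMap (l : List P) :
    tailMap k (tailMap k (Finsupp.single l (1 : k))) + tailMap k (bdry k (Finsupp.single l 1)) +
      bdry k (tailMap k (Finsupp.single l 1)) = 0 := by
  rcases l with _ | ⟨y, _ | ⟨z, _ | ⟨w, m⟩⟩⟩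
  · simp [tailMap_single, bdry_single]
  · simp [tailMap_single, bdry_single]
  · simp [tailMap_single, bdry_single]
  · rw [bdry_cons k y, map_neg, tailMap_consMap (n := m.length) k y]
    · rw [tailMap_single, if_pos (by simp)]
      simp
    · exact Submodule.add_mem _ (tailMap_mem_lists k (z :: w :: m))
        (bdry_mem_lists k (z :: w :: m))

theorem bdry_bdry (c : List P →₀ k) : bdry k (bdry k c) = 0 := by
  refine DFunLike.congr_fun (f := bdry k ∘ₗ bdry k) (g := 0) ?_ c
  refine Finsupp.lhom_ext' fun l => LinearMap.ext_ring ?_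
  simp only [LinearMap.comp_apply, Finsupp.lsingle_apply, LinearMap.zero_apply]
  induction l with
  | nil => simp [bdry_single]
  | cons x l ih =>
    rw [bdry_cons, map_neg, bdry_consMap, map_add (tailMap k), map_add (bdry k), ih, add_zero,
      tailMap_tailMap, map_zero, neg_zero, neg_zero]

/-- Appending an element, on linear combinations of lists. -/
def snocMap (a : P) : (List P →₀ k) →ₗ[k] (List P →₀ k) := Finsupp.lmapDomain k k (· ++ [a])

@[simp] theorem snocMap_single (a : P) (l : List P) (c : k) :
    snocMap k a (Finsupp.single l c) = Finsupp.single (l ++ [a]) c := by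
  simp [snocMap]

theorem bdry_append_singleton (a : P) (l : List P) (hl : 2 ≤ l.length) :
    bdry k (Finsupp.single (l ++ [a]) (1 : k)) = snocMap k a (bdry k (Finsupp.single l 1)) +
      (-1 : k) ^ (l.length - 1) • Finsupp.single (l.dropLast ++ [a]) 1 := by
  obtain ⟨n, hn⟩ := Nat.exists_eq_add_of_le hl
  rw [bdry_single, bdry_single, map_sum]
  have e : (l ++ [a]).length - 1 = l.length - 1 + 1 := by simp; omega
  rw [e, Finset.sum_Ico_succ_top (by omega)]
  congr 1
  · refine Finset.sum_congr rfl fun i hi => ?_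
    rw [Finset.mem_Ico] at hi
    rw [map_smul, snocMap_single, List.eraseIdx_append_of_lt_length (by omega)]
  · rw [List.eraseIdx_append_of_lt_length (by omega), List.eraseIdx_length_sub_one]

theorem bdry_short {l : List P} (hl : l.length ≤ 2) : bdry k (Finsupp.single l (1 : k)) = 0 := by
  rw [bdry_single, Finset.Ico_eq_empty (by omega), Finset.sum_empty]

theorem bdry_mem_head {x : P} (l : List P) : bdry k (Finsupp.single (x :: l) (1 : k)) ∈
    Finsupp.supported k k {m | ∃ m', m = x :: m'} := by
  rw [bdry_cons]
  refine Submodule.neg_mem _ (consMap_mem_supported k (X := Set.univ)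
    (Y := {m | ∃ m', m = x :: m'}) (fun l _ => ⟨l, rfl⟩) ?_)
  simp [Finsupp.supported_univ]

variable [PartialOrder P]

theorem IsPath.eraseIdx {x y : P} {r i : ℕ} {l : List P} (h : IsPath x y (r + 1) l)
    (hi : i ∈ Finset.Ico 1 (l.length - 1)) : IsPath x y r (l.eraseIdx i) := by
  rw [Finset.mem_Ico] at hi
  refine ⟨?_, ?_, ?_, ?_⟩
  · rw [List.length_eraseIdx, if_pos (by omega), h.1]; rfl
  · exact (List.isChain_iff_pairwise.2
      ((List.isChain_iff_pairwise.1 h.2.1).sublist (List.eraseIdx_sublist l i)))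
  · rw [head?_eraseIdx hi.1, h.2.2.1]
  · rw [getLast?_eraseIdx hi.2, h.2.2.2]

theorem bdry_mem_paths {x y : P} {r : ℕ} {z : List P →₀ k} (h : z ∈ paths k x y (r + 1)) :
    bdry k z ∈ paths k x y r := by
  have : paths k x y (r + 1) ≤ (paths k x y r).comap (bdry k) := by
    refine paths_induction k fun l hl => ?_
    rw [Submodule.mem_comap, bdry_single]
    exact Submodule.sum_mem _ fun i hi => Submodule.smul_mem _ _
      (single_mem_paths k (hl.eraseIdx hi))
  exact this h

end BoundarySquare

/-! ### Acyclicity from joins with a fixed element -/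

section Join

variable (k : Type u) [CommRing k] {D : Type*} [PartialOrder D]

/-- Every cycle on chains of length `r` from `a` to `b` is a boundary. -/
def ExactAt (a b : D) (r : ℕ) : Prop :=
  ∀ z ∈ paths k a b r, bdry k z = 0 → ∃ w ∈ paths k a b (r + 1), bdry k w = z

/-- An operation that behaves like the join with `e` on the elements below `α`. -/
structure IsJoin (e α : D) (j : D → D) : Prop where
  le_join : ∀ x ≤ α, x ≤ j x
  le_join' : ∀ x ≤ α, e ≤ j x
  join_le : ∀ x ≤ α, j x ≤ α
  join_min : ∀ x y, x ≤ y → y ≤ α → e ≤ y → j x ≤ y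

variable {e α : D} {j : D → D}

/-- The chains from `x` to `α` whose elements `y < α` satisfy `j y ≠ α`. -/
def IsShort (α : D) (j : D → D) (x : D) (r : ℕ) (l : List D) : Prop :=
  IsPath x α r l ∧ ∀ y ∈ l, y ≠ α → j y ≠ α

open Classical in
/-- Insert `j u` behind the last element `u` of the chain that is not above `e`, unless it is there
already. -/
def insertJoin (e : D) (j : D → D) : List D → (List D →₀ k)
  | [] => 0
  | [_] => 0
  | x :: y :: l =>
    if e ≤ y then (if y = j x then 0 else -Finsupp.single (x :: j x :: y :: l) 1)
    else -consMap k x (insertJoin e j (y :: l))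

/-- The linear extension of `insertJoin`. -/
def insertJoinMap (e : D) (j : D → D) : (List D →₀ k) →ₗ[k] (List D →₀ k) :=
  Finsupp.linearCombination k (insertJoin k e j)

@[simp] theorem insertJoinMap_single (l : List D) :
    insertJoinMap k e j (Finsupp.single l 1) = insertJoin k e j l := by
  simp [insertJoinMap]

theorem insertJoinMap_consMap {X : Set (List D)} (x : D) (f : (List D →₀ k) →ₗ[k] (List D →₀ k))
    (h : ∀ l ∈ X, insertJoin k e j (x :: l) = f (Finsupp.single l 1)) {c : List D →₀ k}
    (hc : c ∈ Finsupp.supported k k X) : insertJoinMap k e j (consMap k x c) = f c := by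
  have : Finsupp.supported k k X ≤ LinearMap.eqLocus (insertJoinMap k e j ∘ₗ consMap k x) f := by
    refine finsupp_lists_induction k fun l hl => ?_
    rw [LinearMap.mem_eqLocus, LinearMap.comp_apply, consMap_single, insertJoinMap_single]
    exact h l hl
  exact this hc

open Classical in
/-- The number of elements of a chain that are not above `e`. -/
def countNot (e : D) (l : List D) : ℕ := l.countP fun y => ¬ e ≤ y

theorem countNot_cons_of_le {x : D} (h : e ≤ x) (l : List D) :
    countNot e (x :: l) = countNot e l := by simp [countNot, h]

theorem countNot_cons_of_not_le {x : D} (h : ¬ e ≤ x) (l : List D) :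
    countNot e (x :: l) = countNot e l + 1 := by simp [countNot, h]

theorem IsPath.isChain_ge {x y : D} {r : ℕ} {l : List D} (h : IsPath x y r l) :
    ∀ z ∈ l, x ≤ z := by
  rcases l with _ | ⟨a, l⟩
  · simp
  · obtain rfl := h.head
    have := List.isChain_iff_pairwise.1 h.2.1
    rw [List.pairwise_cons] at this
    intro z hz
    rcases List.mem_cons.1 hz with rfl | hz
    exacts [le_rfl, (this.1 z hz).le]

theorem IsPath.le {x y : D} {r : ℕ} {l : List D} (h : IsPath x y r l) : x ≤ y :=
  h.isChain_ge y (List.mem_of_getLast? h.2.2.2)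

theorem countNot_eq_zero {x y : D} {r : ℕ} {l : List D} (h : IsPath x y r l) (hx : e ≤ x) :
    countNot e l = 0 := by
  rw [countNot, List.countP_eq_zero]
  intro z hz
  simpa using hx.trans (h.isChain_ge z hz)

theorem IsShort.cons {x y : D} {r : ℕ} {l : List D} (h : IsShort α j y r l) (hxy : x < y)
    (hx : x ≠ α → j x ≠ α) : IsShort α j x (r + 1) (x :: l) := by
  refine ⟨⟨by simp [h.1.1], ?_, rfl, ?_⟩, ?_⟩
  · rw [List.isChain_cons]
    refine ⟨?_, h.1.2.1⟩
    rw [h.1.2.2.1]; rintro _ ⟨⟩; exact hxy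
  · rw [List.getLast?_cons, h.1.2.2.2]; rfl
  · intro z hz
    rcases List.mem_cons.1 hz with rfl | hz
    exacts [hx, h.2 z hz]

theorem IsShort.tail {x y : D} {r : ℕ} {l : List D} (h : IsShort α j x r (x :: y :: l)) :
    ∃ s, r = s + 1 ∧ x < y ∧ IsShort α j y s (y :: l) := by
  obtain ⟨s, hs, hxy, hp⟩ := h.1.tail
  exact ⟨s, hs, hxy, hp, fun z hz => h.2 z (List.mem_cons_of_mem _ hz)⟩

/-- `insertJoin` on short chains. -/
theorem insertJoin_short (hj : IsJoin e α j) {x : D} {r : ℕ} {l : List D}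
    (h : IsShort α j x r l) (hx : ¬ e ≤ x) :
    insertJoin k e j l ∈ Finsupp.supported k k {l | IsShort α j x (r + 1) l} := by
  induction l generalizing x r with
  | nil => simp [insertJoin]
  | cons a l ih =>
    obtain rfl := h.1.head
    rcases l with _ | ⟨y, l⟩
    · simp [insertJoin]
    obtain ⟨s, rfl, hxy, hs⟩ := h.tail
    have hyα := hs.1.le
    have hxα : a ≤ α := hxy.le.trans hyα
    have hxne : a ≠ α := fun he => (hxy.trans_le hyα).ne he
    have hjx := h.2 a (by simp) hxne
    rw [insertJoin]
    split_ifs with h1 h2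
    · exact Submodule.zero_mem _
    · refine Submodule.neg_mem _ (single_mem_span k ?_)
      have hlt : j a < y := (hj.join_min a y hxy.le hyα h1).lt_of_ne (Ne.symm h2)
      refine IsShort.cons (IsShort.cons hs hlt fun _ he => ?_) ?_ fun _ => hjx
      · exact hjx (((hj.join_min _ _ le_rfl (hj.join_le a hxα)
          (hj.le_join' a hxα)).antisymm (hj.le_join _ (hj.join_le a hxα))).symm.trans he)
      · refine (hj.le_join a hxα).lt_of_ne fun he => hx ?_
        rw [he]; exact hj.le_join' a hxα
    · exact Submodule.neg_mem _ (consMap_mem_supported k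
        (fun m hm => IsShort.cons hm hxy fun _ => hjx) (ih hs h1))

theorem insertJoin_cons_of_le {x y : D} {l : List D} (h : e ≤ y) (h' : y ≠ j x) :
    insertJoin k e j (x :: y :: l) = -Finsupp.single (x :: j x :: y :: l) 1 := by
  rw [insertJoin, if_pos h, if_neg h']

theorem insertJoin_cons_of_eq {x y : D} {l : List D} (h : e ≤ y) (h' : y = j x) :
    insertJoin k e j (x :: y :: l) = 0 := by
  rw [insertJoin, if_pos h, if_pos h']

theorem insertJoin_cons_of_not_le {x y : D} {l : List D} (h : ¬ e ≤ y) :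
    insertJoin k e j (x :: y :: l) = -consMap k x (insertJoin k e j (y :: l)) := by
  rw [insertJoin, if_neg h]

/-- `insertJoin` is a contracting homotopy, up to chains with fewer elements not above `e`. -/
theorem insertJoin_homotopy (hj : IsJoin e α j) {x : D} {r : ℕ} {l : List D}
    (h : IsShort α j x r l) (hx : ¬ e ≤ x) :
    bdry k (insertJoin k e j l) + insertJoinMap k e j (bdry k (Finsupp.single l 1)) -
      Finsupp.single l 1 ∈
        Finsupp.supported k k {m | IsShort α j x r m ∧ countNot e m < countNot e l} := by
  induction l generalizing x r with
  | nil => have := h.1.1; simp at this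
  | cons a l ih =>
  obtain rfl := h.1.head
  rcases l with _ | ⟨y, l⟩
  · obtain rfl : a = α := by simpa using h.1.2.2.2
    exact absurd (hj.le_join' a le_rfl |>.trans (hj.join_le a le_rfl)) hx
  obtain ⟨s, rfl, hxy, hs⟩ := h.tail
  have hyα := hs.1.le
  have hxα : a ≤ α := hxy.le.trans hyα
  have hxne : a ≠ α := fun he => (hxy.trans_le hyα).ne he
  have hjx := h.2 a (by simp) hxne
  by_cases hy : e ≤ y
  · by_cases hyj : y = j a
    · rcases l with _ | ⟨w, l⟩
      · obtain rfl : y = α := by simpa using hs.1.2.2.2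
        exact absurd hyj.symm hjx
      obtain ⟨t, rfl, hyw, ht⟩ := hs.tail
      have hw : e ≤ w := hy.trans hyw.le
      rw [insertJoin_cons_of_eq k hy hyj, map_zero, zero_add, bdry_cons, map_neg, map_add,
        map_add, tailMap_single, if_pos (by simp), List.tail_cons, consMap_single,
        insertJoinMap_single, insertJoin_cons_of_le k hw (fun he => hyw.ne (hyj.trans he.symm)),
        insertJoinMap_consMap k a 0 (X := {m | ∃ m', m = y :: m'}) ?_ (bdry_mem_head k _), ← hyj]
      · simp
      · rintro _ ⟨m, rfl⟩
        rw [insertJoin_cons_of_eq k hy hyj]; rfl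
    · have hlt : j a < y := (hj.join_min a y hxy.le hyα hy).lt_of_ne (Ne.symm hyj)
      rw [insertJoin_cons_of_le k hy hyj, map_neg, bdry_cons, bdry_cons k (j a), tailMap_single,
        if_pos (by simp), List.tail_cons, bdry_cons k a (y :: l), map_neg (insertJoinMap k e j),
        insertJoinMap_consMap k a (-(consMap k a ∘ₗ consMap k (j a)))
          (X := {m | ∃ z m', m = z :: m' ∧ e ≤ z ∧ z ≠ j a})]
      · convert Submodule.zero_mem _ using 1
        simp
        abel
      · rintro _ ⟨z, m, rfl, hz, hz'⟩
        rw [insertJoin_cons_of_le k hz hz']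
        simp
      · refine Submodule.add_mem _ ?_ ?_
        · rw [tailMap_single]
          rcases l with _ | ⟨w, l⟩
          · simp
          · obtain ⟨t, rfl, hyw, ht⟩ := hs.tail
            rw [if_pos (by simp)]
            exact single_mem_span k ⟨w, l, rfl, hy.trans hyw.le, (hlt.trans hyw).ne'⟩
        · refine Finsupp.supported_mono ?_ (bdry_mem_head k l)
          rintro m ⟨m', hm'⟩
          exact ⟨y, m', hm', hy, hyj⟩
  · rcases l with _ | ⟨w, l⟩
    · obtain rfl : y = α := by simpa using hs.1.2.2.2
      exact absurd (hj.le_join' y le_rfl |>.trans (hj.join_le y le_rfl)) hy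
    obtain ⟨t, rfl, hyw, ht⟩ := hs.tail
    have hwα := ht.1.le
    have hyne : y ≠ α := fun he => (hyw.trans_le hwα).ne he
    have hjy := hs.2 y (by simp) hyne
    have ih' := ih hs hy
    set c := Finsupp.single (y :: w :: l) (1 : k) with hc
    have key : bdry k (insertJoin k e j (a :: y :: w :: l)) +
        insertJoinMap k e j (bdry k (Finsupp.single (a :: y :: w :: l) 1)) -
          Finsupp.single (a :: y :: w :: l) 1 =
        consMap k a (bdry k (insertJoin k e j (y :: w :: l)) + insertJoinMap k e j (bdry k c) - c)
          + (consMap k a (tailMap k (insertJoin k e j (y :: w :: l))) -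
            insertJoin k e j (a :: w :: l)) := by
      rw [insertJoin_cons_of_not_le k hy, map_neg, bdry_consMap, bdry_cons, map_neg,
        map_add (consMap k a) (tailMap k (Finsupp.single _ _)), map_add (insertJoinMap k e j),
        tailMap_single, if_pos (by simp), List.tail_cons, consMap_single, insertJoinMap_single,
        insertJoinMap_consMap k a (-(consMap k a ∘ₗ insertJoinMap k e j))
          (X := {m | ∃ m', m = y :: m'}) ?_ (bdry_mem_head k _),
          ← consMap_single k a (y :: w :: l), ← hc]
      · simp only [map_add, map_sub, LinearMap.neg_apply, LinearMap.comp_apply]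
        abel
      · rintro _ ⟨m, rfl⟩
        rw [insertJoin_cons_of_not_le k hy]
        simp
    rw [key]
    refine Submodule.add_mem _ (consMap_mem_supported k ?_ ih') ?_
    · rintro m ⟨hm, hm'⟩
      refine ⟨hm.cons hxy fun _ => hjx, ?_⟩
      rw [countNot_cons_of_not_le hx, countNot_cons_of_not_le hx]
      exact Nat.succ_lt_succ hm'
    by_cases hw : e ≤ w
    · have hcount : countNot e (w :: l) = 0 := countNot_eq_zero ht.1 hw
      have aux : ∀ b, b < w → j b ≠ α → a ≤ b → w ≠ j b →
          Finsupp.single (a :: j b :: w :: l) (1 : k) ∈ Finsupp.supported k k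
            {m | IsShort α j a (t + 1 + 1) m ∧ countNot e m < countNot e (a :: y :: w :: l)} := by
        intro b hb hjb hab hne
        have hbα : b ≤ α := hb.le.trans hwα
        refine single_mem_span k ⟨?_, ?_⟩
        · have hlt : j b < w := (hj.join_min b w hb.le hwα hw).lt_of_ne hne.symm
          refine IsShort.cons (IsShort.cons ht hlt fun _ he => ?_) ?_ fun _ => hjx
          · exact hjb (((hj.join_min _ _ le_rfl (hj.join_le b hbα)
              (hj.le_join' b hbα)).antisymm (hj.le_join _ (hj.join_le b hbα))).symm.trans he)
          · refine (hab.trans (hj.le_join b hbα)).lt_of_ne fun he => hx ?_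
            rw [he]; exact hj.le_join' b hbα
        · rw [countNot_cons_of_not_le hx, countNot_cons_of_not_le hx, countNot_cons_of_not_le hy,
            countNot_cons_of_le (hj.le_join' b hbα), hcount]
          omega
      refine Submodule.sub_mem _ ?_ ?_
      · by_cases h' : w = j y
        · rw [insertJoin_cons_of_eq k hw h']; simp
        · rw [insertJoin_cons_of_le k hw h', map_neg, map_neg, tailMap_single, if_pos (by simp),
            List.tail_cons, consMap_single]
          exact Submodule.neg_mem _ (aux y hyw hjy hxy.le h')
      · by_cases h' : w = j a
        · rw [insertJoin_cons_of_eq k hw h']; simp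
        · rw [insertJoin_cons_of_le k hw h']
          exact Submodule.neg_mem _ (aux a (hxy.trans hyw) hjx le_rfl h')
    · rw [insertJoin_cons_of_not_le k hw, insertJoin_cons_of_not_le k hw, map_neg,
        tailMap_consMap (n := t + 1) k]
      · simp
      · exact Finsupp.supported_mono (fun m hm => hm.1.1) (insertJoin_short k hj ht hw)

/-- The complex of short chains is acyclic. -/
theorem exists_bdry_eq_of_short (hj : IsJoin e α j) {x : D} {r : ℕ} (hx : ¬ e ≤ x)
    {z : List D →₀ k} (hz : z ∈ Finsupp.supported k k {l | IsShort α j x r l})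
    (h0 : bdry k z = 0) :
    ∃ w ∈ Finsupp.supported k k {l | IsShort α j x (r + 1) l}, bdry k w = z := by
  -- each application of the homotopy lowers the number of elements not above `e`
  have main : ∀ N : ℕ, ∀ z ∈ Finsupp.supported k k {l | IsShort α j x r l ∧ countNot e l < N},
      bdry k z = 0 → ∃ w ∈ Finsupp.supported k k {l | IsShort α j x (r + 1) l}, bdry k w = z := by
    intro N
    induction N with
    | zero =>
      intro z hz _
      refine ⟨0, Submodule.zero_mem _, ?_⟩
      have : {l | IsShort α j x r l ∧ countNot e l < 0} = ∅ := by ext; simp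
      rw [this, Finsupp.supported_empty, Submodule.mem_bot] at hz
      rw [hz, map_zero]
    | succ N ih =>
      intro z hz h0
      have h1 : Finsupp.supported k k {l | IsShort α j x r l ∧ countNot e l < N + 1} ≤
          (Finsupp.supported k k {l | IsShort α j x r l ∧ countNot e l < N}).comap
            (bdry k ∘ₗ insertJoinMap k e j + insertJoinMap k e j ∘ₗ bdry k - LinearMap.id) := by
        refine finsupp_lists_induction k fun l hl => ?_
        rw [Submodule.mem_comap]
        simp only [LinearMap.add_apply, LinearMap.sub_apply, LinearMap.comp_apply,
          LinearMap.id_apply, insertJoinMap_single]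
        refine Finsupp.supported_mono ?_ (insertJoin_homotopy k hj hl.1 hx)
        rintro m ⟨hm, hm'⟩
        exact ⟨hm, by have := hl.2; omega⟩
      have h2 : Finsupp.supported k k {l | IsShort α j x r l ∧ countNot e l < N + 1} ≤
          (Finsupp.supported k k {l | IsShort α j x (r + 1) l}).comap (insertJoinMap k e j) := by
        refine finsupp_lists_induction k fun l hl => ?_
        rw [Submodule.mem_comap, insertJoinMap_single]
        exact insertJoin_short k hj hl.1 hx
      have h3 := h1 hz
      rw [Submodule.mem_comap] at h3
      simp only [LinearMap.add_apply, LinearMap.sub_apply, LinearMap.comp_apply,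
          LinearMap.id_apply, h0, map_zero, add_zero] at h3
      obtain ⟨w, hw, hw'⟩ := ih _ h3 (by rw [map_sub, h0, bdry_bdry, sub_zero])
      refine ⟨insertJoinMap k e j z - w, Submodule.sub_mem _ (h2 hz) hw, ?_⟩
      rw [map_sub, hw']; abel
  have hle : ∀ z ∈ Finsupp.supported k k {l | IsShort α j x r l}, z ∈
      Finsupp.supported k k {l | IsShort α j x r l ∧ countNot e l < r + 2} := by
    refine fun z hz => Finsupp.supported_mono ?_ hz
    intro l hl
    refine ⟨hl, ?_⟩
    have h1 := hl.1.1
    have : countNot e l ≤ l.length := List.countP_le_length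
    show countNot e l < r + 2
    omega
  exact main _ z (hle z hz) h0

end Join

section Exact

variable (k : Type u) [CommRing k] {D : Type*}

open Classical in
/-- The combinations of the chains whose last element lies in `A`. -/
def lastIn (A : Set D) : (List D →₀ k) →ₗ[k] (List D →₀ k) :=
  Finsupp.linearCombination k fun l =>
    if ∃ x ∈ A, l.getLast? = some x then Finsupp.single l 1 else 0

open Classical in
theorem lastIn_single (A : Set D) (l : List D) : lastIn k A (Finsupp.single l 1) =
    if ∃ x ∈ A, l.getLast? = some x then Finsupp.single l 1 else 0 := by
  simp [lastIn]

theorem bdry_lastIn (A : Set D) (z : List D →₀ k) :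
    bdry k (lastIn k A z) = lastIn k A (bdry k z) := by
  classical
  refine DFunLike.congr_fun (f := bdry k ∘ₗ lastIn k A) (g := lastIn k A ∘ₗ bdry k) ?_ z
  refine Finsupp.lhom_ext' fun l => LinearMap.ext_ring ?_
  simp only [LinearMap.comp_apply, Finsupp.lsingle_apply, lastIn_single, bdry_single, map_sum]
  have : ∀ i ∈ Finset.Ico 1 (l.length - 1),
      lastIn k A ((-1 : k) ^ i • Finsupp.single (l.eraseIdx i) 1) =
      if ∃ x ∈ A, l.getLast? = some x then (-1 : k) ^ i • Finsupp.single (l.eraseIdx i) 1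
      else 0 := by
    intro i hi
    rw [Finset.mem_Ico] at hi
    rw [map_smul, lastIn_single, getLast?_eraseIdx hi.2]
    split_ifs <;> simp
  rw [Finset.sum_congr rfl this]
  split_ifs
  · rw [bdry_single]
  · simp

theorem snocMap_mem_supported {X Y : Set (List D)} {x : D} (h : ∀ l ∈ X, l ++ [x] ∈ Y)
    {c : List D →₀ k} (hc : c ∈ Finsupp.supported k k X) :
    snocMap k x c ∈ Finsupp.supported k k Y := by
  have : Finsupp.supported k k X ≤ (Finsupp.supported k k Y).comap (snocMap k x) :=
    finsupp_lists_induction k fun l hl => by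
      rw [Submodule.mem_comap, snocMap_single]
      exact single_mem_span k (h l hl)
  exact this hc

open Classical in
/-- The combinations of the chains `l` with `l ++ [α]` in the given one and with last
element in `A`. -/
def dropTop (A : Set D) (α : D) : (List D →₀ k) →ₗ[k] (List D →₀ k) :=
  Finsupp.linearCombination k fun l =>
    if l.getLast? = some α ∧ ∃ x ∈ A, l.dropLast.getLast? = some x then
      Finsupp.single l.dropLast 1 else 0

open Classical in
theorem dropTop_append (A : Set D) (α : D) (l : List D) :
    dropTop k A α (Finsupp.single (l ++ [α]) 1) = lastIn k A (Finsupp.single l 1) := by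
  simp [dropTop, lastIn_single]

theorem dropTop_snocMap (A : Set D) (α : D) (z : List D →₀ k) :
    dropTop k A α (snocMap k α z) = lastIn k A z := by
  refine DFunLike.congr_fun (f := dropTop k A α ∘ₗ snocMap k α) (g := lastIn k A) ?_ z
  refine Finsupp.lhom_ext' fun l => LinearMap.ext_ring ?_
  simp [dropTop_append]

variable [PartialOrder D] {e α : D} {j : D → D}

/-- Chains that end in various elements decompose by the last element. -/
theorem exists_bdry_eq_of_exactAt (o : D) (A : Set D) (r : ℕ) (h : ∀ x ∈ A, ExactAt k o x r)
    {t : List D →₀ k} (ht : t ∈ Finsupp.supported k k {l | ∃ x ∈ A, IsPath o x r l})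
    (h0 : bdry k t = 0) :
    ∃ w ∈ Finsupp.supported k k {l | ∃ x ∈ A, IsPath o x (r + 1) l}, bdry k w = t := by
  classical
  have h1 : ∀ x ∈ A, lastIn k {x} t ∈ paths k o x r := by
    intro x hx
    have : Finsupp.supported k k {l | ∃ x ∈ A, IsPath o x r l} ≤
        (paths k o x r).comap (lastIn k {x}) := by
      refine finsupp_lists_induction k fun l hl => ?_
      rw [Submodule.mem_comap, lastIn_single]
      split_ifs with h
      · obtain ⟨x', hx', h⟩ := h
        obtain ⟨y, hy, hp⟩ := hl
        obtain rfl : y = x := by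
          simpa [h, Set.mem_singleton_iff.1 hx'] using hp.2.2.2.symm
        exact single_mem_paths k hp
      · exact Submodule.zero_mem _
    exact this ht
  have h2 : ∀ x ∈ A, ∃ w ∈ paths k o x (r + 1), bdry k w = lastIn k {x} t := fun x hx =>
    h x hx _ (h1 x hx) (by rw [bdry_lastIn, h0, map_zero])
  choose! w hw hw' using h2
  let X : Finset D := (t.support.image fun l => l.getLast?.getD o).filter (· ∈ A)
  have h3 : ∑ x ∈ X, lastIn k {x} t = t := by
    have h4 : ∀ l ∈ t.support, ∑ x ∈ X, lastIn k {x} (Finsupp.single l 1) =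
        Finsupp.single l (1 : k) := by
      intro l hl
      obtain ⟨y, hy, hp⟩ := (Finsupp.mem_supported _ _).1 ht hl
      rw [Finset.sum_eq_single y]
      · rw [lastIn_single, if_pos ⟨y, rfl, hp.2.2.2⟩]
      · intro x _ hxy
        rw [lastIn_single, if_neg]
        rintro ⟨_, rfl, h⟩
        rw [hp.2.2.2] at h
        exact hxy (by simpa using h.symm)
      · intro hn
        refine absurd ?_ hn
        refine Finset.mem_filter.2 ⟨Finset.mem_image.2 ⟨l, hl, ?_⟩, hy⟩
        rw [hp.2.2.2]; rfl
    conv_lhs => rw [← Finsupp.sum_single t]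
    simp only [Finsupp.sum, map_sum]
    rw [Finset.sum_comm]
    conv_rhs => rw [← Finsupp.sum_single t]
    refine Finset.sum_congr rfl fun l hl => ?_
    have e : Finsupp.single l (t l) = t l • Finsupp.single l (1 : k) := by simp
    rw [e]
    simp only [map_smul]
    rw [← Finset.smul_sum, h4 l hl]
  have hX : ∀ x ∈ X, x ∈ A := fun x hx => (Finset.mem_filter.1 hx).2
  refine ⟨∑ x ∈ X, w x, Submodule.sum_mem _ fun x hx => ?_, ?_⟩
  · refine Finsupp.supported_mono ?_ (hw x (hX x hx))
    exact fun l (hl : IsPath o x (r + 1) l) => ⟨x, hX x hx, hl⟩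
  · rw [map_sum, Finset.sum_congr rfl fun x hx => hw' x (hX x hx), h3]

theorem IsPath.exists_append {o x : D} {r : ℕ} {l : List D} (h : IsPath o x (r + 1) l) :
    ∃ q y, l = q ++ [x] ∧ y < x ∧ IsPath o y r q := by
  obtain ⟨h1, h2, h3, h4⟩ := h
  obtain ⟨q, rfl⟩ := List.getLast?_eq_some_iff.1 h4
  have hq : q.length = r + 1 := by simpa using h1
  have hne : q ≠ [] := by rintro rfl; simp at hq
  rw [List.isChain_append] at h2
  refine ⟨q, q.getLast hne, rfl, h2.2.2 _ (List.getLast?_eq_some_getLast hne) _ rfl, hq, h2.1, ?_,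
    List.getLast?_eq_some_getLast hne⟩
  rwa [List.head?_append_of_ne_nil _ hne] at h3

theorem IsPath.append {o x y : D} {r : ℕ} {q : List D} (h : IsPath o y r q) (hy : y < x) :
    IsPath o x (r + 1) (q ++ [x]) := by
  obtain ⟨h1, h2, h3, h4⟩ := h
  have hne : q ≠ [] := by rintro rfl; simp at h1
  refine ⟨by simp [h1], ?_, by rwa [List.head?_append_of_ne_nil _ hne], by simp⟩
  rw [List.isChain_append]
  refine ⟨h2, List.isChain_singleton _, ?_⟩
  rintro a ha b hb
  rw [h4] at ha
  obtain rfl : y = a := by simpa using ha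
  obtain rfl : x = b := by simpa using hb
  exact hy

theorem IsPath.le_last {o x : D} {r : ℕ} {l : List D} (h : IsPath o x r l) :
    ∀ y ∈ l, y ≤ x := by
  obtain ⟨h1, h2, h3, h4⟩ := h
  obtain ⟨q, rfl⟩ := List.getLast?_eq_some_iff.1 h4
  have := List.isChain_iff_pairwise.1 h2
  rw [List.pairwise_append] at this
  intro y hy
  rcases List.mem_append.1 hy with hy | hy
  · exact (this.2.2 y hy x (by simp)).le
  · rw [List.mem_singleton.1 hy]

/-- If all proper elements `x` with `x ∨ e = α` are coatoms of the interval `[o, α]`, then the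
homology of `[o, α]` vanishes wherever that of the intervals `[o, x]` vanishes one degree below: the
chains that avoid these coatoms form an acyclic complex. -/
theorem exactAt_of_isJoin (hj : IsJoin e α j) {o : D} (ho : ¬ e ≤ o)
    (hA : ∀ x < α, j x = α → ∀ y, x < y → y ≤ α → y = α) {r : ℕ}
    (hr : ∀ x < α, j x = α → ExactAt k o x r) : ExactAt k o α (r + 1) := by
  classical
  set A : Set D := {x | x < α ∧ j x = α} with hAdef
  intro z hz h0
  have hne : ∀ x ∈ A, ∀ y < x, y ∉ A := fun x hx y hyx hy =>
    hx.1.ne (hA y hy.1 hy.2 x hyx hx.1.le)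
  -- the part of `z` on the chains through a coatom of the given kind
  have ht : dropTop k A α z ∈ Finsupp.supported k k {l | ∃ x ∈ A, IsPath o x r l} := by
    have : paths k o α (r + 1) ≤
        (Finsupp.supported k k {l | ∃ x ∈ A, IsPath o x r l}).comap (dropTop k A α) := by
      refine paths_induction k fun l hl => ?_
      obtain ⟨q, y, rfl, hy, hq⟩ := hl.exists_append
      rw [Submodule.mem_comap, dropTop_append, lastIn_single]
      split_ifs with h
      · obtain ⟨x, hx, hx'⟩ := h
        obtain rfl : y = x := by simpa [hq.2.2.2] using hx'
        exact single_mem_span k ⟨y, hx, hq⟩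
      · exact Submodule.zero_mem _
    exact this hz
  have hcomm : bdry k (dropTop k A α z) = dropTop k A α (bdry k z) := by
    have : paths k o α (r + 1) ≤
        LinearMap.eqLocus (bdry k ∘ₗ dropTop k A α) (dropTop k A α ∘ₗ bdry k) := by
      refine paths_induction k fun l hl => ?_
      obtain ⟨q, y, rfl, hy, hq⟩ := hl.exists_append
      rw [LinearMap.mem_eqLocus, LinearMap.comp_apply, LinearMap.comp_apply, dropTop_append,
        bdry_lastIn]
      rcases Nat.lt_or_ge q.length 2 with h2 | h2
      · rw [bdry_short k (by omega), bdry_short k (by simp; omega), map_zero, map_zero]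
      · rw [bdry_append_singleton k α q h2, map_add, dropTop_snocMap, map_smul, dropTop_append,
          lastIn_single, if_neg, smul_zero, add_zero]
        rintro ⟨x, hx, hx'⟩
        obtain ⟨r', rfl⟩ : ∃ r', r = r' + 1 := ⟨r - 1, by have := hq.1; omega⟩
        obtain ⟨q', y', rfl, hy', hq'⟩ := hq.exists_append
        rw [List.dropLast_concat, hq'.2.2.2] at hx'
        obtain rfl : y' = x := by simpa using hx'
        exact hy.ne (hA y' hx.1 hx.2 y hy' hy.le)
    exact this hz
  obtain ⟨w, hw, hw'⟩ := exists_bdry_eq_of_exactAt k o A r (fun x hx => hr x hx.1 hx.2) ht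
    (by rw [hcomm, h0, map_zero])
  have hw2 : snocMap k α w ∈ paths k o α (r + 1 + 1) :=
    snocMap_mem_supported k (by rintro l ⟨x, hx, hl⟩; exact hl.append hx.1) hw
  -- the remaining chains avoid these coatoms
  have hz1 : z - bdry k (snocMap k α w) ∈
      Finsupp.supported k k {l | IsShort α j o (r + 1) l} := by
    have e : z - bdry k (snocMap k α w) = (z - snocMap k α (dropTop k A α z)) -
        (bdry k (snocMap k α w) - snocMap k α (bdry k w)) := by rw [hw']; abel
    rw [e]
    refine Submodule.sub_mem _ ?_ ?_
    · have : paths k o α (r + 1) ≤ (Finsupp.supported k k {l | IsShort α j o (r + 1) l}).comap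
          (LinearMap.id - snocMap k α ∘ₗ dropTop k A α) := by
        refine paths_induction k fun l hl => ?_
        obtain ⟨q, y, rfl, hy, hq⟩ := hl.exists_append
        rw [Submodule.mem_comap, LinearMap.sub_apply, LinearMap.comp_apply, dropTop_append,
          lastIn_single]
        split_ifs with h
        · simp
        · rw [map_zero, sub_zero]
          refine single_mem_span k ⟨hl, fun x hx hxα hjx => h ⟨y, ?_, hq.2.2.2⟩⟩
          have hxq : x ∈ q := by
            rcases List.mem_append.1 hx with hx | hx
            · exact hx
            · exact absurd (List.mem_singleton.1 hx) hxα
          have hxy := hq.le_last x hxq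
          rcases hxy.eq_or_lt with rfl | hxy
          · exact ⟨hy, hjx⟩
          · exact absurd (hA x (hxy.trans hy) hjx y hxy hy.le) hy.ne
      exact this hz
    · have : Finsupp.supported k k {l | ∃ x ∈ A, IsPath o x (r + 1) l} ≤
          (Finsupp.supported k k {l | IsShort α j o (r + 1) l}).comap
          (bdry k ∘ₗ snocMap k α - snocMap k α ∘ₗ bdry k) := by
        refine finsupp_lists_induction k fun l hl => ?_
        obtain ⟨x, hx, hl⟩ := hl
        obtain ⟨q, y, rfl, hy, hq⟩ := hl.exists_append
        rw [Submodule.mem_comap, LinearMap.sub_apply, LinearMap.comp_apply, LinearMap.comp_apply,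
          snocMap_single, bdry_append_singleton k α _ (by simp [hq.1]), add_sub_cancel_left,
          List.dropLast_concat]
        refine Submodule.smul_mem _ _ (single_mem_span k ⟨hq.append (hy.trans hx.1), ?_⟩)
        intro y' hy' hy'α hjy
        have hyq : y' ∈ q := by
          rcases List.mem_append.1 hy' with h | h
          · exact h
          · exact absurd (List.mem_singleton.1 h) hy'α
        have hlt := (hq.le_last y' hyq).trans_lt hy
        exact hne x hx y' hlt ⟨hlt.trans hx.1, hjy⟩
      exact this hw
  obtain ⟨w', hw3, hw4⟩ := exists_bdry_eq_of_short k hj ho hz1 (by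
    rw [map_sub, h0, bdry_bdry, sub_zero])
  refine ⟨w' + snocMap k α w, Submodule.add_mem _ ?_ hw2, by rw [map_add, hw4]; abel⟩
  exact Finsupp.supported_mono (fun l hl => hl.1) hw3

theorem exactAt_zero_of_ne {a b : D} (h : a ≠ b) : ExactAt k a b 0 := by
  intro z hz _
  refine ⟨0, Submodule.zero_mem _, ?_⟩
  have : paths k a b 0 ≤ ⊥ := by
    refine paths_induction k fun l hl => ?_
    obtain ⟨h1, -, h3, h4⟩ := hl
    obtain ⟨x, rfl⟩ := List.length_eq_one_iff.1 h1
    simp only [List.head?_cons, Option.some.injEq, List.getLast?_singleton] at h3 h4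
    exact absurd (h3.symm.trans h4) h
  rw [map_zero, (Submodule.mem_bot k).1 (this hz)]

/-! ### Lower intervals, and splitting -/

/-- The homology of a bounded poset vanishes outside degree `n`. -/
def Concentrated (P : Type*) [PartialOrder P] (n : ℕ) : Prop :=
  ∀ r, r ≠ n → cycles k P r ≤ boundaries k P r

theorem Concentrated.subsingleton {P : Type*} [PartialOrder P] {n : ℕ} (h : Concentrated k P n)
    {r : ℕ} (hr : r ≠ n) : Subsingleton (RedHom k P r) := by
  refine subsingleton_of_forall_eq 0 fun x => ?_
  obtain ⟨z, hz, rfl⟩ := SubQuot.mk_surjective x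
  exact SubQuot.mk_eq_zero hz (h r hr hz)

theorem bdry_lmapDomain {P Q : Type*} (f : P → Q) (z : List P →₀ k) :
    bdry k (Finsupp.lmapDomain k k (List.map f) z) =
      Finsupp.lmapDomain k k (List.map f) (bdry k z) := by
  refine DFunLike.congr_fun (f := bdry k ∘ₗ Finsupp.lmapDomain k k (List.map f))
    (g := Finsupp.lmapDomain k k (List.map f) ∘ₗ bdry k) ?_ z
  refine Finsupp.lhom_ext' fun l => LinearMap.ext_ring ?_
  simp [bdry_single, List.eraseIdx_map]

theorem isFull_iic_iff {o α : D} (ho : IsBot o) {r : ℕ} {l : List (Set.Iic α)} :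
    IsFull r l ↔ IsPath o α r (l.map Subtype.val) := by
  have hbot : ∀ x : Set.Iic α, IsBot x ↔ x.1 = o := fun x =>
    ⟨fun h => le_antisymm (h ⟨o, ho α⟩) (ho x.1), fun h y => show x.1 ≤ y.1 by rw [h]; exact ho y.1⟩
  have htop : ∀ x : Set.Iic α, IsTop x ↔ x.1 = α := fun x =>
    ⟨fun h => le_antisymm x.2 (h ⟨α, le_rfl⟩), fun h y => show y.1 ≤ x.1 by rw [h]; exact y.2⟩
  rw [IsFull, IsPath, Ends, List.length_map, List.isChain_map]
  refine and_congr_right fun hl => and_congr Iff.rfl ?_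
  have hne : l ≠ [] := by rintro rfl; simp at hl
  rw [List.head?_map, List.getLast?_map, List.head?_eq_some_head hne,
    List.getLast?_eq_some_getLast hne]
  simp only [Option.mem_def, Option.some.injEq, forall_eq', hbot, htop, Option.map_some]

theorem Concentrated.of_exactAt {o α : D} (ho : IsBot o) {n : ℕ}
    (h : ∀ r, r ≠ n → ExactAt k o α r) : Concentrated k (Set.Iic α) n := by
  classical
  intro r hr z hz
  let f : (List (Set.Iic α) →₀ k) →ₗ[k] (List D →₀ k) :=
    Finsupp.lmapDomain k k (List.map Subtype.val)
  have hinj : Function.Injective f :=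
    Finsupp.mapDomain_injective (List.map_injective_iff.2 Subtype.val_injective)
  have h1 : f z ∈ paths k o α r := by
    have : chains k (Set.Iic α) r ≤ (paths k o α r).comap f := by
      refine chains_induction k fun l hl => ?_
      rw [Submodule.mem_comap]
      simp only [f, Finsupp.lmapDomain_apply, Finsupp.mapDomain_single]
      exact single_mem_paths k ((isFull_iic_iff ho).1 hl)
    exact this hz.1
  obtain ⟨w, hw, hw'⟩ := h r hr (f z) h1 (by
    rw [bdry_lmapDomain, show bdry k z = 0 from hz.2, map_zero])
  have h2 : paths k o α (r + 1) ≤ (chains k (Set.Iic α) (r + 1)).map f := by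
    refine paths_induction k fun l hl => ?_
    obtain ⟨m, rfl⟩ : ∃ m : List (Set.Iic α), m.map Subtype.val = l :=
      ⟨l.attach.map fun x => ⟨x.1, hl.le_last x.1 x.2⟩, by simp⟩
    exact ⟨Finsupp.single m 1, single_mem_chains k ((isFull_iic_iff ho).2 hl), by simp [f]⟩
  obtain ⟨v, hv, rfl⟩ := h2 hw
  exact ⟨v, hv, hinj (by rw [← hw', bdry_lmapDomain])⟩

/-- If the homology vanishes below degree `n`, then the cycles are a direct summand in
degree `n`: preimages of boundaries may be chosen on a basis. -/
theorem exists_projection_cycles {P : Type*} [PartialOrder P] (n : ℕ)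
    (h : ∀ r < n, cycles k P r ≤ boundaries k P r) :
    ∃ π : (List P →₀ k) →ₗ[k] (List P →₀ k), (∀ c, π c ∈ cycles k P n) ∧
      ∀ z ∈ cycles k P n, π z = z := by
  classical
  have hproj : ∀ r, ∃ p : (List P →₀ k) →ₗ[k] (List P →₀ k), (∀ c, p c ∈ chains k P r) ∧
      ∀ z ∈ chains k P r, p z = z := fun r =>
    ⟨(Submodule.subtype _) ∘ₗ Finsupp.restrictDom k k {l | IsFull r l},
      fun c => (Finsupp.restrictDom k k {l | IsFull r l} c).2,
      fun z hz => congrArg Subtype.val (DFunLike.congr_fun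
        (Finsupp.restrictDom_comp_subtype {l | IsFull r l}) (⟨z, hz⟩ : chains k P r))⟩
  have hsq : ∀ r, ∀ c ∈ chains k P (r + 1), bdry k c ∈ cycles k P r := by
    refine fun r c hc => ⟨?_, bdry_bdry k c⟩
    have : chains k P (r + 1) ≤ (chains k P r).comap (bdry k) := by
      refine chains_induction k fun l hl => ?_
      obtain ⟨x, y, hx, hy, hp⟩ := hl.exists_isPath
      exact paths_le_chains k hx hy r (bdry_mem_paths k (single_mem_paths k hp))
    exact this hc
  induction n with
  | zero =>
    obtain ⟨p, hp, hp'⟩ := hproj 0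
    refine ⟨p, fun c => ⟨hp c, ?_⟩, fun z hz => hp' z hz.1⟩
    have : chains k P 0 ≤ LinearMap.ker (bdry k) := by
      refine chains_induction k fun l hl => ?_
      rw [LinearMap.mem_ker, bdry_short k (by rw [hl.1]; omega)]
    exact this (hp c)
  | succ n ih =>
    obtain ⟨π, h1, h2⟩ := ih fun r hr => h r (by omega)
    have h3 : ∀ l : List P, ∃ w ∈ chains k P (n + 1), bdry k w = π (Finsupp.single l 1) :=
      fun l => h n (by omega) (h1 _)
    choose w hw hw' using h3
    let s : (List P →₀ k) →ₗ[k] (List P →₀ k) := Finsupp.linearCombination k w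
    have hs : ∀ c, bdry k (s c) = π c := by
      intro c
      refine DFunLike.congr_fun (f := bdry k ∘ₗ s) (g := π) ?_ c
      refine Finsupp.lhom_ext' fun l => LinearMap.ext_ring ?_
      simp [s, hw']
    have hs' : ∀ c, s c ∈ chains k P (n + 1) := fun c => by
      rw [Finsupp.linearCombination_apply]
      exact Submodule.sum_mem _ fun l _ => Submodule.smul_mem _ _ (hw l)
    obtain ⟨p, hp, hp'⟩ := hproj (n + 1)
    refine ⟨p - s ∘ₗ bdry k ∘ₗ p, fun c => ⟨Submodule.sub_mem _ (hp c) (hs' _), ?_⟩, ?_⟩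
    · change bdry k _ = 0
      rw [LinearMap.sub_apply, map_sub, LinearMap.comp_apply,
        LinearMap.comp_apply, hs, h2 _ (hsq n _ (hp c)), sub_self]
    · intro z hz
      rw [LinearMap.sub_apply, LinearMap.comp_apply, LinearMap.comp_apply, hp' z hz.1,
        show bdry k z = 0 from hz.2, map_zero, sub_zero]

end Exact

/-! ### The rank of an element of a Dowling poset -/

namespace Poset

variable {G : Type*} [Group G] {S : Type*} [MulAction G S] {T : Set S} {I J : Type*}

/-- The equivalence relation whose classes are the blocks. -/
def blockSetoid (α : Poset G S T I) : Setoid {i // α.zero i = none} where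
  r i j := ∃ g, α.rel i g j
  iseqv :=
    { refl := fun i => ⟨1, (α.rel_refl i).2 i.2⟩
      symm := fun ⟨g, h⟩ => ⟨g⁻¹, α.rel_symm h⟩
      trans := fun ⟨g, h⟩ ⟨g', h'⟩ => ⟨g * g', α.rel_trans h h'⟩ }

/-- The blocks of an element of the Dowling poset, without the zero block. -/
abbrev Blocks (α : Poset G S T I) : Type _ := Quotient α.blockSetoid

/-- The number of blocks. -/
def numBlocks (α : Poset G S T I) : ℕ := Nat.card α.Blocks

/-- The rank of `α`: the number of points minus the number of blocks. -/
def rank (α : Poset G S T I) : ℕ := Nat.card I - α.numBlocks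

theorem rel_eq (α : Poset G S T I) {i g h j} (h1 : α.rel i g j) (h2 : α.rel i h j) : g = h := by
  have := α.rel_unique (α.rel_trans h1 (α.rel_symm h2))
  rwa [mul_inv_eq_one] at this

theorem zero_none_of_le {α β : Poset G S T I} (h : α ≤ β) {i} (hi : β.zero i = none) :
    α.zero i = none := by
  by_contra hn
  obtain ⟨s, hs⟩ := Option.ne_none_iff_exists'.1 hn
  rw [h.1 i s hs] at hi
  exact absurd hi (by simp)

theorem rel_of_le {α β : Poset G S T I} (h : α ≤ β) {i g j} (hr : α.rel i g j)
    (hj : β.zero j = none) : β.rel i g j := by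
  rcases h.2 _ _ _ hr with h | ⟨s, hs, -⟩
  · exact h
  · rw [hj] at hs; exact absurd hs (by simp)

theorem zero_of_le {α β : Poset G S T I} (h : α ≤ β) {i g j s} (hr : α.rel i g j)
    (hj : β.zero j = some s) : β.zero i = some (g • s) := by
  rcases h.2 _ _ _ hr with h | ⟨s', hs, hs'⟩
  · rw [β.zero_right h] at hj; exact absurd hj (by simp)
  · rw [hj] at hs; obtain rfl := Option.some.inj hs; exact hs'

theorem zero_eq_of_le {α β : Poset G S T I} (h : α ≤ β) {i} (hi : α.zero i ≠ none) :
    α.zero i = β.zero i := by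
  obtain ⟨s, hs⟩ := Option.ne_none_iff_exists'.1 hi
  rw [hs, h.1 i s hs]

variable [Finite I]

theorem numBlocks_le (α : Poset G S T I) : α.numBlocks ≤ Nat.card I :=
  (Nat.card_le_card_of_surjective _ (Quotient.mk_surjective (s := α.blockSetoid))).trans
    (Nat.card_le_card_of_injective _ Subtype.val_injective)

theorem rank_add_numBlocks (α : Poset G S T I) : α.rank + α.numBlocks = Nat.card I :=
  Nat.sub_add_cancel α.numBlocks_le

theorem numBlocks_lt {α β : Poset G S T I} (h : α < β) : β.numBlocks < α.numBlocks := by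
  let f : β.Blocks → α.Blocks := fun b =>
    Quotient.mk α.blockSetoid ⟨b.out.1, zero_none_of_le h.le b.out.2⟩
  have hf : Function.Injective f := by
    intro b b' hb
    obtain ⟨g, hg⟩ := Quotient.exact hb
    have : β.blockSetoid.r b.out b'.out := ⟨g, rel_of_le h.le hg b'.out.2⟩
    rw [← Quotient.out_eq b, ← Quotient.out_eq b']
    exact Quotient.sound this
  refine (Nat.card_le_card_of_injective f hf).lt_of_ne fun he => h.ne ?_
  have hs : Function.Surjective f := by
    have := Fintype.ofFinite α.Blocks
    have := Fintype.ofFinite β.Blocks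
    refine ((Fintype.bijective_iff_injective_and_card f).2 ⟨hf, ?_⟩).2
    rwa [← Nat.card_eq_fintype_card, ← Nat.card_eq_fintype_card]
  have key : ∀ i, α.zero i = none → ∃ (b : β.Blocks) (g : G), α.rel i g b.out.1 := by
    intro i hi
    obtain ⟨b, hb⟩ := hs (Quotient.mk α.blockSetoid ⟨i, hi⟩)
    obtain ⟨g, hg⟩ := Quotient.exact hb
    exact ⟨b, g⁻¹, α.rel_symm hg⟩
  have hz : ∀ i, α.zero i = none → β.zero i = none := by
    intro i hi
    obtain ⟨b, g, hb⟩ := key i hi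
    exact β.zero_left (rel_of_le h.le hb b.out.2)
  refine h.le.antisymm ⟨fun i s hs => ?_, fun i g j hr => Or.inl ?_⟩
  · have : α.zero i ≠ none := fun hn => by rw [hz i hn] at hs; exact absurd hs (by simp)
    rw [zero_eq_of_le h.le this, hs]
  · obtain ⟨b, g1, h1⟩ := key i (zero_none_of_le h.le (β.zero_left hr))
    obtain ⟨b', g2, h2⟩ := key j (zero_none_of_le h.le (β.zero_right hr))
    have h1' := rel_of_le h.le h1 b.out.2
    have h2' := rel_of_le h.le h2 b'.out.2
    have hbb : b = b' := by
      rw [← Quotient.out_eq b, ← Quotient.out_eq b']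
      exact Quotient.sound ⟨_, β.rel_trans (β.rel_symm h1') (β.rel_trans hr h2')⟩
    subst hbb
    have h3 := α.rel_trans h1 (α.rel_symm h2)
    rw [β.rel_eq hr (rel_of_le h.le h3 (β.zero_right hr))]
    exact h3

theorem rank_strictMono : StrictMono (rank : Poset G S T I → ℕ) := by
  intro α β h
  have h1 := numBlocks_lt h
  have h2 := α.numBlocks_le
  rw [rank, rank]
  omega

/-- If `y` keeps the blocks of `x` apart and nonzero, with the exception of the block
of `p`, then `y` has at most one block less. -/
theorem numBlocks_le_succ {x y : Poset G S T I} (p : I)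
    (h1 : ∀ i, x.zero i = none → (¬ ∃ h, x.rel i h p) → y.zero i = none)
    (h2 : ∀ i j g, (¬ ∃ h, x.rel i h p) → (¬ ∃ h, x.rel j h p) → y.rel i g j →
      ∃ h, x.rel i h j) : x.numBlocks ≤ y.numBlocks + 1 := by
  classical
  let f : x.Blocks → Option y.Blocks := fun b => if h : ∃ h, x.rel b.out.1 h p then none else
    some (Quotient.mk y.blockSetoid ⟨b.out.1, h1 _ b.out.2 h⟩)
  have hf : Function.Injective f := by
    intro b b' hb
    rw [← Quotient.out_eq b, ← Quotient.out_eq b']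
    apply Quotient.sound
    by_cases h : ∃ h, x.rel b.out.1 h p
    · by_cases h' : ∃ h, x.rel b'.out.1 h p
      · obtain ⟨a, ha⟩ := h
        obtain ⟨a', ha'⟩ := h'
        exact ⟨_, x.rel_trans ha (x.rel_symm ha')⟩
      · simp [f, h, h'] at hb
    · by_cases h' : ∃ h, x.rel b'.out.1 h p
      · simp [f, h, h'] at hb
      · simp only [f, dif_neg h, dif_neg h', Option.some.injEq] at hb
        obtain ⟨g, hg⟩ := Quotient.exact hb
        exact h2 _ _ g h h' hg
  have := Nat.card_le_card_of_injective f hf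
  rwa [Finite.card_option] at this

omit [Finite I] in
theorem bot_zero (i : I) : (⊥ : Poset G S T I).zero i = none := rfl

theorem rank_bot : (⊥ : Poset G S T I).rank = 0 := by
  have : Function.Injective fun i : I => Quotient.mk (⊥ : Poset G S T I).blockSetoid ⟨i, rfl⟩ := by
    intro i j h
    obtain ⟨g, hg⟩ := Quotient.exact h
    exact hg.1
  have := Nat.card_le_card_of_injective _ this
  exact Nat.sub_eq_zero_of_le this

/-! ### Joins with atoms -/

omit [Finite I]

open Classical in
/-- Move a union `M` of blocks of `x` into the zero block, with the colours of `α`. -/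
def kill (x α : Poset G S T I) (M : Set I) (h1 : ∀ i ∈ M, α.zero i ≠ none)
    (h2 : ∀ i g j, x.rel i g j → (i ∈ M ↔ j ∈ M)) (h3 : ∀ i ∈ M, x.zero i = none)
    (h4 : ∀ s, ∀ i ∈ M, (∃ g : G, α.zero i = some (g • s)) → (∀ i' ∈ M, (∃ g : G,
      α.zero i' = some (g • s)) → i' = i) → (∀ i' ∉ M, ∀ g : G, x.zero i' ≠ some (g • s)) →
      s ∈ T) : Poset G S T I where
  zero i := if i ∈ M then α.zero i else x.zero i
  rel i g j := x.rel i g j ∧ i ∉ M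
  rel_refl i := by
    by_cases hi : i ∈ M
    · simp [hi, h1 i hi]
    · simp [hi, x.rel_refl]
  rel_symm h := ⟨x.rel_symm h.1, fun hj => h.2 ((h2 _ _ _ h.1).2 hj)⟩
  rel_trans h h' := ⟨x.rel_trans h.1 h'.1, h.2⟩
  rel_unique h := x.rel_unique h.1
  mem_of_unique s := by
    rintro ⟨i, hi, hu⟩
    by_cases hM : i ∈ M
    · refine h4 s i hM ?_ (fun i' hi' h => hu i' ?_) fun i' hi' g h => hi' ?_
      · simpa [hM] using hi
      · simpa [hi'] using h
      · rwa [hu i' ⟨g, by simp [hi', h]⟩]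
    · refine x.mem_of_unique s ⟨i, by simpa [hM] using hi, fun i' hi' => hu i' ?_⟩
      have : i' ∉ M := fun h => by
        obtain ⟨g, hg⟩ := hi'
        rw [h3 i' h] at hg
        exact absurd hg (by simp)
      simpa [this] using hi'

theorem kill_zero_of_mem {x α : Poset G S T I} {M : Set I} {h1 h2 h3 h4} {i : I} (hi : i ∈ M) :
    (kill x α M h1 h2 h3 h4).zero i = α.zero i := by simp [kill, hi]

theorem kill_zero_of_not_mem {x α : Poset G S T I} {M : Set I} {h1 h2 h3 h4} {i : I}
    (hi : i ∉ M) : (kill x α M h1 h2 h3 h4).zero i = x.zero i := by simp [kill, hi]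

theorem le_kill {x α : Poset G S T I} {M : Set I} {h1 h2 h3 h4} (hx : x ≤ α) :
    x ≤ kill x α M h1 h2 h3 h4 := by
  refine ⟨fun i s hs => ?_, fun i g j hr => ?_⟩
  · rw [kill_zero_of_not_mem, hs]
    intro hi
    rw [h3 i hi] at hs
    exact absurd hs (by simp)
  · by_cases hi : i ∈ M
    · have hj := (h2 _ _ _ hr).1 hi
      obtain ⟨s, hs⟩ := Option.ne_none_iff_exists'.1 (h1 j hj)
      refine Or.inr ⟨s, ?_, ?_⟩
      · rw [kill_zero_of_mem hj, hs]
      · rw [kill_zero_of_mem hi, zero_of_le hx hr hs]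
    · exact Or.inl ⟨hr, hi⟩

theorem kill_le {x y α : Poset G S T I} {M : Set I} {h1 h2 h3 h4} (hxy : x ≤ y) (hy : y ≤ α)
    (hM : ∀ i ∈ M, y.zero i ≠ none) : kill x α M h1 h2 h3 h4 ≤ y := by
  refine ⟨fun i s hs => ?_, fun i g j hr => hxy.2 _ _ _ hr.1⟩
  by_cases hi : i ∈ M
  · rw [kill_zero_of_mem hi] at hs
    rw [zero_eq_of_le hy (hM i hi), hs]
  · rw [kill_zero_of_not_mem hi] at hs
    exact hxy.1 _ _ hs

theorem numBlocks_le_kill [Finite I] {x α : Poset G S T I} {M : Set I} {h1 h2 h3 h4} (p : I)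
    (hp : ∀ i ∈ M, ∃ h, x.rel i h p) :
    x.numBlocks ≤ (kill x α M h1 h2 h3 h4).numBlocks + 1 := by
  refine numBlocks_le_succ p (fun i hi hn => ?_) fun i j g _ _ hr => ⟨g, hr.1⟩
  rw [kill_zero_of_not_mem fun h => hn (hp i h), hi]

section Merge

variable (i₀ : I) (g₀ : G) (j₀ : I)

/-- The condition that `y` lies above the element that merges `i₀` and `j₀` with the
ratio `g₀`. -/
def Merged (y : Poset G S T I) : Prop :=
  y.rel i₀ g₀ j₀ ∨ ∃ s, y.zero j₀ = some s ∧ y.zero i₀ = some (g₀ • s)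

/-- The blocks of `i₀` and `j₀` cannot be merged with the ratio `g₀`. -/
def Clash (x : Poset G S T I) : Prop :=
  x.zero i₀ ≠ none ∨ x.zero j₀ ≠ none ∨ ∃ g, g ≠ g₀ ∧ x.rel i₀ g j₀

/-- `b i = c * b i₀` if the blocks of `i₀` and `j₀` are merged with `b i₀ = g₀ * b j₀`. -/
def mergeColor (x : Poset G S T I) (i : I) (c : G) : Prop :=
  x.rel i c i₀ ∨ x.rel i (c * g₀) j₀

variable {i₀ g₀ j₀}

theorem mergeColor_zero {x : Poset G S T I} {i c} (h : x.mergeColor i₀ g₀ j₀ i c) :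
    x.zero i = none := h.elim x.zero_left x.zero_left

theorem mergeColor_unique {x : Poset G S T I} (hc : ¬ x.Clash i₀ g₀ j₀) {i c d}
    (h : x.mergeColor i₀ g₀ j₀ i c) (h' : x.mergeColor i₀ g₀ j₀ i d) : c = d := by
  have key : ∀ {c d}, x.rel i c i₀ → x.rel i (d * g₀) j₀ → c = d := by
    intro c d h h'
    by_contra hne
    refine hc (Or.inr (Or.inr ⟨_, ?_, x.rel_trans (x.rel_symm h) h'⟩))
    intro he
    rw [← mul_assoc, mul_eq_right, inv_mul_eq_one] at he
    exact hne he
  rcases h with h | h <;> rcases h' with h' | h'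
  · exact x.rel_eq h h'
  · exact key h h'
  · exact (key h' h).symm
  · exact mul_right_cancel (x.rel_eq h h')

theorem mergeColor_of_rel {x : Poset G S T I} {i g j c} (hr : x.rel i g j)
    (h : x.mergeColor i₀ g₀ j₀ j c) : x.mergeColor i₀ g₀ j₀ i (g * c) :=
  h.imp (x.rel_trans hr) fun h => by rw [mul_assoc]; exact x.rel_trans hr h

/-- Merge the blocks of `i₀` and `j₀` with the ratio `g₀`. -/
def merge (x : Poset G S T I) (hc : ¬ x.Clash i₀ g₀ j₀) : Poset G S T I where
  zero := x.zero
  rel i g j := x.rel i g j ∨ ∃ c d, x.mergeColor i₀ g₀ j₀ i c ∧ x.mergeColor i₀ g₀ j₀ j d ∧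
    c = g * d
  rel_refl i := by
    rw [x.rel_refl]
    exact ⟨fun h => h.elim id fun ⟨c, d, h, _⟩ => mergeColor_zero h, Or.inl⟩
  rel_symm := by
    rintro i g j (h | ⟨c, d, h, h', e⟩)
    · exact Or.inl (x.rel_symm h)
    · exact Or.inr ⟨d, c, h', h, by rw [e, inv_mul_cancel_left]⟩
  rel_trans := by
    rintro i g j h l (h1 | ⟨c, d, h1, h1', e⟩) (h2 | ⟨c', d', h2, h2', e'⟩)
    · exact Or.inl (x.rel_trans h1 h2)
    · exact Or.inr ⟨g * c', d', mergeColor_of_rel h1 h2, h2', by rw [e', mul_assoc]⟩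
    · exact Or.inr ⟨c, h⁻¹ * d, h1, mergeColor_of_rel (x.rel_symm h2) h1', by
        rw [e, mul_assoc, mul_inv_cancel_left]⟩
    · exact Or.inr ⟨c, d', h1, h2', by
        rw [e, mergeColor_unique hc h1' h2, e', mul_assoc]⟩
  rel_unique := by
    rintro i g (h | ⟨c, d, h, h', e⟩)
    · exact x.rel_unique h
    · rw [mergeColor_unique hc h h'] at e
      exact mul_eq_right.1 e.symm
  mem_of_unique := x.mem_of_unique

theorem le_merge {x : Poset G S T I} (hc : ¬ x.Clash i₀ g₀ j₀) : x ≤ x.merge hc :=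
  ⟨fun _ _ h => h, fun _ _ _ h => Or.inl (Or.inl h)⟩

theorem merged_merge {x : Poset G S T I} (hc : ¬ x.Clash i₀ g₀ j₀) :
    (x.merge hc).Merged i₀ g₀ j₀ := by
  have h1 : x.zero i₀ = none := by_contra fun h => hc (Or.inl h)
  have h2 : x.zero j₀ = none := by_contra fun h => hc (Or.inr (Or.inl h))
  exact Or.inl (Or.inr ⟨1, g₀⁻¹, Or.inl ((x.rel_refl _).2 h1),
    Or.inr (by rw [inv_mul_cancel]; exact (x.rel_refl _).2 h2), by rw [mul_inv_cancel]⟩)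

theorem Merged.mono {x y : Poset G S T I} (h : x.Merged i₀ g₀ j₀) (hxy : x ≤ y) :
    y.Merged i₀ g₀ j₀ := by
  rcases h with h | ⟨s, h, h'⟩
  · exact hxy.2 _ _ _ h
  · exact Or.inr ⟨s, hxy.1 _ _ h, hxy.1 _ _ h'⟩

theorem merge_le {x y : Poset G S T I} (hc : ¬ x.Clash i₀ g₀ j₀) (hxy : x ≤ y)
    (hy : y.Merged i₀ g₀ j₀) : x.merge hc ≤ y := by
  refine ⟨hxy.1, ?_⟩
  rintro i g j (h | ⟨c, d, h1, h2, rfl⟩)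
  · exact hxy.2 _ _ _ h
  rcases hy with hy | ⟨s, hs, hs'⟩
  · have key : ∀ {i c}, x.mergeColor i₀ g₀ j₀ i c → y.rel i c i₀ := by
      rintro i c (h | h)
      · exact rel_of_le hxy h (y.zero_left hy)
      · have := y.rel_trans (rel_of_le hxy h (y.zero_right hy)) (y.rel_symm hy)
        rwa [mul_inv_cancel_right] at this
    have := y.rel_trans (key h1) (y.rel_symm (key h2))
    rw [mul_inv_cancel_right] at this
    exact Or.inl this
  · have key : ∀ {i c}, x.mergeColor i₀ g₀ j₀ i c → y.zero i = some (c • g₀ • s) := by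
      rintro i c (h | h)
      · exact zero_of_le hxy h hs'
      · rw [zero_of_le hxy h hs, mul_smul]
    exact Or.inr ⟨_, key h2, by rw [key h1, mul_smul]⟩

theorem numBlocks_le_merge [Finite I] {x : Poset G S T I} (hc : ¬ x.Clash i₀ g₀ j₀) :
    x.numBlocks ≤ (x.merge hc).numBlocks + 1 := by
  refine numBlocks_le_succ i₀ (fun i hi _ => hi) ?_
  rintro i j g hi hj (h | ⟨c, d, h1, h2, -⟩)
  · exact ⟨g, h⟩
  · rcases h1 with h1 | h1
    · exact absurd ⟨c, h1⟩ hi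
    rcases h2 with h2 | h2
    · exact absurd ⟨d, h2⟩ hj
    exact ⟨_, x.rel_trans h1 (x.rel_symm h2)⟩

/-- The union of the blocks of `i₀` and `j₀`. -/
def mergeSet (i₀ j₀ : I) (x : Poset G S T I) : Set I :=
  {i | (∃ h, x.rel i h i₀) ∨ ∃ h, x.rel i h j₀}

theorem Clash.zero {x y : Poset G S T I} (hc : x.Clash i₀ g₀ j₀) (hxy : x ≤ y)
    (hy : y.Merged i₀ g₀ j₀) : ∃ s, y.zero j₀ = some s ∧ y.zero i₀ = some (g₀ • s) := by
  rcases hy with hy | hy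
  · exfalso
    rcases hc with h | h | ⟨g, hg, h⟩
    · exact h (zero_none_of_le hxy (y.zero_left hy))
    · exact h (zero_none_of_le hxy (y.zero_right hy))
    · exact hg (y.rel_eq (rel_of_le hxy h (y.zero_right hy)) hy)
  · exact hy

theorem Clash.zero_mergeSet {x y : Poset G S T I} (hc : x.Clash i₀ g₀ j₀) (hxy : x ≤ y)
    (hy : y.Merged i₀ g₀ j₀) : ∀ i ∈ x.mergeSet i₀ j₀, y.zero i ≠ none := by
  obtain ⟨s, hs, hs'⟩ := hc.zero hxy hy
  rintro i (⟨h, hi⟩ | ⟨h, hi⟩)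
  · rw [zero_of_le hxy hi hs']; simp
  · rw [zero_of_le hxy hi hs]; simp

theorem Clash.exists_rel {x : Poset G S T I} (hc : x.Clash i₀ g₀ j₀) :
    ∃ p, ∀ i ∈ x.mergeSet i₀ j₀, ∃ h, x.rel i h p := by
  rcases hc with h | h | ⟨g, hg, h⟩
  · exact ⟨j₀, fun i hi => hi.resolve_left fun ⟨a, ha⟩ => h (x.zero_right ha)⟩
  · exact ⟨i₀, fun i hi => hi.resolve_right fun ⟨a, ha⟩ => h (x.zero_right ha)⟩
  · exact ⟨j₀, fun i hi => hi.elim (fun ⟨a, ha⟩ => ⟨_, x.rel_trans ha h⟩) id⟩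

theorem mem_mergeSet_left {x : Poset G S T I} (h : x.zero i₀ = none) : i₀ ∈ x.mergeSet i₀ j₀ :=
  Or.inl ⟨1, (x.rel_refl _).2 h⟩

theorem mem_mergeSet_right {x : Poset G S T I} (h : x.zero j₀ = none) : j₀ ∈ x.mergeSet i₀ j₀ :=
  Or.inr ⟨1, (x.rel_refl _).2 h⟩

/-- Move the blocks of `i₀` and `j₀` into the zero block. -/
def killMerge {x α : Poset G S T I} (hne : i₀ ≠ j₀) (hx : x ≤ α) (hα : α.Merged i₀ g₀ j₀)
    (hc : x.Clash i₀ g₀ j₀) : Poset G S T I :=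
  kill x α (x.mergeSet i₀ j₀) (hc.zero_mergeSet hx hα)
    (fun i g j h => or_congr
      ⟨fun ⟨a, ha⟩ => ⟨_, x.rel_trans (x.rel_symm h) ha⟩, fun ⟨a, ha⟩ => ⟨_, x.rel_trans h ha⟩⟩
      ⟨fun ⟨a, ha⟩ => ⟨_, x.rel_trans (x.rel_symm h) ha⟩, fun ⟨a, ha⟩ => ⟨_, x.rel_trans h ha⟩⟩)
    (fun i h => h.elim (fun ⟨a, ha⟩ => x.zero_left ha) fun ⟨a, ha⟩ => x.zero_left ha)
    (by
      -- `i₀` and `j₀` are two different points of the new zero block in the orbit of `s`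
      rintro s i hi ⟨g, hg⟩ h1 h2
      exfalso
      obtain ⟨t, ht, ht'⟩ := hc.zero hx hα
      obtain ⟨a, ha⟩ : ∃ a : G, t = a • s := by
        rcases hi with ⟨h, hi⟩ | ⟨h, hi⟩
        · refine ⟨g₀⁻¹ * h⁻¹ * g, ?_⟩
          rw [zero_of_le hx hi ht', Option.some.injEq] at hg
          rw [mul_smul, ← hg, mul_smul, inv_smul_smul, inv_smul_smul]
        · refine ⟨h⁻¹ * g, ?_⟩
          rw [zero_of_le hx hi ht, Option.some.injEq] at hg
          rw [mul_smul, ← hg, inv_smul_smul]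
      have hj : j₀ = i := by
        by_cases hz : x.zero j₀ = none
        · exact h1 j₀ (mem_mergeSet_right hz) ⟨a, by rw [ht, ha]⟩
        · refine absurd ?_ (h2 j₀ (fun hm => ?_) a)
          · rw [zero_eq_of_le hx hz, ht, ha]
          · exact hz (hm.elim (fun ⟨a, ha⟩ => x.zero_left ha) fun ⟨a, ha⟩ => x.zero_left ha)
      have hi : i₀ = i := by
        by_cases hz : x.zero i₀ = none
        · exact h1 i₀ (mem_mergeSet_left hz) ⟨g₀ * a, by rw [ht', ha, mul_smul]⟩
        · refine absurd ?_ (h2 i₀ (fun hm => ?_) (g₀ * a))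
          · rw [zero_eq_of_le hx hz, ht', ha, mul_smul]
          · exact hz (hm.elim (fun ⟨a, ha⟩ => x.zero_left ha) fun ⟨a, ha⟩ => x.zero_left ha)
      exact hne (hi.trans hj.symm))

theorem merged_killMerge {x α : Poset G S T I} (hne : i₀ ≠ j₀) (hx : x ≤ α)
    (hα : α.Merged i₀ g₀ j₀) (hc : x.Clash i₀ g₀ j₀) :
    (killMerge hne hx hα hc).Merged i₀ g₀ j₀ := by
  obtain ⟨t, ht, ht'⟩ := hc.zero hx hα
  have key : ∀ i, (x.zero i = none → i ∈ x.mergeSet i₀ j₀) →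
      (killMerge hne hx hα hc).zero i = α.zero i := by
    intro i hi
    by_cases hm : i ∈ x.mergeSet i₀ j₀
    · exact kill_zero_of_mem hm
    · exact (kill_zero_of_not_mem hm).trans (zero_eq_of_le hx fun h => hm (hi h))
  exact Or.inr ⟨t, by rw [key _ mem_mergeSet_right, ht], by rw [key _ mem_mergeSet_left, ht']⟩

/-- Suppose that `α` merges two points `i₀` and `j₀`. The join of `x ≤ α` with the element that
only merges these points merges their blocks, or it moves both of them into the zero block if
their colours clash. Either way at most one block is lost. -/
theorem exists_isJoin_merge [Finite I] {α : Poset G S T I} (hne : i₀ ≠ j₀)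
    (hα : α.Merged i₀ g₀ j₀) : ∃ (e : Poset G S T I) (j : Poset G S T I → Poset G S T I),
    ¬ e ≤ ⊥ ∧ IsJoin e α j ∧ ∀ x ≤ α, x.numBlocks ≤ (j x).numBlocks + 1 := by
  classical
  have hbot : ¬ (⊥ : Poset G S T I).Clash i₀ g₀ j₀ := by
    rintro (h | h | ⟨g, -, h, -⟩)
    · exact h rfl
    · exact h rfl
    · exact hne h
  have he : ∀ {y : Poset G S T I}, merge ⊥ hbot ≤ y ↔ y.Merged i₀ g₀ j₀ :=
    ⟨fun h => (merged_merge hbot).mono h, fun h => merge_le hbot bot_le h⟩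
  let j : Poset G S T I → Poset G S T I := fun x =>
    if h : x.Clash i₀ g₀ j₀ then
      if hx : x ≤ α then killMerge hne hx hα h else x
    else x.merge h
  have hj1 : ∀ {x} (h : x.Clash i₀ g₀ j₀) (hx : x ≤ α), j x = killMerge hne hx hα h :=
    fun h hx => by simp only [j, dif_pos h, dif_pos hx]
  have hj2 : ∀ {x} (h : ¬ x.Clash i₀ g₀ j₀), j x = x.merge h :=
    fun h => by simp only [j, dif_neg h]
  -- where `x` clashes, every `y` above it that merges the two points has them in its zero block
  have hmin : ∀ x y, x ≤ y → y ≤ α → merge ⊥ hbot ≤ y → j x ≤ y := by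
    intro x y hxy hy hey
    by_cases h : x.Clash i₀ g₀ j₀
    · rw [hj1 h (hxy.trans hy)]
      exact kill_le hxy hy (h.zero_mergeSet hxy (he.1 hey))
    · rw [hj2 h]
      exact merge_le h hxy (he.1 hey)
  refine ⟨merge ⊥ hbot, j, ?_, ⟨?_, ?_, fun x hx => hmin x α hx le_rfl (he.2 hα), hmin⟩, ?_⟩
  · rw [he]
    rintro (h | ⟨s, h, -⟩)
    · exact hne h.1
    · exact absurd h (by rw [bot_zero]; simp)
  · intro x hx
    by_cases h : x.Clash i₀ g₀ j₀
    · rw [hj1 h hx]; exact le_kill hx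
    · rw [hj2 h]; exact le_merge h
  · intro x hx
    rw [he]
    by_cases h : x.Clash i₀ g₀ j₀
    · rw [hj1 h hx]; exact merged_killMerge hne hx hα h
    · rw [hj2 h]; exact merged_merge h
  · intro x hx
    by_cases h : x.Clash i₀ g₀ j₀
    · rw [hj1 h hx]
      obtain ⟨p, hp⟩ := h.exists_rel
      exact numBlocks_le_kill p hp
    · rw [hj2 h]; exact numBlocks_le_merge h

end Merge

/-- If no two points can be merged below `α`, then the zero block can be enlarged by any single
point. -/
theorem exists_isJoin_zero [Finite I] {α : Poset G S T I}
    (hα : ∀ i g j, α.Merged i g j → i = j) {i₀ : I} (hi₀ : α.zero i₀ ≠ none) :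
    ∃ (e : Poset G S T I) (j : Poset G S T I → Poset G S T I),
    ¬ e ≤ ⊥ ∧ IsJoin e α j ∧ ∀ x ≤ α, x.numBlocks ≤ (j x).numBlocks + 1 := by
  classical
  have hrel : ∀ x ≤ α, ∀ i g j, x.rel i g j → i = j := fun x hx i g j h =>
    hα i g j (hx.2 _ _ _ h)
  -- two points of the zero block with colours in one orbit could be merged, so every colour of `α`
  -- is the only one of its orbit
  have hT : ∀ s i, (∃ g : G, α.zero i = some (g • s)) → s ∈ T := by
    rintro s i ⟨g, hg⟩
    refine α.mem_of_unique s ⟨i, ⟨g, hg⟩, fun j ⟨h, hj⟩ => hα j (h * g⁻¹) i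
      (Or.inr ⟨_, hg, ?_⟩)⟩
    rw [hj, mul_smul, inv_smul_smul]
  let κ : ∀ x ≤ α, x.zero i₀ = none → Poset G S T I := fun x hx h =>
    kill x α {i₀} (by rintro _ rfl; exact hi₀) (fun i g j hr => by rw [hrel x hx i g j hr])
      (by rintro _ rfl; exact h) fun s i _ h _ _ => hT s i h
  have he : ∀ {y}, y ≤ α → (κ ⊥ bot_le rfl ≤ y ↔ y.zero i₀ ≠ none) := by
    intro y hy
    refine ⟨fun h hn => ?_, fun h => kill_le bot_le hy (by rintro _ rfl; exact h)⟩
    have := zero_none_of_le h hn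
    rw [show (κ ⊥ bot_le rfl).zero i₀ = α.zero i₀ from kill_zero_of_mem rfl] at this
    exact hi₀ this
  let j : Poset G S T I → Poset G S T I := fun x =>
    if h : x ≤ α ∧ x.zero i₀ = none then κ x h.1 h.2 else x
  have hj1 : ∀ {x} (hx : x ≤ α) (h : x.zero i₀ = none), j x = κ x hx h := fun hx h =>
    dif_pos ⟨hx, h⟩
  have hj2 : ∀ {x}, ¬ x.zero i₀ = none → j x = x := fun h => dif_neg fun h' => h h'.2
  have hmin : ∀ x y, x ≤ y → y ≤ α → κ ⊥ bot_le rfl ≤ y → j x ≤ y := by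
    intro x y hxy hy hey
    by_cases h : x.zero i₀ = none
    · rw [hj1 (hxy.trans hy) h]
      exact kill_le hxy hy (by rintro _ rfl; exact (he hy).1 hey)
    · rwa [hj2 h]
  have hle : ∀ x ≤ α, j x ≤ α := fun x hx => hmin x α hx le_rfl ((he le_rfl).2 hi₀)
  refine ⟨κ ⊥ bot_le rfl, j, ?_, ⟨?_, fun x hx => ?_, hle, hmin⟩, ?_⟩
  · rw [he bot_le]
    exact fun h => h rfl
  · intro x hx
    by_cases h : x.zero i₀ = none
    · rw [hj1 hx h]; exact le_kill hx
    · rw [hj2 h]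
  · rw [he (hle x hx)]
    by_cases h : x.zero i₀ = none
    · rw [hj1 hx h, show (κ x hx h).zero i₀ = α.zero i₀ from kill_zero_of_mem rfl]
      exact hi₀
    · rwa [hj2 h]
  · intro x hx
    by_cases h : x.zero i₀ = none
    · rw [hj1 hx h]
      exact numBlocks_le_kill i₀ (by rintro _ rfl; exact ⟨1, (x.rel_refl _).2 h⟩)
    · rw [hj2 h]; omega

/-- Below every `α ≠ ⊥` there is a join with some `e`, and it loses at most one block, so that the
proper elements `x` with `x ∨ e = α` are coatoms. -/
theorem exists_isJoin [Finite I] {α : Poset G S T I} (hα : α ≠ ⊥) :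
    ∃ (e : Poset G S T I) (j : Poset G S T I → Poset G S T I),
    ¬ e ≤ ⊥ ∧ IsJoin e α j ∧ ∀ x ≤ α, x.numBlocks ≤ (j x).numBlocks + 1 := by
  by_cases h : ∀ i g j, α.Merged i g j → i = j
  · obtain ⟨i₀, hi₀⟩ : ∃ i, α.zero i ≠ none := by
      by_contra hn
      push Not at hn
      refine hα (le_antisymm (le_def.2 ⟨fun i s hs => ?_, fun i g j hr => Or.inl ?_⟩) bot_le)
      · rw [hn i] at hs; exact absurd hs (by simp)
      · obtain rfl := h i g j (Or.inl hr)
        exact ⟨rfl, α.rel_unique hr⟩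
    exact exists_isJoin_zero h hi₀
  · push Not at h
    obtain ⟨i, g, j, h, hne⟩ := h
    exact exists_isJoin_merge hne h

/-- Lower intervals of Dowling posets have homology only in the degree of the rank. -/
theorem exactAt_bot (k : Type u) [CommRing k] [Finite I] (α : Poset G S T I) (r : ℕ)
    (hr : r ≠ α.rank) : ExactAt k ⊥ α r := by
  induction hn : α.rank using Nat.strong_induction_on generalizing α r with
  | _ n ih =>
  by_cases hα : α = ⊥
  · subst hα
    intro z hz _
    refine ⟨0, Submodule.zero_mem _, ?_⟩
    have : paths k (⊥ : Poset G S T I) ⊥ r ≤ ⊥ := by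
      refine paths_induction k fun l hl => ?_
      exfalso
      rw [rank_bot] at hr
      obtain ⟨r, rfl⟩ := Nat.exists_eq_succ_of_ne_zero hr
      obtain ⟨q, y, -, hy, -⟩ := hl.exists_append
      exact not_lt_bot hy
    rw [map_zero, (Submodule.mem_bot k).1 (this hz)]
  rcases r with _ | r
  · exact exactAt_zero_of_ne k (Ne.symm hα)
  obtain ⟨e, j, he, hj, hnum⟩ := exists_isJoin hα
  have hrk : ∀ x < α, j x = α → x.rank + 1 = α.rank := by
    intro x hx hjx
    have h1 := hnum x hx.le
    rw [hjx] at h1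
    have h2 := numBlocks_lt hx
    have h3 := x.rank_add_numBlocks
    have h4 := α.rank_add_numBlocks
    omega
  refine exactAt_of_isJoin k hj he (fun x hx hjx y hxy hy => ?_) fun x hx hjx => ?_
  · by_contra hne
    have h1 := rank_strictMono hxy
    have h2 := rank_strictMono (hy.lt_of_ne hne)
    have h3 := hrk x hx hjx
    omega
  · have h3 := hrk x hx hjx
    exact ih x.rank (by omega) x r (by omega) rfl

/-- `exactAt_bot` for the lower interval as a bounded poset. -/
theorem concentrated_iic (k : Type u) [CommRing k] [Finite I] (α : Poset G S T I) :
    Concentrated k (Set.Iic α) α.rank :=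
  Concentrated.of_exactAt k isBot_bot fun r hr => exactAt_bot k α r hr

end Poset

/-! ### The Künneth theorem in the top degree -/

section Kunneth

/-- A rank function on a poset: strictly monotone, from `0` to `n`. -/
structure IsRanked (P : Type*) [PartialOrder P] (ρ : P → ℕ) (n : ℕ) : Prop where
  strictMono : StrictMono ρ
  bot : ∀ x, IsBot x → ρ x = 0
  top : ∀ x, IsTop x → ρ x = n

variable {P Q : Type*} [PartialOrder P] [PartialOrder Q] {ρ : P → ℕ} {σ : Q → ℕ} {n r s : ℕ}

theorem IsRanked.prod (h : IsRanked P ρ r) (h' : IsRanked Q σ s) :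
    IsRanked (P × Q) (fun x => ρ x.1 + σ x.2) (r + s) := by
  refine ⟨?_, ?_, ?_⟩
  · rintro ⟨a, b⟩ ⟨c, d⟩ hlt
    rcases Prod.mk_lt_mk.1 hlt with ⟨h1, h2⟩ | ⟨h1, h2⟩
    · exact add_lt_add_of_lt_of_le (h.strictMono h1) (h'.strictMono.monotone h2)
    · exact add_lt_add_of_le_of_lt (h.strictMono.monotone h1) (h'.strictMono h2)
  · rintro ⟨a, b⟩ hab
    have := isBot_prod_iff.1 hab
    change ρ a + σ b = 0
    rw [h.bot a this.1, h'.bot b this.2]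
  · rintro ⟨a, b⟩ hab
    have := isTop_prod_iff.1 hab
    change ρ a + σ b = r + s
    rw [h.top a this.1, h'.top b this.2]

theorem IsRanked.sorted (h : IsRanked P ρ n) {r : ℕ} {l : List P} (hl : IsFull r l) :
    (l.map ρ).Pairwise (· < ·) ∧ ∀ i ∈ l.map ρ, i < n + 1 := by
  obtain ⟨x, y, hx, hy, hp⟩ := hl.exists_isPath
  refine ⟨?_, ?_⟩
  · rw [List.pairwise_map]
    exact (List.isChain_iff_pairwise.1 hl.2.1).imp fun hab => h.strictMono hab
  · intro i hi
    obtain ⟨z, hz, rfl⟩ := List.mem_map.1 hi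
    have := h.strictMono.monotone (hp.le_last z hz)
    rw [h.top y hy] at this
    omega

theorem IsRanked.subperm (h : IsRanked P ρ n) {r : ℕ} {l : List P} (hl : IsFull r l) :
    (l.map ρ).Subperm (List.range (n + 1)) := by
  refine List.subperm_of_subset ?_ ?_
  · exact (h.sorted hl).1.imp fun hab => hab.ne
  · intro i hi
    exact List.mem_range.2 ((h.sorted hl).2 i hi)

theorem IsRanked.le (h : IsRanked P ρ n) {r : ℕ} {l : List P} (hl : IsFull r l) : r ≤ n := by
  have := (h.subperm hl).length_le
  simp [hl.1] at this
  omega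

theorem IsRanked.map_eq (h : IsRanked P ρ n) {l : List P} (hl : IsFull n l) :
    l.map ρ = List.range (n + 1) := by
  have hp : (l.map ρ).Perm (List.range (n + 1)) :=
    (h.subperm hl).perm_of_length_le (by simp [hl.1])
  exact hp.eq_of_pairwise (fun a b _ _ h1 h2 => absurd h1 h2.le.not_gt) (h.sorted hl).1
    List.pairwise_lt_range

variable (k : Type u) [CommRing k]

theorem IsRanked.boundaries_eq_bot (h : IsRanked P ρ n) : boundaries k P n = ⊥ := by
  have : chains k P (n + 1) ≤ ⊥ := chains_induction k fun l hl => by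
    have := h.le hl
    omega
  rw [boundaries, le_bot_iff.1 this, Submodule.map_bot]

open Classical in
/-- The sum of the coefficients of the lists that arise from `L ++ R` by inserting
an element between `L` and `R`. -/
def insertSum (L R : List P) : (List P →₀ k) →ₗ[k] k :=
  Finsupp.linearCombination k fun l => if ∃ m, l = L ++ m :: R then 1 else 0

omit [PartialOrder P] in
open Classical in
theorem insertSum_single (L R l : List P) :
    insertSum k L R (Finsupp.single l 1) = if ∃ m, l = L ++ m :: R then 1 else 0 := by
  simp [insertSum]

theorem nodup_eraseIdx_inj {α : Type*} {l : List α} (h : l.Nodup) {i j : ℕ} (hi : i < l.length)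
    (e : l.eraseIdx i = l.eraseIdx j) : i = j := by
  by_contra hne
  have h1 : l[i] ∈ l.eraseIdx j := List.mem_eraseIdx_iff_getElem.2 ⟨i, hi, hne, rfl⟩
  rw [← e] at h1
  obtain ⟨a, ha, hne', e'⟩ := List.mem_eraseIdx_iff_getElem.1 h1
  exact hne' ((List.Nodup.getElem_inj_iff h).1 e')

theorem eraseIdx_length_eq_append {α : Type*} {L R l : List α} (h : L.length < l.length) :
    l.eraseIdx L.length = L ++ R ↔ ∃ m, l = L ++ m :: R := by
  constructor
  · intro e
    rw [List.eraseIdx_eq_take_drop_succ] at e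
    obtain ⟨h1, h2⟩ := List.append_inj e (by simp; omega)
    refine ⟨l[L.length], ?_⟩
    conv_lhs => rw [← List.take_append_drop L.length l, List.drop_eq_getElem_cons h]
    rw [h1, h2]
  · rintro ⟨m, rfl⟩
    rw [List.eraseIdx_append_of_length_le le_rfl]
    simp

/-- In the top degree the faces of a chain can be told apart by the ranks of their
elements. -/
theorem IsRanked.bdry_append (h : IsRanked P ρ n) {L R l₀ : List P} (hL : L ≠ []) (hR : R ≠ [])
    (h₀ : IsFull n l₀) (h₀' : ∃ m, l₀ = L ++ m :: R) {z : List P →₀ k} (hz : z ∈ chains k P n) :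
    bdry k z (L ++ R) = (-1 : k) ^ L.length * insertSum k L R z := by
  classical
  have : chains k P n ≤ LinearMap.eqLocus (Finsupp.lapply (L ++ R) ∘ₗ bdry k)
      ((-1 : k) ^ L.length • insertSum k L R) := by
    refine chains_induction k fun l hl => ?_
    have hlen : l.length = l₀.length := by rw [hl.1, h₀.1]
    have hLl : L.length < l.length := by
      obtain ⟨m, rfl⟩ := h₀'
      rw [hlen]; simp
    have hmem : L.length ∈ Finset.Ico 1 (l.length - 1) := by
      obtain ⟨m, rfl⟩ := h₀'
      have := List.length_pos_iff.2 hL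
      have := List.length_pos_iff.2 hR
      rw [hlen, Finset.mem_Ico]; simp; omega
    have key : ∀ i ∈ Finset.Ico 1 (l.length - 1), l.eraseIdx i = L ++ R → i = L.length := by
      intro i hi e
      have e' : l₀.eraseIdx L.length = L ++ R :=
        (eraseIdx_length_eq_append (by omega)).2 h₀'
      have := congrArg (List.map ρ) (e.trans e'.symm)
      rw [← List.eraseIdx_map, ← List.eraseIdx_map, h.map_eq hl, h.map_eq h₀] at this
      rw [Finset.mem_Ico] at hi
      refine nodup_eraseIdx_inj List.nodup_range ?_ this
      · rw [List.length_range, ← hl.1]; omega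
    rw [LinearMap.mem_eqLocus, LinearMap.comp_apply, LinearMap.smul_apply, insertSum_single,
      bdry_single, map_sum, Finset.sum_eq_single_of_mem _ hmem]
    · rw [← eraseIdx_length_eq_append hLl, map_smul, Finsupp.lapply_apply, Finsupp.single_apply]
      congr!
    · intro i hi hne
      rw [map_smul, Finsupp.lapply_apply, Finsupp.single_apply,
        if_neg fun e => hne (key i hi e), smul_zero]
  exact this hz

theorem insertSum_eq_zero {L R : List P} {r : ℕ} (h : ¬ ∃ m, IsFull r (L ++ m :: R))
    {z : List P →₀ k} (hz : z ∈ chains k P r) : insertSum k L R z = 0 := by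
  classical
  have : chains k P r ≤ LinearMap.ker (insertSum k L R) := chains_induction k fun l hl => by
    rw [LinearMap.mem_ker, insertSum_single, if_neg]
    rintro ⟨m, rfl⟩
    exact h ⟨m, hl⟩
  exact this hz

/-- In the top degree the boundary is zero if and only if, for each way to remove an interior
element, the coefficients of the chains with the same remainder add up to zero. -/
theorem IsRanked.mem_cycles_iff (h : IsRanked P ρ n) {z : List P →₀ k} : z ∈ cycles k P n ↔
    z ∈ chains k P n ∧ ∀ L R, L ≠ [] → R ≠ [] → insertSum k L R z = 0 := by
  classical
  constructor
  · rintro ⟨hz, h0⟩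
    refine ⟨hz, fun L R hL hR => ?_⟩
    by_cases he : ∃ m, IsFull n (L ++ m :: R)
    · obtain ⟨m, hm⟩ := he
      have := h.bdry_append k hL hR hm ⟨m, rfl⟩ hz
      rw [show bdry k z = 0 from h0, Finsupp.zero_apply] at this
      have e : (-1 : k) ^ L.length * ((-1 : k) ^ L.length * insertSum k L R z) = 0 := by
        rw [← this, mul_zero]
      rwa [← mul_assoc, ← mul_pow, neg_one_mul, neg_neg, one_pow, one_mul] at e
    · exact insertSum_eq_zero k he hz
  · rintro ⟨hz, h0⟩
    refine ⟨hz, ?_⟩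
    change bdry k z = 0
    ext w
    rw [Finsupp.zero_apply]
    by_cases he : ∃ L R m, w = L ++ R ∧ L ≠ [] ∧ R ≠ [] ∧ IsFull n (L ++ m :: R)
    · obtain ⟨L, R, m, rfl, hL, hR, hm⟩ := he
      rw [h.bdry_append k hL hR hm ⟨m, rfl⟩ hz, h0 L R hL hR, mul_zero]
    · have : chains k P n ≤ LinearMap.ker (Finsupp.lapply w ∘ₗ bdry k) := by
        refine chains_induction k fun l hl => ?_
        rw [LinearMap.mem_ker, LinearMap.comp_apply, bdry_single, map_sum]
        refine Finset.sum_eq_zero fun i hi => ?_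
        rw [map_smul, Finsupp.lapply_apply, Finsupp.single_apply, if_neg, smul_zero]
        rintro rfl
        rw [Finset.mem_Ico] at hi
        have hi' : i < l.length := by omega
        refine he ⟨l.take i, l.drop (i + 1), l[i], List.eraseIdx_eq_take_drop_succ .., ?_, ?_, ?_⟩
        · exact List.ne_nil_of_length_pos (by simp; omega)
        · exact List.ne_nil_of_length_pos (by simp; omega)
        · rw [← List.drop_eq_getElem_cons hi', List.take_append_drop]; exact hl
      exact this hz

/-! #### Slices of cycles -/

/-- The coefficients of the lists `A ++ f c ++ B`. -/
def slice {D : Type*} {f : P → D} (hf : Function.Injective f) (A B : List D) :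
    (List D →₀ k) →ₗ[k] (List P →₀ k) :=
  Finsupp.lcomapDomain (fun c : List P => A ++ c.map f ++ B) fun c c' e => by
    exact List.map_injective_iff.2 hf (List.append_cancel_left (List.append_cancel_right e))

omit [PartialOrder P] in
theorem slice_apply {D : Type*} {f : P → D} (hf : Function.Injective f) (A B : List D)
    (z : List D →₀ k) (c : List P) : slice k hf A B z c = z (A ++ c.map f ++ B) := rfl

/-- If `f` embeds `P` with convex image, then a slice of a cycle of top degree is a cycle: a
condition of `IsRanked.mem_cycles_iff` for the slice is one of the conditions for the given cycle.
-/
theorem slice_mem_cycles {D : Type*} [PartialOrder D] {τ : D → ℕ} (hD : IsRanked D τ n)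
    (hP : IsRanked P ρ r) {f : P → D} (hf : Function.Injective f)
    (hconv : ∀ a m b, f a < m → m < f b → ∃ p, f p = m) {A B : List D}
    (hfull : ∀ c : List P, IsFull n (A ++ c.map f ++ B) → IsFull r c) {z : List D →₀ k}
    (hz : z ∈ cycles k D n) : slice k hf A B z ∈ cycles k P r := by
  classical
  rw [hD.mem_cycles_iff k] at hz
  rw [hP.mem_cycles_iff k]
  refine ⟨?_, fun L R hL hR => ?_⟩
  · rw [chains, Finsupp.mem_supported]
    intro c hc
    refine hfull c ((Finsupp.mem_supported k z).1 hz.1 ?_)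
    simpa [slice_apply] using hc
  · rw [← hz.2 (A ++ L.map f) (R.map f ++ B) (by simp [hL]) (by simp [hR])]
    have : chains k D n ≤ LinearMap.eqLocus (insertSum k L R ∘ₗ slice k hf A B)
        (insertSum k (A ++ L.map f) (R.map f ++ B)) := by
      refine chains_induction k fun l hl => ?_
      rw [LinearMap.mem_eqLocus, LinearMap.comp_apply, insertSum_single]
      by_cases hc : ∃ c : List P, A ++ c.map f ++ B = l
      · obtain ⟨c, rfl⟩ := hc
        have e : slice k hf A B (Finsupp.single (A ++ c.map f ++ B) 1) = Finsupp.single c 1 := by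
          ext c'
          rw [slice_apply, Finsupp.single_apply, Finsupp.single_apply]
          refine if_congr ?_ rfl rfl
          exact ⟨fun e => List.map_injective_iff.2 hf
            (List.append_cancel_left (List.append_cancel_right e)), fun e => e ▸ rfl⟩
        rw [e, insertSum_single]
        refine if_congr ⟨?_, ?_⟩ rfl rfl
        · rintro ⟨m, rfl⟩; exact ⟨f m, by simp⟩
        · rintro ⟨m, e⟩
          have e2 : c.map f = L.map f ++ m :: R.map f := by
            refine List.append_cancel_left (as := A) (List.append_cancel_right (bs := B) ?_)
            simpa using e
          have hm : m ∈ c.map f := by rw [e2]; simp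
          obtain ⟨p, -, rfl⟩ := List.mem_map.1 hm
          exact ⟨p, List.map_injective_iff.2 hf (by simpa using e2)⟩
      · have e : slice k hf A B (Finsupp.single l 1) = 0 := by
          ext c'
          rw [slice_apply, Finsupp.single_apply, if_neg fun e => hc ⟨c', e.symm⟩]; rfl
        rw [e, map_zero, if_neg]
        rintro ⟨m, rfl⟩
        have hch := List.isChain_iff_pairwise.1 hl.2.1
        obtain ⟨L', a, rfl⟩ := (List.eq_nil_or_concat L).resolve_left hL
        obtain ⟨b, R', rfl⟩ := List.exists_cons_of_ne_nil hR
        rw [List.pairwise_append] at hch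
        have h1 : f a < m := hch.2.2 (f a) (by simp) m (by simp)
        have h2 : m < f b := (List.pairwise_cons.1 hch.2.1).1 (f b) (by simp)
        obtain ⟨p, rfl⟩ := hconv a m b h1 h2
        exact hc ⟨L' ++ [a] ++ p :: b :: R', by simp⟩
    exact this hz.1

/-! #### Cycles on a product are determined by the chains that first go through `P` -/

/-- The chain of `P × Q` that goes through `c` first and through `d` afterwards. -/
def firstThen (x₁ : P) (y₀ : Q) (c : List P) (d : List Q) : List (P × Q) :=
  c.dropLast.map (·, y₀) ++ (x₁, y₀) :: d.tail.map (x₁, ·)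

omit [PartialOrder P] [PartialOrder Q] in
theorem firstThen_left {x₁ : P} {y₀ : Q} {c : List P} {d : List Q} (h : c.getLast? = some x₁) :
    firstThen x₁ y₀ c d = c.map (·, y₀) ++ d.tail.map (x₁, ·) := by
  obtain ⟨c, rfl⟩ := List.getLast?_eq_some_iff.1 h
  simp [firstThen]

omit [PartialOrder P] [PartialOrder Q] in
theorem firstThen_right {x₁ : P} {y₀ : Q} {c : List P} {d : List Q} (h : d.head? = some y₀) :
    firstThen x₁ y₀ c d = c.dropLast.map (·, y₀) ++ d.map (x₁, ·) := by
  obtain ⟨d, rfl⟩ := List.head?_eq_some_iff.1 h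
  simp [firstThen]

omit [PartialOrder P] [PartialOrder Q] in
/-- A list whose steps change one coordinate at a time either contains a step in `Q` followed by
one in `P`, or takes all its steps in `P` before those in `Q`. -/
theorem exists_corner (x : P) (y : Q) (l : List (P × Q))
    (h : ((x, y) :: l).IsChain fun a b => a.1 = b.1 ∨ a.2 = b.2) :
    (∃ L p q q' p' R, (x, y) :: l = L ++ (p, q) :: (p, q') :: (p', q') :: R) ∨
      ∃ (c : List P) (x' : P) (d : List Q),
        (x, y) :: l = c.map (·, y) ++ (x', y) :: d.map (x', ·) := by
  induction l generalizing x y with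
  | nil => exact Or.inr ⟨[], x, [], rfl⟩
  | cons b l ih =>
    obtain ⟨x₂, y₂⟩ := b
    rw [List.isChain_cons_cons] at h
    rcases ih x₂ y₂ h.2 with ⟨L, p, q, q', p', R, e⟩ | ⟨c, x', d, e⟩
    · exact Or.inl ⟨(x, y) :: L, p, q, q', p', R, by rw [e]; rfl⟩
    · rcases h.1 with h1 | h1
      · obtain rfl : x = x₂ := h1
        rcases c with _ | ⟨c₁, c⟩
        · obtain ⟨h2, h3⟩ : x = x' ∧ l = d.map (x', ·) := by simpa using e
          exact Or.inr ⟨[], x', y₂ :: d, by rw [h2, h3]; rfl⟩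
        · obtain ⟨h2, h3⟩ : x = c₁ ∧ l = c.map (·, y₂) ++ (x', y₂) :: d.map (x', ·) := by
            simpa using e
          left
          rcases c with _ | ⟨c₂, c⟩
          · exact ⟨[], x, y, y₂, x', d.map (x', ·), by rw [h3]; rfl⟩
          · exact ⟨[], x, y, y₂, c₂, c.map (·, y₂) ++ (x', y₂) :: d.map (x', ·), by rw [h3]; rfl⟩
      · obtain rfl : y = y₂ := h1
        exact Or.inr ⟨x :: c, x', d, by rw [e]; rfl⟩

/-- The consecutive elements of a maximal chain of a product agree in one of the coordinates. -/
theorem IsRanked.isChain_step (h : IsRanked P ρ r) (h' : IsRanked Q σ s) {l : List (P × Q)}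
    (hl : IsFull (r + s) l) : l.IsChain fun a b => a.1 = b.1 ∨ a.2 = b.2 := by
  have h1 : (l.map fun x => ρ x.1 + σ x.2).IsChain fun a b => b = a + 1 := by
    rw [(h.prod h').map_eq hl]
    exact List.isChain_range _ _ |>.2 fun m _ => rfl
  rw [List.isChain_map, List.isChain_iff_getElem] at h1
  have h2 := List.isChain_iff_getElem.1 hl.2.1
  rw [List.isChain_iff_getElem]
  intro i hi
  have e := h1 i hi
  have hlt := h2 i hi
  have hle := Prod.le_def.1 hlt.le
  rcases hle.1.eq_or_lt with h3 | h3
  · exact Or.inl h3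
  rcases hle.2.eq_or_lt with h4 | h4
  · exact Or.inr h4
  have := h.strictMono h3
  have := h'.strictMono h4
  omega

/-- If a full chain of the product goes through `c × y₀` and then along `x₁ × d`, then `c` reaches
the greatest element `x₁`: otherwise `c ++ [x₁]` would be too long for the rank. -/
theorem IsRanked.isFull_left (h : IsRanked P ρ r) {x₁ : P} {y₀ : Q} (hx₁ : IsTop x₁)
    {c : List P} {d : List Q} (hd : IsFull s d)
    (hl : IsFull (r + s) (c.map (·, y₀) ++ d.tail.map (x₁, ·))) : IsFull r c := by
  obtain ⟨h1, h2, h3, h4⟩ := hl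
  have hlen : c.length = r + 1 := by
    have := hd.1
    simp at h1; omega
  have hne : c ≠ [] := List.ne_nil_of_length_pos (by omega)
  rw [List.isChain_append, List.isChain_map] at h2
  have hch : c.IsChain (· < ·) := h2.1.imp fun a b hab => (Prod.mk_lt_mk_iff_left.1 hab)
  have hbot : ∀ x ∈ c.head?, IsBot x := by
    intro x hx
    refine (isBot_prod_iff.1 (h3 (x, y₀) ?_)).1
    obtain ⟨c', rfl⟩ := List.head?_eq_some_iff.1 hx
    rfl
  refine ⟨hlen, hch, hbot, ?_⟩
  intro x hx
  rcases (hx₁ x).eq_or_lt with rfl | hlt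
  · exact hx₁
  · have : IsFull (r + 1) (c ++ [x₁]) := by
      refine ⟨by simp [hlen], ?_, ?_, by simpa using hx₁⟩
      · rw [List.isChain_append]
        refine ⟨hch, List.isChain_singleton _, ?_⟩
        rintro a ha b hb
        obtain rfl : x = a := by
          rw [Option.mem_def] at ha hx
          rw [ha] at hx
          exact (Option.some.inj hx).symm
        obtain rfl : x₁ = b := by simpa using hb
        exact hlt
      · rwa [List.head?_append_of_ne_nil _ hne]
    have := h.le this
    omega

/-- The counterpart of `IsRanked.isFull_left` for a full chain that ends with `x₁ × d`. -/
theorem IsRanked.isFull_right (h' : IsRanked Q σ s) {x₁ : P} {y₀ : Q} (hy₀ : IsBot y₀)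
    {c : List P} {d : List Q} (hc : IsFull r c)
    (hl : IsFull (r + s) (c.dropLast.map (·, y₀) ++ d.map (x₁, ·))) : IsFull s d := by
  obtain ⟨h1, h2, h3, h4⟩ := hl
  have hlen : d.length = s + 1 := by
    have := hc.1
    simp at h1; omega
  have hne : d ≠ [] := List.ne_nil_of_length_pos (by omega)
  rw [List.isChain_append, List.isChain_map, List.isChain_map] at h2
  have hch : d.IsChain (· < ·) := h2.2.1.imp fun a b hab => (Prod.mk_lt_mk_iff_right.1 hab)
  have htop : ∀ x ∈ d.getLast?, IsTop x := by
    intro x hx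
    refine (isTop_prod_iff.1 (h4 (x₁, x) ?_)).2
    rw [List.getLast?_append_of_ne_nil _ (by simpa using hne), List.getLast?_map, hx]
    rfl
  refine ⟨hlen, hch, ?_, htop⟩
  intro x hx
  rcases (hy₀ x).eq_or_lt with rfl | hlt
  · exact hy₀
  · have : IsFull (s + 1) (y₀ :: d) := by
      refine ⟨by simp [hlen], ?_, by simpa using hy₀, ?_⟩
      · rw [List.isChain_cons]
        refine ⟨?_, hch⟩
        intro b hb
        have hxb : some b = some x := by
          rw [← Option.mem_def.1 hb, ← Option.mem_def.1 hx]
        obtain rfl : x = b := (Option.some.inj hxb).symm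
        exact hlt
      · rw [List.getLast?_cons]
        intro y hy
        obtain ⟨d', rfl⟩ | ⟨z, hz⟩ : d = [] ∨ ∃ z, d.getLast? = some z := by
          rcases hz : d.getLast? with _ | z
          · exact Or.inl (by simpa using hz)
          · exact Or.inr ⟨z, rfl⟩
        · exact absurd rfl hne
        · rw [hz] at hy
          obtain rfl : z = y := by simpa using hy
          exact htop z hz
    have := h'.le this
    omega

/-- The two chains are the only full ones that arise by inserting an element between `(p, q)` and
`(p', q')`, so this is an instance of `IsRanked.mem_cycles_iff`. -/
theorem IsRanked.swap (h : IsRanked P ρ r) (h' : IsRanked Q σ s) {z : List (P × Q) →₀ k}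
    (hz : z ∈ cycles k (P × Q) (r + s)) {L R : List (P × Q)} {p p' : P} {q q' : Q}
    (hp : p < p') (hq : q < q') :
    z (L ++ (p, q) :: (p, q') :: (p', q') :: R) + z (L ++ (p, q) :: (p', q) :: (p', q') :: R) =
      0 := by
  classical
  rw [(h.prod h').mem_cycles_iff k] at hz
  rw [← hz.2 (L ++ [(p, q)]) ((p', q') :: R) (by simp) (by simp)]
  have : chains k (P × Q) (r + s) ≤ LinearMap.eqLocus
      (Finsupp.lapply (L ++ (p, q) :: (p, q') :: (p', q') :: R) +
        Finsupp.lapply (L ++ (p, q) :: (p', q) :: (p', q') :: R))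
      (insertSum k (L ++ [(p, q)]) ((p', q') :: R)) := by
    refine chains_induction k fun l hl => ?_
    rw [LinearMap.mem_eqLocus, insertSum_single, LinearMap.add_apply, Finsupp.lapply_apply,
      Finsupp.lapply_apply, Finsupp.single_apply, Finsupp.single_apply]
    by_cases h1 : l = L ++ (p, q) :: (p, q') :: (p', q') :: R
    · rw [if_pos h1, if_neg, if_pos ⟨(p, q'), by rw [h1]; simp⟩, add_zero]
      rw [h1]
      intro e
      simp [hp.ne] at e
    · by_cases h2 : l = L ++ (p, q) :: (p', q) :: (p', q') :: R
      · rw [if_neg h1, if_pos h2, if_pos ⟨(p', q), by rw [h2]; simp⟩, zero_add]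
      · rw [if_neg h1, if_neg h2, if_neg, zero_add]
        rintro ⟨⟨a, b⟩, rfl⟩
        have hs := h.isChain_step h' hl
        have e : L ++ [(p, q)] ++ (a, b) :: (p', q') :: R =
            L ++ (p, q) :: (a, b) :: (p', q') :: R := by simp
        rw [e] at hs h1 h2
        rw [List.isChain_append_cons_cons, List.isChain_cons_cons] at hs
        rcases hs.2.1 with h3 | h3
        · obtain rfl : p = a := h3
          rcases hs.2.2.1 with h4 | h4
          · exact hp.ne h4
          · obtain rfl : b = q' := h4
            exact h1 rfl
        · obtain rfl : q = b := h3
          rcases hs.2.2.1 with h4 | h4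
          · obtain rfl : a = p' := h4
            exact h2 rfl
          · exact hq.ne h4
  exact this hz.1

/-- A cycle of top degree on a product vanishes if it vanishes on the chains that go through `P`
first: by `IsRanked.swap`, the other coefficients agree with these up to sign. -/
theorem IsRanked.eq_zero (h : IsRanked P ρ r) (h' : IsRanked Q σ s) {x₁ : P} {y₀ : Q}
    (hx₁ : IsTop x₁) (hy₀ : IsBot y₀) {z : List (P × Q) →₀ k}
    (hz : z ∈ cycles k (P × Q) (r + s))
    (h0 : ∀ c d, IsFull r c → IsFull s d → z (firstThen x₁ y₀ c d) = 0) : z = 0 := by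
  have hsupp : ∀ m, ¬ IsFull (r + s) m → z m = 0 := fun m hm => by
    by_contra hne
    exact hm ((Finsupp.mem_supported k z).1 hz.1 (by simpa using hne))
  ext m
  rw [Finsupp.zero_apply]
  -- exchanging a corner lowers the sum of the ranks of the second coordinates
  induction hN : (m.map fun x => σ x.2).sum using Nat.strong_induction_on generalizing m with
  | _ N ih =>
  by_cases hm : IsFull (r + s) m
  swap
  · exact hsupp m hm
  rcases m with _ | ⟨⟨x, y⟩, l⟩
  · exact absurd hm.1 (by simp)
  have hb := isBot_prod_iff.1 (hm.2.2.1 (x, y) rfl)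
  obtain rfl : y = y₀ := le_antisymm (hb.2 _) (hy₀ _)
  rcases exists_corner x y l (h.isChain_step h' hm) with ⟨L, p, q, q', p', R, e⟩ | ⟨c, x', d, e⟩
  · rw [e] at hm hN ⊢
    have hch := hm.2.1
    rw [List.isChain_append_cons_cons, List.isChain_cons_cons] at hch
    have hq : q < q' := Prod.mk_lt_mk_iff_right.1 hch.2.1
    have hp : p < p' := Prod.mk_lt_mk_iff_left.1 hch.2.2.1
    have hs := h.swap k h' hz (L := L) (R := R) hp hq
    rw [ih _ ?_ (L ++ (p, q) :: (p', q) :: (p', q') :: R) rfl, add_zero] at hs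
    · exact hs
    · rw [← hN]
      have := h'.strictMono hq
      simp; omega
  · have hx' : x' = x₁ := by
      refine le_antisymm (hx₁ _) ?_
      have hlast : ∃ b, ((x, y) :: l).getLast? = some (x', b) := by
        rw [e, List.getLast?_append_cons, List.getLast?_cons, List.getLast?_map]
        rcases d.getLast? with _ | b
        · exact ⟨y, rfl⟩
        · exact ⟨b, rfl⟩
      obtain ⟨b, hb⟩ := hlast
      exact (isTop_prod_iff.1 (hm.2.2.2 _ hb)).1 x₁
    subst hx'
    have e2 : (x, y) :: l = firstThen x' y (c ++ [x']) (y :: d) := by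
      rw [e]; simp [firstThen]
    rw [e2] at hm ⊢
    have hlen := hm.1
    have hch := hm.2.1
    simp only [firstThen, List.dropLast_concat, List.tail_cons] at hch
    rw [List.isChain_append] at hch
    have hc : IsFull c.length (c ++ [x']) := by
      refine ⟨by simp, ?_, ?_, by simpa using hx₁⟩
      · have := (List.isChain_map (f := fun a : P => (a, y)) (R := (· < ·)) (l := c ++ [x'])).1 (by
          rw [List.map_append, List.isChain_append]
          refine ⟨hch.1, List.isChain_singleton _, fun a ha b hb => hch.2.2 a ha b ?_⟩
          simpa using hb)
        exact this.imp fun a b hab => Prod.mk_lt_mk_iff_left.1 hab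
      · rcases c with _ | ⟨a, c⟩
        · intro z hz
          obtain rfl : x' = z := by simpa using hz
          obtain ⟨h1, -⟩ : x = x' ∧ _ := by simpa using e
          exact h1 ▸ hb.1
        · intro z hz
          obtain rfl : a = z := by simpa using hz
          obtain ⟨h1, -⟩ : x = a ∧ _ := by simpa using e
          exact h1 ▸ hb.1
    have hd : IsFull d.length (y :: d) := by
      refine ⟨by simp, ?_, by simpa using hb.2, ?_⟩
      · have := (List.isChain_map (f := fun a : Q => (x', a)) (R := (· < ·)) (l := y :: d)).1
          (by simpa using hch.2.1)
        exact this.imp fun a b hab => Prod.mk_lt_mk_iff_right.1 hab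
      · intro z hz
        refine (isTop_prod_iff.1 (hm.2.2.2 (x', z) ?_)).2
        rw [firstThen_right (by simp), List.getLast?_append_of_ne_nil _ (by simp),
          List.getLast?_map, hz]
        rfl
    have h1 := h.le hc
    have h2 := h'.le hd
    simp [firstThen] at hlen
    obtain rfl : c.length = r := by omega
    obtain rfl : d.length = s := by omega
    exact h0 _ _ hc hd

end Kunneth

section Kunneth

variable (k : Type u) [CommRing k] {P Q : Type*}

theorem ite_mul_ite (p q : Prop) [Decidable p] [Decidable q] :
    (if p then (1 : k) else 0) * (if q then 1 else 0) = if p ∧ q then 1 else 0 := by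
  by_cases hp : p <;> by_cases hq : q <;> simp [hp, hq]

theorem consMap_apply_cons (x : P) (c : List P →₀ k) (l : List P) :
    consMap k x c (x :: l) = c l :=
  Finsupp.mapDomain_apply (List.cons_injective) c l

theorem consMap_apply_of_ne {x y : P} (h : y ≠ x) (c : List P →₀ k) (l : List P) :
    consMap k x c (y :: l) = 0 := by
  refine Finsupp.mapDomain_of_notMem_range c _ ?_
  rintro ⟨l', e⟩
  exact h (List.cons.inj e).1.symm

theorem consMap_apply_nil (x : P) (c : List P →₀ k) : consMap k x c [] = 0 := by
  refine Finsupp.mapDomain_of_notMem_range c _ ?_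
  rintro ⟨l', e⟩
  exact List.cons_ne_nil _ _ e

theorem shuffle_apply_of_head {x : P} {y : Q} (l : List P) (l' : List Q) {m : List (P × Q)}
    (h : m.head? ≠ some (x, y)) : shuffle k (x :: l) (y :: l') m = 0 := by
  classical
  by_cases he : l = [] ∧ l' = []
  · obtain ⟨rfl, rfl⟩ := he
    rw [shuffle_single_single, Finsupp.single_apply, if_neg]
    rintro rfl
    exact h rfl
  · rw [shuffle_cons_cons k x y l l' he]
    rcases m with _ | ⟨a, m⟩
    · exact consMap_apply_nil k _ _
    · exact consMap_apply_of_ne k (fun e => h (by rw [e]; rfl)) _ _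

theorem shuffle_nil_left' (x : P) (l' : List Q) (y : Q) :
    shuffle k [x] (y :: l') = Finsupp.single ((y :: l').map (x, ·)) 1 := by
  induction l' generalizing y with
  | nil => rw [shuffle_single_single]; rfl
  | cons b l' ih =>
    rw [shuffle_cons_cons k x y [] (b :: l') (by simp), ih]
    simp

variable [PartialOrder P] [PartialOrder Q]

/-- The coefficient in a cross product of a chain that goes through the first factor first. -/
theorem shuffle_apply_firstThen {x₁ : P} {y : Q} {c c' : List P} {l' m' : List Q}
    (hc : c.IsChain (· < ·)) (hc₁ : c.getLast? = some x₁) (hc' : c'.IsChain (· < ·))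
    (hc₁' : c'.getLast? = some x₁) (hd : (y :: l').IsChain (· < ·)) [Decidable (c = c' ∧ l' = m')] :
    shuffle k c (y :: l') (c'.map (·, y) ++ m'.map (x₁, ·)) =
      if c = c' ∧ l' = m' then 1 else 0 := by
  classical
  have hy : y ∉ l' := fun h => lt_irrefl y
    ((List.pairwise_cons.1 (List.isChain_iff_pairwise.1 hd)).1 y h)
  have hlast : ∀ {x b : P} {l : List P}, (x :: b :: l).IsChain (· < ·) →
      (x :: b :: l).getLast? = some x₁ → x < x₁ := by
    intro x b l h1 h2
    refine (List.pairwise_cons.1 (List.isChain_iff_pairwise.1 h1)).1 x₁ ?_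
    rw [List.getLast?_cons_cons] at h2
    exact List.mem_of_getLast? h2
  induction c generalizing c' with
  | nil => simp at hc₁
  | cons x l ih =>
  rcases c' with _ | ⟨x', c'⟩
  · simp at hc₁'
  rcases l with _ | ⟨b, l⟩
  · obtain rfl : x = x₁ := by simpa using hc₁
    rw [shuffle_nil_left', Finsupp.single_apply]
    refine if_congr ⟨fun e => ?_, ?_⟩ rfl rfl
    · rcases c' with _ | ⟨b, c'⟩
      · have e2 : x = x' ∧ l'.map (x, ·) = m'.map (x, ·) := by simpa using e
        refine ⟨by rw [e2.1], List.map_injective_iff.2 (Prod.mk_right_injective x) e2.2⟩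
      · exfalso
        rcases l' with _ | ⟨a, l'⟩
        · simp at e
        · have e2 : a = y := by
            have := congrArg (fun l => l.tail.head?) e
            simpa using (congrArg (Option.map Prod.snd) this)
          exact hy (by rw [e2]; simp)
    · rintro ⟨e1, rfl⟩
      obtain ⟨rfl, rfl⟩ := List.cons.inj e1
      rfl
  · have hx := hlast hc hc₁
    rw [shuffle_cons_cons k x y (b :: l) l' (by simp)]
    by_cases hxx : x' = x
    swap
    · rw [if_neg (fun h => hxx (List.cons.inj h.1).1.symm)]
      exact consMap_apply_of_ne k (fun e => hxx (Prod.mk.inj e).1) _ _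
    subst hxx
    rw [List.map_cons, List.cons_append, consMap_apply_cons, Finsupp.add_apply,
      Finsupp.smul_apply]
    rcases c' with _ | ⟨b', c'⟩
    · obtain rfl : x' = x₁ := by simpa using hc₁'
      exact absurd hx (lt_irrefl _)
    · have h0 : shuffle k (x' :: b :: l) l' ((b' :: c').map (·, y) ++ m'.map (x₁, ·)) = 0 := by
        rcases l' with _ | ⟨a, l'⟩
        · simp
        · refine shuffle_apply_of_head k _ _ ?_
          intro e
          have : y = a := by simpa using congrArg (Option.map Prod.snd) e
          exact hy (by rw [this]; simp)
      rw [h0, smul_zero, add_zero, ih (List.isChain_cons_cons.1 hc).2 (by simpa using hc₁)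
        (List.isChain_cons_cons.1 hc').2 (by simpa using hc₁')]
      refine if_congr ?_ rfl rfl
      simp

variable {k}
variable {ρ : P → ℕ} {σ : Q → ℕ} {r s : ℕ} {x₁ : P} {y₀ : Q}

theorem take_firstThen (hx₁ : IsTop x₁) {c : List P} {d : List Q} (hc : IsFull r c) :
    ((firstThen x₁ y₀ c d).take (r + 1)).map Prod.fst = c := by
  have hl : c.getLast? = some x₁ := by
    obtain ⟨x, y, -, hy, hp⟩ := hc.exists_isPath
    rw [hp.2.2.2, le_antisymm (hy x₁) (hx₁ y)]
  rw [firstThen_left hl, List.take_left' (by simp [hc.1])]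
  simp [Function.comp_def]

theorem drop_firstThen (hy₀ : IsBot y₀) {c : List P} {d : List Q} (hc : IsFull r c)
    (hd : IsFull s d) : ((firstThen x₁ y₀ c d).drop r).map Prod.snd = d := by
  have hl : d.head? = some y₀ := by
    obtain ⟨x, y, hx, -, hp⟩ := hd.exists_isPath
    rw [hp.2.2.1, le_antisymm (hx y₀) (hy₀ x)]
  rw [firstThen_right hl, List.drop_left' (by simp [hc.1])]
  simp [Function.comp_def]

variable (k r s x₁ y₀)

open Classical in
/-- The Alexander-Whitney map in the top degree: read off `c ⊗ d` from the chain that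
goes through `c` first and through `d` afterwards. -/
def awMap : (List (P × Q) →₀ k) →ₗ[k] (List P →₀ k) ⊗[k] (List Q →₀ k) :=
  Finsupp.linearCombination k fun m =>
    let c := (m.take (r + 1)).map Prod.fst
    let d := (m.drop r).map Prod.snd
    if IsFull r c ∧ IsFull s d ∧ m = firstThen x₁ y₀ c d then
      Finsupp.single c 1 ⊗ₜ Finsupp.single d 1 else 0

variable {r s x₁ y₀}

theorem awMap_single (hx₁ : IsTop x₁) (hy₀ : IsBot y₀) {c : List P} {d : List Q}
    (hc : IsFull r c) (hd : IsFull s d) :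
    awMap k r s x₁ y₀ (Finsupp.single (firstThen x₁ y₀ c d) 1) =
      Finsupp.single c 1 ⊗ₜ Finsupp.single d 1 := by
  simp only [awMap, Finsupp.linearCombination_single, one_smul]
  rw [take_firstThen hx₁ hc, drop_firstThen hy₀ hc hd, if_pos ⟨hc, hd, rfl⟩]

theorem awMap_single_of_ne {m : List (P × Q)}
    (h : ¬ ∃ c d, IsFull r c ∧ IsFull s d ∧ m = firstThen x₁ y₀ c d) :
    awMap k r s x₁ y₀ (Finsupp.single m 1) = 0 := by
  simp only [awMap, Finsupp.linearCombination_single, one_smul]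
  rw [if_neg fun h' => h ⟨_, _, h'⟩]

theorem firstThen_inj (hx₁ : IsTop x₁) (hy₀ : IsBot y₀) {c c' : List P} {d d' : List Q}
    (hc : IsFull r c) (hd : IsFull s d) (hc' : IsFull r c') (hd' : IsFull s d')
    (e : firstThen x₁ y₀ c d = firstThen x₁ y₀ c' d') : c = c' ∧ d = d' := by
  constructor
  · rw [← take_firstThen hx₁ hc (d := d), e, take_firstThen hx₁ hc']
  · rw [← drop_firstThen hy₀ hc hd (x₁ := x₁), e, drop_firstThen hy₀ hc' hd']

open Classical in
theorem awMap_apply (hx₁ : IsTop x₁) (hy₀ : IsBot y₀) (f : List (P × Q) →₀ k) (c : List P)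
    (d : List Q) : finsuppTensorFinsupp' k _ _ (awMap k r s x₁ y₀ f) (c, d) =
      if IsFull r c ∧ IsFull s d then f (firstThen x₁ y₀ c d) else 0 := by
  refine Eq.trans (DFunLike.congr_fun (f := Finsupp.lapply (c, d) ∘ₗ
    (finsuppTensorFinsupp' k _ _).toLinearMap ∘ₗ awMap k r s x₁ y₀)
    (g := if IsFull r c ∧ IsFull s d then Finsupp.lapply (firstThen x₁ y₀ c d) else 0) ?_ f) ?_
  · refine Finsupp.lhom_ext' fun m => LinearMap.ext_ring ?_
    simp only [LinearMap.comp_apply, Finsupp.lsingle_apply, LinearEquiv.coe_coe]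
    by_cases h : ∃ c d, IsFull r c ∧ IsFull s d ∧ m = firstThen x₁ y₀ c d
    · obtain ⟨c', d', hc', hd', rfl⟩ := h
      rw [awMap_single k hx₁ hy₀ hc' hd', Finsupp.lapply_apply, finsuppTensorFinsupp'_apply_apply,
        Finsupp.single_apply, Finsupp.single_apply, ite_mul_ite]
      by_cases h2 : IsFull r c ∧ IsFull s d
      · rw [if_pos h2, Finsupp.lapply_apply, Finsupp.single_apply]
        refine if_congr ⟨?_, fun e => firstThen_inj hx₁ hy₀ hc' hd' h2.1 h2.2 e⟩ rfl rfl
        rintro ⟨rfl, rfl⟩; rfl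
      · rw [if_neg h2, LinearMap.zero_apply, if_neg]
        rintro ⟨rfl, rfl⟩
        exact h2 ⟨hc', hd'⟩
    · rw [awMap_single_of_ne k h, map_zero, map_zero]
      split_ifs with h2
      · rw [Finsupp.lapply_apply, Finsupp.single_apply, if_neg]
        rintro rfl
        exact h ⟨c, d, h2.1, h2.2, rfl⟩
      · rfl
  · split_ifs <;> rfl

theorem getLast?_of_isFull (hx₁ : IsTop x₁) {c : List P} (hc : IsFull r c) :
    c.getLast? = some x₁ := by
  obtain ⟨x, y, -, hy, hp⟩ := hc.exists_isPath
  rw [hp.2.2.2, le_antisymm (hy x₁) (hx₁ y)]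

theorem head?_of_isFull (hy₀ : IsBot y₀) {d : List Q} (hd : IsFull s d) :
    d.head? = some y₀ := by
  obtain ⟨x, y, hx, -, hp⟩ := hd.exists_isPath
  rw [hp.2.2.1, le_antisymm (hx y₀) (hy₀ x)]

theorem awMap_shuffle (hx₁ : IsTop x₁) (hy₀ : IsBot y₀) {c : List P} {d : List Q}
    (hc : IsFull r c) (hd : IsFull s d) : awMap k r s x₁ y₀ (shuffle k c d) =
      Finsupp.single c 1 ⊗ₜ Finsupp.single d 1 := by
  classical
  refine (finsuppTensorFinsupp' k _ _).injective ?_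
  ext ⟨c', d'⟩
  rw [awMap_apply k hx₁ hy₀, finsuppTensorFinsupp'_apply_apply, Finsupp.single_apply,
    Finsupp.single_apply, ite_mul_ite]
  by_cases h : IsFull r c' ∧ IsFull s d'
  · obtain ⟨l, rfl⟩ := List.head?_eq_some_iff.1 (head?_of_isFull hy₀ hd)
    obtain ⟨l', rfl⟩ := List.head?_eq_some_iff.1 (head?_of_isFull hy₀ h.2)
    rw [if_pos h, firstThen_left (getLast?_of_isFull hx₁ h.1), List.tail_cons,
      shuffle_apply_firstThen k hc.2.1 (getLast?_of_isFull hx₁ hc) h.1.2.1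
      (getLast?_of_isFull hx₁ h.1) hd.2.1]
    simp
  · rw [if_neg h, if_neg]
    rintro ⟨rfl, rfl⟩
    exact h ⟨hc, hd⟩

theorem awMap_shuffleMap (hx₁ : IsTop x₁) (hy₀ : IsBot y₀) {c : List P →₀ k} {d : List Q →₀ k}
    (hc : c ∈ chains k P r) (hd : d ∈ chains k Q s) :
    awMap k r s x₁ y₀ (shuffleMap k c d) = c ⊗ₜ d := by
  have h1 : ∀ l : List P, IsFull r l → ∀ d ∈ chains k Q s,
      awMap k r s x₁ y₀ (shuffleMap k (Finsupp.single l 1) d) = Finsupp.single l 1 ⊗ₜ d := by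
    intro l hl d hd
    have : chains k Q s ≤ LinearMap.eqLocus (awMap k r s x₁ y₀ ∘ₗ shuffleMap k (Finsupp.single l 1))
        (TensorProduct.mk k _ _ (Finsupp.single l 1)) := by
      refine chains_induction k fun l' hl' => ?_
      rw [LinearMap.mem_eqLocus, LinearMap.comp_apply, shuffleMap_single,
        awMap_shuffle k hx₁ hy₀ hl hl']
      rfl
    exact this hd
  have : chains k P r ≤ LinearMap.eqLocus (awMap k r s x₁ y₀ ∘ₗ (shuffleMap k).flip d)
      ((TensorProduct.mk k _ _).flip d) :=
    chains_induction k fun l hl => h1 l hl d hd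
  exact this hc

/-- The Alexander-Whitney image of a cycle lies in the tensor product of the cycles: its slices are
cycles. -/
theorem map_awMap (h : IsRanked P ρ r) (h' : IsRanked Q σ s) (hx₁ : IsTop x₁) (hy₀ : IsBot y₀)
    {π : (List P →₀ k) →ₗ[k] (List P →₀ k)} (hπ : ∀ z ∈ cycles k P r, π z = z)
    {π' : (List Q →₀ k) →ₗ[k] (List Q →₀ k)} (hπ' : ∀ z ∈ cycles k Q s, π' z = z)
    {z : List (P × Q) →₀ k} (hz : z ∈ cycles k (P × Q) (r + s)) :
    TensorProduct.map π π' (awMap k r s x₁ y₀ z) = awMap k r s x₁ y₀ z := by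
  classical
  have h1 : TensorProduct.map π LinearMap.id (awMap k r s x₁ y₀ z) = awMap k r s x₁ y₀ z := by
    refine (TensorProduct.finsuppScalarRight k k (List P →₀ k) (List Q)).injective ?_
    ext1 d
    have e1 : ∀ t : (List P →₀ k) ⊗[k] (List Q →₀ k),
        TensorProduct.finsuppScalarRight k k (List P →₀ k) (List Q)
          (TensorProduct.map π LinearMap.id t) d =
        π (TensorProduct.finsuppScalarRight k k (List P →₀ k) (List Q) t d) := by
      intro t
      induction t with
      | zero => simp
      | add a b ha hb => simp only [map_add, Finsupp.add_apply, ha, hb]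
      | tmul a b =>
        rw [TensorProduct.map_tmul, TensorProduct.finsuppScalarRight_apply_tmul_apply,
          TensorProduct.finsuppScalarRight_apply_tmul_apply, map_smul]
        rfl
    have e2 : chains k (P × Q) (r + s) ≤ LinearMap.eqLocus
        (Finsupp.lapply d ∘ₗ (TensorProduct.finsuppScalarRight k k (List P →₀ k)
          (List Q)).toLinearMap ∘ₗ awMap k r s x₁ y₀)
        (if IsFull s d then slice k (Prod.mk_left_injective y₀) [] (d.tail.map (x₁, ·))
          else 0) := by
      refine chains_induction k fun m hm => ?_
      rw [LinearMap.mem_eqLocus]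
      simp only [LinearMap.comp_apply, LinearEquiv.coe_coe, Finsupp.lapply_apply]
      by_cases h2 : ∃ c d, IsFull r c ∧ IsFull s d ∧ m = firstThen x₁ y₀ c d
      · obtain ⟨c', d', hc', hd', rfl⟩ := h2
        rw [awMap_single k hx₁ hy₀ hc' hd', TensorProduct.finsuppScalarRight_apply_tmul_apply,
          Finsupp.single_apply]
        by_cases hd : IsFull s d
        · rw [if_pos hd]
          ext c
          rw [slice_apply, List.nil_append, Finsupp.single_apply, Finsupp.smul_apply,
            Finsupp.single_apply, smul_eq_mul, ite_mul_ite]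
          refine if_congr ⟨?_, fun e => ?_⟩ rfl rfl
          · rintro ⟨rfl, rfl⟩
            rw [firstThen_left (getLast?_of_isFull hx₁ hc')]
          · have hc : IsFull r c := h.isFull_left hx₁ hd (by rw [← e]; exact hm)
            rw [← firstThen_left (getLast?_of_isFull hx₁ hc)] at e
            exact (firstThen_inj hx₁ hy₀ hc' hd' hc hd e).symm
        · rw [if_neg hd, if_neg, zero_smul]
          · rfl
          · rintro rfl; exact hd hd'
      · rw [awMap_single_of_ne k h2, map_zero]
        split_ifs with hd
        · ext c
          rw [slice_apply, List.nil_append, Finsupp.single_apply, if_neg]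
          · rfl
          · intro e
            have hc : IsFull r c := h.isFull_left hx₁ hd (by rw [← e]; exact hm)
            exact h2 ⟨c, d, hc, hd, by rw [e, firstThen_left (getLast?_of_isFull hx₁ hc)]⟩
        · rfl
    have e3 : TensorProduct.finsuppScalarRight k k (List P →₀ k) (List Q) (awMap k r s x₁ y₀ z) d =
        (if IsFull s d then slice k (Prod.mk_left_injective y₀) [] (d.tail.map (x₁, ·)) else 0) z :=
      e2 hz.1
    rw [e1, e3]
    split_ifs with hd
    · refine hπ _ (slice_mem_cycles k (h.prod h') h _ ?_ ?_ hz)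
      · rintro a ⟨m, m'⟩ b h1 h2
        refine ⟨m, Prod.ext rfl (le_antisymm ?_ ?_)⟩
        exacts [hy₀ _, (Prod.mk_le_mk.1 h2.le).2]
      · exact fun c hc => h.isFull_left hx₁ hd hc
    · simp
  have h2 : TensorProduct.map LinearMap.id π' (awMap k r s x₁ y₀ z) = awMap k r s x₁ y₀ z := by
    refine (TensorProduct.finsuppScalarLeft k (List Q →₀ k) (List P)).injective ?_
    ext1 c
    have e1 : ∀ t : (List P →₀ k) ⊗[k] (List Q →₀ k),
        TensorProduct.finsuppScalarLeft k (List Q →₀ k) (List P)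
          (TensorProduct.map LinearMap.id π' t) c =
        π' (TensorProduct.finsuppScalarLeft k (List Q →₀ k) (List P) t c) := by
      intro t
      induction t with
      | zero => simp
      | add a b ha hb => simp only [map_add, Finsupp.add_apply, ha, hb]
      | tmul a b =>
        rw [TensorProduct.map_tmul, TensorProduct.finsuppScalarLeft_apply_tmul_apply,
          TensorProduct.finsuppScalarLeft_apply_tmul_apply, map_smul]
        rfl
    have e2 : chains k (P × Q) (r + s) ≤ LinearMap.eqLocus
        (Finsupp.lapply c ∘ₗ (TensorProduct.finsuppScalarLeft k (List Q →₀ k)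
          (List P)).toLinearMap ∘ₗ awMap k r s x₁ y₀)
        (if IsFull r c then slice k (Prod.mk_right_injective x₁) (c.dropLast.map (·, y₀)) []
          else 0) := by
      refine chains_induction k fun m hm => ?_
      rw [LinearMap.mem_eqLocus]
      simp only [LinearMap.comp_apply, LinearEquiv.coe_coe, Finsupp.lapply_apply]
      by_cases h2 : ∃ c d, IsFull r c ∧ IsFull s d ∧ m = firstThen x₁ y₀ c d
      · obtain ⟨c', d', hc', hd', rfl⟩ := h2
        rw [awMap_single k hx₁ hy₀ hc' hd', TensorProduct.finsuppScalarLeft_apply_tmul_apply,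
          Finsupp.single_apply]
        by_cases hc : IsFull r c
        · rw [if_pos hc]
          ext d
          rw [slice_apply, List.append_nil, Finsupp.single_apply, Finsupp.smul_apply,
            Finsupp.single_apply, smul_eq_mul, ite_mul_ite]
          refine if_congr ⟨?_, fun e => ?_⟩ rfl rfl
          · rintro ⟨rfl, rfl⟩
            rw [firstThen_right (head?_of_isFull hy₀ hd')]
          · have hd : IsFull s d := h'.isFull_right hy₀ hc (by rw [← e]; exact hm)
            rw [← firstThen_right (head?_of_isFull hy₀ hd)] at e
            exact firstThen_inj hx₁ hy₀ hc' hd' hc hd e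
        · rw [if_neg hc, if_neg, zero_smul]
          · rfl
          · rintro rfl; exact hc hc'
      · rw [awMap_single_of_ne k h2, map_zero]
        split_ifs with hc
        · ext d
          rw [slice_apply, List.append_nil, Finsupp.single_apply, if_neg]
          · rfl
          · intro e
            have hd : IsFull s d := h'.isFull_right hy₀ hc (by rw [← e]; exact hm)
            exact h2 ⟨c, d, hc, hd, by rw [e, firstThen_right (head?_of_isFull hy₀ hd)]⟩
        · rfl
    have e3 : TensorProduct.finsuppScalarLeft k (List Q →₀ k) (List P) (awMap k r s x₁ y₀ z) c =
        (if IsFull r c then slice k (Prod.mk_right_injective x₁) (c.dropLast.map (·, y₀)) []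
          else 0) z := e2 hz.1
    rw [e1, e3]
    split_ifs with hc
    · refine hπ' _ (slice_mem_cycles k (h.prod h') h' _ ?_ ?_ hz)
      · rintro a ⟨m, m'⟩ b h1 h2
        refine ⟨m', Prod.ext (le_antisymm ?_ ?_) rfl⟩
        exacts [(Prod.mk_le_mk.1 h1.le).1, hx₁ _]
      · exact fun d hd => h'.isFull_right hy₀ hc (by simpa using hd)
    · simp
  have e : TensorProduct.map π π' = TensorProduct.map π LinearMap.id ∘ₗ
      TensorProduct.map LinearMap.id π' := by
    rw [← TensorProduct.map_comp, LinearMap.comp_id, LinearMap.id_comp]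
  rw [e, LinearMap.comp_apply, h2, h1]

/-- The cross product is an isomorphism in the top degree, if the cycles are direct summands. -/
theorem exists_kunneth (h : IsRanked P ρ r) (h' : IsRanked Q σ s) (hx₁ : IsTop x₁) (hy₀ : IsBot y₀)
    {π : (List P →₀ k) →ₗ[k] (List P →₀ k)} (hπc : ∀ c, π c ∈ cycles k P r)
    (hπ : ∀ z ∈ cycles k P r, π z = z) {π' : (List Q →₀ k) →ₗ[k] (List Q →₀ k)}
    (hπc' : ∀ c, π' c ∈ cycles k Q s) (hπ' : ∀ z ∈ cycles k Q s, π' z = z) :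
    ∃ K : RedHom k (P × Q) (r + s) →ₗ[k] RedHom k P r ⊗[k] RedHom k Q s,
      (∀ x y, K (RedHom.cross k r s x y) = x ⊗ₜ y) ∧
      ∀ z, TensorProduct.lift (RedHom.cross k r s) (K z) = z := by
  let p : (List P →₀ k) →ₗ[k] RedHom k P r := SubQuot.mk ∘ₗ π.codRestrict _ hπc
  let p' : (List Q →₀ k) →ₗ[k] RedHom k Q s := SubQuot.mk ∘ₗ π'.codRestrict _ hπc'
  have hp : ∀ z (hz : z ∈ cycles k P r), p z = SubQuot.mk ⟨z, hz⟩ :=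
    fun z hz => SubQuot.mk_congr (hπ z hz) _ _
  have hp' : ∀ z (hz : z ∈ cycles k Q s), p' z = SubQuot.mk ⟨z, hz⟩ :=
    fun z hz => SubQuot.mk_congr (hπ' z hz) _ _
  let K : RedHom k (P × Q) (r + s) →ₗ[k] RedHom k P r ⊗[k] RedHom k Q s :=
    Submodule.liftQ _ (TensorProduct.map p p' ∘ₗ awMap k r s x₁ y₀ ∘ₗ Submodule.subtype _) <| by
      intro z hz
      have : z.1 = 0 := by
        have h0 : z.1 ∈ boundaries k (P × Q) (r + s) := hz
        rwa [(h.prod h').boundaries_eq_bot k] at h0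
      rw [LinearMap.mem_ker, LinearMap.comp_apply, LinearMap.comp_apply, Submodule.subtype_apply,
        this, map_zero, map_zero]
  have hK : ∀ z (hz : z ∈ cycles k (P × Q) (r + s)), K (SubQuot.mk ⟨z, hz⟩) =
      TensorProduct.map p p' (awMap k r s x₁ y₀ z) := fun z hz => rfl
  refine ⟨K, ?_, ?_⟩
  · intro x y
    obtain ⟨z, hz, rfl⟩ := SubQuot.mk_surjective x
    obtain ⟨w, hw, rfl⟩ := SubQuot.mk_surjective y
    refine (hK _ (shuffleMap_cycles k z hz w hw)).trans ?_
    rw [awMap_shuffleMap k hx₁ hy₀ hz.1 hw.1, TensorProduct.map_tmul, hp z hz, hp' w hw]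
  · intro x
    obtain ⟨z, hz, rfl⟩ := SubQuot.mk_surjective x
    have e1 : ∀ t : (List P →₀ k) ⊗[k] (List Q →₀ k),
        ∃ hc : TensorProduct.lift (shuffleMap k) (TensorProduct.map π π' t) ∈
          cycles k (P × Q) (r + s),
        TensorProduct.lift (RedHom.cross k r s) (TensorProduct.map p p' t) =
          SubQuot.mk ⟨_, hc⟩ ∧
        awMap k r s x₁ y₀ (TensorProduct.lift (shuffleMap k) (TensorProduct.map π π' t)) =
          TensorProduct.map π π' t := by
      intro t
      induction t with
      | zero =>
        refine ⟨by simp, ?_, by simp⟩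
        rw [map_zero, map_zero]
        exact (SubQuot.mk_eq_zero _ (by simp)).symm
      | add a b ha hb =>
        obtain ⟨ha, ha', ha''⟩ := ha
        obtain ⟨hb, hb', hb''⟩ := hb
        refine ⟨by rw [map_add, map_add]; exact Submodule.add_mem _ ha hb, ?_, ?_⟩
        · rw [map_add, map_add, ha', hb', ← map_add]
          exact SubQuot.mk_congr (by simp) _ _
        · simp only [map_add, ha'', hb'']
      | tmul a b =>
        refine ⟨shuffleMap_cycles k _ (hπc a) _ (hπc' b), rfl, ?_⟩
        rw [TensorProduct.map_tmul, TensorProduct.lift.tmul,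
          awMap_shuffleMap k hx₁ hy₀ (hπc a).1 (hπc' b).1]
    obtain ⟨hc, hc', hc''⟩ := e1 (awMap k r s x₁ y₀ z)
    rw [hK, hc']
    refine SubQuot.mk_congr ?_ _ _
    rw [map_awMap k h h' hx₁ hy₀ hπ hπ' hz] at hc hc'' ⊢
    rw [← sub_eq_zero]
    refine h.eq_zero k h' hx₁ hy₀ (Submodule.sub_mem _ hc hz) fun c d hc₁ hd₁ => ?_
    have := awMap_apply k hx₁ hy₀ (r := r) (s := s)
      (TensorProduct.lift (shuffleMap k) (awMap k r s x₁ y₀ z) - z) c d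
    rw [if_pos ⟨hc₁, hd₁⟩, map_sub, hc'', sub_self, map_zero] at this
    exact this.symm

end Kunneth

/-! ### Associativity and commutativity of the cross product -/

section ShuffleLaws

variable (k : Type u) [CommRing k] {P Q R : Type*}

theorem lmapDomain_consMap {P' : Type*} (f : P → P') (x : P) (c : List P →₀ k) :
    Finsupp.lmapDomain k k (List.map f) (consMap k x c) =
      consMap k (f x) (Finsupp.lmapDomain k k (List.map f) c) := by
  refine DFunLike.congr_fun (f := Finsupp.lmapDomain k k (List.map f) ∘ₗ consMap k x)
    (g := consMap k (f x) ∘ₗ Finsupp.lmapDomain k k (List.map f)) ?_ c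
  refine Finsupp.lhom_ext' fun l => LinearMap.ext_ring ?_
  simp

theorem shuffle_nil_right' (l : List P) (x : P) (y : Q) :
    shuffle k (x :: l) [y] = Finsupp.single ((x :: l).map (·, y)) 1 := by
  induction l generalizing x with
  | nil => rw [shuffle_single_single]; rfl
  | cons b l ih =>
    rw [shuffle_cons_cons k x y (b :: l) [] (by simp), ih]
    simp

/-- Exchanging the factors in the cross product of chains of dimensions `r` and `s` yields the
sign `(-1) ^ (r * s)`. -/
theorem shuffle_comm (l : List P) (l' : List Q) :
    Finsupp.lmapDomain k k (List.map Prod.swap) (shuffle k l l') =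
      (-1 : k) ^ ((l.length - 1) * (l'.length - 1)) • shuffle k l' l := by
  induction hn : l.length + l'.length using Nat.strong_induction_on generalizing l l' with
  | _ n ih =>
  rcases l with _ | ⟨x, l⟩
  · simp
  rcases l' with _ | ⟨y, l'⟩
  · simp
  by_cases h : l = [] ∧ l' = []
  · obtain ⟨rfl, rfl⟩ := h
    simp [shuffle_single_single]
  · rw [shuffle_cons_cons k x y l l' h, shuffle_cons_cons k y x l' l (fun h' => h h'.symm),
      lmapDomain_consMap, map_add, map_smul,
      ih (l.length + (y :: l').length) (by simp at hn ⊢; omega) l (y :: l') rfl,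
      ih ((x :: l).length + l'.length) (by simp at hn ⊢; omega) (x :: l) l' rfl, ← map_smul]
    rw [Prod.swap_prod_mk, smul_add, smul_smul, smul_smul, add_comm]
    congr 2
    · rcases l' with _ | ⟨b, l'⟩
      · simp
      · congr 1
        rw [← pow_add]
        congr 1
        simp only [List.length_cons, Nat.add_sub_cancel]
        ring
    · rcases l with _ | ⟨b, l⟩
      · simp
      · congr 1
        rw [← pow_add]
        simp only [List.length_cons, Nat.add_sub_cancel]
        rw [show (l.length + 1) * l'.length + l'.length = l.length * l'.length + 2 * l'.length by
          ring, pow_add, pow_mul (-1 : k) 2]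
        simp

/-- The three terms correspond to the factor in which a chain of the triple product takes its
first step. -/
theorem shuffleMap_shuffle_cons (x : P) (y : Q) (z : R) (l : List P) (l' : List Q) (l'' : List R)
    (h : ¬ (l = [] ∧ l' = [])) :
    shuffleMap k (shuffle k (x :: l) (y :: l')) (Finsupp.single (z :: l'') 1) =
      consMap k ((x, y), z) (shuffleMap k (shuffle k l (y :: l')) (Finsupp.single (z :: l'') 1) +
        (-1 : k) ^ l.length • shuffleMap k (shuffle k (x :: l) l') (Finsupp.single (z :: l'') 1) +
        (-1 : k) ^ (l.length + l'.length) •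
          shuffleMap k (shuffle k (x :: l) (y :: l')) (Finsupp.single l'' 1)) := by
  obtain ⟨m, hm⟩ : ∃ m, l.length + l'.length = m + 1 := by
    refine Nat.exists_eq_succ_of_ne_zero fun e => h ?_
    rw [← List.length_eq_zero_iff, ← List.length_eq_zero_iff]
    omega
  have hc : shuffle k l (y :: l') + (-1 : k) ^ l.length • shuffle k (x :: l) l' ∈
      lists k (P × Q) (m + 1) := by
    refine Submodule.add_mem _ ?_ (Submodule.smul_mem _ _ ?_)
    · have := shuffle_mem_lists k l (y :: l')
      rwa [show l.length + (y :: l').length - 1 = m + 1 by simp; omega] at this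
    · have := shuffle_mem_lists k (x :: l) l'
      rwa [show (x :: l).length + l'.length - 1 = m + 1 by simp; omega] at this
  have e := shuffleMap_consMap_consMap k (x, y) z _ hc l''
  rw [← shuffle_cons_cons k x y l l' h] at e
  rw [e, hm, map_add (shuffleMap k), LinearMap.add_apply, map_smul, LinearMap.smul_apply]

/-- The three terms correspond to the factor in which a chain of the triple product takes its
first step. -/
theorem shuffleMap_cons_shuffle (x : P) (y : Q) (z : R) (l : List P) (l' : List Q) (l'' : List R)
    (h : ¬ (l' = [] ∧ l'' = [])) :
    shuffleMap k (Finsupp.single (x :: l) 1) (shuffle k (y :: l') (z :: l'')) =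
      consMap k (x, y, z) (shuffleMap k (Finsupp.single l 1) (shuffle k (y :: l') (z :: l'')) +
        (-1 : k) ^ l.length • shuffleMap k (Finsupp.single (x :: l) 1) (shuffle k l' (z :: l'')) +
        (-1 : k) ^ (l.length + l'.length) •
          shuffleMap k (Finsupp.single (x :: l) 1) (shuffle k (y :: l') l'')) := by
  obtain ⟨m, hm⟩ : ∃ m, l'.length + l''.length = m + 1 := by
    refine Nat.exists_eq_succ_of_ne_zero fun e => h ?_
    rw [← List.length_eq_zero_iff, ← List.length_eq_zero_iff]
    omega
  have hc : shuffle k l' (z :: l'') + (-1 : k) ^ l'.length • shuffle k (y :: l') l'' ∈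
      lists k (Q × R) (m + 1) := by
    refine Submodule.add_mem _ ?_ (Submodule.smul_mem _ _ ?_)
    · have := shuffle_mem_lists k l' (z :: l'')
      rwa [show l'.length + (z :: l'').length - 1 = m + 1 by simp; omega] at this
    · have := shuffle_mem_lists k (y :: l') l''
      rwa [show (y :: l').length + l''.length - 1 = m + 1 by simp; omega] at this
  have e := shuffleMap_consMap_consMap' k x (y, z) l _ hc
  rw [← shuffle_cons_cons k y z l' l'' h] at e
  rw [e, map_add (shuffleMap k (Finsupp.single (x :: l) 1)), map_smul, smul_add, smul_smul,
    ← pow_add, ← add_assoc]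

theorem shuffle_assoc (l : List P) (l' : List Q) (l'' : List R) :
    Finsupp.lmapDomain k k (List.map (Equiv.prodAssoc P Q R))
      (shuffleMap k (shuffle k l l') (Finsupp.single l'' 1)) =
      shuffleMap k (Finsupp.single l 1) (shuffle k l' l'') := by
  induction hn : l.length + l'.length + l''.length using Nat.strong_induction_on
    generalizing l l' l'' with
  | _ n ih =>
  rcases l with _ | ⟨x, l⟩
  · simp [shuffleMap_nil_left]
  rcases l' with _ | ⟨y, l'⟩
  · simp
  rcases l'' with _ | ⟨z, l''⟩
  · simp [shuffleMap_nil_right]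
  by_cases h : l = [] ∧ l' = []
  · obtain ⟨rfl, rfl⟩ := h
    rw [shuffle_single_single, shuffleMap_single, shuffle_nil_left', shuffle_nil_left',
      shuffleMap_single, List.map_cons (l := l''), List.map_cons (l := l''), shuffle_nil_left']
    simp [Function.comp_def]
  by_cases h' : l' = [] ∧ l'' = []
  · obtain ⟨rfl, rfl⟩ := h'
    rw [shuffle_single_single, shuffleMap_single, shuffle_nil_right', shuffle_nil_right',
      shuffleMap_single, List.map_cons (l := l), List.map_cons (l := l), shuffle_nil_right']
    simp [Function.comp_def]
  · rw [shuffleMap_shuffle_cons k x y z l l' l'' h, shuffleMap_cons_shuffle k x y z l l' l'' h',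
      lmapDomain_consMap, map_add (Finsupp.lmapDomain _ _ _),
      map_add (Finsupp.lmapDomain _ _ _), map_smul (Finsupp.lmapDomain _ _ _),
      map_smul (Finsupp.lmapDomain _ _ _)]
    simp only [List.length_cons] at hn
    rw [ih _ (by simp only [List.length_cons]; omega) l (y :: l') (z :: l'') rfl,
      ih _ (by simp only [List.length_cons]; omega) (x :: l) l' (z :: l'') rfl,
      ih _ (by simp only [List.length_cons]; omega) (x :: l) (y :: l') l'' rfl]
    rfl

end ShuffleLaws

section CrossLaws

variable (k : Type u) [CommRing k] {P Q R P' Q' : Type*} [PartialOrder P] [PartialOrder Q]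
  [PartialOrder R] [PartialOrder P'] [PartialOrder Q'] {r s t n m d : ℕ}

/-- The cross product, with the total degree as a variable. -/
def RedHom.mul (h : r + s = n) : RedHom k P r →ₗ[k] RedHom k Q s →ₗ[k] RedHom k (P × Q) n :=
  SubQuot.map₂ (shuffleMap k) (by subst h; exact shuffleMap_cycles k)
    (by subst h; exact shuffleMap_boundaries_left k)
    (by subst h; exact shuffleMap_boundaries_right k)

theorem RedHom.mul_map (h : r + s = n) (f : P ↪o P') (g : Q ↪o Q') (x : RedHom k P r)
    (y : RedHom k Q s) : RedHom.mul k h (RedHom.map k f r x) (RedHom.map k g s y) =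
      RedHom.map k (prodEmb f g) n (RedHom.mul k h x y) := by
  subst h
  exact RedHom.cross_map k f g r s x y

/-- An embedding that preserves the least and the greatest element sends no chain to
zero. -/
theorem chainMap_of_bounded (f : P ↪o Q) (hb : ∀ x, IsBot x → IsBot (f x))
    (ht : ∀ x, IsTop x → IsTop (f x)) {c : List P →₀ k} (hc : c ∈ chains k P r) :
    chainMap k f c = Finsupp.lmapDomain k k (List.map f) c := by
  classical
  have : chains k P r ≤ LinearMap.eqLocus (chainMap k f) (Finsupp.lmapDomain k k (List.map f)) := by
    refine chains_induction k fun l hl => ?_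
    rw [LinearMap.mem_eqLocus, chainMap_single, if_pos]
    · simp
    · refine ⟨?_, ?_⟩
      · intro x hx
        rw [List.head?_map, Option.mem_def, Option.map_eq_some_iff] at hx
        obtain ⟨y, hy, rfl⟩ := hx
        exact hb y (hl.2.2.1 y hy)
      · intro x hx
        rw [List.getLast?_map, Option.mem_def, Option.map_eq_some_iff] at hx
        obtain ⟨y, hy, rfl⟩ := hx
        exact ht y (hl.2.2.2 y hy)
  exact this hc

theorem isBot_orderIso (e : P ≃o Q) (x : P) (h : IsBot x) : IsBot (e x) := fun y => by
  rw [← e.apply_symm_apply y]; exact e.monotone (h _)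

theorem isTop_orderIso (e : P ≃o Q) (x : P) (h : IsTop x) : IsTop (e x) := fun y => by
  rw [← e.apply_symm_apply y]; exact e.monotone (h _)

theorem chainMap_orderIso (e : P ≃o Q) {c : List P →₀ k} (hc : c ∈ chains k P r) :
    chainMap k e.toOrderEmbedding c = Finsupp.lmapDomain k k (List.map e) c :=
  chainMap_of_bounded k e.toOrderEmbedding (isBot_orderIso e) (isTop_orderIso e) hc

theorem RedHom.mul_comm (h : r + s = n) (h' : s + r = n) (x : RedHom k P r) (y : RedHom k Q s) :
    RedHom.map k (OrderIso.prodComm : P × Q ≃o Q × P).toOrderEmbedding n (RedHom.mul k h x y) =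
      (-1 : k) ^ (r * s) • RedHom.mul k h' y x := by
  subst h
  obtain ⟨z, hz, rfl⟩ := SubQuot.mk_surjective x
  obtain ⟨w, hw, rfl⟩ := SubQuot.mk_surjective y
  refine (SubQuot.mk_congr (w := (-1 : k) ^ (r * s) • shuffleMap k w z) ?_ _
    (Submodule.smul_mem _ _ (h' ▸ shuffleMap_cycles k w hw z hz))).trans rfl
  change chainMap k _ (shuffleMap k z w) = _
  refine (chainMap_orderIso k _ (shuffleMap_mem_chains k hz.1 hw.1)).trans ?_
  have h1 : ∀ l : List P, IsFull r l → ∀ w ∈ chains k Q s,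
      Finsupp.lmapDomain k k (List.map Prod.swap) (shuffleMap k (Finsupp.single l 1) w) =
        (-1 : k) ^ (r * s) • shuffleMap k w (Finsupp.single l 1) := by
    intro l hl w hw
    have : chains k Q s ≤ LinearMap.eqLocus
        (Finsupp.lmapDomain k k (List.map Prod.swap) ∘ₗ shuffleMap k (Finsupp.single l 1))
        ((-1 : k) ^ (r * s) • (shuffleMap k).flip (Finsupp.single l 1)) := by
      refine chains_induction k fun l' hl' => ?_
      rw [LinearMap.mem_eqLocus, LinearMap.comp_apply, LinearMap.smul_apply, LinearMap.flip_apply,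
        shuffleMap_single, shuffleMap_single, shuffle_comm, hl.1, hl'.1, Nat.add_sub_cancel,
        Nat.add_sub_cancel]
    exact this hw
  have : chains k P r ≤ LinearMap.eqLocus
      (Finsupp.lmapDomain k k (List.map Prod.swap) ∘ₗ (shuffleMap k).flip w)
      ((-1 : k) ^ (r * s) • shuffleMap k w) :=
    chains_induction k fun l hl => h1 l hl w hw.1
  exact this hz.1

/-- The associativity of products of posets. -/
def prodAssocIso (P Q R : Type*) [PartialOrder P] [PartialOrder Q] [PartialOrder R] :
    (P × Q) × R ≃o P × Q × R where
  toEquiv := Equiv.prodAssoc P Q R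
  map_rel_iff' := by
    rintro ⟨⟨a, b⟩, c⟩ ⟨⟨a', b'⟩, c'⟩
    exact and_assoc.symm

theorem RedHom.mul_assoc (h : r + s = m) (h' : m + t = d) (h₁ : s + t = n) (h₁' : r + n = d)
    (x : RedHom k P r) (y : RedHom k Q s) (z : RedHom k R t) :
    RedHom.map k (prodAssocIso P Q R).toOrderEmbedding d
      (RedHom.mul k h' (RedHom.mul k h x y) z) = RedHom.mul k h₁' x (RedHom.mul k h₁ y z) := by
  subst h h' h₁
  obtain ⟨u, hu, rfl⟩ := SubQuot.mk_surjective x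
  obtain ⟨v, hv, rfl⟩ := SubQuot.mk_surjective y
  obtain ⟨w, hw, rfl⟩ := SubQuot.mk_surjective z
  refine SubQuot.mk_congr ?_ _ _
  have key : ∀ (u : List P →₀ k) (v : List Q →₀ k) (w : List R →₀ k),
      Finsupp.lmapDomain k k (List.map (Equiv.prodAssoc P Q R))
        (shuffleMap k (shuffleMap k u v) w) = shuffleMap k u (shuffleMap k v w) := by
    intro u v w
    induction u using Finsupp.induction_linear with
    | zero => simp
    | add a b ha hb => simp only [map_add, LinearMap.add_apply, ha, hb]
    | single l a =>
    induction v using Finsupp.induction_linear with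
    | zero => simp
    | add a b ha hb => simp only [map_add, LinearMap.add_apply, ha, hb]
    | single l' b =>
    induction w using Finsupp.induction_linear with
    | zero => simp
    | add a b ha hb => simp only [map_add, ha, hb]
    | single l'' c =>
      rw [← Finsupp.smul_single_one l, ← Finsupp.smul_single_one l',
        ← Finsupp.smul_single_one l'']
      simp only [map_smul, LinearMap.smul_apply]
      rw [shuffleMap_single, shuffleMap_single, shuffle_assoc]
  change chainMap k _ (shuffleMap k (shuffleMap k u v) w) = shuffleMap k u (shuffleMap k v w)
  exact (chainMap_orderIso k (prodAssocIso P Q R) (shuffleMap_mem_chains k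
    (shuffleMap_mem_chains k hu.1 hv.1) hw.1)).trans (key u v w)

theorem shuffleMap_point_left (x : P) {c : List Q →₀ k} (hc : c ∈ chains k Q r) :
    shuffleMap k (Finsupp.single [x] 1) c = Finsupp.lmapDomain k k (List.map (x, ·)) c := by
  have : chains k Q r ≤ LinearMap.eqLocus (shuffleMap k (Finsupp.single [x] 1))
      (Finsupp.lmapDomain k k (List.map (x, ·))) := by
    refine chains_induction k fun l hl => ?_
    rcases l with _ | ⟨y, l⟩
    · exact absurd hl.1 (by simp)
    · rw [LinearMap.mem_eqLocus, shuffleMap_single, shuffle_nil_left']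
      simp
  exact this hc

theorem shuffleMap_point_right (y : Q) {c : List P →₀ k} (hc : c ∈ chains k P r) :
    shuffleMap k c (Finsupp.single [y] 1) = Finsupp.lmapDomain k k (List.map (·, y)) c := by
  have : chains k P r ≤ LinearMap.eqLocus ((shuffleMap k).flip (Finsupp.single [y] 1))
      (Finsupp.lmapDomain k k (List.map (·, y))) := by
    refine chains_induction k fun l hl => ?_
    rcases l with _ | ⟨x, l⟩
    · exact absurd hl.1 (by simp)
    · rw [LinearMap.mem_eqLocus, LinearMap.flip_apply, shuffleMap_single, shuffle_nil_right']
      simp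
  exact this hc

theorem RedHom.point_mul (h : 0 + r = r) (x : P) (hb : IsBot x) (ht : IsTop x)
    (f : Q ↪o P × Q) (hf : ∀ y, f y = (x, y)) (y : RedHom k Q r) :
    RedHom.mul k h (RedHom.point k x hb ht) y = RedHom.map k f r y := by
  obtain ⟨w, hw, rfl⟩ := SubQuot.mk_surjective y
  refine SubQuot.mk_congr ?_ _ _
  change shuffleMap k (Finsupp.single [x] 1) w = chainMap k f w
  rw [shuffleMap_point_left k x hw.1, chainMap_of_bounded k f _ _ hw.1]
  · rw [show (f : Q → P × Q) = (x, ·) from funext hf]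
  · intro y hy; rw [hf]; exact isBot_prod hb hy
  · intro y hy; rw [hf]; exact isTop_prod ht hy

theorem RedHom.mul_point (h : r + 0 = r) (y : Q) (hb : IsBot y) (ht : IsTop y)
    (f : P ↪o P × Q) (hf : ∀ x, f x = (x, y)) (x : RedHom k P r) :
    RedHom.mul k h x (RedHom.point k y hb ht) = RedHom.map k f r x := by
  obtain ⟨w, hw, rfl⟩ := SubQuot.mk_surjective x
  refine SubQuot.mk_congr ?_ _ _
  change shuffleMap k w (Finsupp.single [y] 1) = chainMap k f w
  rw [shuffleMap_point_right k y hw.1, chainMap_of_bounded k f _ _ hw.1]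
  · rw [show (f : P → P × Q) = (·, y) from funext hf]
  · intro x hx; rw [hf]; exact isBot_prod hx hb
  · intro x hx; rw [hf]; exact isTop_prod hx ht

end CrossLaws

/-! ### Whitney homology of Dowling posets on arbitrary sets -/

section WhitneyProduct

variable (k : Type u) [CommRing k] {P Q P' Q' : Type*} [PartialOrder P] [PartialOrder Q]
  [PartialOrder P'] [PartialOrder Q'] {r s n : ℕ}

theorem RedHom.mul_map_left (h : r + s = n) (f : P ↪o P') (x : RedHom k P r) (y : RedHom k Q s) :
    RedHom.mul k h (RedHom.map k f r x) y =
      RedHom.map k (prodEmb f (RelEmbedding.refl _)) n (RedHom.mul k h x y) := by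
  rw [← RedHom.mul_map, RedHom.map_id k (f := RelEmbedding.refl _) fun _ => rfl]

theorem RedHom.mul_map_right (h : r + s = n) (g : Q ↪o Q') (x : RedHom k P r) (y : RedHom k Q s) :
    RedHom.mul k h x (RedHom.map k g s y) =
      RedHom.map k (prodEmb (RelEmbedding.refl _) g) n (RedHom.mul k h x y) := by
  rw [← RedHom.mul_map, RedHom.map_id k (f := RelEmbedding.refl _) fun _ => rfl]

/-- The inclusion of a slice of a product. -/
def pairEmb (x : P) : Q ↪o P × Q := OrderEmbedding.ofMapLEIff (x, ·) fun a b => by simp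

/-- The inclusion of a slice of a product. -/
def pairEmb' (y : Q) : P ↪o P × Q := OrderEmbedding.ofMapLEIff (·, y) fun a b => by simp

@[simp] theorem prodEmb_apply (f : P ↪o P') (g : Q ↪o Q') (x : P × Q) :
    prodEmb f g x = (f x.1, g x.2) := rfl

@[simp] theorem pairEmb_apply (x : P) (y : Q) : pairEmb x y = (x, y) := rfl

@[simp] theorem pairEmb'_apply (x : P) (y : Q) : pairEmb' y x = (x, y) := rfl

@[simp] theorem prodAssocIso_apply {R : Type*} [PartialOrder R] (x : (P × Q) × R) :
    (prodAssocIso P Q R).toOrderEmbedding x = (x.1.1, x.1.2, x.2) := rfl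

@[simp] theorem prodComm_apply (x : P × Q) :
    (OrderIso.prodComm : P × Q ≃o Q × P).toOrderEmbedding x = (x.2, x.1) := rfl

@[simp] theorem refl_apply (x : P) : (RelEmbedding.refl (· ≤ ·) : P ↪o P) x = x := rfl

end WhitneyProduct

variable (k : Type u) [CommRing k] {G : Type u} [Group G] {S : Type u} [MulAction G S] {T : Set S}
  {I J K I' J' : Type} {p q r a b c : ℕ}

namespace Poset

/-- Disjoint union, on lower intervals. -/
def iicUnion (α : Poset G S T I) (β : Poset G S T J) :
    Set.Iic α × Set.Iic β ↪o Set.Iic (union α β) :=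
  OrderEmbedding.ofMapLEIff (fun x => ⟨union x.1 x.2, Set.mem_Iic.2 (union_le_union x.1.2 x.2.2)⟩)
    fun _ _ => union_le_union_iff

/-- Functoriality, on lower intervals. -/
def iicMap (φ : FBHom G I J) (α : Poset G S T I) : Set.Iic α ↪o Set.Iic (map φ α) :=
  OrderEmbedding.ofMapLEIff (fun x => ⟨map φ x, Set.mem_Iic.2 (map_le_map φ x.2)⟩)
    fun _ _ => (mapEmb φ).le_iff_le

@[simp] theorem coe_iicUnion (α : Poset G S T I) (β : Poset G S T J) (x : Set.Iic α × Set.Iic β) :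
    (iicUnion α β x : Poset G S T (I ⊕ J)) = union x.1 x.2 := rfl

@[simp] theorem coe_iicMap (φ : FBHom G I J) (α : Poset G S T I) (x : Set.Iic α) :
    (iicMap φ α x : Poset G S T J) = map φ x := rfl

theorem isBot_mk_bot : IsBot (⟨⊥, Set.self_mem_Iic⟩ : Set.Iic (⊥ : Poset G S T I)) :=
  fun _ => isBot_bot _

theorem isTop_mk (α : Poset G S T I) : IsTop (⟨α, Set.self_mem_Iic⟩ : Set.Iic α) :=
  fun x => x.2

end Poset

open Poset

variable (G T) in
/-- The Whitney homology of the Dowling poset of a set, in degree `r`. -/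
def W (I : Type) (r : ℕ) : Type u := WH k (Poset G S T I) r

instance : AddCommGroup (W k G T I r) := inferInstanceAs (AddCommGroup (WH k (Poset G S T I) r))
instance : Module k (W k G T I r) := inferInstanceAs (Module k (WH k (Poset G S T I) r))

namespace W

/-- The class in `W` of a class in the homology of a lower interval. -/
def incl (r : ℕ) (α : Poset G S T I) : RedHom k (Set.Iic α) r →ₗ[k] W k G T I r := WH.incl k r α

variable {k} in
/-- The linear map given by its restrictions to the summands. -/
def desc {M : Type*} [AddCommGroup M] [Module k M]
    (f : ∀ α : Poset G S T I, RedHom k (Set.Iic α) r →ₗ[k] M) : W k G T I r →ₗ[k] M :=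
  WH.desc f

variable {k} in
@[simp] theorem desc_incl {M : Type*} [AddCommGroup M] [Module k M]
    (f : ∀ α : Poset G S T I, RedHom k (Set.Iic α) r →ₗ[k] M) (α : Poset G S T I)
    (x : RedHom k (Set.Iic α) r) : desc f (incl k r α x) = f α x :=
  WH.desc_incl f α x

variable {k} in
theorem hom_ext {M : Type*} [AddCommGroup M] [Module k M] {f g : W k G T I r →ₗ[k] M}
    (h : ∀ α x, f (incl k r α x) = g (incl k r α x)) : f = g :=
  WH.hom_ext h

variable {k} in
theorem induction {N : Submodule k (W k G T I r)} (h : ∀ α x, incl k r α x ∈ N)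
    (w : W k G T I r) : w ∈ N := by
  have : N.mkQ = 0 := hom_ext fun α x => (Submodule.Quotient.mk_eq_zero N).2 (h α x)
  exact (Submodule.Quotient.mk_eq_zero N).1 (DFunLike.congr_fun this w)

theorem incl_map_congr {R : Type*} [PartialOrder R] {α β : Poset G S T I} (h : α = β)
    (f : R ↪o Set.Iic α) (g : R ↪o Set.Iic β)
    (hfg : ∀ x, (f x : Poset G S T I) = g x) (x : RedHom k R r) :
    incl k r α (RedHom.map k f r x) = incl k r β (RedHom.map k g r x) :=
  Dowling.incl_map_congr k h f g hfg x

/-- Functoriality of `W`. -/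
def act (φ : FBHom G I J) : W k G T I r →ₗ[k] W k G T J r :=
  desc fun α => incl k r (map φ α) ∘ₗ RedHom.map k (iicMap φ α) r

/-- The product of `W`, with the total degree as a variable. -/
def mul (h : p + q = r) : W k G T I p →ₗ[k] W k G T J q →ₗ[k] W k G T (I ⊕ J) r :=
  desc fun α => LinearMap.flip <| desc fun β =>
    ((RedHom.mul k h).compr₂ (incl k r (union α β) ∘ₗ RedHom.map k (iicUnion α β) r)).flip

/-- The unit of `W`. -/
def one [IsEmpty I] : W k G T I 0 :=
  incl k 0 ⊥ (RedHom.point k _ isBot_mk_bot (isTop_mk ⊥))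

theorem act_incl (φ : FBHom G I J) (α : Poset G S T I) (x : RedHom k (Set.Iic α) r) :
    act k φ (incl k r α x) = incl k r (map φ α) (RedHom.map k (iicMap φ α) r x) :=
  desc_incl _ _ _

theorem mul_incl (h : p + q = r) (α : Poset G S T I) (β : Poset G S T J)
    (x : RedHom k (Set.Iic α) p) (y : RedHom k (Set.Iic β) q) :
    mul k h (incl k p α x) (incl k q β y) =
      incl k r (union α β) (RedHom.map k (iicUnion α β) r (RedHom.mul k h x y)) := by
  simp [mul]

theorem one_eq [IsEmpty I] : (one k : W k G T I 0) =
    incl k 0 ⊥ (RedHom.point k _ isBot_mk_bot (isTop_mk ⊥)) := rfl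

theorem act_id (x : W k G T I r) : act k (FBHom.id G I) x = x := by
  have e : act k (FBHom.id G I) = (LinearMap.id : W k G T I r →ₗ[k] W k G T I r) := by
    refine hom_ext fun α x => ?_
    rw [act_incl, incl_map_congr k (Poset.map_id α) _ (RelEmbedding.refl _) fun z => by
      rw [coe_iicMap, refl_apply, Poset.map_id], RedHom.map_id k fun _ => rfl, LinearMap.id_apply]
  exact DFunLike.congr_fun e x

theorem act_comp (ψ : FBHom G J K) (φ : FBHom G I J) (x : W k G T I r) :
    act k (FBHom.comp ψ φ) x = act k ψ (act k φ x) := by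
  have e : act k (FBHom.comp ψ φ) = (act k ψ (T := T) (r := r)) ∘ₗ act k φ := by
    refine hom_ext fun α x => ?_
    rw [LinearMap.comp_apply, act_incl, act_incl, act_incl, ← RedHom.map_comp]
    exact incl_map_congr k (Poset.map_comp ψ φ α) _ _ (fun z => by
      simp only [RelEmbedding.coe_trans, Function.comp_apply, coe_iicMap, Poset.map_comp]) _
  exact DFunLike.congr_fun e x

theorem mul_act (h : p + q = r) (φ : FBHom G I I') (ψ : FBHom G J J') (x : W k G T I p)
    (y : W k G T J q) : mul k h (act k φ x) (act k ψ y) = act k (FBHom.sum φ ψ) (mul k h x y) := by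
  have e : (mul k h).compl₁₂ (act k φ) (act k ψ) =
      (mul k h (T := T)).compr₂ (act k (FBHom.sum φ ψ)) := by
    refine hom_ext fun α x => hom_ext fun β y => ?_
    simp only [LinearMap.compl₁₂_apply, LinearMap.compr₂_apply]
    rw [act_incl, act_incl, mul_incl, mul_incl, act_incl, RedHom.mul_map, ← RedHom.map_comp,
      ← RedHom.map_comp]
    exact incl_map_congr k (map_union φ ψ α β).symm _ _
      (fun z => by
      simp only [RelEmbedding.coe_trans, Function.comp_apply, coe_iicMap, coe_iicUnion,
        prodEmb_apply, map_union]) _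
  exact LinearMap.congr_fun₂ e x y

theorem mul_comm (h : p + q = r) (h' : q + p = r) (x : W k G T I p) (y : W k G T J q) :
    act k (FBHom.ofEquiv G (Equiv.sumComm I J)) (mul k h x y) =
      (-1 : k) ^ (p * q) • mul k h' y x := by
  have e : (mul k h).compr₂ (act k (FBHom.ofEquiv G (Equiv.sumComm I J))) =
      (-1 : k) ^ (p * q) • (mul k h' (T := T)).flip := by
    refine hom_ext fun α x => hom_ext fun β y => ?_
    simp only [LinearMap.compr₂_apply, LinearMap.smul_apply, LinearMap.flip_apply]
    rw [mul_incl, mul_incl, act_incl, ← map_smul, ← map_smul, ← RedHom.mul_comm k h h',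
      ← RedHom.map_comp, ← RedHom.map_comp]
    have e : ∀ (α : Poset G S T I) (β : Poset G S T J),
        map (FBHom.ofEquiv G (Equiv.sumComm I J)) (union α β) = union β α := by
      intro α β
      apply Poset.ext
      · funext i; rcases i with i | i <;> simp [map, union, FBHom.ofEquiv]
      · funext i g j
        rcases i with i | i <;> rcases j with j | j <;> simp [map, union, FBHom.ofEquiv]
    exact incl_map_congr k (e α β) _ _ (fun z => by
      simp only [RelEmbedding.coe_trans, Function.comp_apply, coe_iicMap, coe_iicUnion,
        prodComm_apply, e]) _
  exact LinearMap.congr_fun₂ e x y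

theorem map_union_assoc (α : Poset G S T I) (β : Poset G S T J) (γ : Poset G S T K) :
    map (FBHom.ofEquiv G (Equiv.sumAssoc I J K)) (union (union α β) γ) =
      union α (union β γ) := by
  apply Poset.ext
  · funext i; rcases i with i | i | i <;> simp [map, union, FBHom.ofEquiv]
  · funext i g j
    rcases i with i | i | i <;> rcases j with j | j | j <;> simp [map, union, FBHom.ofEquiv]

theorem mul_assoc_incl (h : p + q = a) (h' : a + r = b) (h₁ : q + r = c) (h₁' : p + c = b)
    (α : Poset G S T I) (β : Poset G S T J) (γ : Poset G S T K) (x : RedHom k (Set.Iic α) p)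
    (y : RedHom k (Set.Iic β) q) (z : RedHom k (Set.Iic γ) r) :
    act k (FBHom.ofEquiv G (Equiv.sumAssoc I J K))
      (mul k h' (mul k h (incl k p α x) (incl k q β y)) (incl k r γ z)) =
    mul k h₁' (incl k p α x) (mul k h₁ (incl k q β y) (incl k r γ z)) := by
  rw [mul_incl, mul_incl, mul_incl, mul_incl, act_incl, RedHom.mul_map_left,
    RedHom.mul_map_right, ← RedHom.mul_assoc k h h' h₁ h₁', ← RedHom.map_comp, ← RedHom.map_comp,
    ← RedHom.map_comp, ← RedHom.map_comp]
  generalize RedHom.mul k h' (RedHom.mul k h x y) z = w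
  exact incl_map_congr k (map_union_assoc α β γ) _ _
    (fun z => by
      simp only [RelEmbedding.coe_trans, Function.comp_apply, coe_iicMap, coe_iicUnion,
        prodEmb_apply, prodAssocIso_apply, refl_apply, map_union_assoc]) w

/-- Associativity may be checked on spanning sets. -/
theorem _root_.Dowling.assoc_of_span {X Y Z X' Z' M N : Type*} [AddCommGroup X] [AddCommGroup Y]
    [AddCommGroup Z] [AddCommGroup X'] [AddCommGroup Z'] [AddCommGroup M] [AddCommGroup N]
    [Module k X] [Module k Y] [Module k Z] [Module k X'] [Module k Z'] [Module k M] [Module k N]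
    (f : X →ₗ[k] Y →ₗ[k] X') (g : X' →ₗ[k] Z →ₗ[k] M) (e : M →ₗ[k] N)
    (f' : Y →ₗ[k] Z →ₗ[k] Z') (g' : X →ₗ[k] Z' →ₗ[k] N) {sX : Set X} {sY : Set Y} {sZ : Set Z}
    (hX : ∀ x, x ∈ Submodule.span k sX) (hY : ∀ y, y ∈ Submodule.span k sY)
    (hZ : ∀ z, z ∈ Submodule.span k sZ)
    (h : ∀ x ∈ sX, ∀ y ∈ sY, ∀ z ∈ sZ, e (g (f x y) z) = g' x (f' y z)) (x : X) (y : Y) (z : Z) :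
    e (g (f x y) z) = g' x (f' y z) := by
  induction hX x using Submodule.span_induction with
  | zero => simp
  | add a b _ _ ha hb => simp [ha, hb]
  | smul c a _ ha => simp [ha]
  | mem x hx =>
    induction hY y using Submodule.span_induction with
    | zero => simp
    | add a b _ _ ha hb => simp [ha, hb]
    | smul c a _ ha => simp [ha]
    | mem y hy =>
      induction hZ z using Submodule.span_induction with
      | zero => simp
      | add a b _ _ ha hb => simp [ha, hb]
      | smul c a _ ha => simp [ha]
      | mem z hz => exact h x hx y hy z hz

theorem mem_span (w : W k G T I r) :
    w ∈ Submodule.span k {w : W k G T I r | ∃ α x, incl k r α x = w} := by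
  refine induction (fun α x => Submodule.subset_span ?_) w
  exact ⟨α, x, rfl⟩

theorem mul_assoc (h : p + q = a) (h' : a + r = b) (h₁ : q + r = c) (h₁' : p + c = b)
    (x : W k G T I p) (y : W k G T J q) (z : W k G T K r) :
    act k (FBHom.ofEquiv G (Equiv.sumAssoc I J K)) (mul k h' (mul k h x y) z) =
      mul k h₁' x (mul k h₁ y z) := by
  refine assoc_of_span k (mul k h) (mul k h') (act k _) (mul k h₁) (mul k h₁') (mem_span k)
    (mem_span k) (mem_span k) ?_ x y z
  rintro _ ⟨α, x, rfl⟩ _ ⟨β, y, rfl⟩ _ ⟨γ, z, rfl⟩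
  exact mul_assoc_incl k h h' h₁ h₁' α β γ x y z

theorem one_mul [IsEmpty I] (h : 0 + r = r) (x : W k G T J r) :
    mul k h (one k : W k G T I 0) x = act k (FBHom.ofEquiv G (Equiv.emptySum I J).symm) x := by
  have e : mul k h (one k : W k G T I 0) = act k (FBHom.ofEquiv G (Equiv.emptySum I J).symm) := by
    refine hom_ext fun β y => ?_
    rw [act_incl, one_eq, mul_incl, RedHom.point_mul k h _ _ _ (pairEmb _) fun _ => rfl,
      ← RedHom.map_comp]
    have e : ∀ (β : Poset G S T J), union (⊥ : Poset G S T I) β =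
        map (FBHom.ofEquiv G (Equiv.emptySum I J).symm) β := by
      intro β
      apply Poset.ext
      · funext i; rcases i with i | i
        · exact isEmptyElim i
        · simp [map, union, FBHom.ofEquiv]
      · funext i g j
        rcases i with i | i
        · exact isEmptyElim i
        rcases j with j | j
        · exact isEmptyElim j
        simp [map, union, FBHom.ofEquiv]
    exact incl_map_congr k (e β) _ _ (fun z => by
      simp only [RelEmbedding.coe_trans, Function.comp_apply, coe_iicMap, coe_iicUnion,
        pairEmb_apply, e]) _
  rw [e]

theorem mul_one [IsEmpty J] (h : r + 0 = r) (x : W k G T I r) :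
    mul k h x (one k : W k G T J 0) = act k (FBHom.ofEquiv G (Equiv.sumEmpty I J).symm) x := by
  have e : (mul k h).flip (one k : W k G T J 0) =
      act k (FBHom.ofEquiv G (Equiv.sumEmpty I J).symm) := by
    refine hom_ext fun β y => ?_
    rw [LinearMap.flip_apply, act_incl, one_eq, mul_incl,
      RedHom.mul_point k h _ _ _ (pairEmb' _) fun _ => rfl, ← RedHom.map_comp]
    have e : ∀ (β : Poset G S T I), union β (⊥ : Poset G S T J) =
        map (FBHom.ofEquiv G (Equiv.sumEmpty I J).symm) β := by
      intro β
      apply Poset.ext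
      · funext i; rcases i with i | i
        · simp [map, union, FBHom.ofEquiv]
        · exact isEmptyElim i
      · funext i g j
        rcases i with i | i
        swap
        · exact isEmptyElim i
        rcases j with j | j
        swap
        · exact isEmptyElim j
        simp [map, union, FBHom.ofEquiv]
    exact incl_map_congr k (e β) _ _ (fun z => by
      simp only [RelEmbedding.coe_trans, Function.comp_apply, coe_iicMap, coe_iicUnion,
        pairEmb'_apply, e]) _
  exact DFunLike.congr_fun e x

theorem act_one [IsEmpty I] [IsEmpty J] (φ : FBHom G I J) :
    act k φ (one k : W k G T I 0) = one k := by
  have key : ∀ (α β : Poset G S T J), α = β → ∀ hα hα' hβ hβ',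
      incl k 0 α (RedHom.point k ⟨α, Set.self_mem_Iic⟩ hα hα') =
      incl k 0 β (RedHom.point k ⟨β, Set.self_mem_Iic⟩ hβ hβ') := by
    rintro α β rfl _ _ _ _
    rfl
  have e : map φ (⊥ : Poset G S T I) = ⊥ := Subsingleton.elim _ _
  have hb : IsBot (⟨map φ (⊥ : Poset G S T I), Set.self_mem_Iic⟩ : Set.Iic (map φ ⊥)) :=
    fun z => (congrArg (· ≤ z.1) e).mpr bot_le
  rw [one_eq, one_eq, act_incl]
  exact (congrArg (incl k 0 _) (RedHom.map_point k (iicMap φ ⊥) _ _ _ hb (isTop_mk _))).trans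
    (key _ _ e _ _ _ _)

end W

/-! ### The Whitney homology of the empty set -/

section Point

variable {P : Type*} [PartialOrder P] [Subsingleton P]

theorem isRanked_of_subsingleton : IsRanked P (fun _ => 0) 0 :=
  ⟨fun a b h => absurd (Subsingleton.elim a b) h.ne, fun _ _ => rfl, fun _ _ => rfl⟩

theorem RedHom.subsingleton_of_subsingleton {r : ℕ} (hr : r ≠ 0) : Subsingleton (RedHom k P r) := by
  refine subsingleton_of_forall_eq 0 fun x => ?_
  obtain ⟨z, hz, rfl⟩ := SubQuot.mk_surjective x
  refine SubQuot.mk_eq_zero hz ?_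
  have : chains k P r ≤ ⊥ := chains_induction k fun l hl => by
    have := (isRanked_of_subsingleton (P := P)).le hl
    omega
  rw [(Submodule.mem_bot k).1 (this hz.1)]
  exact Submodule.zero_mem _

/-- The coefficient of the generator in the homology of a point. -/
def pointCoeff (x : P) : RedHom k P 0 →ₗ[k] k :=
  Submodule.liftQ _ (Finsupp.lapply [x] ∘ₗ Submodule.subtype _) <| by
    intro z hz
    have h0 : z.1 ∈ boundaries k P 0 := hz
    rw [(isRanked_of_subsingleton (P := P)).boundaries_eq_bot k, Submodule.mem_bot] at h0
    rw [LinearMap.mem_ker, LinearMap.comp_apply, Submodule.subtype_apply, h0, map_zero]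

theorem pointCoeff_point (x : P) (hb : IsBot x) (ht : IsTop x) :
    pointCoeff k x (RedHom.point k x hb ht) = 1 := by
  change Finsupp.single [x] (1 : k) [x] = 1
  simp

theorem pointCoeff_smul (x : P) (hb : IsBot x) (ht : IsTop x) (c : RedHom k P 0) :
    pointCoeff k x c • RedHom.point k x hb ht = c := by
  obtain ⟨z, hz, rfl⟩ := SubQuot.mk_surjective c
  refine SubQuot.mk_congr (z := z [x] • Finsupp.single [x] (1 : k)) ?_ (Submodule.smul_mem _ _
    (Submodule.mem_inf.2 ⟨single_mem_chains k ⟨rfl, List.isChain_singleton _,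
      by simpa [Ends] using ⟨hb, ht⟩⟩,
      by simp [bdry]⟩)) hz
  have : chains k P 0 ≤ LinearMap.eqLocus
      ((Finsupp.lapply [x]).smulRight (Finsupp.single [x] (1 : k))) LinearMap.id := by
    refine chains_induction k fun l hl => ?_
    obtain ⟨y, rfl⟩ := List.length_eq_one_iff.1 hl.1
    rw [Subsingleton.elim y x]
    simp [LinearMap.mem_eqLocus]
  exact this hz.1

end Point

namespace W

theorem subsingleton_of_isEmpty [IsEmpty I] (hr : r ≠ 0) : Subsingleton (W k G T I r) := by
  have h : (LinearMap.id : W k G T I r →ₗ[k] W k G T I r) = 0 := hom_ext fun α x => by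
    have := RedHom.subsingleton_of_subsingleton k (P := Set.Iic α) hr
    rw [Subsingleton.elim x 0]; simp
  exact subsingleton_of_forall_eq 0 fun x => DFunLike.congr_fun h x

theorem bijective_smul_one [IsEmpty I] :
    Function.Bijective fun c : k => c • (one k : W k G T I 0) := by
  let f : W k G T I 0 →ₗ[k] k := desc fun α => pointCoeff k ⟨α, Set.self_mem_Iic⟩
  have h1 : f (one k) = 1 := by
    rw [one_eq]
    exact (desc_incl _ _ _).trans (pointCoeff_point k _ _ _)
  have h2 : f.smulRight (one k : W k G T I 0) = LinearMap.id := hom_ext fun α x => by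
    have hα : α = ⊥ := Subsingleton.elim _ _
    subst hα
    rw [LinearMap.smulRight_apply, one_eq, desc_incl, ← map_smul, pointCoeff_smul]
    rfl
  refine ⟨fun c d h => ?_, fun x => ⟨f x, DFunLike.congr_fun h2 x⟩⟩
  have := congrArg f h
  simpa [h1] using this

end W

/-! ### The GTCA of Whitney homologies -/

section WhitneyGTCA

variable (k : Type u) [CommRing k] {G : Type u} [Group G] {S : Type u} [MulAction G S] {T : Set S}
  {I J K I' J' : Type} {p q r a b c : ℕ}

namespace W

theorem mul_act_left (h : p + q = r) (φ : FBHom G I I') (x : W k G T I p) (y : W k G T J q) :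
    mul k h (act k φ x) y = act k (FBHom.sum φ (FBHom.id G J)) (mul k h x y) := by
  rw [← mul_act, act_id]

theorem mul_act_right (h : p + q = r) (ψ : FBHom G J J') (x : W k G T I p) (y : W k G T J q) :
    mul k h x (act k ψ y) = act k (FBHom.sum (FBHom.id G I) ψ) (mul k h x y) := by
  rw [← mul_act, act_id]

theorem act_congr {φ ψ : FBHom G I J} (h : φ = ψ) (x : W k G T I r) : act k φ x = act k ψ x := by
  rw [h]

theorem act_mul_one [IsEmpty J] (h : r + 0 = r) (x : W k G T I r) :
    act k (FBHom.ofEquiv G (Equiv.sumEmpty I J)) (mul k h x (one k : W k G T J 0)) = x := by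
  rw [mul_one, ← act_comp, ← FBHom.ofEquiv_trans, Equiv.symm_trans_self]
  exact act_id k x

end W

section

variable (G S T) in
/-- The values of the algebra `whitney` are Whitney homologies of the sets `[n]`. -/
def toW (n p : ℕ) : (whitney k G S T).obj n p ≃ₗ[k] W k G T (Fin n) p := LinearEquiv.refl k _

theorem toW_act {n p : ℕ} (w : Wr G n) (x : (whitney k G S T).obj n p) :
    toW k G S T n p ((whitney k G S T).act n p w x) = W.act k w (toW k G S T n p x) := rfl

theorem toW_one : toW k G S T 0 0 (whitney k G S T).one = W.one k := rfl

theorem toW_mul {m n p q : ℕ} (x : (whitney k G S T).obj m p) (y : (whitney k G S T).obj n q) :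
    toW k G S T (m + n) (p + q) ((whitney k G S T).mul m n p q x y) =
      W.act k (FBHom.ofEquiv G finSumFinEquiv)
        (W.mul k rfl (toW k G S T m p x) (toW k G S T n q y)) := by
  have e : (((whitney k G S T).mul m n p q).compr₂ (toW k G S T (m + n) (p + q)).toLinearMap) =
      (((W.mul k rfl).compl₁₂ (toW k G S T m p).toLinearMap (toW k G S T n q).toLinearMap).compr₂
        (W.act k (FBHom.ofEquiv G finSumFinEquiv))) := by
    refine WH.hom_ext fun α x => WH.hom_ext fun β y => ?_
    refine ((congrArg (WH.map k (Poset.mulEmb G S T m n) (p + q))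
      (WH.cross_incl_incl k p q α β x y)).trans (WH.map_incl k _ _ _ _)).trans ?_
    have e1 := W.mul_incl k (T := T) (rfl : p + q = p + q) α β x y
    have e2 := congrArg (W.act k (FBHom.ofEquiv G finSumFinEquiv)) e1
    refine Eq.trans ?_ (e2.trans (W.act_incl k _ _ _)).symm
    rw [← RedHom.map_comp, ← RedHom.map_comp]
    exact incl_map_congr k (R := Set.Iic α × Set.Iic β) rfl _ _ (fun _ => rfl) _
  exact LinearMap.congr_fun₂ e x y

/-- A criterion for equality of elements in equal arities and degrees. -/
theorem elem_congr {n n' p p' : ℕ} {x : (whitney k G S T).obj n p}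
    {y : (whitney k G S T).obj n' p'} (F : ∀ d, p = d → W k G T (Fin n) d)
    (hF : toW k G S T n p x = F p rfl) (hn : n = n') (hp : p = p')
    (h : W.act k (FBHom.ofEquiv G (finCongr hn)) (F p' hp) = toW k G S T n' p' y) :
    (whitney k G S T).elem x = (whitney k G S T).elem y := by
  subst hn hp
  rw [← hF] at h
  have : x = y := (toW k G S T n p).injective ((W.act_id k _).symm.trans h)
  rw [this]

variable (G S T) in
/-- The axioms are the laws for `W` on arbitrary sets, transported along the bijections `[m] ⊔ [n]
≃ [m + n]`. -/
theorem whitney_isGTCA : (whitney k G S T).IsGTCA where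
  mul_assoc {l m n p q r} x y z := by
    refine elem_congr k (fun d hd => W.act k (FBHom.comp (FBHom.ofEquiv G finSumFinEquiv)
      (FBHom.sum (FBHom.ofEquiv G finSumFinEquiv) (FBHom.id G _))) (W.mul k hd (W.mul k rfl
        (toW k G S T l p x) (toW k G S T m q y)) (toW k G S T n r z))) ?_
      (Nat.add_assoc l m n) (Nat.add_assoc p q r) ?_
    · rw [toW_mul, toW_mul, W.mul_act_left, ← W.act_comp]
    · rw [toW_mul, toW_mul, W.mul_act_right, ← W.act_comp, ← W.act_comp,
        ← W.mul_assoc k rfl (Nat.add_assoc p q r) rfl rfl, ← W.act_comp]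
      refine W.act_congr k ?_ _
      apply FBHom.ext
      · ext ((i | i) | i) <;> simp [FBHom.comp, FBHom.ofEquiv, FBHom.sum, FBHom.id, Nat.add_assoc]
      · funext i
        rcases i with (i | i) | i <;> simp [FBHom.comp, FBHom.ofEquiv, FBHom.sum, FBHom.id]
  one_mul {n p} x := by
    refine elem_congr k (fun d hd => W.act k (FBHom.ofEquiv G finSumFinEquiv)
      (W.mul k hd (W.one k) (toW k G S T n p x))) ?_ (Nat.zero_add n) (Nat.zero_add p) ?_
    · rw [toW_mul, toW_one]
    · rw [W.one_mul, ← W.act_comp, ← W.act_comp]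
      refine (W.act_congr k ?_ _).trans (W.act_id k _)
      apply FBHom.ext
      · ext i; simp [FBHom.comp, FBHom.ofEquiv, FBHom.id]
      · funext i; simp [FBHom.comp, FBHom.ofEquiv, FBHom.id]
  mul_one {n p} x := by
    refine elem_congr k (fun d hd => W.act k (FBHom.ofEquiv G finSumFinEquiv)
      (W.mul k hd (toW k G S T n p x) (W.one k))) ?_ rfl rfl ?_
    · rw [toW_mul, toW_one]
    · rw [W.mul_one, ← W.act_comp, ← W.act_comp]
      refine (W.act_congr k ?_ _).trans (W.act_id k _)
      apply FBHom.ext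
      · ext i; rfl
      · funext i; simp [FBHom.comp, FBHom.ofEquiv, FBHom.id]
  mul_comm {m n p q} x y := by
    refine elem_congr k (fun d hd => W.act k (FBHom.comp (FBHom.ofEquiv G (TwAlg.blockSwap m n))
      (FBHom.ofEquiv G finSumFinEquiv)) (W.mul k hd (toW k G S T m p x) (toW k G S T n q y))) ?_
      (Nat.add_comm m n) (Nat.add_comm p q) ?_
    · rw [toW_act, toW_mul, ← W.act_comp]
    · rw [map_smul, toW_mul, ← map_smul, ← W.mul_comm k (Nat.add_comm p q) rfl, ← W.act_comp,
        ← W.act_comp]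
      refine W.act_congr k ?_ _
      apply FBHom.ext
      · ext (i | i) <;> simp [FBHom.comp, FBHom.ofEquiv, TwAlg.blockSwap]
      · funext i; rcases i with i | i <;> simp [FBHom.comp, FBHom.ofEquiv]
  unital := W.bijective_smul_one k (T := T) (I := Fin 0)
  unital' p hp := W.subsingleton_of_isEmpty k (T := T) (I := Fin 0) hp

end

end WhitneyGTCA

/-! ### Splitting a lower interval of a disjoint union -/

namespace Poset

variable {G : Type*} [Group G] {S : Type*} [MulAction G S] {T : Set S} {I J K I' J' : Type*}

theorem map_zero_apply (φ : FBHom G I J) (α : Poset G S T I) (i : I) :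
    (map φ α).zero (φ.toEquiv i) = (α.zero i).map (φ.color i • ·) := by
  simp [map]

theorem map_rel_apply (φ : FBHom G I J) (α : Poset G S T I) {i j : I} {g : G} :
    (map φ α).rel (φ.toEquiv i) g (φ.toEquiv j) ↔
      α.rel i ((φ.color i)⁻¹ * g * φ.color j) j := by
  simp [map]

theorem exists_map_rel (φ : FBHom G I J) (α : Poset G S T I) {i j : I} :
    (∃ g, (map φ α).rel (φ.toEquiv i) g (φ.toEquiv j)) ↔ ∃ g, α.rel i g j := by
  constructor
  · rintro ⟨g, hg⟩
    exact ⟨_, (map_rel_apply φ α).1 hg⟩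
  · rintro ⟨g, hg⟩
    refine ⟨φ.color i * g * (φ.color j)⁻¹, (map_rel_apply φ α).2 ?_⟩
    simpa [mul_assoc] using hg

/-- The numbers of blocks of isomorphic elements agree. -/
theorem numBlocks_map (φ : FBHom G I J) (α : Poset G S T I) :
    (map φ α).numBlocks = α.numBlocks := by
  refine (Nat.card_congr (Quotient.congr
    (φ.toEquiv.subtypeEquiv fun i => ?_) fun i j => ?_)).symm
  · simp [map]
  · exact (exists_map_rel φ α).symm

theorem rank_map (φ : FBHom G I J) (α : Poset G S T I) : (map φ α).rank = α.rank := by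
  rw [rank, rank, numBlocks_map, Nat.card_congr φ.toEquiv]

theorem numBlocks_union [Finite I] [Finite J] (β : Poset G S T I) (γ : Poset G S T J) :
    (union β γ).numBlocks = β.numBlocks + γ.numBlocks := by
  let f : β.Blocks ⊕ γ.Blocks → (union β γ).Blocks := Sum.elim
    (Quotient.map (fun i => ⟨.inl i.1, i.2⟩) fun i j h => h)
    (Quotient.map (fun i => ⟨.inr i.1, i.2⟩) fun i j h => h)
  have hf : Function.Bijective f := by
    constructor
    · rintro (a | a) (b | b) <;> induction a using Quotient.inductionOn <;>
        induction b using Quotient.inductionOn <;> intro h <;> obtain ⟨g, hg⟩ := Quotient.exact h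
      · exact congrArg Sum.inl (Quotient.sound ⟨g, hg⟩)
      · exact hg.elim
      · exact hg.elim
      · exact congrArg Sum.inr (Quotient.sound ⟨g, hg⟩)
    · intro b
      induction b using Quotient.inductionOn with | _ b
      obtain ⟨i | i, hi⟩ := b
      · exact ⟨.inl (Quotient.mk _ ⟨i, hi⟩), rfl⟩
      · exact ⟨.inr (Quotient.mk _ ⟨i, hi⟩), rfl⟩
  rw [numBlocks, ← Nat.card_congr (Equiv.ofBijective f hf), Nat.card_sum]
  rfl

theorem rank_union [Finite I] [Finite J] (β : Poset G S T I) (γ : Poset G S T J) :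
    (union β γ).rank = β.rank + γ.rank := by
  have h1 := (union β γ).rank_add_numBlocks
  have h2 := β.rank_add_numBlocks
  have h3 := γ.rank_add_numBlocks
  rw [numBlocks_union, Nat.card_sum] at h1
  omega

/-- No block, and no orbit of colours in the zero block, meets both summands. -/
def Sep (α : Poset G S T (I ⊕ J)) : Prop :=
  (∀ i g j, ¬ α.rel (.inl i) g (.inr j)) ∧
    ∀ i (g : G) j s, α.zero (.inr j) = some s → α.zero (.inl i) ≠ some (g • s)

theorem Sep.mono {α β : Poset G S T (I ⊕ J)} (h : Sep β) (hαβ : α ≤ β) : Sep α := by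
  refine ⟨fun i g j hr => ?_, fun i g j s hs hs' => h.2 i g j s (hαβ.1 _ _ hs) (hαβ.1 _ _ hs')⟩
  rcases hαβ.2 _ _ _ hr with hr | ⟨s, hs, hs'⟩
  · exact h.1 _ _ _ hr
  · exact h.2 i g j s hs hs'

/-- The restriction to the left summand. -/
def left (α : Poset G S T (I ⊕ J)) (h : Sep α) : Poset G S T I where
  zero i := α.zero (.inl i)
  rel i g j := α.rel (.inl i) g (.inl j)
  rel_refl i := α.rel_refl _
  rel_symm := α.rel_symm
  rel_trans := α.rel_trans
  rel_unique := α.rel_unique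
  mem_of_unique s := by
    rintro ⟨i, ⟨g, hi⟩, hu⟩
    refine α.mem_of_unique s ⟨.inl i, ⟨g, hi⟩, ?_⟩
    rintro (j | j) ⟨g', hj⟩
    · exact congrArg _ (hu j ⟨g', hj⟩)
    · refine absurd ?_ (h.2 i (g * g'⁻¹) j _ hj)
      rw [hi, mul_smul, inv_smul_smul]

/-- The restriction to the right summand. -/
def right (α : Poset G S T (I ⊕ J)) (h : Sep α) : Poset G S T J where
  zero i := α.zero (.inr i)
  rel i g j := α.rel (.inr i) g (.inr j)
  rel_refl i := α.rel_refl _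
  rel_symm := α.rel_symm
  rel_trans := α.rel_trans
  rel_unique := α.rel_unique
  mem_of_unique s := by
    rintro ⟨i, ⟨g, hi⟩, hu⟩
    refine α.mem_of_unique s ⟨.inr i, ⟨g, hi⟩, ?_⟩
    rintro (j | j) ⟨g', hj⟩
    · refine absurd ?_ (h.2 j (g' * g⁻¹) i _ hi)
      rw [hj, mul_smul, inv_smul_smul]
    · exact congrArg _ (hu j ⟨g', hj⟩)

theorem union_left_right (α : Poset G S T (I ⊕ J)) (h : Sep α) :
    union (α.left h) (α.right h) = α := by
  apply Poset.ext
  · funext i; rcases i with i | i <;> rfl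
  · funext i g j
    rcases i with i | i <;> rcases j with j | j
    · rfl
    · exact propext ⟨False.elim, h.1 i g j⟩
    · exact propext ⟨False.elim, fun hr => h.1 _ _ _ (α.rel_symm hr)⟩
    · rfl

/-- The product of lower intervals, in a lower interval of the disjoint union. -/
def splitEmb {α : Poset G S T K} {β : Poset G S T I} {γ : Poset G S T J}
    (φ : FBHom G (I ⊕ J) K) (hα : map φ (union β γ) = α) :
    Set.Iic β × Set.Iic γ ↪o Set.Iic α :=
  OrderEmbedding.ofMapLEIff
    (fun x => ⟨map φ (union x.1 x.2),
      Set.mem_Iic.2 (hα ▸ map_le_map φ (union_le_union x.1.2 x.2.2))⟩)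
    fun _ _ => ((mapEmb φ).le_iff_le).trans union_le_union_iff

@[simp] theorem coe_splitEmb {α : Poset G S T K} {β : Poset G S T I} {γ : Poset G S T J}
    (φ : FBHom G (I ⊕ J) K) (hα : map φ (union β γ) = α) (x : Set.Iic β × Set.Iic γ) :
    (splitEmb φ hα x : Poset G S T K) = map φ (union x.1 x.2) := rfl

theorem map_map_symm (φ : FBHom G I J) (α : Poset G S T J) : map φ (map φ.symm α) = α := by
  apply map_injective φ.symm
  rw [map_symm_map]

/-- If no block and no orbit of colours meets both summands, this also holds below, so that every
smaller element is a disjoint union: the lower interval is a product. -/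
theorem splitEmb_surjective {α : Poset G S T K} {β : Poset G S T I} {γ : Poset G S T J}
    (φ : FBHom G (I ⊕ J) K) (hα : map φ (union β γ) = α) (hs : Sep (union β γ)) :
    Function.Surjective (splitEmb φ hα) := by
  rintro ⟨x, hx⟩
  have h1 : map φ.symm x ≤ union β γ := by
    subst hα
    simpa only [map_symm_map] using map_le_map φ.symm hx
  have h2 := hs.mono h1
  have h3 := union_left_right _ h2
  have h4 := union_le_union_iff.1 (h3.le.trans h1)
  refine ⟨(⟨_, h4.1⟩, ⟨_, h4.2⟩), Subtype.ext ?_⟩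
  rw [coe_splitEmb]
  change map φ (union (left _ h2) (right _ h2)) = x
  rw [h3, map_map_symm]

theorem isRanked_iic [Finite I] (α : Poset G S T I) :
    IsRanked (Set.Iic α) (fun x => x.1.rank) α.rank := by
  refine ⟨fun _ _ h => rank_strictMono h, fun x hx => ?_, fun x hx => ?_⟩
  · rw [le_antisymm (hx ⟨⊥, Set.mem_Iic.2 bot_le⟩) bot_le, rank_bot]
  · rw [le_antisymm x.2 (hx ⟨α, Set.self_mem_Iic⟩)]

end Poset

section Split

open Poset

variable (k : Type u) [CommRing k]

theorem RedHom.map_congr {P Q : Type*} [PartialOrder P] [PartialOrder Q] {f g : P ↪o Q}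
    (h : ∀ x, f x = g x) {r : ℕ} (x : RedHom k P r) : RedHom.map k f r x = RedHom.map k g r x := by
  rw [RelEmbedding.ext h]

theorem RedHom.map_symm_map {P Q : Type*} [PartialOrder P] [PartialOrder Q] (e : P ≃o Q) {r : ℕ}
    (x : RedHom k P r) :
    RedHom.map k e.symm.toOrderEmbedding r (RedHom.map k e.toOrderEmbedding r x) = x := by
  rw [← RedHom.map_comp]
  exact RedHom.map_id k (fun x => e.symm_apply_apply x) r x

theorem RedHom.map_map_symm {P Q : Type*} [PartialOrder P] [PartialOrder Q] (e : P ≃o Q) {r : ℕ}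
    (x : RedHom k Q r) :
    RedHom.map k e.toOrderEmbedding r (RedHom.map k e.symm.toOrderEmbedding r x) = x :=
  RedHom.map_symm_map k e.symm x

variable {G : Type*} [Group G] {S : Type*} [MulAction G S] {T : Set S} {I J K : Type*} {p : ℕ}

theorem subsingleton_iic [Finite I] (α : Poset G S T I) (h : p ≠ α.rank) :
    Subsingleton (RedHom k (Set.Iic α) p) :=
  (concentrated_iic k α).subsingleton k h

/-- The Künneth isomorphism for a lower interval below a disjoint union, in top degree. -/
theorem exists_split [Finite I] [Finite J] {α : Poset G S T K} {β : Poset G S T I}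
    {γ : Poset G S T J} (φ : FBHom G (I ⊕ J) K) (hα : map φ (union β γ) = α)
    (hs : Sep (union β γ)) (h : β.rank + γ.rank = p) :
    ∃ t : RedHom k (Set.Iic α) p →ₗ[k]
        RedHom k (Set.Iic β) β.rank ⊗[k] RedHom k (Set.Iic γ) γ.rank,
      (∀ x y, t (RedHom.map k (splitEmb φ hα) p (RedHom.mul k h x y)) = x ⊗ₜ y) ∧
      ∀ z, RedHom.map k (splitEmb φ hα) p (TensorProduct.lift (RedHom.mul k h) (t z)) = z := by
  subst h
  obtain ⟨π, hπc, hπ⟩ := exists_projection_cycles k (P := Set.Iic β) β.rank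
    fun r hr => concentrated_iic k β r hr.ne
  obtain ⟨π', hπc', hπ'⟩ := exists_projection_cycles k (P := Set.Iic γ) γ.rank
    fun r hr => concentrated_iic k γ r hr.ne
  obtain ⟨t, ht, ht'⟩ := exists_kunneth k (isRanked_iic β) (isRanked_iic γ)
    (x₁ := ⟨β, Set.self_mem_Iic⟩)
    (y₀ := ⟨⊥, Set.mem_Iic.2 bot_le⟩) (fun x => x.2) (fun x => bot_le (a := x.1)) hπc hπ hπc' hπ'
  let e : Set.Iic β × Set.Iic γ ≃o Set.Iic α :=
    RelIso.ofSurjective (splitEmb φ hα) (splitEmb_surjective φ hα hs)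
  have he : e.toOrderEmbedding = splitEmb φ hα := rfl
  refine ⟨t ∘ₗ RedHom.map k e.symm.toOrderEmbedding _, fun x y => ?_, fun z => ?_⟩
  · rw [LinearMap.comp_apply, ← he, RedHom.map_symm_map]
    exact ht x y
  · rw [LinearMap.comp_apply, ← he]
    exact (congrArg _ (ht' _)).trans (RedHom.map_map_symm k e z)

end Split

/-! ### Types of points -/

namespace Poset

variable {G : Type u} [Group G] {S : Type u} [MulAction G S] {T : Set S} {I J K I' J' : Type}

/-- The type of the point `i`: the orbit of its colour if it lies in the zero block, and
the size of its block otherwise. -/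
def type (α : Poset G S T I) (i : I) : ℕ ⊕ MulAction.orbitRel.Quotient G S :=
  match α.zero i with
  | none => .inl (Nat.card {j // ∃ g, α.rel i g j})
  | some s => .inr (Quotient.mk _ s)

theorem type_of_none {α : Poset G S T I} {i : I} (h : α.zero i = none) :
    α.type i = .inl (Nat.card {j // ∃ g, α.rel i g j}) := by
  rw [type, h]

theorem type_of_some {α : Poset G S T I} {i : I} {s : S} (h : α.zero i = some s) :
    α.type i = .inr (Quotient.mk _ s) := by
  rw [type, h]

theorem type_map (φ : FBHom G I J) (α : Poset G S T I) (i : I) :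
    (map φ α).type (φ.toEquiv i) = α.type i := by
  cases h : α.zero i with
  | none =>
    have h' : (map φ α).zero (φ.toEquiv i) = none := by simp [map, h]
    rw [type_of_none h, type_of_none h']
    exact congrArg _ (Nat.card_congr
      (φ.toEquiv.subtypeEquiv fun j => (exists_map_rel φ α).symm)).symm
  | some s =>
    have h' : (map φ α).zero (φ.toEquiv i) = some (φ.color i • s) := by simp [map, h]
    rw [type_of_some h, type_of_some h']
    exact congrArg _ (Quotient.sound (MulAction.orbitRel_apply.2 (MulAction.mem_orbit _ _)))

theorem type_union_inl (β : Poset G S T I) (γ : Poset G S T J) (i : I) :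
    (union β γ).type (.inl i) = β.type i := by
  cases h : β.zero i with
  | none =>
    have h' : (union β γ).zero (.inl i) = none := h
    rw [type_of_none h, type_of_none h']
    refine congrArg _ (Nat.card_congr ?_)
    exact
      { toFun := fun
          | ⟨.inl j, hj⟩ => ⟨j, hj⟩
          | ⟨.inr j, hj⟩ => (hj.choose_spec : False).elim
        invFun := fun j => ⟨.inl j.1, j.2⟩
        left_inv := by
          rintro ⟨j | j, hj⟩
          · rfl
          · exact (hj.choose_spec : False).elim
        right_inv := fun _ => rfl }
  | some s =>
    have h' : (union β γ).zero (.inl i) = some s := h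
    rw [type_of_some h, type_of_some h']

theorem map_sumComm (β : Poset G S T I) (γ : Poset G S T J) :
    map (FBHom.ofEquiv G (Equiv.sumComm I J)) (union β γ) = union γ β := by
  apply Poset.ext
  · funext i; rcases i with i | i <;> simp [map, union, FBHom.ofEquiv]
  · funext i g j
    rcases i with i | i <;> rcases j with j | j <;> simp [map, union, FBHom.ofEquiv]

theorem type_union_inr (β : Poset G S T I) (γ : Poset G S T J) (i : J) :
    (union β γ).type (.inr i) = γ.type i := by
  rw [← type_map (FBHom.ofEquiv G (Equiv.sumComm I J)), map_sumComm]
  exact type_union_inl γ β i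

theorem type_eq_of_rel {α : Poset G S T I} {i j : I} {g : G} (h : α.rel i g j) :
    α.type i = α.type j := by
  rw [type_of_none (α.zero_left h), type_of_none (α.zero_right h)]
  refine congrArg _ (Nat.card_congr (Equiv.subtypeEquivRight fun l => ?_))
  exact ⟨fun ⟨c, hc⟩ => ⟨_, α.rel_trans (α.rel_symm h) hc⟩, fun ⟨c, hc⟩ => ⟨_, α.rel_trans h hc⟩⟩

/-- All the points have types in `U`. -/
def HasTypes (U : Set (ℕ ⊕ MulAction.orbitRel.Quotient G S)) (α : Poset G S T I) : Prop :=
  ∀ i, α.type i ∈ U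

variable {U V : Set (ℕ ⊕ MulAction.orbitRel.Quotient G S)}

theorem hasTypes_map (φ : FBHom G I J) {α : Poset G S T I} :
    HasTypes U (map φ α) ↔ HasTypes U α := by
  refine ⟨fun h i => by rw [← type_map φ]; exact h _, fun h j => ?_⟩
  obtain ⟨i, rfl⟩ := φ.toEquiv.surjective j
  rw [type_map]; exact h i

theorem hasTypes_union {β : Poset G S T I} {γ : Poset G S T J} :
    HasTypes U (union β γ) ↔ HasTypes U β ∧ HasTypes U γ := by
  refine ⟨fun h => ⟨fun i => ?_, fun i => ?_⟩, fun h => ?_⟩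
  · rw [← type_union_inl β γ]; exact h _
  · rw [← type_union_inr β γ]; exact h _
  · rintro (i | i)
    · rw [type_union_inl]; exact h.1 i
    · rw [type_union_inr]; exact h.2 i

theorem HasTypes.mono (h : U ⊆ V) {α : Poset G S T I} (hα : HasTypes U α) : HasTypes V α :=
  fun i => h (hα i)

/-- Summands with points of different types are separated. -/
theorem sep_of_types (hUV : Disjoint U V) {α : Poset G S T (I ⊕ J)}
    (hU : ∀ i, α.type (.inl i) ∈ U) (hV : ∀ j, α.type (.inr j) ∈ V) : Sep α := by
  refine ⟨fun i g j hr => ?_, fun i g j s hs hs' => ?_⟩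
  · exact Set.disjoint_left.1 hUV (hU i) (type_eq_of_rel hr ▸ hV j)
  · refine Set.disjoint_left.1 hUV (hU i) ?_
    have e : α.type (.inl i) = α.type (.inr j) := by
      rw [type_of_some hs, type_of_some hs']
      exact congrArg _ (Quotient.sound (MulAction.orbitRel_apply.2 (MulAction.mem_orbit _ _)))
    rw [e]; exact hV j

theorem sep_union_of_types (hUV : Disjoint U V) {β : Poset G S T I} {γ : Poset G S T J}
    (hβ : HasTypes U β) (hγ : HasTypes V γ) : Sep (union β γ) :=
  sep_of_types hUV (fun i => by rw [type_union_inl]; exact hβ i)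
    fun i => by rw [type_union_inr]; exact hγ i

/-- Every element with points of types in `U` and `V` is a disjoint union of one with types in `U`
and one with types in `V`. -/
theorem exists_decomposition [Finite K] (hUV : Disjoint U V) {α : Poset G S T K}
    (hα : HasTypes (U ∪ V) α) : ∃ (i j : ℕ) (φ : FBHom G (Fin i ⊕ Fin j) K)
      (β : Poset G S T (Fin i)) (γ : Poset G S T (Fin j)),
      HasTypes U β ∧ HasTypes V γ ∧ map φ (union β γ) = α := by
  classical
  have := Fintype.ofFinite K
  let e : Fin (Fintype.card {x // α.type x ∈ U}) ⊕ Fin (Fintype.card {x // ¬ α.type x ∈ U}) ≃ K :=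
    (Equiv.sumCongr (Fintype.equivFin _).symm (Fintype.equivFin _).symm).trans
      (Equiv.sumCompl fun x => α.type x ∈ U)
  let φ := FBHom.ofEquiv G e
  have hty : ∀ x, (map φ.symm α).type x = α.type (e x) := fun x => by
    rw [← type_map φ, map_map_symm]; rfl
  have hU : ∀ x, (map φ.symm α).type (.inl x) ∈ U := fun x => by
    rw [hty]; exact ((Fintype.equivFin {x // α.type x ∈ U}).symm x).2
  have hV : ∀ x, (map φ.symm α).type (.inr x) ∈ V := fun x => by
    rw [hty]
    exact (hα _).resolve_left ((Fintype.equivFin {x // ¬ α.type x ∈ U}).symm x).2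
  have hs := sep_of_types hUV hU hV
  have hlr := union_left_right _ hs
  refine ⟨_, _, φ, left _ hs, right _ hs, fun x => ?_, fun x => ?_, ?_⟩
  · rw [← type_union_inl _ (right _ hs), hlr]; exact hU x
  · rw [← type_union_inr (left _ hs), hlr]; exact hV x
  · rw [hlr, map_map_symm]

theorem _root_.Dowling.FBHom.exists_sum {ψ : FBHom G (I ⊕ J) (I' ⊕ J')}
    (hl : ∀ i, ∃ i', ψ.toEquiv (.inl i) = .inl i') (hr : ∀ j, ∃ j', ψ.toEquiv (.inr j) = .inr j') :
    ∃ (g : FBHom G I I') (h : FBHom G J J'), ψ = FBHom.sum g h := by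
  choose f hf using hl
  choose f' hf' using hr
  have hb : Function.Bijective f := by
    constructor
    · intro a b hab
      exact Sum.inl_injective (ψ.toEquiv.injective (by rw [hf, hf, hab]))
    · intro c
      obtain ⟨a | a, ha⟩ := ψ.toEquiv.surjective (.inl c)
      · exact ⟨a, Sum.inl_injective (by rw [← hf, ha])⟩
      · rw [hf'] at ha; exact absurd ha (by simp)
  have hb' : Function.Bijective f' := by
    constructor
    · intro a b hab
      exact Sum.inr_injective (ψ.toEquiv.injective (by rw [hf', hf', hab]))
    · intro c
      obtain ⟨a | a, ha⟩ := ψ.toEquiv.surjective (.inr c)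
      · rw [hf] at ha; exact absurd ha (by simp)
      · exact ⟨a, Sum.inr_injective (by rw [← hf', ha])⟩
  refine ⟨⟨Equiv.ofBijective f hb, fun i => ψ.color (.inl i)⟩,
    ⟨Equiv.ofBijective f' hb', fun i => ψ.color (.inr i)⟩, ?_⟩
  apply FBHom.ext
  · ext (x | x)
    · simp [FBHom.sum, hf]
    · simp [FBHom.sum, hf']
  · funext x; rcases x with x | x <;> rfl

/-- Uniqueness of the decomposition by types. -/
theorem decomposition_unique (hUV : Disjoint U V) {β : Poset G S T I} {γ : Poset G S T J}
    {β' : Poset G S T I'} {γ' : Poset G S T J'} (hβ : HasTypes U β) (hγ : HasTypes V γ)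
    (hβ' : HasTypes U β') (hγ' : HasTypes V γ') {φ : FBHom G (I ⊕ J) K}
    {φ' : FBHom G (I' ⊕ J') K} (h : map φ (union β γ) = map φ' (union β' γ')) :
    ∃ (a : FBHom G I I') (b : FBHom G J J'), φ = FBHom.comp φ' (FBHom.sum a b) ∧
      map a β = β' ∧ map b γ = γ' := by
  have h1 : map (FBHom.comp φ'.symm φ) (union β γ) = union β' γ' := by
    rw [map_comp, h, map_symm_map]
  have hty : ∀ x, (union β' γ').type ((FBHom.comp φ'.symm φ).toEquiv x) = (union β γ).type x :=
    fun x => by rw [← h1, type_map]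
  obtain ⟨a, b, hab⟩ := FBHom.exists_sum (ψ := FBHom.comp φ'.symm φ)
    (fun i => by
      have h2 := hty (.inl i)
      rw [type_union_inl] at h2
      cases hx : (FBHom.comp φ'.symm φ).toEquiv (.inl i) with
      | inl x => exact ⟨x, rfl⟩
      | inr x =>
        rw [hx, type_union_inr] at h2
        exact absurd (h2 ▸ hγ' x) (Set.disjoint_left.1 hUV (hβ i)))
    (fun i => by
      have h2 := hty (.inr i)
      rw [type_union_inr] at h2
      cases hx : (FBHom.comp φ'.symm φ).toEquiv (.inr i) with
      | inl x =>
        rw [hx, type_union_inl] at h2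
        exact absurd (h2 ▸ hβ' x) (Set.disjoint_right.1 hUV (hγ i))
      | inr x => exact ⟨x, rfl⟩)
  have e : FBHom.comp φ' φ'.symm = FBHom.id G K := by
    apply FBHom.ext
    · exact Equiv.symm_trans_self _
    · funext i; simp [FBHom.comp, FBHom.symm, FBHom.id]
  rw [hab, map_union] at h1
  obtain ⟨h3, h4⟩ := union_injective h1
  refine ⟨a, b, ?_, h3, h4⟩
  rw [← hab, ← FBHom.comp_assoc, e, FBHom.id_comp]

end Poset

/-! ### Realizations of twisted algebras in Whitney homology -/

section Realize

variable (k : Type u) [CommRing k] {G : Type u} [Group G] {S : Type u} [MulAction G S] {T : Set S}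
  {I J K I' J' : Type} {p q r a b c p' q' a' b' : ℕ}

namespace W

theorem mul_assoc' (h : p + q = a) (h' : a + r = b) (h₁ : q + r = c) (h₁' : p + c = b)
    (x : W k G T I p) (y : W k G T J q) (z : W k G T K r) :
    mul k h' (mul k h x y) z =
      act k (FBHom.ofEquiv G (Equiv.sumAssoc I J K).symm) (mul k h₁' x (mul k h₁ y z)) := by
  rw [← mul_assoc k h h' h₁ h₁', ← act_comp, ← FBHom.ofEquiv_trans, Equiv.self_trans_symm]
  exact (act_id k _).symm

theorem mul_comm' (h : p + q = r) (h' : q + p = r) (x : W k G T I p) (y : W k G T J q) :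
    mul k h x y =
      (-1 : k) ^ (p * q) • act k (FBHom.ofEquiv G (Equiv.sumComm J I)) (mul k h' y x) := by
  rw [← map_smul, ← mul_comm k h h', ← act_comp, ← FBHom.ofEquiv_trans]
  have e : (Equiv.sumComm I J).trans (Equiv.sumComm J I) = Equiv.refl _ := by
    ext (x | x) <;> rfl
  rw [e]
  exact (act_id k _).symm

theorem mul_mul_mul_comm (h₁ : a + b = p) (h₂ : a' + b' = p') (h : p + p' = r) (h₃ : a + a' = q)
    (h₄ : b + b' = q') (h' : q + q' = r) (x : W k G T I a) (y : W k G T J b) (x' : W k G T I' a')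
    (y' : W k G T J' b') :
    act k (FBHom.ofEquiv G (Equiv.sumSumSumComm I J I' J')) (mul k h (mul k h₁ x y)
      (mul k h₂ x' y')) = (-1 : k) ^ (b * a') • mul k h' (mul k h₃ x x') (mul k h₄ y y') := by
  rw [mul_assoc' k h₁ h (c := b + p') rfl (by omega),
    ← mul_assoc k (a := b + a') rfl (by omega) h₂ rfl y x' y',
    mul_comm' k rfl (Nat.add_comm a' b) y x', map_smul, LinearMap.smul_apply, mul_act_left,
    mul_assoc' k (Nat.add_comm a' b) (by omega) h₄ (by omega : a' + q' = b + p'), map_smul,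
    map_smul, map_smul, map_smul, ← act_comp, ← act_comp, mul_act_right, ← act_comp,
    mul_act_right, ← act_comp,
    ← mul_assoc k h₃ h' (c := b + p') (by omega) (by omega), ← act_comp]
  refine congrArg _ ((act_congr k ?_ _).trans (act_id k _))
  apply FBHom.ext
  · ext ((i | i) | (i | i)) <;> simp [FBHom.comp, FBHom.ofEquiv, FBHom.sum, FBHom.id]
  · funext i; rcases i with (i | i) | (i | i) <;>
      simp [FBHom.comp, FBHom.ofEquiv, FBHom.sum, FBHom.id]

open Poset

/-- The product of two classes, moved along a morphism. -/
theorem act_mul_incl {α : Poset G S T K} {β : Poset G S T I} {γ : Poset G S T J}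
    (φ : FBHom G (I ⊕ J) K) (hα : map φ (union β γ) = α) (h : p + q = r)
    (x : RedHom k (Set.Iic β) p) (y : RedHom k (Set.Iic γ) q) :
    act k φ (mul k h (incl k p β x) (incl k q γ y)) =
      incl k r α (RedHom.map k (splitEmb φ hα) r (RedHom.mul k h x y)) := by
  rw [mul_incl, act_incl, ← RedHom.map_comp]
  exact incl_map_congr k hα _ _ (fun _ => rfl) _

variable {k} in
/-- A linear map into Whitney homology is injective if its source is spanned by elements that are
sent to classes in homologies of lower intervals and are determined linearly by these classes. -/
theorem injective_of_sections {M : Type*} [AddCommGroup M] [Module k M]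
    (f : M →ₗ[k] W k G T I p) (X : Set (Poset G S T I))
    (Gen : ∀ α : Poset G S T I, RedHom k (Set.Iic α) p → M → Prop)
    (hf : ∀ α x a, Gen α x a → f a = incl k p α x)
    (hs : ∀ α ∈ X, ∃ s : RedHom k (Set.Iic α) p →ₗ[k] M, ∀ x a, Gen α x a → a = s x)
    (hspan : ∀ a, a ∈ Submodule.span k {a | ∃ α ∈ X, ∃ x, Gen α x a}) :
    Function.Injective f := by
  classical
  let g : W k G T I p →ₗ[k] M := desc fun α => if h : α ∈ X then (hs α h).choose else 0
  refine Function.LeftInverse.injective (g := g) fun a => ?_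
  induction hspan a using Submodule.span_induction with
  | zero => simp
  | add a b _ _ ha hb => rw [map_add, map_add, ha, hb]
  | smul c a _ ha => rw [map_smul, map_smul, ha]
  | mem a ha =>
    obtain ⟨α, hα, x, hx⟩ := ha
    rw [hf α x a hx]
    refine (desc_incl _ _ _).trans ?_
    rw [dif_pos hα]
    exact ((hs α hα).choose_spec x a hx).symm

end W

/-- A factorization through an injective linear map is linear. -/
theorem exists_linear_lift {A B C : Type*} [AddCommGroup A] [AddCommGroup B] [AddCommGroup C]
    [Module k A] [Module k B] [Module k C] (f : A →ₗ[k] C) (hf : Function.Injective f)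
    (g : B →ₗ[k] C) (h : ∀ x, ∃ a, f a = g x) : ∃ s : B →ₗ[k] A, ∀ x, f (s x) = g x := by
  refine ⟨(LinearEquiv.ofInjective f hf).symm.toLinearMap ∘ₗ g.codRestrict _ h, fun x => ?_⟩
  have := (LinearEquiv.ofInjective f hf).apply_symm_apply (g.codRestrict _ h x)
  exact congrArg Subtype.val this

theorem glue_mem {J : Type*} {M : J → Type*} [∀ j, AddCommGroup (M j)] [∀ j, Module k (M j)]
    {R : (Σ j, M j) → (Σ j, M j) → Prop} (N : Submodule k (Glue k M R))
    (h : ∀ j x, Glue.of k R j x ∈ N) (z : Glue k M R) : z ∈ N := by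
  have e : N.mkQ = 0 := Glue.hom_ext fun j x => (Submodule.Quotient.mk_eq_zero N).2 (h j x)
  exact (Submodule.Quotient.mk_eq_zero N).1 (DFunLike.congr_fun e z)

theorem map_mem_span {A B : Type*} [AddCommGroup A] [AddCommGroup B] [Module k A] [Module k B]
    (f : A →ₗ[k] B) {s : Set A} {N : Submodule k B} (h : ∀ x ∈ s, f x ∈ N) {x : A}
    (hx : x ∈ Submodule.span k s) : f x ∈ N :=
  (Submodule.span_le.2 h : Submodule.span k s ≤ N.comap f) hx

section DayDesc

variable {k} {A B : TwAlg.{u} k G} {n : ℕ} {N : Type u} [AddCommGroup N] [Module k N]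
  (f : ∀ (i j a b : ℕ), a + b = p → FBHom G (Fin i ⊕ Fin j) (Fin n) →
    A.obj i a ⊗[k] B.obj j b →ₗ[k] N)
  (hf : ∀ (i j a b : ℕ) (deg : a + b = p) (φ : FBHom G (Fin i ⊕ Fin j) (Fin n)) (g : Wr G i)
    (h : Wr G j) (t : A.obj i a ⊗[k] B.obj j b), f i j a b deg (FBHom.comp φ (FBHom.sum g h)) t =
      f i j a b deg φ (TensorProduct.map (A.act i a g) (B.act j b h) t))

/-- The universal property of the Day convolution. -/
def TwAlg.dayDesc : TwAlg.DayObj A B n p →ₗ[k] N :=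
  Glue.desc (fun d => f d.i d.j d.a d.b d.deg d.hom) <| by
    rintro _ _ ⟨i, j, a, b, deg, φ, g, h, t⟩
    exact hf i j a b deg φ g h t

theorem TwAlg.dayDesc_of {i j a b : ℕ} (deg : a + b = p) (φ : FBHom G (Fin i ⊕ Fin j) (Fin n))
    (t : A.obj i a ⊗[k] B.obj j b) :
    TwAlg.dayDesc f hf (TwAlg.DayObj.of A B deg φ t) = f i j a b deg φ t :=
  Glue.desc_of _ _ _ _

end DayDesc

variable (S T) in
/-- A realization of a twisted algebra `A` as the part of the Whitney homology
supported on the elements whose points have types in `U`: an injective homomorphism of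
algebras with this image. -/
structure Realization (A : TwAlg.{u} k G) (U : Set (ℕ ⊕ MulAction.orbitRel.Quotient G S)) where
  f : ∀ n p, A.obj n p →ₗ[k] W k G T (Fin n) p
  map_act : ∀ {n p : ℕ} (w : Wr G n) (x : A.obj n p),
    f n p (A.act n p w x) = W.act k w (f n p x)
  map_mul : ∀ {m n p q : ℕ} (x : A.obj m p) (y : A.obj n q), f (m + n) (p + q) (A.mul m n p q x y) =
    W.act k (FBHom.ofEquiv G finSumFinEquiv) (W.mul k rfl (f m p x) (f n q y))
  map_one : f 0 0 A.one = W.one k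
  injective : ∀ n p, Function.Injective (f n p)
  exists_eq : ∀ {n p : ℕ} (α : Poset G S T (Fin n)), α.HasTypes U →
    ∀ x, ∃ a, f n p a = W.incl k p α x
  span : ∀ {n p : ℕ} (a : A.obj n p), a ∈ Submodule.span k
    {a | ∃ α : Poset G S T (Fin n), α.HasTypes U ∧ ∃ x, f n p a = W.incl k p α x}

namespace Realization

open Poset

variable {k} {A B : TwAlg.{u} k G} {U V : Set (ℕ ⊕ MulAction.orbitRel.Quotient G S)}

theorem exists_lift (R : Realization k S T A U) {n : ℕ} (p : ℕ) (α : Poset G S T (Fin n))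
    (hα : α.HasTypes U) : ∃ s : RedHom k (Set.Iic α) p →ₗ[k] A.obj n p,
      ∀ x, R.f n p (s x) = W.incl k p α x :=
  exists_linear_lift k (R.f n p) (R.injective n p) (W.incl k p α) (R.exists_eq α hα)

/-- The map `x ⊗ y ↦ x * y`, followed by a morphism. -/
def tensorMap₀ (R : Realization k S T A U) (R' : Realization k S T B V) {n p : ℕ} (i j a b : ℕ)
    (deg : a + b = p) (φ : FBHom G (Fin i ⊕ Fin j) (Fin n)) :
    A.obj i a ⊗[k] B.obj j b →ₗ[k] W k G T (Fin n) p :=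
  TensorProduct.lift (((W.mul k deg).compl₁₂ (R.f i a) (R'.f j b)).compr₂ (W.act k φ))

theorem tensorMap₀_tmul (R : Realization k S T A U) (R' : Realization k S T B V)
    {n p i j a b : ℕ} (deg : a + b = p) (φ : FBHom G (Fin i ⊕ Fin j) (Fin n)) (x : A.obj i a)
    (y : B.obj j b) :
    tensorMap₀ R R' i j a b deg φ (x ⊗ₜ y) = W.act k φ (W.mul k deg (R.f i a x) (R'.f j b y)) :=
  TensorProduct.lift.tmul _ _

theorem tensorMap₀_comp (R : Realization k S T A U) (R' : Realization k S T B V)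
    {n p : ℕ} (i j a b : ℕ) (deg : a + b = p) (φ : FBHom G (Fin i ⊕ Fin j) (Fin n)) (g : Wr G i)
    (h : Wr G j) (t : A.obj i a ⊗[k] B.obj j b) :
    tensorMap₀ R R' i j a b deg (FBHom.comp φ (FBHom.sum g h)) t =
      tensorMap₀ R R' i j a b deg φ (TensorProduct.map (A.act i a g) (B.act j b h) t) := by
  induction t using TensorProduct.induction_on with
  | zero => rw [_root_.map_zero, _root_.map_zero, _root_.map_zero]
  | add x y hx hy => rw [map_add, map_add, map_add, hx, hy]
  | tmul x y =>
    rw [TensorProduct.map_tmul, tensorMap₀_tmul, tensorMap₀_tmul, R.map_act, R'.map_act, W.mul_act,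
      ← W.act_comp]

/-- The homomorphism on the tensor product: `x ⊗ y` is sent to `x * y`. -/
def tensorMap (R : Realization k S T A U) (R' : Realization k S T B V) (n p : ℕ) :
    TwAlg.DayObj A B n p →ₗ[k] W k G T (Fin n) p :=
  TwAlg.dayDesc (tensorMap₀ R R') (tensorMap₀_comp R R')

theorem tensorMap_of (R : Realization k S T A U) (R' : Realization k S T B V) {n p i j a b : ℕ}
    (deg : a + b = p) (φ : FBHom G (Fin i ⊕ Fin j) (Fin n)) (x : A.obj i a) (y : B.obj j b) :
    tensorMap R R' n p (TwAlg.DayObj.of A B deg φ (x ⊗ₜ y)) =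
      W.act k φ (W.mul k deg (R.f i a x) (R'.f j b y)) := by
  rw [tensorMap, TwAlg.dayDesc_of, tensorMap₀_tmul]

/-- An element `x ⊗ y` of the tensor product that corresponds to a product of classes in homologies
of lower intervals. -/
def TensorGen (R : Realization k S T A U) (R' : Realization k S T B V) {n p : ℕ}
    (α : Poset G S T (Fin n)) (z : RedHom k (Set.Iic α) p) (t : TwAlg.DayObj A B n p) : Prop :=
  ∃ (i j a b : ℕ) (deg : a + b = p) (φ : FBHom G (Fin i ⊕ Fin j) (Fin n))
    (β : Poset G S T (Fin i)) (γ : Poset G S T (Fin j)) (_ : HasTypes U β) (_ : HasTypes V γ)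
    (hα : map φ (union β γ) = α) (u : A.obj i a) (v : B.obj j b) (x : RedHom k (Set.Iic β) a)
    (y : RedHom k (Set.Iic γ) b), R.f i a u = W.incl k a β x ∧ R'.f j b v = W.incl k b γ y ∧
      z = RedHom.map k (splitEmb φ hα) p (RedHom.mul k deg x y) ∧
      t = TwAlg.DayObj.of A B deg φ (u ⊗ₜ v)

theorem TensorGen.map_eq {R : Realization k S T A U} {R' : Realization k S T B V} {n p : ℕ}
    {α : Poset G S T (Fin n)} {z : RedHom k (Set.Iic α) p} {t : TwAlg.DayObj A B n p}
    (h : TensorGen R R' α z t) : tensorMap R R' n p t = W.incl k p α z := by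
  obtain ⟨i, j, a, b, deg, φ, β, γ, hβ, hγ, hα, u, v, x, y, hu, hv, rfl, rfl⟩ := h
  rw [tensorMap_of, hu, hv, W.act_mul_incl]

/-- Classes outside the degree of the rank vanish, on both sides. -/
theorem eq_zero_of_rank_ne (R : Realization k S T A U) {n p : ℕ} {α : Poset G S T (Fin n)}
    (h : p ≠ α.rank) {u : A.obj n p} {x : RedHom k (Set.Iic α) p}
    (hu : R.f n p u = W.incl k p α x) : u = 0 ∧ x = 0 := by
  have := subsingleton_iic k α h
  obtain rfl : x = 0 := Subsingleton.elim _ _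
  exact ⟨R.injective n p (by rw [hu, _root_.map_zero, _root_.map_zero]), rfl⟩

/-- The Künneth isomorphism below a disjoint union lifts classes linearly to the tensor product.
Every generator over `α` is obtained in this way: decompositions of `α` differ by automorphisms of
the parts, which can be moved across the tensor product. -/
theorem exists_tensorSection (hUV : Disjoint U V) (R : Realization k S T A U)
    (R' : Realization k S T B V) {n p : ℕ} (α : Poset G S T (Fin n)) (hα : HasTypes (U ∪ V) α) :
    ∃ s : RedHom k (Set.Iic α) p →ₗ[k] TwAlg.DayObj A B n p,
      (∀ z, tensorMap R R' n p (s z) = W.incl k p α z) ∧ ∀ z t, TensorGen R R' α z t → t = s z := by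
  obtain ⟨i₀, j₀, φ₀, β₀, γ₀, hβ₀, hγ₀, hα₀⟩ := exists_decomposition hUV hα
  have hsep := sep_union_of_types hUV hβ₀ hγ₀
  by_cases hp : β₀.rank + γ₀.rank = p
  · -- the lift: the Künneth isomorphism, followed by lifts to the two factors
    obtain ⟨t, ht, ht'⟩ := exists_split k φ₀ hα₀ hsep hp
    obtain ⟨s, hs⟩ := R.exists_lift β₀.rank β₀ hβ₀
    obtain ⟨s', hs'⟩ := R'.exists_lift γ₀.rank γ₀ hγ₀
    refine ⟨TwAlg.DayObj.of A B hp φ₀ ∘ₗ TensorProduct.map s s' ∘ₗ t, fun z => ?_, ?_⟩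
    · rw [← congrArg (W.incl k p α) (ht' z), LinearMap.comp_apply, LinearMap.comp_apply]
      induction t z using TensorProduct.induction_on with
      | zero => simp
      | add x y hx hy => simp only [map_add, hx, hy]
      | tmul x y =>
        rw [TensorProduct.map_tmul, tensorMap_of, hs, hs', W.act_mul_incl k φ₀ hα₀,
          TensorProduct.lift.tmul]
    · rintro _ _ ⟨i, j, a, b, deg, φ, β, γ, hβ, hγ, hα, u, v, x, y, hu, hv, rfl, rfl⟩
      obtain ⟨g, h, rfl, rfl, rfl⟩ := decomposition_unique hUV hβ hγ hβ₀ hγ₀ (hα.trans hα₀.symm)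
      obtain rfl : i = i₀ := by simpa using Fintype.card_congr g.toEquiv
      obtain rfl : j = j₀ := by simpa using Fintype.card_congr h.toEquiv
      -- outside the degrees of the ranks both sides vanish
      by_cases ha : a = β.rank
      swap
      · obtain ⟨rfl, rfl⟩ := R.eq_zero_of_rank_ne ha hu
        simp
      by_cases hb : b = γ.rank
      swap
      · obtain ⟨rfl, rfl⟩ := R'.eq_zero_of_rank_ne hb hv
        simp
      rw [← rank_map g] at ha
      rw [← rank_map h] at hb
      subst ha hb
      rw [TwAlg.DayObj.of_comp, TensorProduct.map_tmul]
      have e : RedHom.map k (splitEmb (FBHom.comp φ₀ (FBHom.sum g h)) hα) p (RedHom.mul k deg x y) =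
          RedHom.map k (splitEmb φ₀ hα₀) p (RedHom.mul k hp (RedHom.map k (iicMap g β) _ x)
            (RedHom.map k (iicMap h γ) _ y)) := by
        rw [RedHom.mul_map, ← RedHom.map_comp]
        refine RedHom.map_congr k (fun z => Subtype.ext ?_) _
        simp only [coe_splitEmb, RelEmbedding.coe_trans, Function.comp_apply, prodEmb_apply,
          coe_iicMap, map_comp, map_union]
      have e1 : A.act i _ g u = s (RedHom.map k (iicMap g β) _ x) := R.injective _ _ <| by
        rw [R.map_act, hu, W.act_incl, hs]
      have e2 : B.act j _ h v = s' (RedHom.map k (iicMap h γ) _ y) := R'.injective _ _ <| by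
        rw [R'.map_act, hv, W.act_incl, hs']
      rw [LinearMap.comp_apply, LinearMap.comp_apply, e, ht, TensorProduct.map_tmul, e1, e2]
  · refine ⟨0, fun z => ?_, ?_⟩
    · have := subsingleton_iic k α (p := p) (by rw [← hα₀, rank_map, rank_union]; exact Ne.symm hp)
      rw [Subsingleton.elim z 0]; simp
    · rintro _ _ ⟨i, j, a, b, deg, φ, β, γ, hβ, hγ, hα, u, v, x, y, hu, hv, rfl, rfl⟩
      obtain ⟨g, h, rfl, rfl, rfl⟩ := decomposition_unique hUV hβ hγ hβ₀ hγ₀ (hα.trans hα₀.symm)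
      rw [rank_map, rank_map] at hp
      by_cases ha : a = β.rank
      swap
      · obtain ⟨rfl, rfl⟩ := R.eq_zero_of_rank_ne ha hu
        simp
      by_cases hb : b = γ.rank
      swap
      · obtain ⟨rfl, rfl⟩ := R'.eq_zero_of_rank_ne hb hv
        simp
      exact absurd (ha ▸ hb ▸ deg) hp

theorem mem_span_tensorGen (R : Realization k S T A U) (R' : Realization k S T B V) {n p : ℕ}
    (t : TwAlg.DayObj A B n p) : t ∈ Submodule.span k {t | ∃ α : Poset G S T (Fin n),
      α ∈ {α | HasTypes (U ∪ V) α} ∧ ∃ z, TensorGen R R' α z t} := by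
  refine glue_mem k _ (fun ⟨i, j, a, b, deg, φ⟩ t => ?_) t
  change TwAlg.DayObj.of A B deg φ t ∈ _
  induction t using TensorProduct.induction_on with
  | zero => rw [_root_.map_zero]; exact Submodule.zero_mem _
  | add x y hx hy => rw [map_add]; exact Submodule.add_mem _ hx hy
  | tmul u v =>
    refine map_mem_span k (TwAlg.DayObj.of A B deg φ ∘ₗ (TensorProduct.mk k _ _).flip v) ?_
      (R.span u)
    rintro u ⟨β, hβ, x, hu⟩
    refine map_mem_span k (TwAlg.DayObj.of A B deg φ ∘ₗ TensorProduct.mk k _ _ u) ?_ (R'.span v)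
    rintro v ⟨γ, hγ, y, hv⟩
    refine Submodule.subset_span ⟨map φ (union β γ), ?_, _,
      i, j, a, b, deg, φ, β, γ, hβ, hγ, rfl, u, v, x, y, hu, hv, rfl, rfl⟩
    exact (hasTypes_map φ).2 (hasTypes_union.2 ⟨hβ.mono Set.subset_union_left,
      hγ.mono Set.subset_union_right⟩)

/-- Realizations with disjoint sets of types can be multiplied. -/
def tensor (hUV : Disjoint U V) (R : Realization k S T A U) (R' : Realization k S T B V) :
    Realization k S T (TwAlg.tensor A B) (U ∪ V) where
  f n p := tensorMap R R' n p
  map_act {n p} w x := by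
    have e : tensorMap R R' n p ∘ₗ TwAlg.dayAct A B w = W.act k w ∘ₗ tensorMap R R' n p := by
      refine Glue.hom_ext fun ⟨i, j, a, b, deg, φ⟩ t => ?_
      change tensorMap R R' n p (TwAlg.dayAct A B w (TwAlg.DayObj.of A B deg φ t)) =
        W.act k w (tensorMap R R' n p (TwAlg.DayObj.of A B deg φ t))
      rw [TwAlg.dayAct_of]
      induction t using TensorProduct.induction_on with
      | zero => simp
      | add x y hx hy => simp only [map_add, hx, hy]
      | tmul x y => rw [tensorMap_of, tensorMap_of, W.act_comp]
    exact DFunLike.congr_fun e x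
  map_mul {m n p q} x y := by
    have e : (TwAlg.dayMul A B m n p q).compr₂ (tensorMap R R' (m + n) (p + q)) =
        ((W.mul k rfl).compl₁₂ (tensorMap R R' m p) (tensorMap R R' n q)).compr₂
          (W.act k (FBHom.ofEquiv G finSumFinEquiv)) := by
      refine Glue.hom_ext₂ fun ⟨i, j, a, b, deg, φ⟩ t ⟨i', j', a', b', deg', φ'⟩ t' => ?_
      change tensorMap R R' (m + n) (p + q) (TwAlg.dayMul A B m n p q
        (TwAlg.DayObj.of A B deg φ t) (TwAlg.DayObj.of A B deg' φ' t')) =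
        W.act k (FBHom.ofEquiv G finSumFinEquiv) (W.mul k rfl
          (tensorMap R R' m p (TwAlg.DayObj.of A B deg φ t))
          (tensorMap R R' n q (TwAlg.DayObj.of A B deg' φ' t')))
      rw [TwAlg.dayMul_of]
      induction t using TensorProduct.induction_on with
      | zero => simp
      | add x y hx hy => simp only [map_add, LinearMap.add_apply, hx, hy]
      | tmul x y =>
        induction t' using TensorProduct.induction_on with
        | zero => simp
        | add x y hx hy => simp only [map_add, hx, hy]
        | tmul x' y' =>
          rw [TwAlg.dayMul₀_tmul, map_smul, map_smul, tensorMap_of, tensorMap_of, tensorMap_of,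
            R.map_mul, R'.map_mul, W.mul_act, W.mul_act, ← map_smul, ← map_smul,
            ← W.mul_mul_mul_comm k deg deg' rfl rfl rfl, ← W.act_comp, ← W.act_comp, ← W.act_comp]
          refine W.act_congr k ?_ _
          apply FBHom.ext
          · ext ((i | i) | (i | i)) <;> simp [TwAlg.dayJoin, TwAlg.dayShuf, FBHom.join, FBHom.comp,
              FBHom.ofEquiv, FBHom.sum]
          · funext i; rcases i with (i | i) | (i | i) <;> simp [TwAlg.dayJoin, TwAlg.dayShuf,
              FBHom.join, FBHom.comp, FBHom.ofEquiv, FBHom.sum]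
    exact LinearMap.congr_fun₂ e x y
  map_one := by
    refine (tensorMap_of R R' rfl _ _ _).trans ?_
    rw [R.map_one, R'.map_one, W.one_mul, ← W.act_comp, W.act_one]
  injective n p := W.injective_of_sections (tensorMap R R' n p) {α | HasTypes (U ∪ V) α}
    (TensorGen R R') (fun α x a h => h.map_eq)
    (fun α hα => (exists_tensorSection hUV R R' α hα).imp fun s hs => hs.2)
    (mem_span_tensorGen R R')
  exists_eq α hα z := by
    obtain ⟨s, hs, -⟩ := exists_tensorSection hUV R R' α hα
    exact ⟨s z, hs z⟩
  span t := by
    refine Submodule.span_mono ?_ (mem_span_tensorGen R R' t)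
    rintro t ⟨α, hα, z, hz⟩
    exact ⟨α, hα, z, hz.map_eq⟩

end Realization

end Realize

/-! ### Realizations of finite and infinite tensor products -/

namespace Realization

open Poset

variable {k : Type u} [CommRing k] {G : Type u} [Group G] {S : Type u} [MulAction G S] {T : Set S}
  {A B : TwAlg.{u} k G} {U V : Set (ℕ ⊕ MulAction.orbitRel.Quotient G S)}

section Unit

variable (k G T) in
/-- The unit of Whitney homology in arity and degree zero, and zero otherwise. -/
def unitValue : ∀ n p, W k G T (Fin n) p
  | 0, 0 => W.one k
  | _ + 1, _ => 0
  | 0, _ + 1 => 0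

theorem act_unitValue {n p : ℕ} (w : Wr G n) :
    W.act k w (unitValue k G T n p) = unitValue k G T n p := by
  rcases n with _ | n
  · rcases p with _ | p
    · exact W.act_one k _
    · exact _root_.map_zero _
  · exact _root_.map_zero _

theorem act_one_mul_one : W.act k (FBHom.ofEquiv G finSumFinEquiv)
    (W.mul k rfl (unitValue k G T 0 0) (unitValue k G T 0 0)) =
      unitValue k G T (0 + 0) (0 + 0) := by
  change W.act k _ (W.mul k (rfl : 0 + 0 = 0) (W.one k : W k G T (Fin 0) 0)
    (W.one k : W k G T (Fin 0) 0)) = (W.one k : W k G T (Fin 0) 0)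
  rw [W.one_mul, ← W.act_comp, W.act_one]

variable (k G S T) in
/-- The unit is realized on the empty set. -/
def unit : Realization k S T (TwAlg.unit k G) ∅ where
  f n p := (LinearMap.toSpanSingleton k _ (unitValue k G T n p)) ∘ₗ Submodule.subtype _
  map_act {n p} w x := by
    change x.1 • unitValue k G T n p = W.act k w (x.1 • unitValue k G T n p)
    rw [map_smul, act_unitValue]
  map_mul {m n p q} x y := by
    change (x.1 * y.1) • unitValue k G T (m + n) (p + q) = W.act k _ (W.mul k rfl
      (x.1 • unitValue k G T m p) (y.1 • unitValue k G T n q))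
    rw [map_smul, map_smul, map_smul, LinearMap.smul_apply, map_smul, smul_smul, _root_.mul_comm]
    by_cases hx : m = 0 ∧ p = 0
    · by_cases hy : n = 0 ∧ q = 0
      · obtain ⟨rfl, rfl⟩ := hx
        obtain ⟨rfl, rfl⟩ := hy
        exact congrArg _ act_one_mul_one.symm
      · rw [y.2 hy, zero_mul, zero_smul, zero_smul]
    · rw [x.2 hx, mul_zero, zero_smul, zero_smul]
  map_one := one_smul k _
  injective n p x y h := by
    by_cases hx : n = 0 ∧ p = 0
    · obtain ⟨rfl, rfl⟩ := hx
      exact Subtype.ext ((W.bijective_smul_one k (T := T) (I := Fin 0)).1 h)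
    · exact Subtype.ext ((x.2 hx).trans (y.2 hx).symm)
  exists_eq {n p} α hα x := by
    rcases n with _ | n
    · by_cases hp : p = 0
      · subst hp
        obtain ⟨c, hc⟩ := (W.bijective_smul_one k (T := T) (I := Fin 0)).2 (W.incl k 0 α x)
        exact ⟨⟨c, fun h => absurd ⟨rfl, rfl⟩ h⟩, hc⟩
      · have := W.subsingleton_of_isEmpty k (G := G) (T := T) (I := Fin 0) hp
        exact ⟨0, Subsingleton.elim _ _⟩
    · exact (hα 0).elim
  span {n p} a := by
    by_cases hx : n = 0 ∧ p = 0
    · obtain ⟨rfl, rfl⟩ := hx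
      refine Submodule.subset_span ⟨⊥, fun i => i.elim0,
        a.1 • RedHom.point k _ isBot_mk_bot (isTop_mk ⊥), ?_⟩
      rw [map_smul]
      rfl
    · rw [show a = 0 from Subtype.ext (a.2 hx)]
      exact Submodule.zero_mem _

end Unit

/-- Replacing the set of types by an equal one. -/
def ofEq (h : U = V) (R : Realization k S T A U) : Realization k S T A V where
  f := R.f
  map_act := R.map_act
  map_mul := R.map_mul
  map_one := R.map_one
  injective := R.injective
  exists_eq := h ▸ R.exists_eq
  span := h ▸ R.span

theorem nonempty_tensorList (l : List (TwAlg.{u} k G × Set (ℕ ⊕ MulAction.orbitRel.Quotient G S)))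
    (h : ∀ x ∈ l, Nonempty (Realization k S T x.1 x.2))
    (hl : l.Pairwise fun x y => Disjoint x.2 y.2) :
    Nonempty (Realization k S T (TwAlg.tensorList (l.map Prod.fst)) {t | ∃ x ∈ l, t ∈ x.2}) := by
  induction l with
  | nil => exact ⟨(unit k G S T).ofEq (by simp)⟩
  | cons x l ih =>
    obtain ⟨R'⟩ := ih (fun y hy => h y (List.mem_cons_of_mem _ hy)) (List.pairwise_cons.1 hl).2
    obtain ⟨R⟩ := h x List.mem_cons_self
    refine ⟨(tensor ?_ R R').ofEq ?_⟩
    · rw [Set.disjoint_left]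
      rintro t ht ⟨y, hy, ht'⟩
      exact Set.disjoint_left.1 ((List.pairwise_cons.1 hl).1 y hy) ht ht'
    · ext t
      simp

section Seq

variable {A : ℕ → TwAlg.{u} k G} {U : ℕ → Set (ℕ ⊕ MulAction.orbitRel.Quotient G S)}
  (hU : ∀ m n, m < n → Disjoint (U m) (U n)) (R : ∀ n, Realization k S T (A n) (U n))

/-- The realizations of the finite tensor products. -/
def upTo : ∀ N, Realization k S T (TwAlg.tensorUpTo A N) {t | ∃ n < N, t ∈ U n}
  | 0 => (unit k G S T).ofEq (by simp)
  | N + 1 => (tensor (by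
      rw [Set.disjoint_left]
      rintro t ⟨n, hn, ht⟩ ht'
      exact Set.disjoint_left.1 (hU n N hn) ht ht') (upTo N) (R N)).ofEq (by
      ext t
      constructor
      · rintro (⟨n, hn, ht⟩ | ht)
        exacts [⟨n, by omega, ht⟩, ⟨N, by omega, ht⟩]
      · rintro ⟨n, hn, ht⟩
        rcases Nat.lt_succ_iff_lt_or_eq.1 hn with hn | rfl
        exacts [Or.inl ⟨n, hn, ht⟩, Or.inr ht])

theorem upTo_step {N n p : ℕ} (x : (TwAlg.tensorUpTo A N).obj n p) :
    (upTo hU R (N + 1)).f n p (TwAlg.step A N n p x) = (upTo hU R N).f n p x := by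
  refine (tensorMap_of (upTo hU R N) (R N) (b := 0) rfl _ x (A N).one).trans ?_
  rw [(R N).map_one, W.act_mul_one]

theorem upTo_stage {M N n p : ℕ} (h : M ≤ N) (x : (TwAlg.tensorUpTo A M).obj n p) :
    (upTo hU R N).f n p (TwAlg.stage A h n p x) = (upTo hU R M).f n p x := by
  induction N, h using Nat.le_induction with
  | base => rw [TwAlg.stage_self, LinearMap.id_apply]
  | succ N h ih => rw [TwAlg.stage_succ A h, LinearMap.comp_apply, upTo_step, ih]

theorem upTo_rel {n p : ℕ} (x y) (h : TwAlg.SeqRel A n p x y) :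
    (upTo hU R x.1).f n p x.2 = (upTo hU R y.1).f n p y.2 := by
  cases h with
  | mk M N h x => exact (upTo_stage hU R h x).symm

/-- The homomorphism on the infinite tensor product. -/
def seqMap (n p : ℕ) : TwAlg.SeqObj A n p →ₗ[k] W k G T (Fin n) p :=
  Glue.desc (fun N => (upTo hU R N).f n p) (upTo_rel hU R)

theorem seqMap_of {N n p : ℕ} (x : (TwAlg.tensorUpTo A N).obj n p) :
    seqMap hU R n p (TwAlg.SeqObj.of A N x) = (upTo hU R N).f n p x :=
  Glue.desc_of (fun N => (upTo hU R N).f n p) (upTo_rel hU R) N x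

/-- An element of a finite stage that corresponds to a class in the homology of a lower
interval. -/
def SeqGen {n p : ℕ} (α : Poset G S T (Fin n)) (z : RedHom k (Set.Iic α) p)
    (t : TwAlg.SeqObj A n p) : Prop :=
  ∃ (N : ℕ) (a : (TwAlg.tensorUpTo A N).obj n p), (upTo hU R N).f n p a = W.incl k p α z ∧
    t = TwAlg.SeqObj.of A N a

/-- The finitely many points of `α` have types in a finite stage, and the stages embed compatibly
in Whitney homology. -/
theorem exists_seqSection {n p : ℕ} (α : Poset G S T (Fin n)) (hα : HasTypes {t | ∃ n, t ∈ U n} α) :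
    ∃ s : RedHom k (Set.Iic α) p →ₗ[k] TwAlg.SeqObj A n p,
      (∀ z, seqMap hU R n p (s z) = W.incl k p α z) ∧ ∀ z t, SeqGen hU R α z t → t = s z := by
  choose m hm using hα
  obtain ⟨N, hN⟩ : ∃ N, ∀ i, m i < N := by
    refine ⟨Finset.univ.sup m + 1, fun i => Nat.lt_succ_of_le ?_⟩
    exact Finset.le_sup (Finset.mem_univ i)
  obtain ⟨s, hs⟩ := (upTo hU R N).exists_lift p α fun i => ⟨m i, hN i, hm i⟩
  refine ⟨TwAlg.SeqObj.of A N ∘ₗ s, fun z => by rw [LinearMap.comp_apply, seqMap_of, hs], ?_⟩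
  rintro z _ ⟨M, a, ha, rfl⟩
  rw [LinearMap.comp_apply, ← TwAlg.SeqObj.of_stage A (le_max_left M N) a,
    ← TwAlg.SeqObj.of_stage A (le_max_right M N) (s z)]
  refine congrArg _ ((upTo hU R (max M N)).injective n p ?_)
  rw [upTo_stage, upTo_stage, ha, hs]

theorem mem_span_seqGen {n p : ℕ} (t : TwAlg.SeqObj A n p) :
    t ∈ Submodule.span k {t | ∃ α : Poset G S T (Fin n),
      α ∈ {α | HasTypes {t | ∃ n, t ∈ U n} α} ∧ ∃ z, SeqGen hU R α z t} := by
  refine glue_mem k _ (fun N a => ?_) t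
  refine map_mem_span k (TwAlg.SeqObj.of A N) ?_ ((upTo hU R N).span a)
  rintro a ⟨α, hα, z, ha⟩
  exact Submodule.subset_span ⟨α, fun i => (hα i).imp fun _ h => h.2, z, N, a, ha, rfl⟩

/-- A sequence of realizations with disjoint sets of types can be multiplied. -/
def tensorSeq : Realization k S T (TwAlg.tensorSeq A) {t | ∃ n, t ∈ U n} where
  f n p := seqMap hU R n p
  map_act {n p} w x := by
    have e : seqMap hU R n p ∘ₗ TwAlg.seqAct A w = W.act k w ∘ₗ seqMap hU R n p := by
      refine Glue.hom_ext fun N x => ?_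
      change seqMap hU R n p (TwAlg.seqAct A w (TwAlg.SeqObj.of A N x)) =
        W.act k w (seqMap hU R n p (TwAlg.SeqObj.of A N x))
      rw [TwAlg.seqAct_of, seqMap_of, seqMap_of, (upTo hU R N).map_act]
    exact DFunLike.congr_fun e x
  map_mul {m n p q} x y := by
    have e : (TwAlg.seqMul A m n p q).compr₂ (seqMap hU R (m + n) (p + q)) =
        ((W.mul k rfl).compl₁₂ (seqMap hU R m p) (seqMap hU R n q)).compr₂
          (W.act k (FBHom.ofEquiv G finSumFinEquiv)) := by
      refine Glue.hom_ext₂ fun M x N y => ?_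
      change seqMap hU R (m + n) (p + q) (TwAlg.seqMul A m n p q
        (TwAlg.SeqObj.of A M x) (TwAlg.SeqObj.of A N y)) =
        W.act k (FBHom.ofEquiv G finSumFinEquiv) (W.mul k rfl
          (seqMap hU R m p (TwAlg.SeqObj.of A M x)) (seqMap hU R n q (TwAlg.SeqObj.of A N y)))
      rw [TwAlg.seqMul_of, TwAlg.seqMul₀_apply, seqMap_of, seqMap_of, seqMap_of,
        (upTo hU R _).map_mul, upTo_stage, upTo_stage]
    exact LinearMap.congr_fun₂ e x y
  map_one := (seqMap_of hU R _).trans (upTo hU R 0).map_one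
  injective n p := W.injective_of_sections (seqMap hU R n p)
    {α | HasTypes {t | ∃ n, t ∈ U n} α} (SeqGen hU R)
    (fun α x a ⟨N, b, hb, h⟩ => by rw [h, seqMap_of, hb])
    (fun α hα => (exists_seqSection hU R α hα).imp fun s hs => hs.2)
    (mem_span_seqGen hU R)
  exists_eq α hα z := by
    obtain ⟨s, hs, -⟩ := exists_seqSection hU R α hα
    exact ⟨s z, hs z⟩
  span t := by
    refine Submodule.span_mono ?_ (mem_span_seqGen hU R t)
    rintro _ ⟨α, hα, z, N, a, ha, rfl⟩
    exact ⟨α, hα, z, (seqMap_of hU R a).trans ha⟩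

end Seq

/-- A realization on all types is an isomorphism with Whitney homology. -/
theorem nonempty_iso (R : Realization k S T A U)
    (hU : ∀ n (α : Poset G S T (Fin n)), HasTypes U α) :
    Nonempty (TwAlg.Iso (whitney k G S T) A) := by
  have hs : ∀ n p, Function.Surjective (R.f n p) := by
    intro n p x
    have : x ∈ LinearMap.range (R.f n p) := W.induction (fun α z => R.exists_eq α (hU n α) z) x
    exact this
  let e : ∀ n p, A.obj n p ≃ₗ[k] W k G T (Fin n) p := fun n p =>
    LinearEquiv.ofBijective (R.f n p) ⟨R.injective n p, hs n p⟩
  have he : ∀ n p x, e n p x = R.f n p x := fun _ _ _ => rfl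
  have hse : ∀ n p x, R.f n p ((e n p).symm x) = x := fun n p x => (e n p).apply_symm_apply x
  refine ⟨⟨fun n p => (toW k G S T n p).trans (e n p).symm, fun n p w x => ?_,
    fun m n p q x y => ?_, ?_⟩⟩
  · refine R.injective n p ?_
    rw [R.map_act, LinearEquiv.trans_apply, LinearEquiv.trans_apply, hse, hse, toW_act]
  · refine R.injective (m + n) (p + q) ?_
    rw [R.map_mul, LinearEquiv.trans_apply, LinearEquiv.trans_apply, LinearEquiv.trans_apply, hse,
      hse, hse, toW_mul]
  · refine R.injective 0 0 ?_
    rw [R.map_one, LinearEquiv.trans_apply, hse, toW_one]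

end Realization

/-! ### Realizations of induced algebras -/

section IndRealize

open Poset

variable {k : Type u} [CommRing k] {G H : Type u} [Group G] [Group H] {D : Type}
  {ρ : H →* FBHom G D D} {A : TwAlg.{u} k H} {S : Type u} [MulAction G S] {T : Set S}

section IndDesc

variable {n p : ℕ} {N : Type u} [AddCommGroup N] [Module k N]
  (f : ∀ m : ℕ, FBHom G (Fin m × D) (Fin n) → A.obj m p →ₗ[k] N)
  (hf : ∀ (m : ℕ) (φ : FBHom G (Fin m × D) (Fin n)) (h : Wr H m) (x : A.obj m p),
    f m (FBHom.comp φ (TwAlg.blow ρ h)) x = f m φ (A.act m p h x))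

/-- The universal property of induction. -/
def TwAlg.indDesc : TwAlg.IndObj ρ A n p →ₗ[k] N :=
  Glue.desc (fun j => f j.1 j.2) <| by
    rintro _ _ ⟨m, φ, h, x⟩
    exact hf m φ h x

theorem TwAlg.indDesc_of {m : ℕ} (φ : FBHom G (Fin m × D) (Fin n)) (x : A.obj m p) :
    TwAlg.indDesc f hf (TwAlg.IndObj.of ρ A φ x) = f m φ x :=
  Glue.desc_of _ _ _ _

end IndDesc

/-- Functoriality on lower intervals, as an isomorphism of posets. -/
def Poset.iicIso {I J : Type*} {κ : Poset G S T I} {α : Poset G S T J} (φ : FBHom G I J)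
    (hα : map φ κ = α) : Set.Iic κ ≃o Set.Iic α where
  toFun x := ⟨map φ x, Set.mem_Iic.2 (hα ▸ map_le_map φ x.2)⟩
  invFun y := ⟨map φ.symm y, Set.mem_Iic.2 ((map_le_map φ.symm y.2).trans
    (by rw [← hα, map_symm_map]))⟩
  left_inv x := Subtype.ext (map_symm_map φ _)
  right_inv y := Subtype.ext (map_map_symm φ _)
  map_rel_iff' := (mapEmb φ).le_iff_le

theorem W.act_incl_eq {I J : Type} {κ : Poset G S T I} {α : Poset G S T J} (φ : FBHom G I J)
    (hα : map φ κ = α) {p : ℕ} (x : RedHom k (Set.Iic κ) p) :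
    W.act k φ (W.incl k p κ x) =
      W.incl k p α (RedHom.map k (iicIso φ hα).toOrderEmbedding p x) := by
  rw [W.act_incl]
  exact W.incl_map_congr k hα _ _ (fun _ => rfl) x

variable (ρ S T A) in
/-- The data for realizing an induced algebra: an equivariant and multiplicative family of injective
maps `F` to the Whitney homologies of the sets `[m] × D`, whose images are the homologies
of the lower intervals of certain elements `κ` with `IsBase κ`. The translates of these are
the elements whose points have types in `U`, and two of them are translates of one another only in
the obvious way. -/
structure IndData (U : Set (ℕ ⊕ MulAction.orbitRel.Quotient G S)) where
  F : ∀ m p, A.obj m p →ₗ[k] W k G T (Fin m × D) p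
  map_act : ∀ {m p : ℕ} (h : Wr H m) (x : A.obj m p),
    F m p (A.act m p h x) = W.act k (TwAlg.blow ρ h) (F m p x)
  map_mul : ∀ {m n p q : ℕ} (x : A.obj m p) (y : A.obj n q),
    W.act k (FBHom.ofEquiv G (TwAlg.blowSum D m n)) (F (m + n) (p + q) (A.mul m n p q x y)) =
      W.mul k rfl (F m p x) (F n q y)
  map_one : F 0 0 A.one = W.one k
  injective : ∀ m p, Function.Injective (F m p)
  IsBase : ∀ {m : ℕ}, Poset G S T (Fin m × D) → Prop
  hasTypes : ∀ {m : ℕ} {κ : Poset G S T (Fin m × D)}, IsBase κ → κ.HasTypes U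
  exists_base : ∀ {n : ℕ} (α : Poset G S T (Fin n)), α.HasTypes U →
    ∃ (m : ℕ) (φ : FBHom G (Fin m × D) (Fin n)) (κ : Poset G S T (Fin m × D)),
      IsBase κ ∧ map φ κ = α
  arity_eq : ∀ {m m' : ℕ} {κ : Poset G S T (Fin m × D)} {κ' : Poset G S T (Fin m' × D)}
    (ψ : FBHom G (Fin m × D) (Fin m' × D)), IsBase κ → IsBase κ' → map ψ κ = κ' → m = m'
  exists_blow : ∀ {m : ℕ} {κ κ' : Poset G S T (Fin m × D)} (ψ : FBHom G (Fin m × D) (Fin m × D)),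
    IsBase κ → IsBase κ' → map ψ κ = κ' → ∃ h : Wr H m, ψ = TwAlg.blow ρ h
  exists_eq : ∀ {m p : ℕ} {κ : Poset G S T (Fin m × D)}, IsBase κ →
    ∀ x, ∃ a, F m p a = W.incl k p κ x
  eq_incl : ∀ {m p : ℕ} (a : A.obj m p), a = 0 ∨
    ∃ κ : Poset G S T (Fin m × D), IsBase κ ∧ ∃ x, F m p a = W.incl k p κ x

namespace IndData

variable {U : Set (ℕ ⊕ MulAction.orbitRel.Quotient G S)} (E : IndData ρ A S T U)

/-- The map induced by `F`. -/
def map₀ (n p m : ℕ) (φ : FBHom G (Fin m × D) (Fin n)) : A.obj m p →ₗ[k] W k G T (Fin n) p :=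
  W.act k φ ∘ₗ E.F m p

theorem map₀_apply {n p m : ℕ} (φ : FBHom G (Fin m × D) (Fin n)) (x : A.obj m p) :
    E.map₀ n p m φ x = W.act k φ (E.F m p x) := rfl

theorem map₀_comp {n p : ℕ} (m : ℕ) (φ : FBHom G (Fin m × D) (Fin n)) (h : Wr H m)
    (x : A.obj m p) :
    E.map₀ n p m (FBHom.comp φ (TwAlg.blow ρ h)) x = E.map₀ n p m φ (A.act m p h x) := by
  rw [map₀_apply, map₀_apply, E.map_act, W.act_comp]

/-- The homomorphism on the induced algebra. -/
def indMap (n p : ℕ) : TwAlg.IndObj ρ A n p →ₗ[k] W k G T (Fin n) p :=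
  TwAlg.indDesc (E.map₀ n p) E.map₀_comp

theorem indMap_of {n p m : ℕ} (φ : FBHom G (Fin m × D) (Fin n)) (x : A.obj m p) :
    E.indMap n p (TwAlg.IndObj.of ρ A φ x) = W.act k φ (E.F m p x) := by
  rw [indMap, TwAlg.indDesc_of, map₀_apply]

/-- An element of the induced algebra that corresponds to a class in the homology of a lower
interval. -/
def Gen {n p : ℕ} (α : Poset G S T (Fin n)) (z : RedHom k (Set.Iic α) p)
    (t : TwAlg.IndObj ρ A n p) : Prop :=
  ∃ (m : ℕ) (φ : FBHom G (Fin m × D) (Fin n)) (κ : Poset G S T (Fin m × D)) (_ : E.IsBase κ)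
    (hα : map φ κ = α) (a : A.obj m p) (x : RedHom k (Set.Iic κ) p), E.F m p a = W.incl k p κ x ∧
      z = RedHom.map k (iicIso φ hα).toOrderEmbedding p x ∧ t = TwAlg.IndObj.of ρ A φ a

theorem Gen.map_eq {n p : ℕ} {α : Poset G S T (Fin n)} {z : RedHom k (Set.Iic α) p}
    {t : TwAlg.IndObj ρ A n p} (h : E.Gen α z t) : E.indMap n p t = W.incl k p α z := by
  obtain ⟨m, φ, κ, hκ, hα, a, x, ha, rfl, rfl⟩ := h
  rw [indMap_of, ha, W.act_incl_eq φ hα]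

/-- The inverse of `F` on a chosen base element lifts classes linearly to the induced algebra.
Other choices differ by elements of the wreath product, which can be moved across the induction.
-/
theorem exists_section {n p : ℕ} (α : Poset G S T (Fin n)) (hα : α.HasTypes U) :
    ∃ s : RedHom k (Set.Iic α) p →ₗ[k] TwAlg.IndObj ρ A n p,
      (∀ z, E.indMap n p (s z) = W.incl k p α z) ∧ ∀ z t, E.Gen α z t → t = s z := by
  obtain ⟨m₀, φ₀, κ₀, hκ₀, hα₀⟩ := E.exists_base α hα
  obtain ⟨s, hs⟩ := exists_linear_lift k (E.F m₀ p) (E.injective m₀ p) (W.incl k p κ₀)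
    (E.exists_eq hκ₀)
  refine ⟨TwAlg.IndObj.of ρ A φ₀ ∘ₗ s ∘ₗ
    RedHom.map k (iicIso φ₀ hα₀).symm.toOrderEmbedding p, fun z => ?_, ?_⟩
  · rw [LinearMap.comp_apply, LinearMap.comp_apply, indMap_of, hs, W.act_incl_eq φ₀ hα₀,
      RedHom.map_map_symm]
  · rintro _ _ ⟨m, φ, κ, hκ, hα', a, x, ha, rfl, rfl⟩
    have e : FBHom.comp φ₀ φ₀.symm = FBHom.id G (Fin n) := by
      apply FBHom.ext
      · exact Equiv.symm_trans_self _
      · funext i; simp [FBHom.comp, FBHom.symm, FBHom.id]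
    have h1 : map (FBHom.comp φ₀.symm φ) κ = κ₀ := by
      rw [map_comp, hα', ← hα₀, map_symm_map]
    obtain rfl := E.arity_eq _ hκ hκ₀ h1
    obtain ⟨h, hh⟩ := E.exists_blow _ hκ hκ₀ h1
    have h2 : φ = FBHom.comp φ₀ (TwAlg.blow ρ h) := by
      rw [← hh, ← FBHom.comp_assoc, e, FBHom.id_comp]
    subst h2
    rw [TwAlg.IndObj.of_comp, LinearMap.comp_apply, LinearMap.comp_apply]
    refine congrArg _ (E.injective m p ?_)
    have h3 : map (TwAlg.blow ρ h) κ = κ₀ := by rw [← hh, h1]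
    rw [E.map_act, ha, hs, W.act_incl_eq _ h3, ← RedHom.map_comp]
    refine congrArg _ (RedHom.map_congr k (fun z => Subtype.ext ?_) x)
    change map (TwAlg.blow ρ h) z.1 = map φ₀.symm (map (FBHom.comp φ₀ (TwAlg.blow ρ h)) z.1)
    rw [map_comp, map_symm_map]

theorem mem_span_gen {n p : ℕ} (t : TwAlg.IndObj ρ A n p) :
    t ∈ Submodule.span k {t | ∃ α : Poset G S T (Fin n), α ∈ {α | HasTypes U α} ∧
      ∃ z, E.Gen α z t} := by
  refine glue_mem k _ (fun ⟨m, φ⟩ a => ?_) t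
  rcases E.eq_incl a with rfl | ⟨κ, hκ, x, ha⟩
  · rw [_root_.map_zero]; exact Submodule.zero_mem _
  · exact Submodule.subset_span ⟨map φ κ, (hasTypes_map φ).2 (E.hasTypes hκ), _, m, φ, κ, hκ, rfl,
      a, x, ha, rfl, rfl⟩

/-- The realization of the induced algebra. -/
def realization : Realization k S T (TwAlg.Ind ρ A) U where
  f n p := E.indMap n p
  map_act {n p} w x := by
    have e : E.indMap n p ∘ₗ TwAlg.indAct ρ A w = W.act k w ∘ₗ E.indMap n p := by
      refine Glue.hom_ext fun ⟨m, φ⟩ x => ?_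
      change E.indMap n p (TwAlg.indAct ρ A w (TwAlg.IndObj.of ρ A φ x)) =
        W.act k w (E.indMap n p (TwAlg.IndObj.of ρ A φ x))
      rw [TwAlg.indAct_of, indMap_of, indMap_of, W.act_comp]
    exact DFunLike.congr_fun e x
  map_mul {n n' p q} x y := by
    have e : (TwAlg.indMul ρ A n n' p q).compr₂ (E.indMap (n + n') (p + q)) =
        ((W.mul k rfl).compl₁₂ (E.indMap n p) (E.indMap n' q)).compr₂
          (W.act k (FBHom.ofEquiv G finSumFinEquiv)) := by
      refine Glue.hom_ext₂ fun ⟨m, φ⟩ x ⟨m', φ'⟩ y => ?_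
      change E.indMap (n + n') (p + q) (TwAlg.indMul ρ A n n' p q
        (TwAlg.IndObj.of ρ A φ x) (TwAlg.IndObj.of ρ A φ' y)) =
        W.act k (FBHom.ofEquiv G finSumFinEquiv) (W.mul k rfl
          (E.indMap n p (TwAlg.IndObj.of ρ A φ x)) (E.indMap n' q (TwAlg.IndObj.of ρ A φ' y)))
      rw [TwAlg.indMul_of, indMap_of, indMap_of, indMap_of, TwAlg.indJoin, W.act_comp, E.map_mul,
        W.mul_act, ← W.act_comp]
      rfl
    exact LinearMap.congr_fun₂ e x y
  map_one := by
    refine (E.indMap_of _ _).trans ?_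
    rw [E.map_one, W.act_one]
  injective n p := W.injective_of_sections (E.indMap n p) {α | HasTypes U α} E.Gen
    (fun α x a h => h.map_eq)
    (fun α hα => (E.exists_section α hα).imp fun s hs => hs.2) E.mem_span_gen
  exists_eq α hα z := by
    obtain ⟨s, hs, -⟩ := E.exists_section α hα
    exact ⟨s z, hs z⟩
  span t := by
    refine Submodule.span_mono ?_ (E.mem_span_gen t)
    rintro t ⟨α, hα, z, hz⟩
    exact ⟨α, hα, z, hz.map_eq⟩

end IndData

end IndRealize

/-! ### Realizations of the factors indexed by orbits -/

section PointPoset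

open Poset MulAction

variable {H : Type u} [Group H] {b : Prop} {I J : Type}

/-- In the Dowling poset of a one point set, all points of `I` may lie in the zero block. -/
def Full (b : Prop) (I : Type) : Prop := (∃! _i : I, True) → b

open Classical in
variable (H b I) in
/-- The greatest element of the Dowling poset of a one point set: all points of `I` lie in the zero
block, unless this is forbidden because `I` is a point, in which case this is also
the least element. -/
def pointTop : Poset H PUnit.{u + 1} (pointSet b) I where
  zero _ := if Full b I then some PUnit.unit else none
  rel _ g _ := ¬ Full b I ∧ g = 1
  rel_refl _ := by split_ifs with h <;> simp [h]
  rel_symm := by rintro i g j ⟨h, rfl⟩; simp [h]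
  rel_trans := by rintro i g j h l ⟨h, rfl⟩ ⟨-, rfl⟩; simp [h]
  rel_unique := by rintro i g ⟨-, rfl⟩; rfl
  mem_of_unique t := by
    rintro ⟨i, ⟨g, hi⟩, hu⟩
    split_ifs at hi with h
    exact h ⟨i, trivial, fun j _ => hu j ⟨g, by rw [if_pos h, hi]⟩⟩

theorem pointTop_zero (h : Full b I) (i : I) : (pointTop H b I).zero i = some PUnit.unit :=
  if_pos h

theorem eq_of_not_full (h : ¬ Full b I) (i j : I) : i = j :=
  have ⟨hu, _⟩ := Classical.not_imp.1 h
  hu.unique trivial trivial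

theorem zero_of_not_full (h : ¬ Full b I) (x : Poset H PUnit.{u + 1} (pointSet b) I) (i : I) :
    x.zero i = none := by
  by_contra hn
  obtain ⟨t, ht⟩ := Option.ne_none_iff_exists'.1 hn
  exact h fun _ => x.mem_of_unique t ⟨i, ⟨1, ht⟩, fun j _ => eq_of_not_full h j i⟩

theorem subsingleton_of_not_full (h : ¬ Full b I) :
    Subsingleton (Poset H PUnit.{u + 1} (pointSet b) I) := by
  refine ⟨fun x y => Poset.ext ?_ ?_⟩
  · funext i; rw [zero_of_not_full h, zero_of_not_full h]
  · have key : ∀ (x y : Poset H PUnit.{u + 1} (pointSet b) I) i g j, x.rel i g j → y.rel i g j := by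
      intro x y i g j hr
      obtain rfl := eq_of_not_full h i j
      rw [x.rel_unique hr, y.rel_refl, zero_of_not_full h]
    funext i g j
    exact propext ⟨key x y i g j, key y x i g j⟩

theorem isTop_pointTop : IsTop (pointTop H b I) := by
  intro x
  by_cases h : Full b I
  · exact ⟨fun i t _ => pointTop_zero h i, fun i g j _ =>
      Or.inr ⟨_, pointTop_zero h j, pointTop_zero h i⟩⟩
  · have := subsingleton_of_not_full (H := H) h
    exact (Subsingleton.elim x (pointTop H b I)).le

theorem map_pointTop (φ : FBHom H I J) : map φ (pointTop H b I) = pointTop H b J :=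
  (isTop_pointTop _).antisymm (by
    rw [← map_map_symm φ (pointTop H b J)]
    exact map_le_map φ (isTop_pointTop _))

theorem full_sum (hI : Full b I) (hJ : Full b J) : Full b (I ⊕ J) := by
  rintro ⟨i | i, -, hu⟩
  · exact hI ⟨i, trivial, fun j _ => Sum.inl_injective (hu (.inl j) trivial)⟩
  · exact hJ ⟨i, trivial, fun j _ => Sum.inr_injective (hu (.inr j) trivial)⟩

theorem union_pointTop (hI : Full b I) (hJ : Full b J) :
    union (pointTop H b I) (pointTop H b J) = pointTop H b (I ⊕ J) := by
  refine (isTop_pointTop _).antisymm ⟨?_, ?_⟩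
  · rintro (i | i) t -
    exacts [pointTop_zero (H := H) hI i, pointTop_zero (H := H) hJ i]
  · rintro i g j hr
    exact absurd (full_sum hI hJ) hr.1

variable {G : Type u} [Group G] {S : Type u} [MulAction G S] {T : Set S}
  (hT : ∀ g : G, ∀ x ∈ T, g • x ∈ T) (s : S)

/-- An element of the Dowling poset of the stabilizer of `s` and the one point set
`{s}`, as an element of the Dowling poset of `G` and `S`. -/
def fromPoint (x : Poset (stabilizer G s) PUnit.{u + 1} (pointSet (s ∈ T)) I) :
    Poset G S T (I × Unit) where
  zero i := (x.zero i.1).map fun _ => s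
  rel i g j := ∃ h : stabilizer G s, (h : G) = g ∧ x.rel i.1 h j.1
  rel_refl i := by
    rw [Option.map_eq_none_iff, ← x.rel_refl]
    constructor
    · rintro ⟨h, h1, hr⟩
      obtain rfl : h = 1 := Subtype.ext h1
      exact hr
    · exact fun hr => ⟨1, rfl, hr⟩
  rel_symm := by
    rintro i _ j ⟨h, rfl, hr⟩
    exact ⟨h⁻¹, rfl, x.rel_symm hr⟩
  rel_trans := by
    rintro i _ j _ l ⟨h, rfl, hr⟩ ⟨h', rfl, hr'⟩
    exact ⟨h * h', rfl, x.rel_trans hr hr'⟩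
  rel_unique := by
    rintro i _ ⟨h, rfl, hr⟩
    rw [x.rel_unique hr, Subgroup.coe_one]
  mem_of_unique t := by
    rintro ⟨⟨i, c⟩, ⟨g, hi⟩, hu⟩
    obtain ⟨z, hz, hs⟩ := Option.map_eq_some_iff.1 hi
    have h : s ∈ T := by
      refine x.mem_of_unique z ⟨i, ⟨1, hz⟩, fun j ⟨h, hj⟩ => ?_⟩
      refine congrArg Prod.fst (hu (j, c) ⟨g, ?_⟩)
      simp only [hj, Option.map_some, hs]
    have := hT g⁻¹ s h
    rwa [hs, inv_smul_smul] at this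

variable {s}

theorem fromPoint_zero {x : Poset (stabilizer G s) PUnit.{u + 1} (pointSet (s ∈ T)) I} {i : I}
    (h : x.zero i = some PUnit.unit) (c : Unit) : (fromPoint hT s x).zero (i, c) = some s := by
  simp only [fromPoint, h, Option.map_some]

theorem fromPoint_le_iff {x y : Poset (stabilizer G s) PUnit.{u + 1} (pointSet (s ∈ T)) I} :
    fromPoint hT s x ≤ fromPoint hT s y ↔ x ≤ y := by
  constructor
  · refine fun h => ⟨fun i z hz => ?_, fun i g j hr => ?_⟩
    · obtain ⟨z', hz', -⟩ := Option.map_eq_some_iff.1 (h.1 (i, ()) s (fromPoint_zero hT hz ()))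
      exact hz'
    · rcases h.2 (i, ()) g (j, ()) ⟨g, rfl, hr⟩ with ⟨g', hg, hr'⟩ | ⟨t, ht, ht'⟩
      · exact Or.inl (by rwa [Subtype.ext (a1 := g') (a2 := g) hg] at hr')
      · obtain ⟨z, hz, -⟩ := Option.map_eq_some_iff.1 ht
        obtain ⟨z', hz', -⟩ := Option.map_eq_some_iff.1 ht'
        exact Or.inr ⟨z, hz, hz'⟩
  · refine fun h => ⟨fun i t ht => ?_, ?_⟩
    · obtain ⟨z, hz, rfl⟩ := Option.map_eq_some_iff.1 ht
      exact fromPoint_zero hT (h.1 _ _ hz) _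
    · rintro i _ j ⟨g, rfl, hr⟩
      rcases h.2 _ _ _ hr with hr | ⟨z, hz, hz'⟩
      · exact Or.inl ⟨g, rfl, hr⟩
      · refine Or.inr ⟨s, fromPoint_zero hT hz _, (fromPoint_zero hT hz' _).trans ?_⟩
        rw [g.2]

theorem fromPoint_blow {m : ℕ} (h : Wr (stabilizer G s) m)
    (x : Poset (stabilizer G s) PUnit.{u + 1} (pointSet (s ∈ T)) (Fin m)) :
    fromPoint hT s (map h x) =
      map (TwAlg.blow (pointHom (stabilizer G s)) h) (fromPoint hT s x) := by
  apply Poset.ext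
  · funext ⟨i, c⟩
    change ((x.zero (h.toEquiv.symm i)).map (h.color (h.toEquiv.symm i) • ·)).map (fun _ => s) =
      ((x.zero (h.toEquiv.symm i)).map fun _ => s).map
        ((h.color (h.toEquiv.symm i) : G) • ·)
    rw [Option.map_map, Option.map_map]
    refine congrArg (fun f => Option.map f _) (funext fun _ => ?_)
    exact (h.color (h.toEquiv.symm i)).2.symm
  · funext ⟨i, c⟩ g ⟨j, d⟩
    refine propext ⟨?_, ?_⟩
    · rintro ⟨a, rfl, hr⟩
      exact ⟨_, rfl, hr⟩
    · rintro ⟨a, ha, hr⟩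
      refine ⟨h.color (h.toEquiv.symm i) * a * (h.color (h.toEquiv.symm j))⁻¹, ?_, ?_⟩
      · rw [Subgroup.coe_mul, Subgroup.coe_mul, ha]
        change (h.color (h.toEquiv.symm i) : G) * (((h.color (h.toEquiv.symm i) : G))⁻¹ * g *
          (h.color (h.toEquiv.symm j) : G)) * ((h.color (h.toEquiv.symm j) : G))⁻¹ = g
        group
      · have e : (h.color (h.toEquiv.symm i))⁻¹ * (h.color (h.toEquiv.symm i) * a *
            (h.color (h.toEquiv.symm j))⁻¹) * h.color (h.toEquiv.symm j) = a := by group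
        exact (congrArg (fun g => x.rel (h.toEquiv.symm i) g (h.toEquiv.symm j)) e).mpr hr

theorem fromPoint_mul {m n : ℕ}
    (x : Poset (stabilizer G s) PUnit.{u + 1} (pointSet (s ∈ T)) (Fin m))
    (y : Poset (stabilizer G s) PUnit.{u + 1} (pointSet (s ∈ T)) (Fin n)) :
    map (FBHom.ofEquiv G (TwAlg.blowSum Unit m n)) (fromPoint hT s (Poset.mul x y)) =
      union (fromPoint hT s x) (fromPoint hT s y) := by
  apply Poset.ext
  · funext i
    rcases i with ⟨i, c⟩ | ⟨i, c⟩ <;>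
      simp [map, union, fromPoint, Poset.mul, FBHom.ofEquiv, TwAlg.blowSum, Function.comp_def]
  · funext i g j
    rcases i with ⟨i, c⟩ | ⟨i, c⟩ <;> rcases j with ⟨j, d⟩ | ⟨j, d⟩ <;>
      simp [map, union, fromPoint, Poset.mul, FBHom.ofEquiv, TwAlg.blowSum]

variable (s I) in
/-- `fromPoint`, as an embedding in a lower interval. -/
def fromPointEmb : Poset (stabilizer G s) PUnit.{u + 1} (pointSet (s ∈ T)) I ↪o
    Set.Iic (fromPoint hT s (pointTop (stabilizer G s) (s ∈ T) I)) :=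
  OrderEmbedding.ofMapLEIff
    (fun x => ⟨fromPoint hT s x, Set.mem_Iic.2 ((fromPoint_le_iff hT).2 (isTop_pointTop x))⟩)
    fun _ _ => fromPoint_le_iff hT

/-- The lower interval of the element for which all points have colour `s` is the Dowling
poset of the stabilizer of `s`. -/
theorem fromPointEmb_surjective (hI : Full (s ∈ T) I) :
    Function.Surjective (fromPointEmb I hT s) := by
  rintro ⟨z, hz⟩
  have h0 : ∀ i c, (fromPoint hT s (pointTop (stabilizer G s) (s ∈ T) I)).zero (i, c) = some s :=
    fun i c => fromPoint_zero hT (pointTop_zero hI i) c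
  have h1 : ∀ i t, z.zero i = some t → t = s := fun i t ht =>
    Option.some_injective _ (((Set.mem_Iic.1 hz).1 _ _ ht).symm.trans (h0 i.1 i.2))
  have h2 : ∀ i g j, z.rel i g j → g ∈ stabilizer G s := by
    intro i g j hr
    rcases (Set.mem_Iic.1 hz).2 _ _ _ hr with ⟨h, -, hn, -⟩ | ⟨t, ht, ht'⟩
    · exact absurd hI hn
    · obtain rfl := Option.some_injective _ (ht.symm.trans (h0 j.1 j.2))
      exact Option.some_injective _ (ht'.symm.trans (h0 i.1 i.2))
  let x : Poset (stabilizer G s) PUnit.{u + 1} (pointSet (s ∈ T)) I :=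
    { zero := fun i => (z.zero (i, ())).map fun _ => PUnit.unit
      rel := fun i g j => z.rel (i, ()) g (j, ())
      rel_refl := fun i => by
        rw [Option.map_eq_none_iff, ← z.rel_refl, Subgroup.coe_one]
      rel_symm := fun h => z.rel_symm h
      rel_trans := fun h h' => z.rel_trans h h'
      rel_unique := fun h => Subtype.ext (z.rel_unique h)
      mem_of_unique := by
        rintro t ⟨i, ⟨g, hi⟩, hu⟩
        obtain ⟨r, hr, -⟩ := Option.map_eq_some_iff.1 hi
        refine z.mem_of_unique s ⟨(i, ()), ⟨1, by rw [hr, h1 _ _ hr, one_smul]⟩, ?_⟩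
        rintro ⟨j, c⟩ ⟨g', hj⟩
        exact Prod.ext (hu j ⟨1, by rw [hj]; rfl⟩) rfl }
  refine ⟨x, Subtype.ext (Poset.ext ?_ ?_)⟩
  · funext ⟨i, c⟩
    change ((z.zero (i, c)).map fun _ => PUnit.unit).map (fun _ => s) = z.zero (i, c)
    cases hc : z.zero (i, c) with
    | none => rfl
    | some t => rw [h1 _ _ hc]; rfl
  · funext ⟨i, c⟩ g ⟨j, d⟩
    refine propext ⟨?_, fun hr => ⟨⟨g, h2 _ _ _ hr⟩, rfl, hr⟩⟩
    rintro ⟨h, rfl, hr⟩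
    exact hr

end PointPoset

section DowlingFactor

open Poset MulAction

variable {k : Type u} [CommRing k] {G : Type u} [Group G] {S : Type u} [MulAction G S] {T : Set S}
  (hT : ∀ g : G, ∀ x ∈ T, g • x ∈ T) (s : S)

theorem rank_of_zero {I : Type*} (α : Poset G S T I) (h : ∀ i, α.zero i ≠ none) :
    α.rank = Nat.card I := by
  have : IsEmpty α.Blocks := ⟨fun b => Quotient.inductionOn b fun i => h i i.2⟩
  rw [rank, show α.numBlocks = 0 from Nat.card_of_isEmpty, Nat.sub_zero]

theorem W.incl_injective {I : Type} (r : ℕ) (α : Poset G S T I) :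
    Function.Injective (W.incl k r α) := by
  classical
  intro x y h
  have h1 := congrArg (W.desc (M := RedHom k (Set.Iic α) r) fun β => if e : β = α then
    (show RedHom k (Set.Iic β) r →ₗ[k] RedHom k (Set.Iic α) r from e ▸ LinearMap.id) else 0) h
  rwa [W.desc_incl, W.desc_incl, dif_pos rfl] at h1

theorem RedHom.map_bijective {P Q : Type*} [PartialOrder P] [PartialOrder Q] (f : P ↪o Q)
    (hf : Function.Surjective f) (p : ℕ) : Function.Bijective (RedHom.map k f p) := by
  let e := RelIso.ofSurjective f hf
  have h : ∀ x, RedHom.map k f p x = RedHom.map k e.toRelEmbedding p x :=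
    fun x => RedHom.map_congr k (fun _ => rfl) x
  refine ⟨fun x y hxy => ?_, fun y => ⟨RedHom.map k e.symm.toRelEmbedding p y, ?_⟩⟩
  · rw [h, h] at hxy
    rw [← RedHom.map_symm_map k e x, ← RedHom.map_symm_map k e y]
    exact congrArg _ hxy
  · rw [h]
    exact RedHom.map_map_symm k e y

/-- The realization on the elements for which the points of `[m]` lie in the zero block and
have colour `s`. -/
def pointF (m p : ℕ) : (dowlingTop k (stabilizer G s) (s ∈ T)).obj m p →ₗ[k]
    W k G T (Fin m × Unit) p :=
  W.incl k p (fromPoint hT s (pointTop (stabilizer G s) (s ∈ T) (Fin m))) ∘ₗ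
    RedHom.map k (fromPointEmb (Fin m) hT s) p ∘ₗ Submodule.subtype _

variable {s}

theorem pointF_apply {m p : ℕ} (x : (dowlingTop k (stabilizer G s) (s ∈ T)).obj m p) :
    pointF hT s m p x = W.incl k p (fromPoint hT s (pointTop (stabilizer G s) (s ∈ T) (Fin m)))
      (RedHom.map k (fromPointEmb (Fin m) hT s) p x.1) := rfl

theorem pointF_act {m p : ℕ} (h : Wr (stabilizer G s) m)
    (x : (dowlingTop k (stabilizer G s) (s ∈ T)).obj m p) :
    pointF hT s m p ((dowlingTop k (stabilizer G s) (s ∈ T)).act m p h x) =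
      W.act k (TwAlg.blow (pointHom (stabilizer G s)) h) (pointF hT s m p x) := by
  rw [pointF_apply, pointF_apply, W.act_incl, ← RedHom.map_comp]
  refine (congrArg _ (RedHom.map_comp k _ _ _ _).symm).trans ?_
  refine W.incl_map_congr k ?_ _ _ (fun z => ?_) _
  · rw [← fromPoint_blow, map_pointTop]
  · exact fromPoint_blow hT h z

/-- In a forbidden arity the module vanishes: it is the homology of a point in degree one. -/
theorem eq_zero_of_not_full {m p : ℕ} (hm : ¬ Full (s ∈ T) (Fin m))
    (x : (dowlingTop k (stabilizer G s) (s ∈ T)).obj m p) : x = 0 := by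
  refine Subtype.ext ?_
  by_cases hp : p = m
  · have := subsingleton_of_not_full (H := stabilizer G s) hm
    have hm0 : m ≠ 0 := by
      rintro rfl
      exact hm fun ⟨i, _⟩ => i.elim0
    have := RedHom.subsingleton_of_subsingleton k
      (P := Poset (stabilizer G s) PUnit.{u + 1} (pointSet (s ∈ T)) (Fin m)) (hp ▸ hm0 : p ≠ 0)
    exact Subsingleton.elim _ _
  · exact x.2 hp

theorem coe_dowlingTop_mul {m n p q : ℕ} (x : (dowlingTop k (stabilizer G s) (s ∈ T)).obj m p)
    (y : (dowlingTop k (stabilizer G s) (s ∈ T)).obj n q) :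
    ((dowlingTop k (stabilizer G s) (s ∈ T)).mul m n p q x y).1 =
      RedHom.map k (Poset.mulEmb (stabilizer G s) PUnit (pointSet (s ∈ T)) m n) (p + q)
        (RedHom.mul k rfl x.1 y.1) := rfl

/-- Both sides vanish if one of the arities is forbidden; otherwise the disjoint union of greatest
elements is the greatest element. -/
theorem pointF_mul {m n p q : ℕ} (x : (dowlingTop k (stabilizer G s) (s ∈ T)).obj m p)
    (y : (dowlingTop k (stabilizer G s) (s ∈ T)).obj n q) :
    W.act k (FBHom.ofEquiv G (TwAlg.blowSum Unit m n)) (pointF hT s (m + n) (p + q)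
      ((dowlingTop k (stabilizer G s) (s ∈ T)).mul m n p q x y)) =
      W.mul k rfl (pointF hT s m p x) (pointF hT s n q y) := by
  by_cases hm : Full (s ∈ T) (Fin m)
  swap
  · rw [eq_zero_of_not_full hm x]
    simp only [_root_.map_zero, LinearMap.zero_apply]
  by_cases hn : Full (s ∈ T) (Fin n)
  swap
  · rw [eq_zero_of_not_full hn y]
    simp only [_root_.map_zero]
  rw [pointF_apply, pointF_apply, pointF_apply, W.act_incl, W.mul_incl, RedHom.mul_map,
    coe_dowlingTop_mul, ← RedHom.map_comp, ← RedHom.map_comp, ← RedHom.map_comp]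
  refine W.incl_map_congr k ?_ _ _ (fun z => ?_) _
  · rw [← fromPoint_mul, Poset.mul, union_pointTop hm hn, map_pointTop]
  · exact fromPoint_mul hT z.1 z.2

theorem pointF_one : pointF hT s 0 0 (dowlingTop k (stabilizer G s) (s ∈ T)).one = W.one k := by
  have key : ∀ (α β : Poset G S T (Fin 0 × Unit)), α = β → ∀ z hα hα' hβ hβ',
      W.incl k 0 α (RedHom.point k z hα hα') =
      W.incl k 0 β (RedHom.point k ⟨β, Set.self_mem_Iic⟩ hβ hβ') := by
    rintro α β rfl z _ _ _ _
    exact congrArg _ (SubQuot.mk_congr (congrArg (fun z => Finsupp.single [z] (1 : k))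
      (Subtype.ext (Subsingleton.elim _ _))) _ _)
  have h₀ : ∀ z : Poset (stabilizer G s) PUnit.{u + 1} (pointSet (s ∈ T)) (Fin 0),
      IsBot z ∧ IsTop z := fun z =>
    ⟨fun y => (Subsingleton.elim z y).le, fun y => (Subsingleton.elim y z).le⟩
  have h : ∀ α : Poset G S T (Fin 0 × Unit), ∀ z : Set.Iic α, IsBot z ∧ IsTop z := fun α z =>
    ⟨fun y => (Subsingleton.elim z.1 y.1).le, fun y => (Subsingleton.elim y.1 z.1).le⟩
  rw [pointF_apply, W.one_eq]
  refine (congrArg _ (RedHom.map_point k _ _ (h₀ _).1 (h₀ _).2 (h _ _).1 (h _ _).2)).trans ?_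
  exact key _ _ (Subsingleton.elim _ _) _ _ _ _ _

theorem pointF_injective (m p : ℕ) : Function.Injective (pointF (k := k) hT s m p) := by
  intro x y h
  by_cases hm : Full (s ∈ T) (Fin m)
  · rw [pointF_apply, pointF_apply] at h
    exact Subtype.ext ((RedHom.map_bijective _ (fromPointEmb_surjective hT hm) p).1
      (W.incl_injective _ _ h))
  · rw [eq_zero_of_not_full hm x, eq_zero_of_not_full hm y]

/-- An element for which all points have colour `s` is the greatest element coming from the one
point set. It exists only if a zero block of this size is allowed. -/
theorem eq_fromPoint {m : ℕ} {κ : Poset G S T (Fin m × Unit)} (h : ∀ i, κ.zero i = some s) :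
    Full (s ∈ T) (Fin m) ∧ fromPoint hT s (pointTop (stabilizer G s) (s ∈ T) (Fin m)) = κ := by
  have hm : Full (s ∈ T) (Fin m) := by
    rintro ⟨i, -, hu⟩
    exact κ.mem_of_unique s ⟨(i, ()), ⟨1, by rw [h, one_smul]⟩,
      fun j _ => Prod.ext (hu j.1 trivial) rfl⟩
  refine ⟨hm, Poset.ext ?_ ?_⟩
  · funext ⟨i, c⟩
    rw [h, fromPoint_zero hT (pointTop_zero hm i)]
  · funext i g j
    refine propext ⟨?_, fun hr => ?_⟩
    · rintro ⟨a, -, hn, -⟩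
      exact absurd hm hn
    · exact absurd ((κ.zero_left hr).symm.trans (h i)) (by simp)

variable (s) in
/-- The realization of the algebra of top homologies, before induction to `G`. -/
def pointData : IndData (pointHom (stabilizer G s)) (dowlingTop k (stabilizer G s) (s ∈ T)) S T
    {.inr (Quotient.mk _ s)} where
  F := pointF hT s
  map_act := pointF_act hT
  map_mul := pointF_mul hT
  map_one := pointF_one hT
  injective := pointF_injective hT
  IsBase κ := ∀ i, κ.zero i = some s
  hasTypes h i := type_of_some (h i)
  exists_base {n} α hα := by
    have h : ∀ i, ∃ g : G, α.zero i = some (g • s) := by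
      intro i
      have hi := hα i
      cases hz : α.zero i with
      | none =>
        rw [type_of_none hz] at hi
        cases hi
      | some t =>
        rw [type_of_some hz] at hi
        obtain ⟨g, hg⟩ := Quotient.exact (Sum.inr_injective hi)
        exact ⟨g, congrArg some hg.symm⟩
    choose c hc using h
    let φ : FBHom G (Fin n × Unit) (Fin n) := ⟨Equiv.prodPUnit _, fun i => c i.1⟩
    refine ⟨n, φ, map φ.symm α, fun i => ?_, map_map_symm φ α⟩
    obtain ⟨j, rfl⟩ := φ.symm.toEquiv.surjective i
    rw [map_zero_apply, hc]
    change some ((c j)⁻¹ • c j • s) = some s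
    rw [inv_smul_smul]
  arity_eq ψ _ _ _ := by
    simpa using Nat.card_congr ψ.toEquiv
  exists_blow {m κ κ'} ψ hκ hκ' h := by
    have hs : ∀ i, ψ.color (i, ()) ∈ stabilizer G s := by
      intro i
      have h1 := map_zero_apply ψ κ (i, ())
      rw [h, hκ', hκ] at h1
      exact (Option.some_injective _ h1).symm
    refine ⟨⟨(Equiv.prodPUnit _).symm.trans (ψ.toEquiv.trans (Equiv.prodPUnit _)),
      fun i => ⟨ψ.color (i, ()), hs i⟩⟩, ?_⟩
    apply FBHom.ext
    · rfl
    · rfl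
  exists_eq {m p κ} hκ x := by
    obtain ⟨hm, rfl⟩ := eq_fromPoint hT hκ
    by_cases hp : p = m
    · obtain ⟨a, rfl⟩ := (RedHom.map_bijective _ (fromPointEmb_surjective hT hm) p).2 x
      exact ⟨⟨a, fun h => absurd hp h⟩, rfl⟩
    · have : Subsingleton (RedHom k (Set.Iic _) p) := subsingleton_iic k
        (fromPoint hT s (pointTop (stabilizer G s) (s ∈ T) (Fin m))) (by
          rw [rank_of_zero _ fun i => by rw [hκ i]; simp]
          simpa using hp)
      exact ⟨0, by rw [Subsingleton.elim x 0, _root_.map_zero, _root_.map_zero]⟩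
  eq_incl {m p} a := by
    by_cases hm : Full (s ∈ T) (Fin m)
    · exact Or.inr ⟨_, fun i => fromPoint_zero hT (pointTop_zero hm i.1) i.2, _, rfl⟩
    · exact Or.inl (eq_zero_of_not_full hm a)

variable (k s) in
/-- The part of Whitney homology supported on the elements without blocks, for which the
colours lie in one orbit. -/
def dowlingRealization : Realization k S T (dowlingFactor k G T s) {.inr (Quotient.mk _ s)} :=
  (pointData hT s).realization

end DowlingFactor

/-! ### Elements all of whose blocks have the same size -/

section BlockPoset

open Poset

variable {G : Type u} [Group G] {S : Type u} [MulAction G S] {T : Set S} {D : Type}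

variable (G S T) in
/-- The blocks are the sets `{i} × D`, with trivial colouring. -/
def blocks (I D : Type) : Poset G S T (I × D) where
  zero _ := none
  rel x g y := x.1 = y.1 ∧ g = 1
  rel_refl _ := by simp
  rel_symm := by rintro i g j ⟨h, rfl⟩; simp [h]
  rel_trans := by rintro i g j h l ⟨h1, rfl⟩ ⟨h2, rfl⟩; simp [h1, h2]
  rel_unique h := h.2
  mem_of_unique t := by rintro ⟨i, ⟨g, h⟩, -⟩; cases h

variable (G S T) in
/-- The blocks are the classes of an equivalence relation, with trivial colouring. -/
def ofSetoid (r : Setoid D) : Poset G S T D where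
  zero _ := none
  rel x g y := r x y ∧ g = 1
  rel_refl x := by simp
  rel_symm := by rintro i g j ⟨h, rfl⟩; exact ⟨r.symm h, inv_one⟩
  rel_trans := by rintro i g j h l ⟨h1, rfl⟩ ⟨h2, rfl⟩; exact ⟨r.trans h1 h2, mul_one _⟩
  rel_unique h := h.2
  mem_of_unique t := by rintro ⟨i, ⟨g, h⟩, -⟩; cases h

theorem ofSetoid_le_iff {r r' : Setoid D} : ofSetoid G S T r ≤ ofSetoid G S T r' ↔ r ≤ r' := by
  constructor
  · intro h x y hxy
    rcases h.2 x 1 y ⟨hxy, rfl⟩ with h | ⟨t, ht, -⟩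
    · exact h.1
    · cases ht
  · exact fun h => ⟨fun i t ht => (by cases ht), fun x g y hr => Or.inl ⟨h hr.1, hr.2⟩⟩

variable (G S T D) in
/-- The partition lattice, as a lower interval. -/
def setoidEmb : Setoid D ↪o Set.Iic (ofSetoid G S T (⊤ : Setoid D)) :=
  OrderEmbedding.ofMapLEIff (fun r => ⟨ofSetoid G S T r, Set.mem_Iic.2 (ofSetoid_le_iff.2 le_top)⟩)
    fun _ _ => ofSetoid_le_iff

theorem setoidEmb_surjective : Function.Surjective (setoidEmb G S T D) := by
  rintro ⟨z, hz⟩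
  have h0 : ∀ i, z.zero i = none := fun i => zero_none_of_le (Set.mem_Iic.1 hz) rfl
  have h1 : ∀ i g j, z.rel i g j → g = 1 := fun i g j hr =>
    (rel_of_le (Set.mem_Iic.1 hz) hr rfl).2
  refine ⟨⟨fun x y => z.rel x 1 y, ⟨fun x => (z.rel_refl x).2 (h0 x),
    fun h => by simpa using z.rel_symm h, fun h h' => by simpa using z.rel_trans h h'⟩⟩,
    Subtype.ext (Poset.ext ?_ ?_)⟩
  · funext i; exact (h0 i).symm
  · funext i g j
    refine propext ⟨?_, fun hr => ?_⟩
    · rintro ⟨hr, rfl⟩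
      exact hr
    · obtain rfl := h1 i g j hr
      exact ⟨hr, rfl⟩

theorem map_diagHom {n : ℕ} (g : G × Equiv.Perm (Fin n)) (r : Setoid (Fin n)) :
    map (diagHom G n g) (ofSetoid G S T r) = ofSetoid G S T (partEmb g.2 r) := by
  apply Poset.ext
  · rfl
  · funext i h j
    refine propext (and_congr Iff.rfl ?_)
    change g.1⁻¹ * h * g.1 = 1 ↔ h = 1
    rw [mul_assoc, inv_mul_eq_one]
    exact ⟨fun e => mul_eq_right.1 e.symm, fun e => by rw [e, one_mul]⟩

/-- The bijection `[m] × D ⊔ D ≃ [m + 1] × D`. -/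
def snocEquiv (D : Type) (m : ℕ) : (Fin m × D) ⊕ D ≃ Fin (m + 1) × D :=
  (Equiv.sumCongr (Equiv.refl _) (Equiv.uniqueProd D (Fin 1)).symm).trans
    (TwAlg.blowSum D m 1).symm

@[simp] theorem snocEquiv_inl (m : ℕ) (i : Fin m) (x : D) :
    snocEquiv D m (.inl (i, x)) = (i.castSucc, x) := by
  simp [snocEquiv, TwAlg.blowSum, Fin.castSucc]

@[simp] theorem snocEquiv_inr (m : ℕ) (x : D) :
    snocEquiv D m (.inr x) = (Fin.last m, x) := by
  simp [snocEquiv, TwAlg.blowSum, Fin.last, Fin.natAdd]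

theorem union_blocks (m : ℕ) :
    map (FBHom.ofEquiv G (snocEquiv D m)) (union (blocks G S T (Fin m) D) (ofSetoid G S T ⊤)) =
      blocks G S T (Fin (m + 1)) D := by
  apply map_injective (FBHom.ofEquiv G (snocEquiv D m)).symm
  rw [map_symm_map]
  apply Poset.ext
  · funext i; rcases i with i | i <;> rfl
  · funext i g j
    change _ = ((snocEquiv D m i).1 = (snocEquiv D m j).1 ∧ (1 : G)⁻¹⁻¹ * g * 1⁻¹ = 1)
    rw [inv_inv, inv_one, mul_one, one_mul]
    rcases i with ⟨i, x⟩ | i <;> rcases j with ⟨j, y⟩ | j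
    · rw [snocEquiv_inl, snocEquiv_inl]
      exact propext (and_congr (Fin.castSucc_inj).symm Iff.rfl)
    · rw [snocEquiv_inl, snocEquiv_inr]
      exact propext ⟨False.elim, fun h => (Fin.castSucc_lt_last i).ne h.1⟩
    · rw [snocEquiv_inl, snocEquiv_inr]
      exact propext ⟨False.elim, fun h => (Fin.castSucc_lt_last j).ne' h.1⟩
    · rw [snocEquiv_inr, snocEquiv_inr]
      exact propext (and_congr (iff_of_true trivial rfl) Iff.rfl)

theorem rank_ofSetoid_top (n : ℕ) (hn : n ≠ 0) :
    (ofSetoid G S T (⊤ : Setoid (Fin n))).rank = n - 1 := by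
  have h : (ofSetoid G S T (⊤ : Setoid (Fin n))).numBlocks = 1 := by
    rw [numBlocks, Nat.card_eq_one_iff_unique]
    refine ⟨⟨fun a b => Quotient.inductionOn₂ a b fun x y => Quotient.sound ⟨1, trivial, rfl⟩⟩,
      ⟨Quotient.mk _ ⟨⟨0, Nat.pos_of_ne_zero hn⟩, rfl⟩⟩⟩
  rw [rank, h, Nat.card_fin]

theorem rank_blocks (n : ℕ) (hn : n ≠ 0) (m : ℕ) :
    (blocks G S T (Fin m) (Fin n)).rank = (n - 1) * m := by
  induction m with
  | zero =>
    rw [rank]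
    simp
  | succ m ih => rw [← union_blocks, rank_map, rank_union, ih, rank_ofSetoid_top n hn, Nat.mul_succ]

end BlockPoset

/-! ### Tensor powers of the top homology of the partition lattice -/

section TensorPowers

variable {k : Type u} [CommRing k] {V : Type u} [AddCommGroup V] [Module k V]

/-- Linear maps on `V^{⊗ (m + n)}` that agree on products agree. -/
theorem tpow_ext {m n : ℕ} {M : Type*} [AddCommGroup M] [Module k M]
    {f g : (⨂[k]^(m + n) V) →ₗ[k] M}
    (h : ∀ x y, f (TwAlg.tpowMul V m n x y) = g (TwAlg.tpowMul V m n x y)) : f = g := by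
  have e : f ∘ₗ TensorPower.mulEquiv.toLinearMap =
      g ∘ₗ (TensorPower.mulEquiv (R := k) (M := V) (n := m) (m := n)).toLinearMap :=
    TensorProduct.ext' h
  refine LinearMap.ext fun z => ?_
  obtain ⟨w, rfl⟩ := TensorPower.mulEquiv.surjective z
  exact DFunLike.congr_fun e w

variable (k V) in
/-- The unit of the tensor algebra. -/
def tpowOne : ⨂[k]^0 V := PiTensorProduct.tprod k Fin.elim0

theorem eq_smul_tpowOne (x : ⨂[k]^0 V) : ∃ c : k, x = c • tpowOne k V := by
  refine ⟨PiTensorProduct.isEmptyEquiv (Fin 0) x, ?_⟩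
  apply (PiTensorProduct.isEmptyEquiv (Fin 0)).injective
  rw [map_smul, tpowOne, PiTensorProduct.isEmptyEquiv_apply_tprod, smul_eq_mul, mul_one]

theorem tpowMul_one {m : ℕ} (x : ⨂[k]^m V) : TwAlg.tpowMul V m 0 x (tpowOne k V) = x := by
  have e : (TwAlg.tpowMul V m 0).flip (tpowOne k V) = LinearMap.id := by
    refine PiTensorProduct.ext (MultilinearMap.ext fun f => ?_)
    refine (TwAlg.tpowMul_tprod m 0 f _).trans ?_
    rw [Fin.append_right_nil _ _ rfl]
    rfl
  exact DFunLike.congr_fun e x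

theorem one_tpowMul (x : ⨂[k]^1 V) : TwAlg.tpowMul V 0 1 (tpowOne k V) x = x := by
  have e : TwAlg.tpowMul V 0 1 (tpowOne k V) = LinearMap.id := by
    refine PiTensorProduct.ext (MultilinearMap.ext fun f => ?_)
    refine (TwAlg.tpowMul_tprod 0 1 _ f).trans ?_
    rw [Fin.append_left_nil _ _ rfl]
    rfl
  exact DFunLike.congr_fun e x

theorem mem_span_tprod {m : ℕ} (x : ⨂[k]^m V) :
    x ∈ Submodule.span k (Set.range (PiTensorProduct.tprod k (s := fun _ : Fin m => V))) :=
  PiTensorProduct.span_tprod_eq_top (R := k) (s := fun _ : Fin m => V) ▸ Submodule.mem_top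

theorem tpowMul_assoc {m n : ℕ} (x : ⨂[k]^m V) (y : ⨂[k]^n V) (z : ⨂[k]^1 V) :
    TwAlg.tpowMul V (m + n) 1 (TwAlg.tpowMul V m n x y) z =
      TwAlg.tpowMul V m (n + 1) x (TwAlg.tpowMul V n 1 y z) := by
  refine assoc_of_span k (TwAlg.tpowMul V m n) (TwAlg.tpowMul V (m + n) 1) LinearMap.id
    (TwAlg.tpowMul V n 1) (TwAlg.tpowMul V m (n + 1)) mem_span_tprod mem_span_tprod
    mem_span_tprod ?_ x y z
  rintro _ ⟨f, rfl⟩ _ ⟨g, rfl⟩ _ ⟨h, rfl⟩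
  rw [LinearMap.id_apply, TwAlg.tpowMul_tprod, TwAlg.tpowMul_tprod, TwAlg.tpowMul_tprod,
    TwAlg.tpowMul_tprod, Fin.append_assoc]
  rfl

end TensorPowers

section PartitionFactor

open Poset

variable {k : Type u} [CommRing k] {G : Type u} [Group G] {S : Type u} [MulAction G S] {T : Set S}
  {n : ℕ}

variable (k G S T n) in
/-- The top homology of the partition lattice, in the Whitney homology of a block. -/
def blockMap : RedHom k (Setoid (Fin n)) (n - 1) →ₗ[k] W k G T (Fin n) (n - 1) :=
  W.incl k (n - 1) (ofSetoid G S T ⊤) ∘ₗ RedHom.map k (setoidEmb G S T (Fin n)) (n - 1)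

theorem blockMap_apply (v : RedHom k (Setoid (Fin n)) (n - 1)) : blockMap k G S T n v =
    W.incl k (n - 1) (ofSetoid G S T ⊤) (RedHom.map k (setoidEmb G S T (Fin n)) (n - 1) v) := rfl

theorem blockMap_act (g : G × Equiv.Perm (Fin n)) (v : RedHom k (Setoid (Fin n)) (n - 1)) :
    blockMap k G S T n (partRep k G n g v) =
      W.act k (diagHom G n g) (blockMap k G S T n v) := by
  rw [blockMap_apply, blockMap_apply, W.act_incl, ← RedHom.map_comp]
  refine (congrArg _ (RedHom.map_comp k _ _ _ _).symm).trans ?_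
  refine W.incl_map_congr k ?_ _ _ (fun z => ?_) _
  · rw [map_diagHom]
    congr 1
  · exact (map_diagHom g z).symm

variable (k G S T n) in
/-- `blockMap`, on the first tensor power. -/
def oneMap : (⨂[k]^1 (RedHom k (Setoid (Fin n)) (n - 1))) →ₗ[k] W k G T (Fin n) (n - 1) :=
  blockMap k G S T n ∘ₗ (PiTensorProduct.subsingletonEquiv (0 : Fin 1)).toLinearMap

variable (k G S T n) in
/-- The product of the classes of the blocks `{i} × [n]`. The degree is written as `(n - 1) * m`,
with `m` on the right, because `Nat.mul_succ` then matches the recursion over `m`. -/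
def powMap : ∀ m, (⨂[k]^m (RedHom k (Setoid (Fin n)) (n - 1))) →ₗ[k]
    W k G T (Fin m × Fin n) ((n - 1) * m)
  | 0 => (PiTensorProduct.isEmptyEquiv (Fin 0)).toLinearMap.smulRight (W.one k)
  | m + 1 => TensorProduct.lift (((W.mul k (Nat.mul_succ _ _).symm).compl₁₂ (powMap m)
      (oneMap k G S T n)).compr₂ (W.act k (FBHom.ofEquiv G (snocEquiv (Fin n) m)))) ∘ₗ
        TensorPower.mulEquiv.symm.toLinearMap

theorem powMap_one : powMap k G S T n 0 (tpowOne k _) = W.one k := by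
  change PiTensorProduct.isEmptyEquiv (Fin 0) (PiTensorProduct.tprod k _) • W.one k = _
  rw [PiTensorProduct.isEmptyEquiv_apply_tprod, one_smul]

theorem powMap_snoc {m : ℕ} (x : ⨂[k]^m (RedHom k (Setoid (Fin n)) (n - 1)))
    (y : ⨂[k]^1 (RedHom k (Setoid (Fin n)) (n - 1))) :
    powMap k G S T n (m + 1) (TwAlg.tpowMul _ m 1 x y) =
      W.act k (FBHom.ofEquiv G (snocEquiv (Fin n) m))
        (W.mul k (Nat.mul_succ _ _).symm (powMap k G S T n m x) (oneMap k G S T n y)) := by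
  change TensorProduct.lift _ (TensorPower.mulEquiv.symm (TensorPower.mulEquiv (x ⊗ₜ y))) = _
  rw [LinearEquiv.symm_apply_apply, TensorProduct.lift.tmul]
  rfl

theorem powMap_mul {m l : ℕ} (x : ⨂[k]^m (RedHom k (Setoid (Fin n)) (n - 1)))
    (y : ⨂[k]^l (RedHom k (Setoid (Fin n)) (n - 1))) :
    powMap k G S T n (m + l) (TwAlg.tpowMul _ m l x y) =
      W.act k (FBHom.ofEquiv G (TwAlg.blowSum (Fin n) m l).symm)
        (W.mul k (Nat.mul_add _ _ _).symm (powMap k G S T n m x) (powMap k G S T n l y)) := by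
  induction l with
  | zero =>
    obtain ⟨c, rfl⟩ := eq_smul_tpowOne y
    simp only [map_smul]
    refine congrArg (c • ·) ?_
    rw [tpowMul_one, powMap_one]
    have e := W.mul_one k (J := Fin 0 × Fin n) rfl (powMap k G S T n m x)
    refine Eq.trans ?_ (congrArg (W.act k _) e).symm
    rw [← W.act_comp]
    refine (W.act_id k _).symm.trans (W.act_congr k ?_ _)
    apply FBHom.ext
    · ext ⟨i, x⟩ <;> rfl
    · funext i; simp [FBHom.id, FBHom.comp, FBHom.ofEquiv]
  | succ l ih =>
    refine DFunLike.congr_fun (f := powMap k G S T n (m + (l + 1)) ∘ₗ TwAlg.tpowMul _ m (l + 1) x)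
      (g := W.act k (FBHom.ofEquiv G (TwAlg.blowSum (Fin n) m (l + 1)).symm) ∘ₗ
        W.mul k (Nat.mul_add _ _ _).symm (powMap k G S T n m x) ∘ₗ powMap k G S T n (l + 1)) ?_ y
    refine tpow_ext fun y z => ?_
    rw [LinearMap.comp_apply, LinearMap.comp_apply, LinearMap.comp_apply, ← tpowMul_assoc,
      powMap_snoc]
    refine (powMap_snoc (m := m + l) _ z).trans ?_
    rw [ih, W.mul_act_left, W.mul_act_right, W.mul_assoc' k _ _ (Nat.mul_succ _ _).symm
      (Nat.mul_add _ _ _).symm, ← W.act_comp, ← W.act_comp, ← W.act_comp]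
    refine W.act_congr k ?_ _
    apply FBHom.ext
    · refine Equiv.ext ?_
      rintro (⟨i, a⟩ | ⟨i, a⟩ | a)
      · have e : (Fin.castAdd l i).castSucc = Fin.castAdd (l + 1) i := rfl
        simpa [FBHom.id, FBHom.comp, FBHom.ofEquiv, FBHom.sum, TwAlg.blowSum] using e
      all_goals simp [FBHom.id, FBHom.comp, FBHom.ofEquiv, FBHom.sum, TwAlg.blowSum]
    · funext i
      rcases i with i | i | i <;>
        simp [FBHom.id, FBHom.comp, FBHom.ofEquiv, FBHom.sum]

end PartitionFactor

/-! ### Equivariance of the tensor powers -/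

section PowEquivariance

open Poset

variable {k : Type u} [CommRing k] {G : Type u} [Group G] {S : Type u} [MulAction G S] {T : Set S}
  {n : ℕ}

theorem blow_mul {H : Type u} [Group H] {D : Type} (ρ : H →* FBHom G D D) {m : ℕ} (a b : Wr H m) :
    TwAlg.blow ρ (a * b) = FBHom.comp (TwAlg.blow ρ a) (TwAlg.blow ρ b) := by
  apply FBHom.ext
  · ext ⟨i, x⟩ <;> simp [TwAlg.blow, FBHom.comp]
  · funext ⟨i, x⟩
    simp [TwAlg.blow, FBHom.comp]

theorem blow_block {H : Type u} [Group H] {D : Type} (ρ : H →* FBHom G D D) {m l : ℕ} (a : Wr H m)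
    (b : Wr H l) :
    FBHom.comp (FBHom.ofEquiv G (TwAlg.blowSum D m l).symm)
      (FBHom.sum (TwAlg.blow ρ a) (TwAlg.blow ρ b)) =
    FBHom.comp (TwAlg.blow ρ (Wr.block a b)) (FBHom.ofEquiv G (TwAlg.blowSum D m l).symm) := by
  apply FBHom.ext
  · refine Equiv.ext ?_
    rintro (⟨i, x⟩ | ⟨i, x⟩) <;>
      simp [TwAlg.blow, TwAlg.blowSum, Wr.block, FBHom.join, FBHom.comp, FBHom.ofEquiv, FBHom.sum]
  · funext i
    rcases i with ⟨i, x⟩ | ⟨i, x⟩ <;>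
      simp [TwAlg.blow, TwAlg.blowSum, Wr.block, FBHom.join, FBHom.comp, FBHom.ofEquiv, FBHom.sum]

theorem tpowAct_mul {H V : Type u} [Group H] [AddCommGroup V] [Module k V]
    (ρ : Representation k H V) (d : ℕ) {m : ℕ} (a b : Wr H m) (x : ⨂[k]^m V) :
    TwAlg.tpowAct ρ d m (a * b) x = TwAlg.tpowAct ρ d m a (TwAlg.tpowAct ρ d m b x) :=
  congrArg Subtype.val (DFunLike.congr_fun (map_mul ((TwAlg.TPow ρ d).act m (m * d)) a b)
    (show (TwAlg.TPow ρ d).obj m (m * d) from ⟨x, fun h => absurd rfl h⟩))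

theorem tpowAct_one {H V : Type u} [Group H] [AddCommGroup V] [Module k V]
    (ρ : Representation k H V) (d : ℕ) {m : ℕ} (x : ⨂[k]^m V) :
    TwAlg.tpowAct ρ d m (1 : Wr H m) x = x :=
  congrArg Subtype.val (DFunLike.congr_fun (map_one ((TwAlg.TPow ρ d).act m (m * d)))
    (show (TwAlg.TPow ρ d).obj m (m * d) from ⟨x, fun h => absurd rfl h⟩))

variable (k S T) in
/-- The map `powMap` respects the action of `h`. -/
def Respects {m : ℕ} (h : Wr (G × Equiv.Perm (Fin n)) m) : Prop :=
  ∀ x, powMap k G S T n m (TwAlg.tpowAct (partRep k G n) (n - 1) m h x) =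
    W.act k (TwAlg.blow (diagHom G n) h) (powMap k G S T n m x)

theorem respects_one {m : ℕ} : Respects k S T (1 : Wr (G × Equiv.Perm (Fin n)) m) := by
  intro x
  rw [tpowAct_one, TwAlg.blow_one, W.act_id]

theorem Respects.mul {m : ℕ} {a b : Wr (G × Equiv.Perm (Fin n)) m} (ha : Respects k S T a)
    (hb : Respects k S T b) : Respects k S T (a * b) := by
  intro x
  rw [tpowAct_mul, ha, hb, blow_mul, W.act_comp]

theorem Respects.block {m l : ℕ} {a : Wr (G × Equiv.Perm (Fin n)) m}
    {b : Wr (G × Equiv.Perm (Fin n)) l} (ha : Respects k S T a) (hb : Respects k S T b) :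
    Respects k S T (Wr.block a b) := by
  refine fun z => DFunLike.congr_fun
    (f := powMap k G S T n (m + l) ∘ₗ TwAlg.tpowAct (partRep k G n) (n - 1) (m + l) (Wr.block a b))
    (g := W.act k (TwAlg.blow (diagHom G n) (Wr.block a b)) ∘ₗ powMap k G S T n (m + l)) ?_ z
  refine tpow_ext fun x y => ?_
  rw [LinearMap.comp_apply, LinearMap.comp_apply, ← TwAlg.tpowMul_act, powMap_mul, powMap_mul,
    ha, hb, W.mul_act, ← W.act_comp, ← W.act_comp, blow_block]

theorem oneMap_act (h : Wr (G × Equiv.Perm (Fin n)) 1)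
    (y : ⨂[k]^1 (RedHom k (Setoid (Fin n)) (n - 1))) :
    oneMap k G S T n (TwAlg.tpowAct (partRep k G n) (n - 1) 1 h y) =
      W.act k (diagHom G n (h.color 0)) (oneMap k G S T n y) := by
  refine DFunLike.congr_fun (f := oneMap k G S T n ∘ₗ TwAlg.tpowAct (partRep k G n) (n - 1) 1 h)
    (g := W.act k (diagHom G n (h.color 0)) ∘ₗ oneMap k G S T n) ?_ y
  refine PiTensorProduct.ext (MultilinearMap.ext fun f => ?_)
  have h1 : h.toEquiv = 1 := Subsingleton.elim _ _
  change oneMap k G S T n (TwAlg.tpowAct _ _ 1 h _) =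
    W.act k _ (oneMap k G S T n (PiTensorProduct.tprod k f))
  have e : ∀ f : Fin 1 → RedHom k (Setoid (Fin n)) (n - 1),
      oneMap k G S T n (PiTensorProduct.tprod k f) = blockMap k G S T n (f 0) := fun f =>
    congrArg (blockMap k G S T n) (PiTensorProduct.subsingletonEquiv_apply_tprod 0 f)
  rw [TwAlg.tpowAct_tprod, map_smul, e, e, ← blockMap_act, h1]
  rw [Subsingleton.elim ((Equiv.symm (1 : Equiv.Perm (Fin 1))) 0) 0]
  simp [TwAlg.sgn]

theorem powMap_arity_one (y : ⨂[k]^1 (RedHom k (Setoid (Fin n)) (n - 1))) :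
    powMap k G S T n 1 y = W.act k (FBHom.ofEquiv G (snocEquiv (Fin n) 0))
      (W.mul k (Nat.mul_succ (n - 1) 0).symm (powMap k G S T n 0 (tpowOne k _))
        (oneMap k G S T n y)) := by
  conv_lhs => rw [← one_tpowMul y]
  exact powMap_snoc (m := 0) _ _

theorem respects_of_arity_one (h : Wr (G × Equiv.Perm (Fin n)) 1) : Respects k S T h := by
  intro y
  rw [powMap_arity_one, powMap_arity_one y, oneMap_act, W.mul_act_right, ← W.act_comp, ← W.act_comp]
  refine W.act_congr k ?_ _
  have h1 : h.toEquiv = 1 := Subsingleton.elim _ _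
  apply FBHom.ext
  · refine Equiv.ext ?_
    rintro (⟨i, x⟩ | x)
    · exact i.elim0
    · change snocEquiv (Fin n) 0 (.inr ((h.color 0).2 x)) =
        (TwAlg.blow (diagHom G n) h).toEquiv (snocEquiv (Fin n) 0 (.inr x))
      rw [snocEquiv_inr, snocEquiv_inr]
      exact Prod.ext (Subsingleton.elim (α := Fin 1) _ _) rfl
  · funext i
    rcases i with ⟨i, x⟩ | x
    · exact i.elim0
    · change 1 * (h.color 0).1 =
        (TwAlg.blow (diagHom G n) h).color (snocEquiv (Fin n) 0 (.inr x)) * 1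
      rw [snocEquiv_inr, one_mul, mul_one]
      rfl

/-- With `d = n - 1`, the exchange of two factors of degree `d` has the Koszul sign `(-1) ^ d`, and
the signed commutativity of the product contributes `(-1) ^ (d * d)`, which is the same. -/
theorem respects_swap :
    Respects k S T (FBHom.ofEquiv (G × Equiv.Perm (Fin n)) (Equiv.swap (0 : Fin 2) 1)) := by
  refine fun z => DFunLike.congr_fun
    (f := powMap k G S T n 2 ∘ₗ TwAlg.tpowAct (partRep k G n) (n - 1) 2
      (FBHom.ofEquiv (G × Equiv.Perm (Fin n)) (Equiv.swap (0 : Fin 2) 1)))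
    (g := W.act k (TwAlg.blow (diagHom G n)
      (FBHom.ofEquiv (G × Equiv.Perm (Fin n)) (Equiv.swap (0 : Fin 2) 1))) ∘ₗ
        powMap k G S T n 2) ?_ z
  refine tpow_ext (m := 1) (n := 1) fun x y => ?_
  have e : TwAlg.tpowAct (partRep k G n) (n - 1) 2
      (FBHom.ofEquiv (G × Equiv.Perm (Fin n)) (Equiv.swap (0 : Fin 2) 1))
        (TwAlg.tpowMul _ 1 1 x y) = (-1 : k) ^ (n - 1) • TwAlg.tpowMul _ 1 1 y x := by
    refine LinearMap.congr_fun₂ (f := (TwAlg.tpowMul _ 1 1).compr₂ (TwAlg.tpowAct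
      (partRep k G n) (n - 1) 2
        (FBHom.ofEquiv (G × Equiv.Perm (Fin n)) (Equiv.swap (0 : Fin 2) 1))))
      (g := (-1 : k) ^ (n - 1) • (TwAlg.tpowMul _ 1 1).flip) ?_ x y
    refine PiTensorProduct.ext (MultilinearMap.ext fun f =>
      PiTensorProduct.ext (MultilinearMap.ext fun g => ?_))
    change TwAlg.tpowAct (partRep k G n) (n - 1) 2
      (FBHom.ofEquiv (G × Equiv.Perm (Fin n)) (Equiv.swap (0 : Fin 2) 1))
        (TwAlg.tpowMul _ 1 1 (PiTensorProduct.tprod k f) (PiTensorProduct.tprod k g)) =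
      (-1 : k) ^ (n - 1) •
        TwAlg.tpowMul _ 1 1 (PiTensorProduct.tprod k g) (PiTensorProduct.tprod k f)
    rw [TwAlg.tpowMul_tprod, TwAlg.tpowMul_tprod, TwAlg.tpowAct_tprod]
    congr 2
    · simp [TwAlg.sgn, FBHom.ofEquiv]
    · funext i
      change partRep k G n 1 _ = _
      rw [map_one]
      fin_cases i <;> rfl
  have e2 := powMap_mul (k := k) (S := S) (T := T) (G := G) (n := n) (m := 1) (l := 1)
  rw [LinearMap.comp_apply, LinearMap.comp_apply, e, map_smul]
  refine (congrArg _ (e2 y x)).trans (Eq.trans ?_ (congrArg _ (e2 x y).symm))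
  rw [W.mul_comm' k _ (Nat.mul_add _ _ _).symm (powMap k G S T n 1 x), map_smul, map_smul,
    ← W.act_comp, ← W.act_comp]
  have e3 : (-1 : k) ^ ((n - 1) * 1 * ((n - 1) * 1)) = (-1) ^ (n - 1) := by
    rw [mul_one, ← sq]
    rcases Nat.even_or_odd (n - 1) with h | h
    · rw [h.neg_one_pow, (h.pow_of_ne_zero two_ne_zero).neg_one_pow]
    · rw [h.neg_one_pow, h.pow.neg_one_pow]
  rw [e3]
  refine congrArg (_ • ·) (W.act_congr k ?_ _)
  apply FBHom.ext
  · refine Equiv.ext ?_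
    rintro (⟨i, x⟩ | ⟨i, x⟩) <;> obtain rfl := Subsingleton.elim i 0 <;>
      simp only [TwAlg.blow, TwAlg.blowSum, FBHom.comp, FBHom.ofEquiv] <;> rfl
  · funext i
    rcases i with ⟨i, x⟩ | ⟨i, x⟩ <;>
      simp [TwAlg.blow, TwAlg.blowSum, FBHom.comp, FBHom.ofEquiv]

/-- Every adjacent transposition is the block sum of an identity with a permutation of fewer
elements or with the exchange of two elements. -/
theorem respects_of_swap {m : ℕ}
    (ih : ∀ h : Wr (G × Equiv.Perm (Fin n)) (m + 1), Respects k S T h) (i : Fin (m + 1)) :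
    Respects k S T (FBHom.ofEquiv (G × Equiv.Perm (Fin n)) (Equiv.swap i.castSucc i.succ)) := by
  induction i using Fin.lastCases with
  | last =>
    have e : FBHom.ofEquiv (G × Equiv.Perm (Fin n))
        (Equiv.swap (Fin.last m).castSucc (Fin.last m).succ) =
        Wr.block (1 : Wr _ m) (FBHom.ofEquiv _ (Equiv.swap (0 : Fin 2) 1)) := by
      apply FBHom.ext
      · change _ = (finSumFinEquiv.symm.trans
          (Equiv.Perm.sumCongr (Equiv.refl _) (Equiv.swap (0 : Fin 2) 1))).trans finSumFinEquiv
        rw [Equiv.Perm.sumCongr_refl_swap, Equiv.symm_trans_swap_trans]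
        rfl
      · funext x
        refine Fin.addCases (m := m) (n := 2) (fun i => ?_) (fun i => ?_) x <;>
          simp [Wr.block, FBHom.join, FBHom.comp, FBHom.ofEquiv, FBHom.sum]
    rw [e]
    exact respects_one.block respects_swap
  | cast i =>
    have e : FBHom.ofEquiv (G × Equiv.Perm (Fin n))
        (Equiv.swap i.castSucc.castSucc i.castSucc.succ) =
        Wr.block (FBHom.ofEquiv _ (Equiv.swap i.castSucc i.succ)) (1 : Wr _ 1) := by
      apply FBHom.ext
      · change _ = (finSumFinEquiv.symm.trans (Equiv.Perm.sumCongr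
          (Equiv.swap i.castSucc i.succ) (Equiv.refl (Fin 1)))).trans finSumFinEquiv
        rw [Equiv.Perm.sumCongr_swap_refl, Equiv.symm_trans_swap_trans]
        rfl
      · funext x
        refine Fin.addCases (m := m + 1) (n := 1) (fun i => ?_) (fun i => ?_) x <;>
          simp [Wr.block, FBHom.join, FBHom.comp, FBHom.ofEquiv, FBHom.sum]
    rw [e]
    exact (ih _).block respects_one

/-- Equivariance of `powMap`: the wreath product is generated by block sums and the exchange of two
factors. -/
theorem respects {m : ℕ} (h : Wr (G × Equiv.Perm (Fin n)) m) : Respects k S T h := by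
  induction m with
  | zero =>
    have e : h = 1 := FBHom.ext (Subsingleton.elim _ _) (funext fun i => i.elim0)
    rw [e]
    exact respects_one
  | succ m ih =>
    cases m with
    | zero => exact respects_of_arity_one h
    | succ m =>
      have h1 : Respects k S T (FBHom.ofEquiv (G × Equiv.Perm (Fin n)) h.toEquiv) := by
        have hm : h.toEquiv ∈ Submonoid.closure
            (Set.range fun i : Fin (m + 1) => Equiv.swap i.castSucc i.succ) := by
          rw [Equiv.Perm.mclosure_swap_castSucc_succ]
          trivial
        generalize h.toEquiv = σ at hm ⊢
        induction hm using Submonoid.closure_induction with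
        | mem σ hσ =>
          obtain ⟨i, rfl⟩ := hσ
          exact respects_of_swap ih i
        | one => exact respects_one
        | mul σ τ _ _ hσ hτ =>
          have e : FBHom.ofEquiv (G × Equiv.Perm (Fin n)) (σ * τ) =
              (FBHom.ofEquiv _ σ * FBHom.ofEquiv _ τ : Wr _ (m + 2)) := by
            apply FBHom.ext
            · rfl
            · funext i; exact (mul_one _).symm
          rw [e]
          exact hσ.mul hτ
      have h2 : Respects k S T (⟨Equiv.refl _, h.color⟩ : Wr (G × Equiv.Perm (Fin n)) (m + 2)) := by
        have e : (⟨Equiv.refl _, h.color⟩ : Wr (G × Equiv.Perm (Fin n)) (m + 2)) =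
            Wr.block (⟨Equiv.refl _, fun i => h.color i.castSucc⟩ : Wr _ (m + 1))
              (⟨Equiv.refl _, fun _ => h.color (Fin.last _)⟩ : Wr _ 1) := by
          apply FBHom.ext
          · refine Equiv.ext fun x => ?_
            refine Fin.addCases (m := m + 1) (n := 1) (fun i => ?_) (fun i => ?_) x <;>
              simp [Wr.block, FBHom.join, FBHom.comp, FBHom.ofEquiv, FBHom.sum]
          · funext x
            refine Fin.addCases (m := m + 1) (n := 1) (fun i => ?_) (fun i => ?_) x
            · simp [Wr.block, FBHom.join, FBHom.comp, FBHom.ofEquiv, FBHom.sum]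
              rfl
            · obtain rfl := Subsingleton.elim i 0
              simp [Wr.block, FBHom.join, FBHom.comp, FBHom.ofEquiv, FBHom.sum]
              rfl
        rw [e]
        exact (ih _).block (respects_of_arity_one _)
      have e : h = FBHom.ofEquiv _ h.toEquiv * ⟨Equiv.refl _, h.color⟩ := by
        apply FBHom.ext
        · rfl
        · funext i; exact (one_mul _).symm
      rw [e]
      exact h1.mul h2

end PowEquivariance

/-! ### Realizations of the factors indexed by block sizes -/

section PowBijective

open Poset

variable {k : Type u} [CommRing k] {G : Type u} [Group G] {S : Type u} [MulAction G S] {T : Set S}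
  {n : ℕ}

/-- The Künneth isomorphism for a lower interval of a disjoint union. -/
theorem exists_splitEquiv {I J K : Type*} [Finite I] [Finite J] {α : Poset G S T K}
    {β : Poset G S T I} {γ : Poset G S T J} (φ : FBHom G (I ⊕ J) K) (hα : map φ (union β γ) = α)
    (hs : Sep (union β γ)) {p q r : ℕ} (hp : β.rank = p) (hq : γ.rank = q) (h : p + q = r) :
    ∃ t : RedHom k (Set.Iic β) p ⊗[k] RedHom k (Set.Iic γ) q ≃ₗ[k] RedHom k (Set.Iic α) r,
      ∀ x y, t (x ⊗ₜ y) = RedHom.map k (splitEmb φ hα) r (RedHom.mul k h x y) := by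
  subst hp hq
  obtain ⟨t, h1, h2⟩ := exists_split k φ hα hs h
  refine ⟨LinearEquiv.ofLinearMap (RedHom.map k (splitEmb φ hα) r ∘ₗ
    TensorProduct.lift (RedHom.mul k h)) t (LinearMap.ext h2) (TensorProduct.ext' fun x y => ?_),
    fun x y => ?_⟩
  · exact h1 x y
  · rfl

/-- `powMap` identifies the tensor power with the homology of a lower interval. -/
theorem exists_powEquiv (hn : n ≠ 0) (m : ℕ) :
    ∃ e : (⨂[k]^m (RedHom k (Setoid (Fin n)) (n - 1))) ≃ₗ[k]
        RedHom k (Set.Iic (blocks G S T (Fin m) (Fin n))) ((n - 1) * m),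
      ∀ x, powMap k G S T n m x = W.incl k ((n - 1) * m) _ (e x) := by
  induction m with
  | zero =>
    have hb : blocks G S T (Fin 0) (Fin n) = ⊥ := Subsingleton.elim _ _
    have h1 := W.bijective_smul_one k (G := G) (T := T) (I := Fin 0 × Fin n)
    have h2 : Function.Bijective (powMap k G S T n 0) :=
      h1.comp (PiTensorProduct.isEmptyEquiv (Fin 0)).bijective
    have h3 : Function.Surjective (W.incl k 0 (blocks G S T (Fin 0) (Fin n))) := by
      intro w
      refine W.induction (N := LinearMap.range (W.incl k 0 (blocks G S T (Fin 0) (Fin n))))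
        (fun α x => ?_) w
      obtain rfl : α = blocks G S T (Fin 0) (Fin n) := Subsingleton.elim _ _
      exact ⟨x, rfl⟩
    let f := LinearEquiv.ofBijective (W.incl k 0 (blocks G S T (Fin 0) (Fin n)))
      ⟨W.incl_injective 0 _, h3⟩
    refine ⟨(LinearEquiv.ofBijective (powMap k G S T n 0) h2).trans f.symm, fun x => ?_⟩
    exact (f.apply_symm_apply (powMap k G S T n 0 x)).symm
  | succ m ih =>
    obtain ⟨e, he⟩ := ih
    have hs : Sep (union (blocks G S T (Fin m) (Fin n)) (ofSetoid G S T (⊤ : Setoid (Fin n)))) :=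
      ⟨fun _ _ _ h => h, fun _ _ _ _ h => by cases h⟩
    obtain ⟨t, ht⟩ := exists_splitEquiv (k := k) _ (union_blocks (G := G) (S := S) (T := T)
      (D := Fin n) m) hs (rank_blocks n hn m) (rank_ofSetoid_top n hn) (Nat.mul_succ _ _).symm
    let b := LinearEquiv.ofBijective _ (RedHom.map_bijective (k := k) (setoidEmb G S T (Fin n))
      setoidEmb_surjective (n - 1))
    let c := TensorPower.mulEquiv.symm.trans ((TensorProduct.congr e
      ((PiTensorProduct.subsingletonEquiv (0 : Fin 1)).trans b)).trans t)
    refine ⟨c, fun x => ?_⟩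
    refine DFunLike.congr_fun (f := powMap k G S T n (m + 1))
      (g := W.incl k ((n - 1) * (m + 1)) _ ∘ₗ c.toLinearMap) ?_ x
    refine tpow_ext fun x y => ?_
    have hc : c (TwAlg.tpowMul _ m 1 x y) =
        t (e x ⊗ₜ b (PiTensorProduct.subsingletonEquiv (0 : Fin 1) y)) := by
      change t (TensorProduct.congr e _
        (TensorPower.mulEquiv.symm (TensorPower.mulEquiv (x ⊗ₜ y)))) = _
      rw [LinearEquiv.symm_apply_apply]
      rfl
    rw [powMap_snoc, he]
    refine Eq.trans ?_ (congrArg (W.incl k _ _) (hc.trans (ht _ _)).symm)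
    exact W.act_mul_incl k _ (union_blocks m) _ _ _

end PowBijective

section PartitionData

open Poset

variable {k : Type u} [CommRing k] {G : Type u} [Group G] {S : Type u} [MulAction G S] {T : Set S}
  {n : ℕ} {I : Type} {p q r p' q' r' : ℕ}

/-- Equality of degrees, as a linear map: the degree of a tensor power equals `(n - 1) * m` only
propositionally. -/
def W.castDeg (h : p = q) : W k G T I p →ₗ[k] W k G T I q := h ▸ LinearMap.id

theorem W.castDeg_injective (h : p = q) :
    Function.Injective (W.castDeg h : W k G T I p →ₗ[k] W k G T I q) := by
  subst h
  exact Function.injective_id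

theorem W.castDeg_self (x : W k G T I p) : W.castDeg rfl x = x := rfl

theorem W.castDeg_incl (h : p = q) (α : Poset G S T I) (x : RedHom k (Set.Iic α) p) :
    ∃ y, W.castDeg h (W.incl k p α x) = W.incl k q α y := by
  subst h
  exact ⟨x, rfl⟩

theorem W.castDeg_act (h : p = q) {J : Type} (φ : FBHom G I J) (x : W k G T I p) :
    W.castDeg h (W.act k φ x) = W.act k φ (W.castDeg h x) := by
  subst h
  rfl

theorem W.castDeg_mul (h : p = p') (h' : q = q') (hr : r = r') (e : p + q = r) (e' : p' + q' = r')
    {J : Type} (x : W k G T I p) (y : W k G T J q) :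
    W.castDeg hr (W.mul k e x y) = W.mul k e' (W.castDeg h x) (W.castDeg h' y) := by
  subst h h' hr
  rfl

variable (k G S T n) in
/-- `powMap`, in all degrees. -/
def partF (m p : ℕ) : (TwAlg.TPow (partRep k G n) (n - 1)).obj m p →ₗ[k]
    W k G T (Fin m × Fin n) p :=
  if h : (n - 1) * m = p then W.castDeg h ∘ₗ powMap k G S T n m ∘ₗ Submodule.subtype _ else 0

theorem partF_apply {m p : ℕ} (h : (n - 1) * m = p)
    (x : (TwAlg.TPow (partRep k G n) (n - 1)).obj m p) :
    partF k G S T n m p x = W.castDeg h (powMap k G S T n m x.1) := by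
  rw [partF, dif_pos h]
  rfl

theorem eq_zero_of_degree {m p : ℕ} (h : (n - 1) * m ≠ p)
    (x : (TwAlg.TPow (partRep k G n) (n - 1)).obj m p) : x = 0 :=
  Subtype.ext (x.2 fun e => h (by rw [e, Nat.mul_comm]))

theorem partF_act {m p : ℕ} (h : Wr (G × Equiv.Perm (Fin n)) m)
    (x : (TwAlg.TPow (partRep k G n) (n - 1)).obj m p) :
    partF k G S T n m p ((TwAlg.TPow (partRep k G n) (n - 1)).act m p h x) =
      W.act k (TwAlg.blow (diagHom G n) h) (partF k G S T n m p x) := by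
  by_cases hp : (n - 1) * m = p
  · rw [partF_apply hp, partF_apply hp, ← W.castDeg_act, ← respects h]
    rfl
  · rw [eq_zero_of_degree hp x, map_zero, map_zero, map_zero]

theorem partF_mul {m l p q : ℕ} (x : (TwAlg.TPow (partRep k G n) (n - 1)).obj m p)
    (y : (TwAlg.TPow (partRep k G n) (n - 1)).obj l q) :
    W.act k (FBHom.ofEquiv G (TwAlg.blowSum (Fin n) m l)) (partF k G S T n (m + l) (p + q)
      ((TwAlg.TPow (partRep k G n) (n - 1)).mul m l p q x y)) =
      W.mul k rfl (partF k G S T n m p x) (partF k G S T n l q y) := by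
  by_cases hp : (n - 1) * m = p
  swap
  · rw [eq_zero_of_degree hp x]
    simp only [map_zero, LinearMap.zero_apply]
  by_cases hq : (n - 1) * l = q
  swap
  · rw [eq_zero_of_degree hq y]
    simp only [map_zero]
  have hr : (n - 1) * (m + l) = p + q := by rw [← hp, ← hq, Nat.mul_add]
  rw [partF_apply hp, partF_apply hq, partF_apply hr,
    ← W.castDeg_mul hp hq hr (Nat.mul_add _ _ _).symm, ← W.castDeg_act]
  refine congrArg _ ((congrArg _ (powMap_mul x.1 y.1)).trans ?_)
  rw [← W.act_comp, ← FBHom.ofEquiv_trans, Equiv.symm_trans_self]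
  exact W.act_id k _

/-- An element with blocks of size `n` only is a translate of `blocks`: number the blocks and
their points, and choose colourings. -/
theorem exists_eq_blocks {N : ℕ} (α : Poset G S T (Fin N))
    (hα : α.HasTypes {.inl n}) :
    ∃ (m : ℕ) (φ : FBHom G (Fin m × Fin n) (Fin N)), map φ (blocks G S T (Fin m) (Fin n)) = α := by
  have h0 : ∀ i, α.zero i = none := by
    intro i
    by_contra h
    obtain ⟨t, ht⟩ := Option.ne_none_iff_exists'.1 h
    have hi := hα i
    rw [type_of_some ht] at hi
    cases hi
  let r : Setoid (Fin N) := ⟨fun i j => ∃ g, α.rel i g j, fun i => ⟨1, (α.rel_refl i).2 (h0 i)⟩,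
    fun ⟨g, h⟩ => ⟨g⁻¹, α.rel_symm h⟩, fun ⟨g, h⟩ ⟨g', h'⟩ => ⟨g * g', α.rel_trans h h'⟩⟩
  have hc : ∀ b : Quotient r, Nonempty ({i // Quotient.mk r i = b} ≃ Fin n) := by
    intro b
    induction b using Quotient.inductionOn with | _ i
    have hi := hα i
    rw [type_of_none (h0 i)] at hi
    have hi : Nat.card {j // ∃ g, α.rel i g j} = n := Sum.inl_injective hi
    refine ⟨(Finite.equivFinOfCardEq ?_)⟩
    rw [← hi]
    refine Nat.card_congr (Equiv.subtypeEquivRight fun j => ?_)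
    rw [Quotient.eq]
    exact ⟨r.symm, r.symm⟩
  let c := fun b => (hc b).some
  let ι := Finite.equivFin (Quotient r)
  obtain ⟨b, hb⟩ := α.exists_coloring
  let e : Fin (Nat.card (Quotient r)) × Fin n ≃ Fin N :=
    (Equiv.prodCongr ι.symm (Equiv.refl _)).trans ((Equiv.sigmaEquivProd _ _).symm.trans
      ((Equiv.sigmaCongrRight fun b => (c b).symm).trans (Equiv.sigmaFiberEquiv (Quotient.mk r))))
  have he : ∀ x, Quotient.mk r (e x) = ι.symm x.1 := fun x => ((c (ι.symm x.1)).symm x.2).2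
  let φ : FBHom G (Fin (Nat.card (Quotient r)) × Fin n) (Fin N) := ⟨e, fun x => b (e x)⟩
  refine ⟨_, φ, Poset.ext ?_ ?_⟩
  · funext i
    obtain ⟨i, rfl⟩ := φ.toEquiv.surjective i
    rw [map_zero_apply, h0]
    rfl
  · funext i g j
    obtain ⟨i, rfl⟩ := φ.toEquiv.surjective i
    obtain ⟨j, rfl⟩ := φ.toEquiv.surjective j
    refine propext ((map_rel_apply φ _).trans (Iff.trans (and_congr ?_ ?_) (hb _ _ _).symm))
    · rw [← ι.symm.injective.eq_iff, ← he, ← he]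
      exact Quotient.eq
    · change (b (e i))⁻¹ * g * b (e j) = 1 ↔ b (e i) = g * b (e j)
      rw [mul_assoc, inv_mul_eq_one]

/-- The automorphisms of `blocks` permute the blocks, and on each block they consist of a
bijection and a constant colour. -/
theorem exists_blow_blocks (hn : n ≠ 0) {m : ℕ} (ψ : FBHom G (Fin m × Fin n) (Fin m × Fin n))
    (h : map ψ (blocks G S T (Fin m) (Fin n)) = blocks G S T (Fin m) (Fin n)) :
    ∃ h : Wr (G × Equiv.Perm (Fin n)) m, ψ = TwAlg.blow (diagHom G n) h := by
  have h1 : ∀ i g j, (ψ.toEquiv i).1 = (ψ.toEquiv j).1 ∧ g = 1 ↔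
      i.1 = j.1 ∧ (ψ.color i)⁻¹ * g * ψ.color j = 1 := by
    intro i g j
    refine Iff.trans ?_ (map_rel_apply ψ (blocks G S T (Fin m) (Fin n)))
    rw [h]
    rfl
  have h2 : ∀ i j, i.1 = j.1 → (ψ.toEquiv i).1 = (ψ.toEquiv j).1 ∧ ψ.color i = ψ.color j := by
    intro i j hij
    obtain ⟨h3, h4⟩ := (h1 i (ψ.color i * (ψ.color j)⁻¹) j).2 ⟨hij, by group⟩
    exact ⟨h3, mul_inv_eq_one.1 h4⟩
  have h3 : ∀ i j, (ψ.toEquiv i).1 = (ψ.toEquiv j).1 → i.1 = j.1 := fun i j hij =>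
    ((h1 i 1 j).1 ⟨hij, rfl⟩).1
  let x₀ : Fin n := ⟨0, Nat.pos_of_ne_zero hn⟩
  have hσ : Function.Injective fun i => (ψ.toEquiv (i, x₀)).1 := fun i j hij => h3 _ _ hij
  have hτ : ∀ i, Function.Injective fun x => (ψ.toEquiv (i, x)).2 := fun i x y hxy =>
    congrArg Prod.snd (ψ.toEquiv.injective (Prod.ext (h2 (i, x) (i, y) rfl).1 hxy))
  refine ⟨⟨Equiv.ofBijective _ (Finite.injective_iff_bijective.1 hσ), fun i =>
    (ψ.color (i, x₀), Equiv.ofBijective _ (Finite.injective_iff_bijective.1 (hτ i)))⟩, ?_⟩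
  apply FBHom.ext
  · refine Equiv.ext fun x => Prod.ext ?_ rfl
    exact (h2 x (x.1, x₀) rfl).1
  · funext x
    exact (h2 x (x.1, x₀) rfl).2

variable (k G S T) in
/-- The realization of the tensor powers of the top homology of the partition
lattice, before induction. -/
def partData (hn : n ≠ 0) :
    IndData (diagHom G n) (TwAlg.TPow (partRep k G n) (n - 1)) S T {.inl n} where
  F := partF k G S T n
  map_act := partF_act
  map_mul := partF_mul
  map_one := by
    refine (partF_apply (Nat.mul_zero _) _).trans ?_
    exact powMap_one
  injective m p x y h := by
    by_cases hp : (n - 1) * m = p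
    · obtain ⟨e, he⟩ := exists_powEquiv (k := k) (G := G) (S := S) (T := T) hn m
      rw [partF_apply hp, partF_apply hp, he, he] at h
      exact Subtype.ext (e.injective (W.incl_injective _ _ (W.castDeg_injective hp h)))
    · rw [eq_zero_of_degree hp x, eq_zero_of_degree hp y]
  IsBase {m} κ := κ = blocks G S T (Fin m) (Fin n)
  hasTypes {m κ} h i := by
    subst h
    rw [type_of_none rfl]
    refine congrArg Sum.inl ?_
    have e : {j : Fin m × Fin n // ∃ g, (blocks G S T (Fin m) (Fin n)).rel i g j} ≃ Fin n :=
      { toFun := fun j => j.1.2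
        invFun := fun x => ⟨(i.1, x), 1, rfl, rfl⟩
        left_inv := by
          rintro ⟨j, g, hj, -⟩
          exact Subtype.ext (Prod.ext hj rfl)
        right_inv := fun _ => rfl }
    rw [Nat.card_congr e, Nat.card_fin]
  exists_base α hα := by
    obtain ⟨m, φ, h⟩ := exists_eq_blocks α hα
    exact ⟨m, φ, _, rfl, h⟩
  arity_eq {m m'} _ _ ψ _ _ _ := by
    have h := Nat.card_congr ψ.toEquiv
    simp only [Nat.card_prod, Nat.card_fin] at h
    exact Nat.eq_of_mul_eq_mul_right (Nat.pos_of_ne_zero hn) h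
  exists_blow ψ h h' e := by
    subst h h'
    exact exists_blow_blocks hn ψ e
  exists_eq {m p κ} h x := by
    subst h
    by_cases hp : (n - 1) * m = p
    · subst hp
      obtain ⟨e, he⟩ := exists_powEquiv (k := k) (G := G) (S := S) (T := T) hn m
      refine ⟨⟨e.symm x, fun h => absurd (Nat.mul_comm _ _) h⟩, ?_⟩
      refine (partF_apply rfl _).trans ?_
      rw [W.castDeg_self, he, LinearEquiv.apply_symm_apply]
    · have : Subsingleton (RedHom k (Set.Iic (blocks G S T (Fin m) (Fin n))) p) :=
        subsingleton_iic k _ (by rw [rank_blocks n hn]; exact fun e => hp e.symm)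
      exact ⟨0, by rw [Subsingleton.elim x 0, map_zero, map_zero]⟩
  eq_incl {m p} a := by
    by_cases hp : (n - 1) * m = p
    · obtain ⟨e, he⟩ := exists_powEquiv (k := k) (G := G) (S := S) (T := T) hn m
      obtain ⟨y, hy⟩ := W.castDeg_incl hp _ (e a.1)
      refine Or.inr ⟨_, rfl, y, ?_⟩
      rw [partF_apply hp, he, hy]
    · exact Or.inl (eq_zero_of_degree hp a)

variable (k G S T) in
/-- The part of Whitney homology supported on the elements with empty zero block, all of whose
blocks have `n` points. -/
def partitionRealization (hn : n ≠ 0) : Realization k S T (partitionFactor k G n) {.inl n} :=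
  (partData k G S T hn).realization

end PartitionData

end Dowling

end

theorem mainTheorem8 (k : Type u) [CommRing k] (G : Type u) [Group G] [Finite G]
    (S : Type u) [MulAction G S] [Finite S] (T : Set S) (hT : ∀ (g : G), ∀ x ∈ T, g • x ∈ T)
    {m : ℕ} (s : Fin m → S) (hs : ∀ x : S, ∃! i, x ∈ MulAction.orbit G (s i)) :
    (Dowling.whitney k G S T).IsGTCA ∧
    Nonempty (Dowling.TwAlg.Iso (Dowling.whitney k G S T)
      (Dowling.TwAlg.tensor
        (Dowling.TwAlg.tensorSeq fun n => Dowling.partitionFactor k G (n + 1))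
        (Dowling.TwAlg.tensorList (List.ofFn fun i => Dowling.dowlingFactor k G T (s i))))) := by
  classical
  refine ⟨Dowling.whitney_isGTCA k G S T, ?_⟩
  have hU : ∀ m n : ℕ, m < n → Disjoint
      ({.inl (m + 1)} : Set (ℕ ⊕ MulAction.orbitRel.Quotient G S)) {.inl (n + 1)} := by
    intro m n h
    rw [Set.disjoint_singleton]
    exact fun e => h.ne (Nat.succ_injective (Sum.inl_injective e))
  let R := Dowling.Realization.tensorSeq hU fun n =>
    Dowling.partitionRealization k G S T n.succ_ne_zero
  let l : List (Dowling.TwAlg.{u} k G × Set (ℕ ⊕ MulAction.orbitRel.Quotient G S)) :=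
    List.ofFn fun i => (Dowling.dowlingFactor k G T (s i), {.inr (Quotient.mk _ (s i))})
  have hl : l.map Prod.fst = List.ofFn fun i => Dowling.dowlingFactor k G T (s i) :=
    List.map_ofFn
  have hs' : ∀ i j : Fin m, (Quotient.mk (MulAction.orbitRel G S) (s i)) = Quotient.mk _ (s j) →
      i = j := fun i j h =>
    (hs (s i)).unique (MulAction.mem_orbit_self _) (Quotient.exact h)
  obtain ⟨R'⟩ := Dowling.Realization.nonempty_tensorList (k := k) (S := S) (T := T) l
    (by
      intro x hx
      obtain ⟨i, rfl⟩ := (List.mem_ofFn' _ _).1 hx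
      exact ⟨Dowling.dowlingRealization k hT (s i)⟩)
    (by
      rw [List.pairwise_ofFn]
      intro i j hij
      rw [Set.disjoint_singleton]
      exact fun e => hij.ne (hs' i j (Sum.inr_injective e)))
  have hd : Disjoint
      {t : ℕ ⊕ MulAction.orbitRel.Quotient G S | ∃ n : ℕ, t ∈ ({.inl (n + 1)} : Set _)}
      {t | ∃ x ∈ l, t ∈ x.2} := by
    rw [Set.disjoint_left]
    rintro _ ⟨n, rfl⟩ ⟨x, hx, h⟩
    obtain ⟨i, rfl⟩ := (List.mem_ofFn' _ _).1 hx
    cases h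
  rw [← hl]
  refine Dowling.Realization.nonempty_iso (Dowling.Realization.tensor hd R R') ?_
  -- every type occurs: blocks are nonempty, and the `s i` represent all orbits
  intro n α i
  cases hz : α.zero i with
  | none =>
    rw [Dowling.Poset.type_of_none hz]
    have : Nonempty {j // ∃ g, α.rel i g j} := ⟨⟨i, 1, (α.rel_refl i).2 hz⟩⟩
    exact Or.inl ⟨_, congrArg Sum.inl (Nat.succ_pred_eq_of_pos Nat.card_pos).symm⟩
  | some t =>
    rw [Dowling.Poset.type_of_some hz]
    obtain ⟨j, hj, -⟩ := hs t
    exact Or.inr ⟨_, (List.mem_ofFn' _ _).2 ⟨j, rfl⟩, congrArg Sum.inr (Quotient.sound hj)⟩
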